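/- **Setting.** Let $0<\alpha<\pi$ and let $K_\alpha=\{(r\cos\theta,r\sin\theta): r>0,\ -\alpha<\theta<\alpha\}$. A *self-similar (SS) solution* in $K_\alpha$ is a velocity field $u\in C^2(K_\alpha;\mathbb R^2)\cap C(\overline{K_\alpha}\setminus\{0\};\mathbb R^2)$ for which there is a pressure $p\in C^1(K_\alpha)$ such that $$-\Delta u+u\cdot\nabla u+\nabla p=0,\qquad \operatorname{div}u=0\ \text{ in }K_\alpha,\qquad u=0\ \text{ on }\partial K_\alpha\setminus\{0\},$$ and $u(x)=\lambda u(\lambda x)$, $p(x)=\lambda^2p(\lambda x)$ for all $x\in K_\alpha$ and $\lambda>0$. Write $u^r$ for the radial component of $u$ and put $f(\theta)=r\,u^r(r,\theta)$, which does not depend on $r$. The *flux* of $u$ is $\int_{-\alpha}^{\alpha}f(\theta)\,d\theta$. For non-negative integers $(a,b)\neq(0,0)$, an SS solution is *of type $(a,b)$* if $\{\theta\in(-\alpha,\alpha): f(\theta)>0\}$ consists of exactly $a$ intervals (connected components) and $\{\theta\in(-\alpha,\alpha): f(\theta)<0\}$ of exactly $b$ intervals. Let $\Phi^{(a,b)}_{max}(\alpha)$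 be the supremum of the fluxes of all SS solutions of type $(a,b)$ in $K_\alpha$. The *reflection* of $u=(u_1,u_2)$ is the field $(x_1,x_2)\mapsto(u_1(x_1,-x_2),-u_2(x_1,-x_2))$; it replaces $f(\theta)$ by $f(-\theta)$. Solutions are compared as functions on $K_\alpha$. **Theorem.** For $|a-b|\le1$, $(a,b)\ne(0,0)$, and $0<\alpha<\pi$ ($0<\alpha<\frac\pi2$ if $(a,b)=(1,0)$), the set of fluxes of SS solutions of type $(a,b)$ is non-empty and bounded above, so that $\Phi^{(a,b)}_{max}(\alpha)$ is a real number. Moreover: *Properties of the maximal fluxes.* 1. $\Phi^{(1,0)}_{max}(\alpha)=\frac{3\pi}{\alpha}+o\left(\frac1\alpha\right)$ as $\alpha\to0^+$, and $\Phi^{(1,0)}_{max}(\alpha)=8\left(\frac\pi2-\alpha\right)+o\left(\frac\pi2-\alpha\right)$ as $\alpha\to\frac\pi2^-$. 2. $\Phi^{(1,1)}_{max}$ is strictly decreasing on $(0,\pi)$; $\Phi^{(1,1)}_{max}(\alpha)=\Phi^{(1,0)}_{max}(\alpha)$ for $0<\alpha<\frac\pi2$, and $\Phi^{(1,1)}_{max}(\alpha)=\Phi^{(0,1)}_{max}(\alpha)$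 for $\frac\pi2\le\alpha<\pi$. 3. $\Phi^{(m,m)}_{max}(\alpha)=m\,\Phi^{(1,1)}_{max}\left(\frac\alpha m\right)=m\,\Phi^{(1,0)}_{max}\left(\frac\alpha m\right)$ for all $m\ge2$ and $0<\alpha<\pi$. 4. For all $m\ge1$ and $0<\alpha<\pi$, $$\Phi^{(m,m)}_{max}(\alpha)<\Phi^{(m,m+1)}_{max}(\alpha)\le\tfrac{m}{m+1}\Phi^{(m+1,m+1)}_{max}(\alpha)<\Phi^{(m+1,m+1)}_{max}(\alpha)\le\Phi^{(m+1,m)}_{max}(\alpha).$$ *Uniqueness.* 1. For $0<\alpha<\frac\pi2$ and every $0<\Phi<\Phi^{(1,0)}_{max}(\alpha)$ there is exactly one SS solution of type $(1,0)$ with flux $\Phi$. 2. For $0<\alpha<\pi$ and every $\Phi<\Phi^{(0,1)}_{max}(\alpha)$ there is exactly one SS solution of type $(0,1)$ with flux $\Phi$. 3. For $0<\alpha<\pi$, $m\ge1$ and every $\Phi<\Phi^{(m,m)}_{max}(\alpha)$ there is an SS solution of type $(m,m)$ with flux $\Phi$, and it is unique up to reflection. *Non-uniqueness.* Let $m\ge1$,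 and let $0<\alpha\le\frac\pi2$ if $m=1$, $0<\alpha<\pi$ if $m\ge2$. For every $\Phi$ with $\Phi^{(m,m)}_{max}(\alpha)<\Phi<\Phi^{(m,m+1)}_{max}(\alpha)$ there exist at least two different SS solutions of type $(m,m+1)$ with flux $\Phi$, which moreover are not reflections of each other. -/

import Mathlib

namespace SectorFlow

noncomputable section

/-- The Euclidean plane. -/
abbrev Plane : Type := EuclideanSpace ℝ (Fin 2)

/-- The radial unit vector `e_r` at the polar angle `θ`. -/
def eR (θ : ℝ) : Plane := !₂[Real.cos θ, Real.sin θ]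

/-- The open sector of opening angle `2α` centred at the origin:
all points with polar coordinates `(r, θ)`, `r > 0`, `-α < θ < α`. -/
def sector (α : ℝ) : Set Plane :=
  {x | ∃ r θ : ℝ, 0 < r ∧ θ ∈ Set.Ioo (-α) α ∧ x = r • eR θ}

/-- The divergence of a vector field on the plane. -/
def divergence (u : Plane → Plane) (x : Plane) : ℝ :=
  ∑ i : Fin 2, (fderiv ℝ u x (EuclideanSpace.single i 1)) i

/-- `(u, p)` is a classical solution in the sector of the steady Navier-Stokes system
`-Δu + (u · ∇)u + ∇p = 0`, `div u = 0`. -/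
structure IsNavierStokes (α : ℝ) (u : Plane → Plane) (p : Plane → ℝ) : Prop where
  contDiffOn_velocity : ContDiffOn ℝ 2 u (sector α)
  contDiffOn_pressure : ContDiffOn ℝ 1 p (sector α)
  momentum : ∀ x ∈ sector α,
    -(Laplacian.laplacian u x) + fderiv ℝ u x (u x) + gradient p x = 0
  incompressible : ∀ x ∈ sector α, divergence u x = 0

/-- The no-slip condition: `u` is continuous up to the boundary away from the vertex of the sector,
and vanishes there. -/
structure NoSlip (α : ℝ) (u : Plane → Plane) : Prop where
  continuousOn : ContinuousOn u (closure (sector α) \ {0})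
  eq_zero : ∀ x ∈ frontier (sector α) \ {0}, u x = 0

/-- Invariance of `(u, p)` under the Navier-Stokes scaling. -/
def IsScalingInvariant (α : ℝ) (u : Plane → Plane) (p : Plane → ℝ) : Prop :=
  ∀ x ∈ sector α, ∀ t : ℝ, 0 < t → u x = t • u (t • x) ∧ p x = t ^ 2 * p (t • x)

/-- `u` is (the velocity field of) a self-similar solution of the steady Navier-Stokes system
in the sector with the no-slip boundary condition. -/
def IsSelfSimilarSolution (α : ℝ) (u : Plane → Plane) : Prop :=
  ∃ p : Plane → ℝ, IsNavierStokes α u p ∧ NoSlip α u ∧ IsScalingInvariant α u p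

/-- The angular profile `f(θ) = r uʳ(r, θ)`, evaluated at `r = 1`; for a self-similar `u` the
product `r uʳ(r, θ)` does not depend on `r`. -/
def profile (u : Plane → Plane) (θ : ℝ) : ℝ := inner ℝ (u (eR θ)) (eR θ)

/-- The flux `∫ uʳ(1, θ) dθ` over `-α < θ < α`. -/
def flux (α : ℝ) (u : Plane → Plane) : ℝ := ∫ θ in (-α)..α, profile u θ

/-- The number of connected components of a set of angles, that is, of the maximal intervals that
make it up. -/
def numIntervals (S : Set ℝ) : ℕ∞ :=
  ((fun θ => connectedComponentIn S θ) '' S).encard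

/-- `u` is a self-similar solution of type `(a, b)`: there are `a` intervals of outflow and `b`
intervals of inflow. -/
structure IsOfType (α : ℝ) (a b : ℕ) (u : Plane → Plane) : Prop where
  solution : IsSelfSimilarSolution α u
  outflow : numIntervals {θ | θ ∈ Set.Ioo (-α) α ∧ 0 < profile u θ} = a
  inflow : numIntervals {θ | θ ∈ Set.Ioo (-α) α ∧ profile u θ < 0} = b

/-- The fluxes of the self-similar solutions of type `(a, b)`. -/
def fluxSet (a b : ℕ) (α : ℝ) : Set ℝ :=
  {Φ | ∃ u : Plane → Plane, IsOfType α a b u ∧ flux α u = Φ}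

/-- The maximal flux of type `(a, b)` for the half-angle `α`. -/
def maxFlux (a b : ℕ) (α : ℝ) : ℝ := sSup (fluxSet a b α)

/-- The mirror image of a vector field in the axis `θ = 0` of the sector. -/
def reflect (u : Plane → Plane) (x : Plane) : Plane :=
  !₂[(u !₂[x 0, -x 1]) 0, -(u !₂[x 0, -x 1]) 1]

end

end SectorFlow

/-! A self-similar field has no angular component: incompressibility makes that component constant
and no-slip makes it zero. What is left is a profile f on (-α, α) that vanishes at both ends and
solves the Jeffery-Hamel equation f'' + 4f + f² = C (`IsSelfSimilarSolution.isJH`, and conversely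
`IsJH.isSelfSimilarSolution`). The whole theorem is therefore about one scalar equation whose first
integral makes f'² a cubic in f.

If f changes sign, the cubic has two roots at the extrema of f and a third one strictly below them,
and f is a piece of a periodic function p (sin² A - sin² x). Here A is an amplitude function with A'
proportional to √(1 + κ sin² A), and p and the scaling s are explicit in κ and x
(`IsJH.exists_wave`). The two parameters are κ > 0 and the phase x in (0, π/2) of the zeros. With T
half the period and n half the length of a negative arc, the types (m, m), (m, m+1), (m+1, m) have α
= mT, mT + n, (m+1)T - n.

The decisive identity is `halfPeriod_mul_halfFlux`: T times half the flux over a period equals 2c(κ)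
- 2T², where c is `fluxCoeff`. The phase x has disappeared, and c is strictly decreasing to -∞
(`strictAntiOn_fluxCoeff`). For type (m, m) the half-period is fixed at α/m, so the flux determines
κ and then x, which is uniqueness up to reflection; the admissible κ form a half-line (κ₀, ∞), so
the fluxes form an open half-line. At κ₀ the wave degenerates to an edge arc, which is tangent to
zero at the walls and is described by its extremal value M > -3 alone. Its length decreases and its
flux increases with M (`strictAntiOn_edgeT`, `strictMonoOn_edgeF`), which gives the monotonicity of
the maximal flux and the relations between types.

Solutions of one sign are arcs f = M cos² ψ with a second parameter d ≥ 0 that measures the squared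
slope at the wall. For M > 0 length and flux are monotone in both parameters, in a way that makes
the flux at fixed length increase with M. For M < 0 two arcs of equal length are compared by a
single-crossing argument (`arcF_lt_of_arcT_eq`).

For type (m, m+1) the condition mT + n = α defines a continuous curve x = X(κ), along which the flux
is continuous and tends to -∞. If α ≤ mπ/2 the curve starts at the edge flow of type (m, m). Opening
an extra negative arc of size x there shortens the periods and gains flux to first order in x, while
every loss is of order x² (`WaveFamily.exists_waveFlux_gt`). So the flux first rises above the
maximum for (m, m) and later falls: each intermediate value is taken at two different κ, and these
profiles are even, so reflection does not identify them. For type (m+1, m), small x near the edge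
flow of type (m+1, m+1) gives the lower bound, and the identity for T gives boundedness.

The asymptotics concern edge arcs only. As M → ∞ the product of length and flux tends to a product
of two lemniscate integrals, evaluated by a Wallis argument (`lemniscateInt_zero_mul_two`); as M → 0
the integrands are expanded to first order. -/

namespace SectorFlow

open Set Filter Topology Real

/-! ### Polar coordinates on the slit plane -/

/-- The plane vector `x` as a complex number. -/
noncomputable def toComplex : Plane →L[ℝ] ℂ :=
  Complex.ofRealCLM.comp (EuclideanSpace.proj (0 : Fin 2)) +
    Complex.I • Complex.ofRealCLM.comp (EuclideanSpace.proj (1 : Fin 2))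

theorem toComplex_apply (x : Plane) : toComplex x = (x 0 : ℂ) + (x 1 : ℂ) * Complex.I := by
  simp [toComplex, mul_comm]

@[simp] theorem toComplex_re (x : Plane) : (toComplex x).re = x 0 := by simp [toComplex_apply]

@[simp] theorem toComplex_im (x : Plane) : (toComplex x).im = x 1 := by simp [toComplex_apply]

/-- The polar angle of a point of the plane. -/
noncomputable def angle (x : Plane) : ℝ := (toComplex x).arg

@[simp] theorem eR_zero (θ : ℝ) : eR θ 0 = cos θ := by simp [eR]

@[simp] theorem eR_one (θ : ℝ) : eR θ 1 = sin θ := by simp [eR]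

theorem toComplex_smul_eR (r θ : ℝ) :
    toComplex (r • eR θ) = r * (Complex.cos θ + Complex.sin θ * Complex.I) := by
  apply Complex.ext <;> simp [← Complex.ofReal_cos, ← Complex.ofReal_sin]

theorem angle_smul_eR {r θ : ℝ} (hr : 0 < r) (hθ : θ ∈ Ioc (-π) π) : angle (r • eR θ) = θ := by
  rw [angle, toComplex_smul_eR, Complex.arg_mul_cos_add_sin_mul_I hr hθ]

/-- The squared distance to the origin. -/
noncomputable def radSq (x : Plane) : ℝ := x 0 ^ 2 + x 1 ^ 2

theorem radSq_smul_eR (r θ : ℝ) : radSq (r • eR θ) = r ^ 2 := by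
  simp only [radSq, PiLp.smul_apply, eR_zero, eR_one, smul_eq_mul]
  nlinarith [sin_sq_add_cos_sq θ]

theorem radSq_pos {x : Plane} (hx : toComplex x ∈ Complex.slitPlane) : 0 < radSq x := by
  have h := Complex.slitPlane_ne_zero hx
  have h2 : Complex.normSq (toComplex x) = radSq x := by
    simp [Complex.normSq_apply, radSq, sq]
  rw [← h2]
  exact Complex.normSq_pos.2 h

theorem exists_polar {x : Plane} (hx : x ≠ 0) :
    ∃ r θ : ℝ, 0 < r ∧ θ ∈ Ioc (-π) π ∧ x = r • eR θ := by
  refine ⟨‖toComplex x‖, angle x, ?_, Complex.arg_mem_Ioc _, ?_⟩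
  · rw [norm_pos_iff]
    intro h
    apply hx
    have h0 : x 0 = 0 := by rw [← toComplex_re, h]; rfl
    have h1 : x 1 = 0 := by rw [← toComplex_im, h]; rfl
    ext i
    fin_cases i
    · exact h0
    · exact h1
  · ext i
    fin_cases i
    · simp [angle]
    · simp [angle]

theorem eR_ne_zero (θ : ℝ) : eR θ ≠ 0 := by
  intro h
  have h0 := radSq_smul_eR 1 θ
  rw [h] at h0
  simp [radSq] at h0

/-- The differential of the polar angle. -/
noncomputable def angleDeriv (x : Plane) : Plane →L[ℝ] ℝ :=
  (x 0 / radSq x) • EuclideanSpace.proj (1 : Fin 2) -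
    (x 1 / radSq x) • EuclideanSpace.proj (0 : Fin 2)

theorem angle_eq_comp : angle = fun x => Complex.imCLM (Complex.log (toComplex x)) := by
  ext y
  simp [angle, Complex.log_im]

theorem hasFDerivAt_angle {x : Plane} (hx : toComplex x ∈ Complex.slitPlane) :
    HasFDerivAt angle (angleDeriv x) x := by
  have h1 : HasFDerivAt Complex.log
      ((ContinuousLinearMap.toSpanSingleton ℂ (toComplex x)⁻¹).restrictScalars ℝ)
      (toComplex x) := (Complex.hasStrictDerivAt_log hx).hasDerivAt.hasFDerivAt.restrictScalars ℝ
  have h2 := Complex.imCLM.hasFDerivAt.comp x (h1.comp x toComplex.hasFDerivAt)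
  have hpos := radSq_pos hx
  rw [angle_eq_comp]
  refine h2.congr_fderiv ?_
  ext v
  have h4 : Complex.normSq (toComplex x) = radSq x := by simp [Complex.normSq_apply, radSq, sq]
  simp only [angleDeriv, ContinuousLinearMap.comp_apply, sub_apply,
    smul_apply, PiLp.proj_apply, smul_eq_mul,
    Complex.imCLM_apply, ContinuousLinearMap.coe_restrictScalars',
    ContinuousLinearMap.toSpanSingleton_apply, Complex.mul_im, Complex.inv_re, Complex.inv_im,
    toComplex_re, toComplex_im, h4]
  field_simp
  ring

theorem contDiffAt_angle {x : Plane} (hx : toComplex x ∈ Complex.slitPlane) {n : ℕ∞} :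
    ContDiffAt ℝ n angle x := by
  have h1 : ContDiffAt ℝ n Complex.log (toComplex x) :=
    (Complex.contDiffAt_log hx).restrict_scalars ℝ
  rw [angle_eq_comp]
  exact Complex.imCLM.contDiff.contDiffAt.comp x (h1.comp x toComplex.contDiff.contDiffAt)

/-- For α ≤ π the open sector avoids the cut of the principal logarithm, so membership is a
condition on one smooth function, the principal argument. This gives openness and lets all
differentiation be done through `angle`. -/
theorem mem_sector_iff {α : ℝ} (hα : α ≤ π) (x : Plane) :
    x ∈ sector α ↔ toComplex x ∈ Complex.slitPlane ∧ angle x ∈ Ioo (-α) α := by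
  constructor
  · rintro ⟨r, θ, hr, hθ, rfl⟩
    have hm : θ ∈ Ioc (-π) π := ⟨by linarith [hθ.1], by linarith [hθ.2]⟩
    have ha := angle_smul_eR hr hm
    refine ⟨?_, by rwa [ha]⟩
    rw [Complex.mem_slitPlane_iff_arg]
    refine ⟨?_, ?_⟩
    · change angle (r • eR θ) ≠ π
      rw [ha]
      exact (lt_of_lt_of_le hθ.2 hα).ne
    · intro h
      have h0 := radSq_smul_eR r θ
      rw [radSq, ← toComplex_re, ← toComplex_im, h] at h0
      simp at h0
      exact (pow_pos hr 2).ne h0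
  · rintro ⟨h1, h2⟩
    have hx : x ≠ 0 := by
      rintro rfl
      exact Complex.slitPlane_ne_zero h1 (map_zero _)
    obtain ⟨r, θ, hr, hθ, rfl⟩ := exists_polar hx
    rw [angle_smul_eR hr hθ] at h2
    exact ⟨r, θ, hr, h2, rfl⟩

theorem isOpen_sector {α : ℝ} (hα : α ≤ π) : IsOpen (sector α) := by
  have : sector α = {x | toComplex x ∈ Complex.slitPlane} ∩ angle ⁻¹' (Ioo (-α) α) := by
    ext x
    exact mem_sector_iff hα x
  rw [this]
  refine ContinuousOn.isOpen_inter_preimage ?_ ?_ isOpen_Ioo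
  · exact fun x hx => (hasFDerivAt_angle hx).continuousAt.continuousWithinAt
  · exact Complex.isOpen_slitPlane.preimage toComplex.continuous

/-! ### Differential operators applied to scaling-invariant fields -/

theorem hasFDerivAt_coord (i : Fin 2) (x : Plane) :
    HasFDerivAt (fun y : Plane => y i) (EuclideanSpace.proj i : Plane →L[ℝ] ℝ) x :=
  (EuclideanSpace.proj i : Plane →L[ℝ] ℝ).hasFDerivAt

theorem hasFDerivAt_radSq (x : Plane) :
    HasFDerivAt radSq ((2 * x 0) • (EuclideanSpace.proj 0 : Plane →L[ℝ] ℝ) +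
      (2 * x 1) • (EuclideanSpace.proj 1 : Plane →L[ℝ] ℝ)) x := by
  have h := ((hasFDerivAt_coord 0 x).pow 2).add ((hasFDerivAt_coord 1 x).pow 2)
  refine h.congr_fderiv ?_
  simp

/-- The differential of `(p(θ) A + q(θ) B) / r^(2n)`. -/
theorem hasFDerivAt_polar {x : Plane} (hx : toComplex x ∈ Complex.slitPlane) {p q : ℝ → ℝ}
    {p' q' : ℝ} (hp : HasDerivAt p p' (angle x)) (hq : HasDerivAt q q' (angle x))
    {A B : Plane → ℝ} {A' B' : Plane →L[ℝ] ℝ} (hA : HasFDerivAt A A' x) (hB : HasFDerivAt B B' x)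
    (n : ℕ) :
    HasFDerivAt (fun y => (p (angle y) * A y + q (angle y) * B y) / radSq y ^ n)
      ((radSq x ^ n)⁻¹ • (p (angle x) • A' + A x • p' • angleDeriv x
        + (q (angle x) • B' + B x • q' • angleDeriv x))
        + (p (angle x) * A x + q (angle x) * B x) • (-(n : ℝ) * ((radSq x) ^ (n + 1))⁻¹) •
          ((2 * x 0) • (EuclideanSpace.proj 0 : Plane →L[ℝ] ℝ) +
      (2 * x 1) • (EuclideanSpace.proj 1 : Plane →L[ℝ] ℝ))) x := by
  have ha := (hasFDerivAt_angle hx)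
  have hpos := radSq_pos hx
  have h1 := (hp.comp_hasFDerivAt x ha).mul hA
  have h2 := (hq.comp_hasFDerivAt x ha).mul hB
  have hpow : HasDerivAt (fun t : ℝ => (t ^ n)⁻¹) (-(n : ℝ) * ((radSq x) ^ (n + 1))⁻¹)
      (radSq x) := by
    have := (hasDerivAt_pow n (radSq x)).inv (by positivity)
    refine this.congr_deriv ?_
    rcases n with _ | n
    · simp
    · field_simp
      simp
      ring
  have h3 := hpow.comp_hasFDerivAt x (hasFDerivAt_radSq x)
  have h4 := (h1.add h2).mul h3
  refine (h4.congr_fderiv ?_).congr_of_eventuallyEq ?_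
  · ext v
    simp
    ring
  · exact Eventually.of_forall fun y => by simp [div_eq_mul_inv]

/-- Reduces the vector Laplacian to repeated directional derivatives of scalar coordinates, the form
in which `hasFDerivAt_polar` can be applied twice. -/
theorem laplacian_coord {u : Plane → Plane} {x : Plane} (h : ContDiffAt ℝ 2 u x) (j : Fin 2) :
    (Laplacian.laplacian u x) j = ∑ i : Fin 2,
      fderiv ℝ (fun y => fderiv ℝ (fun z => u z j) y (EuclideanSpace.single i 1)) x
        (EuclideanSpace.single i 1) := by
  rw [InnerProductSpace.laplacian_eq_iteratedFDeriv_orthonormalBasis u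
    (EuclideanSpace.basisFun (Fin 2) ℝ)]
  simp only [iteratedFDeriv_two_apply, EuclideanSpace.basisFun_apply, Matrix.cons_val_zero,
    Matrix.cons_val_one]
  rw [WithLp.ofLp_sum, Finset.sum_apply]
  refine Finset.sum_congr rfl fun i _ => ?_
  have hd : DifferentiableAt ℝ (fderiv ℝ u) x :=
    (h.fderiv_right (m := 1) (by norm_num)).differentiableAt (by norm_num)
  have hev : (fun y => fderiv ℝ (fun z => u z j) y (EuclideanSpace.single i 1)) =ᶠ[𝓝 x]
      fun y => (EuclideanSpace.proj j : Plane →L[ℝ] ℝ)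
        (fderiv ℝ u y (EuclideanSpace.single i 1)) := by
    have := h.eventually (by simp)
    filter_upwards [this] with y hy
    have hy' : DifferentiableAt ℝ u y := hy.differentiableAt (by norm_num)
    have := ((EuclideanSpace.proj j : Plane →L[ℝ] ℝ).hasFDerivAt.comp y hy'.hasFDerivAt).fderiv
    exact congrArg (fun L : Plane →L[ℝ] ℝ => L (EuclideanSpace.single i 1)) this
  rw [hev.fderiv_eq]
  have h2 := ((EuclideanSpace.proj j : Plane →L[ℝ] ℝ).hasFDerivAt.comp x
    (hd.hasFDerivAt.clm_apply (hasFDerivAt_const (EuclideanSpace.single i (1 : ℝ)) x))).fderiv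
  have h3 := congrArg (fun L : Plane →L[ℝ] ℝ => L (EuclideanSpace.single i 1)) h2
  refine Eq.trans ?_ h3.symm
  simp

theorem fderiv_coord {u : Plane → Plane} {x : Plane} (h : DifferentiableAt ℝ u x) (j : Fin 2)
    (v : Plane) : (fderiv ℝ u x v) j = fderiv ℝ (fun z => u z j) x v := by
  have := ((EuclideanSpace.proj j : Plane →L[ℝ] ℝ).hasFDerivAt.comp x h.hasFDerivAt).fderiv
  exact (congrArg (fun L : Plane →L[ℝ] ℝ => L v) this).symm

/-- The scaling-invariant velocity field with angular components `f` (radial) and `g`. -/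
noncomputable def polarField (f g : ℝ → ℝ) (x : Plane) : Plane :=
  !₂[(f (angle x) * x 0 + g (angle x) * (-x 1)) / radSq x,
    (f (angle x) * x 1 + g (angle x) * x 0) / radSq x]

/-- The radial scaling-invariant velocity field with angular profile `f`. -/
noncomputable def radialField (f : ℝ → ℝ) : Plane → Plane := polarField f 0

theorem polarField_zero (f g : ℝ → ℝ) (x : Plane) :
    polarField f g x 0 = (f (angle x) * x 0 + g (angle x) * (-x 1)) / radSq x ^ 1 := by
  simp [polarField]

theorem polarField_one (f g : ℝ → ℝ) (x : Plane) :
    polarField f g x 1 = (f (angle x) * x 1 + g (angle x) * x 0) / radSq x ^ 1 := by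
  simp [polarField]

theorem hasFDerivAt_neg_coord (x : Plane) :
    HasFDerivAt (fun y : Plane => -y 1) (-EuclideanSpace.proj 1 : Plane →L[ℝ] ℝ) x :=
  (hasFDerivAt_coord 1 x).neg

theorem angleDeriv_single_zero (x : Plane) :
    angleDeriv x (EuclideanSpace.single 0 1) = -x 1 / radSq x := by
  simp [angleDeriv, neg_div]

theorem angleDeriv_single_one (x : Plane) :
    angleDeriv x (EuclideanSpace.single 1 1) = x 0 / radSq x := by
  simp [angleDeriv]

theorem differentiableAt_polarField {x : Plane} (hx : toComplex x ∈ Complex.slitPlane)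
    {f g : ℝ → ℝ} (hf : DifferentiableAt ℝ f (angle x))
    (hg : DifferentiableAt ℝ g (angle x)) : DifferentiableAt ℝ (polarField f g) x := by
  rw [differentiableAt_euclidean]
  intro i
  fin_cases i
  · simp only [Fin.zero_eta, polarField_zero]
    exact (hasFDerivAt_polar hx hf.hasDerivAt hg.hasDerivAt (hasFDerivAt_coord 0 x)
      (hasFDerivAt_neg_coord x) 1).differentiableAt
  · simp only [Fin.mk_one, polarField_one]
    exact (hasFDerivAt_polar hx hf.hasDerivAt hg.hasDerivAt (hasFDerivAt_coord 1 x)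
      (hasFDerivAt_coord 0 x) 1).differentiableAt

/-- A purely radial field of degree -1 is divergence-free for any profile, so only the angular
component contributes. This is why incompressibility forces that component to be constant. -/
theorem divergence_polarField {x : Plane} (hx : toComplex x ∈ Complex.slitPlane)
    {f g : ℝ → ℝ} {f' g' : ℝ} (hf : HasDerivAt f f' (angle x))
    (hg : HasDerivAt g g' (angle x)) : divergence (polarField f g) x = g' / radSq x := by
  have hd := differentiableAt_polarField hx hf.differentiableAt hg.differentiableAt
  have hpos := radSq_pos hx
  rw [divergence, Fin.sum_univ_two, fderiv_coord hd, fderiv_coord hd]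
  simp only [polarField_zero, polarField_one]
  rw [(hasFDerivAt_polar hx hf hg (hasFDerivAt_coord 0 x) (hasFDerivAt_neg_coord x) 1).fderiv,
    (hasFDerivAt_polar hx hf hg (hasFDerivAt_coord 1 x) (hasFDerivAt_coord 0 x) 1).fderiv]
  simp only [add_apply, smul_apply, neg_apply, smul_eq_mul, angleDeriv_single_zero,
    angleDeriv_single_one, PiLp.proj_apply, PiLp.single_apply]
  have h : radSq x = x 0 ^ 2 + x 1 ^ 2 := rfl
  simp
  field_simp
  rw [h]
  ring

theorem fderiv_radialField_zero {x : Plane} (hx : toComplex x ∈ Complex.slitPlane)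
    {f : ℝ → ℝ} {f' : ℝ} (hf : HasDerivAt f f' (angle x))
    (v : Plane) : (fderiv ℝ (radialField f) x v) 0 =
      (f' * (-(x 0 * x 1) * v 0 + x 0 ^ 2 * v 1) +
        f (angle x) * ((x 1 ^ 2 - x 0 ^ 2) * v 0 - 2 * x 0 * x 1 * v 1)) / radSq x ^ 2 := by
  have hz : HasDerivAt (0 : ℝ → ℝ) 0 (angle x) := hasDerivAt_const _ _
  have hd := differentiableAt_polarField hx hf.differentiableAt hz.differentiableAt
  have hpos := radSq_pos hx
  rw [radialField, fderiv_coord hd]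
  simp only [polarField_zero]
  rw [(hasFDerivAt_polar hx hf hz (hasFDerivAt_coord 0 x) (hasFDerivAt_neg_coord x) 1).fderiv]
  simp [angleDeriv]
  field_simp
  rw [radSq]
  ring

theorem fderiv_radialField_one {x : Plane} (hx : toComplex x ∈ Complex.slitPlane)
    {f : ℝ → ℝ} {f' : ℝ} (hf : HasDerivAt f f' (angle x))
    (v : Plane) : (fderiv ℝ (radialField f) x v) 1 =
      (f' * (-(x 1 ^ 2) * v 0 + x 0 * x 1 * v 1) +
        f (angle x) * ((x 0 ^ 2 - x 1 ^ 2) * v 1 - 2 * x 0 * x 1 * v 0)) / radSq x ^ 2 := by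
  have hz : HasDerivAt (0 : ℝ → ℝ) 0 (angle x) := hasDerivAt_const _ _
  have hd := differentiableAt_polarField hx hf.differentiableAt hz.differentiableAt
  have hpos := radSq_pos hx
  rw [radialField, fderiv_coord hd]
  simp only [polarField_one]
  rw [(hasFDerivAt_polar hx hf hz (hasFDerivAt_coord 1 x) (hasFDerivAt_coord 0 x) 1).fderiv]
  simp [angleDeriv]
  field_simp
  rw [radSq]
  ring

/-- The field is advected along its own ray, on which it decays like 1/r and the angle does not
change; hence no derivative of the profile survives. -/
theorem convection_radialField {x : Plane} (hx : toComplex x ∈ Complex.slitPlane)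
    {f : ℝ → ℝ} {f' : ℝ} (hf : HasDerivAt f f' (angle x))
    (i : Fin 2) : (fderiv ℝ (radialField f) x (radialField f x)) i =
      -(f (angle x)) ^ 2 * x i / radSq x ^ 2 := by
  have hpos := radSq_pos hx
  fin_cases i
  · simp only [Fin.zero_eta]
    rw [fderiv_radialField_zero hx hf]
    simp only [radialField, polarField_zero, polarField_one]
    simp
    field_simp
    rw [radSq]
    ring
  · simp only [Fin.mk_one]
    rw [fderiv_radialField_one hx hf]
    simp only [radialField, polarField_zero, polarField_one]
    simp
    field_simp
    rw [radSq]
    ring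

theorem gradient_pressure {x : Plane} (hx : toComplex x ∈ Complex.slitPlane)
    {P : ℝ → ℝ} {P' : ℝ} (hP : HasDerivAt P P' (angle x)) :
    gradient (fun y => P (angle y) / radSq y) x 0 =
      (-P' * x 1 - 2 * P (angle x) * x 0) / radSq x ^ 2 ∧
    gradient (fun y => P (angle y) / radSq y) x 1 =
      (P' * x 0 - 2 * P (angle x) * x 1) / radSq x ^ 2 := by
  have hz : HasDerivAt (0 : ℝ → ℝ) 0 (angle x) := hasDerivAt_const _ _
  have hpos := radSq_pos hx
  have h := hasFDerivAt_polar hx hP hz (hasFDerivAt_const 1 x) (hasFDerivAt_const 1 x) 1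
  have h2 : (fun y => P (angle y) / radSq y) =
      (fun y => (P (angle y) * 1 + (0 : ℝ → ℝ) (angle y) * 1) / radSq y ^ 1) := by
    ext y
    simp
  have key : ∀ i, gradient (fun y => P (angle y) / radSq y) x i =
      fderiv ℝ (fun y => P (angle y) / radSq y) x (EuclideanSpace.single i 1) := by
    intro i
    have h3 := InnerProductSpace.toDual_symm_apply (𝕜 := ℝ) (E := Plane)
      (x := EuclideanSpace.single i 1) (y := fderiv ℝ (fun y => P (angle y) / radSq y) x)
    rw [← h3, gradient]
    simp [-InnerProductSpace.toDual_symm_apply, EuclideanSpace.inner_single_right]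
  rw [key, key, h2, h.fderiv]
  constructor
  · simp [angleDeriv]
    field_simp
    ring
  · simp [angleDeriv]
    field_simp
    ring

theorem contDiffAt_radSq (x : Plane) {n : ℕ∞} : ContDiffAt ℝ n radSq x := by
  have h : ∀ i : Fin 2, ContDiffAt ℝ n (fun y : Plane => y i) x := fun i =>
    (EuclideanSpace.proj i : Plane →L[ℝ] ℝ).contDiff.contDiffAt
  exact ((h 0).pow 2).add ((h 1).pow 2)

theorem contDiffAt_radialField {x : Plane} (hx : toComplex x ∈ Complex.slitPlane) {f : ℝ → ℝ}
    (hf : ContDiffAt ℝ 2 f (angle x)) : ContDiffAt ℝ 2 (radialField f) x := by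
  have h : ∀ i : Fin 2, ContDiffAt ℝ 2 (fun y : Plane => y i) x := fun i =>
    (EuclideanSpace.proj i : Plane →L[ℝ] ℝ).contDiff.contDiffAt
  have hfa : ContDiffAt ℝ 2 (fun y => f (angle y)) x :=
    hf.comp x (contDiffAt_angle hx (n := 2))
  have hr := contDiffAt_radSq x (n := 2)
  have hpos := radSq_pos hx
  rw [contDiffAt_piLp]
  intro i
  fin_cases i
  · simp only [Fin.zero_eta, radialField, polarField_zero, Pi.zero_apply, zero_mul, add_zero, pow_one]
    exact (hfa.mul (h 0)).div hr hpos.ne'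
  · simp only [Fin.mk_one, radialField, polarField_one, Pi.zero_apply, zero_mul, add_zero, pow_one]
    exact (hfa.mul (h 1)).div hr hpos.ne'

/-- The first partial derivatives are again of the form treated in `hasFDerivAt_polar`, with f' and
f as angular factors and `radSq` squared below. They have to be known in a neighbourhood, hence the
eventual hypothesis on f. -/
theorem laplacian_radialField {x : Plane} (hx : toComplex x ∈ Complex.slitPlane) {f f' : ℝ → ℝ}
    {f'' : ℝ} (hf : ∀ᶠ θ in 𝓝 (angle x), HasDerivAt f (f' θ) θ)
    (hf' : HasDerivAt f' f'' (angle x)) (hc : ContDiffAt ℝ 2 f (angle x)) :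
    (Laplacian.laplacian (radialField f) x) 0 =
      (f'' * x 0 - 2 * f' (angle x) * x 1) / radSq x ^ 2 ∧
    (Laplacian.laplacian (radialField f) x) 1 =
      (f'' * x 1 + 2 * f' (angle x) * x 0) / radSq x ^ 2 := by
  have hpos := radSq_pos hx
  have hev : ∀ᶠ y in 𝓝 x, toComplex y ∈ Complex.slitPlane ∧ HasDerivAt f (f' (angle y)) (angle y) := by
    filter_upwards [(Complex.isOpen_slitPlane.preimage toComplex.continuous).mem_nhds hx,
      (hasFDerivAt_angle hx).continuousAt.eventually hf] with y h1 h2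
    exact ⟨h1, h2⟩
  have hfx := hf.self_of_nhds
  have hd : ∀ᶠ y in 𝓝 x, DifferentiableAt ℝ (radialField f) y := by
    filter_upwards [hev] with y hy
    exact differentiableAt_polarField hy.1 hy.2.differentiableAt (differentiableAt_const _)
  have hC := contDiffAt_radialField hx hc
  have h0 := hasFDerivAt_coord 0 x
  have h1 := hasFDerivAt_coord 1 x
  have p01 : HasFDerivAt (fun y : Plane => y 0 * y 1) _ x := h0.mul h1
  have n01 : HasFDerivAt (fun y : Plane => -(y 0 * y 1)) _ x := p01.neg
  have d01 : HasFDerivAt (fun y : Plane => -(2 * (y 0 * y 1))) _ x := (p01.const_mul 2).neg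
  have s0 : HasFDerivAt (fun y : Plane => y 0 ^ 2) _ x := h0.pow 2
  have s1 : HasFDerivAt (fun y : Plane => y 1 ^ 2) _ x := h1.pow 2
  have n1 : HasFDerivAt (fun y : Plane => -(y 1 ^ 2)) _ x := s1.neg
  have m10 : HasFDerivAt (fun y : Plane => y 1 ^ 2 - y 0 ^ 2) _ x := s1.sub s0
  have m01 : HasFDerivAt (fun y : Plane => y 0 ^ 2 - y 1 ^ 2) _ x := s0.sub s1
  have e00 : (fun y => fderiv ℝ (fun z => radialField f z 0) y (EuclideanSpace.single 0 1)) =ᶠ[𝓝 x]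
      fun y => (f' (angle y) * (-(y 0 * y 1)) + f (angle y) * (y 1 ^ 2 - y 0 ^ 2)) / radSq y ^ 2 := by
    filter_upwards [hev, hd] with y hy hdy
    rw [← fderiv_coord hdy, fderiv_radialField_zero hy.1 hy.2]
    simp
  have e01 : (fun y => fderiv ℝ (fun z => radialField f z 0) y (EuclideanSpace.single 1 1)) =ᶠ[𝓝 x]
      fun y => (f' (angle y) * (y 0 ^ 2) + f (angle y) * (-(2 * (y 0 * y 1)))) / radSq y ^ 2 := by
    filter_upwards [hev, hd] with y hy hdy
    rw [← fderiv_coord hdy, fderiv_radialField_zero hy.1 hy.2]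
    simp [mul_assoc]
  have e10 : (fun y => fderiv ℝ (fun z => radialField f z 1) y (EuclideanSpace.single 0 1)) =ᶠ[𝓝 x]
      fun y => (f' (angle y) * (-(y 1 ^ 2)) + f (angle y) * (-(2 * (y 0 * y 1)))) / radSq y ^ 2 := by
    filter_upwards [hev, hd] with y hy hdy
    rw [← fderiv_coord hdy, fderiv_radialField_one hy.1 hy.2]
    simp [mul_assoc]
  have e11 : (fun y => fderiv ℝ (fun z => radialField f z 1) y (EuclideanSpace.single 1 1)) =ᶠ[𝓝 x]
      fun y => (f' (angle y) * (y 0 * y 1) + f (angle y) * (y 0 ^ 2 - y 1 ^ 2)) / radSq y ^ 2 := by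
    filter_upwards [hev, hd] with y hy hdy
    rw [← fderiv_coord hdy, fderiv_radialField_one hy.1 hy.2]
    simp
  constructor
  · rw [laplacian_coord hC, Fin.sum_univ_two, e00.fderiv_eq, e01.fderiv_eq,
      (hasFDerivAt_polar hx hf' hfx n01 m10 2).fderiv,
      (hasFDerivAt_polar hx hf' hfx s0 d01 2).fderiv]
    simp [angleDeriv]
    field_simp
    rw [radSq]
    ring
  · rw [laplacian_coord hC, Fin.sum_univ_two, e10.fderiv_eq, e11.fderiv_eq,
      (hasFDerivAt_polar hx hf' hfx n1 d01 2).fderiv,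
      (hasFDerivAt_polar hx hf' hfx p01 m01 2).fderiv]
    simp [angleDeriv]
    field_simp
    rw [radSq]
    ring

/-! ### Reduction of the flow to the Jeffery-Hamel equation -/

/-- `f` solves the Jeffery-Hamel equation `f'' + 4 f + f² = C` on `(a, b)`, with `f'` its
derivative. -/
def IsJHOn (C a b : ℝ) (f f' : ℝ → ℝ) : Prop :=
  ∀ θ ∈ Ioo a b, HasDerivAt f (f' θ) θ ∧ HasDerivAt f' (C - 4 * f θ - f θ ^ 2) θ

/-- `f` is the angular profile of a self-similar solution in the sector of half-angle `α`. -/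
structure IsJH (α : ℝ) (f : ℝ → ℝ) : Prop where
  ode : ∃ C f', IsJHOn C (-α) α f f'
  continuousOn : ContinuousOn f (Icc (-α) α)
  left : f (-α) = 0
  right : f α = 0

theorem continuous_eR : Continuous eR := by
  unfold eR
  fun_prop

theorem contDiff_eR {n : ℕ∞} : ContDiff ℝ n eR := by
  rw [contDiff_euclidean]
  intro i
  fin_cases i
  · simpa using Real.contDiff_cos
  · simpa using Real.contDiff_sin

theorem eR_mem_sector {α θ : ℝ} (hθ : θ ∈ Ioo (-α) α) : eR θ ∈ sector α :=
  ⟨1, θ, one_pos, hθ, by simp⟩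

theorem eR_mem_closure {α θ : ℝ} (hα : 0 < α) (hθ : θ ∈ Icc (-α) α) :
    eR θ ∈ closure (sector α) := by
  have h : θ ∈ closure (Ioo (-α) α) := by rwa [closure_Ioo (by linarith)]
  exact map_mem_closure continuous_eR h fun _ => eR_mem_sector

/-- The inequality |x| cos α ≤ x₀ is a closed condition satisfied on the sector, and since the
cosine decreases on [0, π] it says exactly |θ| ≤ α. This covers non-convex sectors as well. -/
theorem mem_Icc_of_mem_closure {α r θ : ℝ} (hα : 0 < α) (hαπ : α < π) (hr : 0 < r)
    (hθ : θ ∈ Ioc (-π) π) (h : r • eR θ ∈ closure (sector α)) : θ ∈ Icc (-α) α := by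
  have hcl : IsClosed {x : Plane | √(radSq x) * cos α ≤ x 0} := by
    refine isClosed_le ?_ ?_
    · unfold radSq
      fun_prop
    · fun_prop
  have hsub : sector α ⊆ {x : Plane | √(radSq x) * cos α ≤ x 0} := by
    rintro x ⟨r, θ, hr, hθ, rfl⟩
    simp only [mem_ofPred_eq, radSq_smul_eR, sqrt_sq hr.le, PiLp.smul_apply, eR_zero, smul_eq_mul]
    refine mul_le_mul_of_nonneg_left ?_ hr.le
    rw [← cos_abs θ]
    exact cos_le_cos_of_nonneg_of_le_pi (abs_nonneg _) hαπ.le (abs_lt.2 hθ).le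
  have := closure_minimal hsub hcl h
  simp only [mem_ofPred_eq, radSq_smul_eR, sqrt_sq hr.le, PiLp.smul_apply, eR_zero,
    smul_eq_mul] at this
  have hc := le_of_mul_le_mul_left this hr
  rw [mem_Icc, ← abs_le]
  by_contra! hlt
  have : cos |θ| < cos α :=
    cos_lt_cos_of_nonneg_of_le_pi hα.le (abs_le.2 ⟨hθ.1.le, hθ.2⟩) hlt
  rw [cos_abs] at this
  linarith

theorem smul_eR_mem_sector_iff {α r θ : ℝ} (hα : α ≤ π) (hr : 0 < r) (hθ : θ ∈ Ioc (-π) π) :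
    r • eR θ ∈ sector α ↔ θ ∈ Ioo (-α) α := by
  constructor
  · intro h
    have := ((mem_sector_iff hα _).1 h).2
    rwa [angle_smul_eR hr hθ] at this
  · exact fun h => ⟨r, θ, hr, h, rfl⟩

theorem eR_mem_frontier {α : ℝ} (hα : 0 < α) (hαπ : α < π) :
    eR α ∈ frontier (sector α) \ {0} ∧ eR (-α) ∈ frontier (sector α) \ {0} := by
  have key : ∀ θ ∈ Icc (-α) α, θ ∉ Ioo (-α) α → eR θ ∈ frontier (sector α) \ {0} := by
    intro θ h1 h2
    refine ⟨?_, eR_ne_zero θ⟩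
    rw [(isOpen_sector hαπ.le).frontier_eq]
    refine ⟨eR_mem_closure hα h1, fun h => h2 ?_⟩
    rw [← smul_eR_mem_sector_iff hαπ.le one_pos ⟨by linarith [h1.1], by linarith [h1.2]⟩, one_smul]
    exact h
  exact ⟨key α ⟨by linarith, le_rfl⟩ (by simp), key (-α) ⟨le_rfl, by linarith⟩ (by simp)⟩

theorem profile_eq (u : Plane → Plane) (θ : ℝ) :
    profile u θ = u (eR θ) 0 * cos θ + u (eR θ) 1 * sin θ := by
  simp [profile, PiLp.inner_apply, Fin.sum_univ_two, mul_comm]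

theorem isConst_of_hasDerivAt_zero {a b : ℝ} {g : ℝ → ℝ}
    (h : ∀ θ ∈ Ioo a b, HasDerivAt g 0 θ) {x y : ℝ} (hx : x ∈ Ioo a b) (hy : y ∈ Ioo a b) :
    g x = g y :=
  isOpen_Ioo.is_const_of_deriv_eq_zero isPreconnected_Ioo
    (fun θ hθ => (h θ hθ).differentiableAt.differentiableWithinAt)
    (fun θ hθ => (h θ hθ).deriv) hx hy

/-- Zero divergence makes the angular component g constant, and its value at the wall is 0. With g
gone, the angular momentum equation reads P' = 2f' and the radial one f'' + f² + 2P = 0; integrating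
the first and inserting it in the second leaves one constant of integration, which becomes C. -/
theorem IsSelfSimilarSolution.isJH {α : ℝ} (hα : 0 < α) (hαπ : α < π) {u : Plane → Plane}
    (hu : IsSelfSimilarSolution α u) : IsJH α (profile u) ∧
      ∀ r θ : ℝ, 0 < r → θ ∈ Ioo (-α) α → u (r • eR θ) = (profile u θ / r) • eR θ := by
  obtain ⟨p, hNS, hns, hsc⟩ := hu
  set f := profile u with hf_def
  set g : ℝ → ℝ := fun θ => u (eR θ) 1 * cos θ - u (eR θ) 0 * sin θ with hg_def
  have hfe : ∀ θ, f θ = u (eR θ) 0 * cos θ + u (eR θ) 1 * sin θ := profile_eq u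
  have hop := isOpen_sector hαπ.le
  have hIoc : ∀ θ ∈ Ioo (-α) α, θ ∈ Ioc (-π) π := fun θ hθ =>
    ⟨by linarith [hθ.1], by linarith [hθ.2]⟩
  have hslit : ∀ x ∈ sector α, toComplex x ∈ Complex.slitPlane := fun x hx =>
    ((mem_sector_iff hαπ.le x).1 hx).1
  have hang : ∀ θ ∈ Ioo (-α) α, angle (eR θ) = θ := fun θ hθ => by
    simpa using angle_smul_eR one_pos (hIoc θ hθ)
  have hrad : ∀ θ, radSq (eR θ) = 1 := fun θ => by simpa using radSq_smul_eR 1 θ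
  -- the velocity in polar form
  have hupol : ∀ r θ : ℝ, 0 < r → θ ∈ Ioo (-α) α → u (r • eR θ) = r⁻¹ • u (eR θ) := by
    intro r θ hr hθ
    have := (hsc (r • eR θ) ⟨r, θ, hr, hθ, rfl⟩ r⁻¹ (inv_pos.2 hr)).1
    rwa [smul_smul, inv_mul_cancel₀ hr.ne', one_smul] at this
  have hppol : ∀ r θ : ℝ, 0 < r → θ ∈ Ioo (-α) α → p (r • eR θ) = r⁻¹ ^ 2 * p (eR θ) := by
    intro r θ hr hθ
    have := (hsc (r • eR θ) ⟨r, θ, hr, hθ, rfl⟩ r⁻¹ (inv_pos.2 hr)).2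
    rwa [smul_smul, inv_mul_cancel₀ hr.ne', one_smul] at this
  have hupolar : ∀ x ∈ sector α, u x = polarField f g x := by
    rintro x ⟨r, θ, hr, hθ, rfl⟩
    rw [hupol r θ hr hθ]
    ext i
    fin_cases i
    · simp only [Fin.zero_eta, polarField_zero, angle_smul_eR hr (hIoc θ hθ), radSq_smul_eR, hfe,
        hg_def, PiLp.smul_apply, eR_zero, eR_one, smul_eq_mul]
      field_simp
      linear_combination (-u (eR θ) 0) * sin_sq_add_cos_sq θ
    · simp only [Fin.mk_one, polarField_one, angle_smul_eR hr (hIoc θ hθ), radSq_smul_eR, hfe,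
        hg_def, PiLp.smul_apply, eR_zero, eR_one, smul_eq_mul]
      field_simp
      linear_combination (-u (eR θ) 1) * sin_sq_add_cos_sq θ
  -- regularity of the angular components
  have hue : ContDiffOn ℝ 2 (fun θ => u (eR θ)) (Ioo (-α) α) :=
    hNS.contDiffOn_velocity.comp (contDiff_eR (n := 2)).contDiffOn fun θ hθ => eR_mem_sector hθ
  have hcomp : ∀ i : Fin 2, ContDiffOn ℝ 2 (fun θ => u (eR θ) i) (Ioo (-α) α) := fun i =>
    (EuclideanSpace.proj i : Plane →L[ℝ] ℝ).contDiff.comp_contDiffOn hue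
  have hfC : ContDiffOn ℝ 2 f (Ioo (-α) α) := by
    refine ContDiffOn.congr ?_ fun θ _ => hfe θ
    exact ((hcomp 0).mul contDiff_cos.contDiffOn).add ((hcomp 1).mul contDiff_sin.contDiffOn)
  have hgC : ContDiffOn ℝ 2 g (Ioo (-α) α) :=
    ((hcomp 1).mul contDiff_cos.contDiffOn).sub ((hcomp 0).mul contDiff_sin.contDiffOn)
  have hucont : ContinuousOn (fun θ => u (eR θ)) (Icc (-α) α) :=
    hns.continuousOn.comp continuous_eR.continuousOn fun θ hθ =>
      ⟨eR_mem_closure hα hθ, eR_ne_zero θ⟩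
  have hccont : ∀ i : Fin 2, ContinuousOn (fun θ => u (eR θ) i) (Icc (-α) α) := fun i =>
    (EuclideanSpace.proj i : Plane →L[ℝ] ℝ).continuous.comp_continuousOn hucont
  have hfcont : ContinuousOn f (Icc (-α) α) := by
    refine ContinuousOn.congr ?_ fun θ _ => hfe θ
    exact ((hccont 0).mul continuous_cos.continuousOn).add
      ((hccont 1).mul continuous_sin.continuousOn)
  have hgcont : ContinuousOn g (Icc (-α) α) :=
    ((hccont 1).mul continuous_cos.continuousOn).sub ((hccont 0).mul continuous_sin.continuousOn)
  obtain ⟨hfr1, hfr2⟩ := eR_mem_frontier hα hαπ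
  have hub1 := hns.eq_zero _ hfr1
  have hub2 := hns.eq_zero _ hfr2
  have hdf : ∀ θ ∈ Ioo (-α) α, HasDerivAt f (deriv f θ) θ := fun θ hθ =>
    ((hfC.contDiffAt (isOpen_Ioo.mem_nhds hθ)).differentiableAt (by norm_num)).hasDerivAt
  have hdg : ∀ θ ∈ Ioo (-α) α, HasDerivAt g (deriv g θ) θ := fun θ hθ =>
    ((hgC.contDiffAt (isOpen_Ioo.mem_nhds hθ)).differentiableAt (by norm_num)).hasDerivAt
  have hddf : ∀ θ ∈ Ioo (-α) α, HasDerivAt (deriv f) (deriv (deriv f) θ) θ := by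
    intro θ hθ
    have h1 := (contDiffOn_succ_iff_deriv_of_isOpen (n := 1) isOpen_Ioo).1 hfC
    exact ((h1.2.2.contDiffAt (isOpen_Ioo.mem_nhds hθ)).differentiableAt (by norm_num)).hasDerivAt
  -- the angular velocity vanishes
  have hg0 : ∀ θ ∈ Ioo (-α) α, HasDerivAt g 0 θ := by
    intro θ hθ
    have hx := eR_mem_sector hθ
    have hev : u =ᶠ[𝓝 (eR θ)] polarField f g := by
      filter_upwards [hop.mem_nhds hx] with y hy using hupolar y hy
    have hdiv := hNS.incompressible _ hx
    have hang' := hang θ hθ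
    rw [divergence, hev.fderiv_eq] at hdiv
    have h2 := divergence_polarField (hslit _ hx) (f := f) (g := g) (f' := deriv f θ)
      (g' := deriv g θ) (by rw [hang']; exact hdf θ hθ) (by rw [hang']; exact hdg θ hθ)
    rw [divergence, hdiv, hrad, div_one] at h2
    have h3 := hdg θ hθ
    rwa [← h2] at h3
  have h0mem : (0 : ℝ) ∈ Ioo (-α) α := ⟨by linarith, hα⟩
  have hgz : ∀ θ ∈ Ioo (-α) α, g θ = 0 := by
    have hc : ∀ θ ∈ Ioo (-α) α, g θ = g 0 := fun θ hθ =>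
      isConst_of_hasDerivAt_zero hg0 hθ h0mem
    have hcl : ∀ θ ∈ closure (Ioo (-α) α), g θ = g 0 := by
      have h := hgcont
      rw [← closure_Ioo (by linarith : -α ≠ α)] at h
      intro θ hθ
      exact (show EqOn g (fun _ => g 0) (closure (Ioo (-α) α)) from
        EqOn.of_subset_closure (fun θ hθ => hc θ hθ) h continuousOn_const
          subset_closure Subset.rfl) hθ
    have hα' := hcl α (by rw [closure_Ioo (by linarith)]; exact ⟨by linarith, le_rfl⟩)
    have hgα : g α = 0 := by simp [hg_def, hub1]
    intro θ hθ
    rw [hc θ hθ, ← hα', hgα]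
  have hurad : ∀ x ∈ sector α, u x = radialField f x := by
    intro x hx
    have := ((mem_sector_iff hαπ.le x).1 hx).2
    rw [hupolar x hx]
    simp [radialField, polarField, hgz _ this]
  -- the pressure
  set P : ℝ → ℝ := fun θ => p (eR θ) with hP_def
  have hPC : ContDiffOn ℝ 1 P (Ioo (-α) α) :=
    hNS.contDiffOn_pressure.comp (contDiff_eR (n := 1)).contDiffOn fun θ hθ => eR_mem_sector hθ
  have hdP : ∀ θ ∈ Ioo (-α) α, HasDerivAt P (deriv P θ) θ := fun θ hθ =>
    ((hPC.contDiffAt (isOpen_Ioo.mem_nhds hθ)).differentiableAt (by norm_num)).hasDerivAt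
  have hprad : ∀ x ∈ sector α, p x = P (angle x) / radSq x := by
    rintro x ⟨r, θ, hr, hθ, rfl⟩
    rw [hppol r θ hr hθ, angle_smul_eR hr (hIoc θ hθ), radSq_smul_eR, inv_pow, div_eq_inv_mul]
  have hmom : ∀ θ ∈ Ioo (-α) α, deriv (deriv f) θ + f θ ^ 2 + 2 * P θ = 0 ∧
      deriv P θ = 2 * deriv f θ := by
    intro θ hθ
    have hx := eR_mem_sector hθ
    have hxs := hslit _ hx
    have hang' := hang θ hθ
    have hev : u =ᶠ[𝓝 (eR θ)] radialField f := by
      filter_upwards [hop.mem_nhds hx] with y hy using hurad y hy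
    have hevp : p =ᶠ[𝓝 (eR θ)] fun y => P (angle y) / radSq y := by
      filter_upwards [hop.mem_nhds hx] with y hy using hprad y hy
    have hm := hNS.momentum _ hx
    rw [InnerProductSpace.laplacian_congr_nhds hev |>.self_of_nhds, hev.fderiv_eq,
      hurad _ hx, gradient, hevp.fderiv_eq, ← gradient] at hm
    obtain ⟨hl0, hl1⟩ := laplacian_radialField hxs (f := f) (f' := deriv f)
      (f'' := deriv (deriv f) θ)
      (by rw [hang']; filter_upwards [isOpen_Ioo.mem_nhds hθ] with t ht using hdf t ht)
      (by rw [hang']; exact hddf θ hθ)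
      (by rw [hang']; exact hfC.contDiffAt (isOpen_Ioo.mem_nhds hθ))
    have hconv := convection_radialField hxs (f := f) (f' := deriv f θ)
      (by rw [hang']; exact hdf θ hθ)
    obtain ⟨hp0, hp1⟩ := gradient_pressure hxs (P := P) (P' := deriv P θ)
      (by rw [hang']; exact hdP θ hθ)
    have hm0 := congrArg (fun v : Plane => v 0) hm
    have hm1 := congrArg (fun v : Plane => v 1) hm
    simp only [PiLp.add_apply, PiLp.neg_apply, PiLp.zero_apply, hl0, hl1, hconv, hp0, hp1, hrad,
      eR_zero, eR_one, hang', one_pow, div_one] at hm0 hm1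
    constructor
    -- The two combinations project the momentum equation onto -e_r and onto the angular unit
    -- vector.
    · linear_combination (-cos θ) * hm0 + (-sin θ) * hm1 -
        (deriv (deriv f) θ + f θ ^ 2 + 2 * P θ) * sin_sq_add_cos_sq θ
    · linear_combination (-sin θ) * hm0 + (cos θ) * hm1 -
        (deriv P θ - 2 * deriv f θ) * sin_sq_add_cos_sq θ
  have hPf : ∀ θ ∈ Ioo (-α) α, P θ = 2 * f θ + (P 0 - 2 * f 0) := by
    intro θ hθ
    have := isConst_of_hasDerivAt_zero (g := fun θ => P θ - 2 * f θ) (a := -α) (b := α)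
      (fun t ht => by
        have := (hdP t ht).sub ((hdf t ht).const_mul 2)
        rwa [(hmom t ht).2, sub_self] at this) hθ h0mem
    linarith
  refine ⟨⟨⟨-2 * (P 0 - 2 * f 0), deriv f, fun θ hθ => ⟨hdf θ hθ, ?_⟩⟩, hfcont, ?_, ?_⟩, ?_⟩
  · refine (hddf θ hθ).congr_deriv ?_
    have h1 := (hmom θ hθ).1
    have h2 := hPf θ hθ
    linarith
  · simp [hfe, hub2]
  · simp [hfe, hub1]
  · intro r θ hr hθ
    rw [hurad _ ⟨r, θ, hr, hθ, rfl⟩]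
    ext i
    fin_cases i
    · simp [radialField, polarField, angle_smul_eR hr (hIoc θ hθ), radSq_smul_eR]
      field_simp
    · simp [radialField, polarField, angle_smul_eR hr (hIoc θ hθ), radSq_smul_eR]
      field_simp

theorem contDiffOn_of_isJHOn {C a b : ℝ} {f f' : ℝ → ℝ} (h : IsJHOn C a b f f') :
    ContDiffOn ℝ 2 f (Ioo a b) := by
  have hd : ∀ θ ∈ Ioo a b, deriv f θ = f' θ := fun θ hθ => (h θ hθ).1.deriv
  have hd2 : ∀ θ ∈ Ioo a b, deriv f' θ = C - 4 * f θ - f θ ^ 2 := fun θ hθ => (h θ hθ).2.deriv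
  have hcf : ContinuousOn f (Ioo a b) := fun θ hθ => (h θ hθ).1.continuousAt.continuousWithinAt
  refine (contDiffOn_succ_iff_deriv_of_isOpen (n := 1) isOpen_Ioo).2 ⟨fun θ hθ =>
    (h θ hθ).1.differentiableAt.differentiableWithinAt, by simp, ?_⟩
  refine ContDiffOn.congr ?_ hd
  rw [← zero_add (1 : WithTop ℕ∞)]
  refine (contDiffOn_succ_iff_deriv_of_isOpen (n := 0) isOpen_Ioo).2 ⟨fun θ hθ =>
    (h θ hθ).2.differentiableAt.differentiableWithinAt, by simp, ?_⟩
  rw [contDiffOn_zero]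
  exact ContinuousOn.congr (by fun_prop) hd2

theorem mem_closure_sector_diff {α : ℝ} (hα : 0 < α) (hαπ : α < π) {x : Plane}
    (hx : x ∈ closure (sector α) \ {0}) :
    ∃ r θ : ℝ, 0 < r ∧ θ ∈ Icc (-α) α ∧ x = r • eR θ := by
  obtain ⟨r, θ, hr, hθ, rfl⟩ := exists_polar hx.2
  exact ⟨r, θ, hr, mem_Icc_of_mem_closure hα hαπ hr hθ hx.1, rfl⟩

theorem profile_radialField {α θ : ℝ} (hαπ : α < π) (hθ : θ ∈ Icc (-α) α) (f : ℝ → ℝ) :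
    profile (radialField f) θ = f θ := by
  have hm : θ ∈ Ioc (-π) π := ⟨by linarith [hθ.1], by linarith [hθ.2]⟩
  have ha := angle_smul_eR one_pos hm
  have hr := radSq_smul_eR 1 θ
  rw [one_smul] at ha hr
  rw [profile_eq]
  simp [radialField, polarField, ha, hr]
  linear_combination (f θ) * sin_sq_add_cos_sq θ

/-- The pressure must be (2f - C/2)/r², by integrating P' = 2f'. Because α < π strictly, even the
closed sector without its vertex avoids the cut, so continuity up to the walls is inherited from f
and the argument. -/
theorem IsJH.isSelfSimilarSolution {α : ℝ} (hα : 0 < α) (hαπ : α < π) {f : ℝ → ℝ}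
    (hf : IsJH α f) : IsSelfSimilarSolution α (radialField f) := by
  obtain ⟨C, f', hode⟩ := hf.ode
  have hop := isOpen_sector hαπ.le
  have hslit : ∀ x ∈ sector α, toComplex x ∈ Complex.slitPlane := fun x hx =>
    ((mem_sector_iff hαπ.le x).1 hx).1
  have hang : ∀ x ∈ sector α, angle x ∈ Ioo (-α) α := fun x hx =>
    ((mem_sector_iff hαπ.le x).1 hx).2
  have hC2 := contDiffOn_of_isJHOn hode
  have hcl : ∀ r θ : ℝ, 0 < r → θ ∈ Icc (-α) α → toComplex (r • eR θ) ∈ Complex.slitPlane ∧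
      angle (r • eR θ) = θ := by
    intro r θ hr hθ
    have hm : θ ∈ Ioo (-π) π := ⟨by linarith [hθ.1], by linarith [hθ.2]⟩
    refine ⟨?_, angle_smul_eR hr ⟨hm.1, hm.2.le⟩⟩
    exact ((mem_sector_iff le_rfl _).1 ⟨r, θ, hr, hm, rfl⟩).1
  refine ⟨fun x => (fun θ => 2 * f θ - C / 2) (angle x) / radSq x, ⟨?_, ?_, ?_, ?_⟩, ⟨?_, ?_⟩, ?_⟩
  · intro x hx
    exact (contDiffAt_radialField (hslit x hx)
      (hC2.contDiffAt (isOpen_Ioo.mem_nhds (hang x hx)))).contDiffWithinAt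
  · intro x hx
    have h1 : ContDiffAt ℝ 1 (fun y => f (angle y)) x :=
      ((hC2.contDiffAt (isOpen_Ioo.mem_nhds (hang x hx))).of_le (by norm_num)).comp x
        (contDiffAt_angle (hslit x hx) (n := 1))
    have h2 := contDiffAt_radSq x (n := 1)
    exact (((contDiffAt_const.mul h1).sub contDiffAt_const).div h2
      (radSq_pos (hslit x hx)).ne').contDiffWithinAt
  · intro x hx
    have ha := hang x hx
    have hxs := hslit x hx
    obtain ⟨hl0, hl1⟩ := laplacian_radialField hxs (f := f) (f' := f')
      (by filter_upwards [isOpen_Ioo.mem_nhds ha] with t ht using (hode t ht).1) (hode _ ha).2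
      (hC2.contDiffAt (isOpen_Ioo.mem_nhds ha))
    have hconv := convection_radialField hxs (hode _ ha).1
    obtain ⟨hp0, hp1⟩ := gradient_pressure hxs (P := fun θ => 2 * f θ - C / 2)
      (((hode _ ha).1.const_mul 2).sub_const (C / 2))
    have hpos := radSq_pos hxs
    ext i
    fin_cases i
    · simp only [Fin.zero_eta, PiLp.add_apply, PiLp.neg_apply, PiLp.zero_apply, hl0, hconv, hp0]
      field_simp
      ring
    · simp only [Fin.mk_one, PiLp.add_apply, PiLp.neg_apply, PiLp.zero_apply, hl1, hconv, hp1]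
      field_simp
      ring
  · intro x hx
    have h := divergence_polarField (hslit x hx) (hode _ (hang x hx)).1
      (hasDerivAt_const (angle x) (0 : ℝ))
    rw [zero_div] at h
    exact h
  · have ha : ContinuousOn angle (closure (sector α) \ {0}) := by
      intro x hx
      obtain ⟨r, θ, hr, hθ, rfl⟩ := mem_closure_sector_diff hα hαπ hx
      exact (hasFDerivAt_angle (hcl r θ hr hθ).1).continuousAt.continuousWithinAt
    have hm : MapsTo angle (closure (sector α) \ {0}) (Icc (-α) α) := by
      intro x hx
      obtain ⟨r, θ, hr, hθ, rfl⟩ := mem_closure_sector_diff hα hαπ hx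
      rwa [(hcl r θ hr hθ).2]
    have hfa : ContinuousOn (fun x => f (angle x)) (closure (sector α) \ {0}) :=
      hf.continuousOn.comp ha hm
    have hr : ContinuousOn radSq (closure (sector α) \ {0}) := fun x _ =>
      (contDiffAt_radSq x (n := 0)).continuousAt.continuousWithinAt
    have hr0 : ∀ x ∈ closure (sector α) \ {0}, radSq x ≠ 0 := by
      intro x hx
      obtain ⟨r, θ, hr, hθ, rfl⟩ := mem_closure_sector_diff hα hαπ hx
      exact (radSq_pos (hcl r θ hr hθ).1).ne'
    have hco : ∀ i : Fin 2, ContinuousOn (fun x : Plane => x i) (closure (sector α) \ {0}) :=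
      fun i => (EuclideanSpace.proj i : Plane →L[ℝ] ℝ).continuous.continuousOn
    refine (PiLp.continuous_toLp 2 _).comp_continuousOn (continuousOn_pi.2 fun i => ?_)
    fin_cases i
    · have h := (hfa.mul (hco 0)).div hr hr0
      simp only [Pi.zero_apply, zero_mul, add_zero]
      exact h
    · have h := (hfa.mul (hco 1)).div hr hr0
      simp only [Pi.zero_apply, zero_mul, add_zero]
      exact h
  · intro x hx
    have hx' : x ∈ closure (sector α) \ {0} := ⟨frontier_subset_closure hx.1, hx.2⟩
    obtain ⟨r, θ, hr, hθ, rfl⟩ := mem_closure_sector_diff hα hαπ hx'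
    have hns : θ ∉ Ioo (-α) α := by
      intro h
      have := hx.1
      rw [hop.frontier_eq] at this
      exact this.2 ⟨r, θ, hr, h, rfl⟩
    have hz : f θ = 0 := by
      rcases eq_or_lt_of_le hθ.1 with h | h
      · rw [← h]; exact hf.left
      rcases eq_or_lt_of_le hθ.2 with h' | h'
      · rw [h']; exact hf.right
      exact absurd ⟨h, h'⟩ hns
    ext i
    fin_cases i <;> simp [radialField, polarField, (hcl r θ hr hθ).2, hz]
  · rintro x ⟨r, θ, hr, hθ, rfl⟩ t ht
    have hm : θ ∈ Icc (-α) α := Ioo_subset_Icc_self hθ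
    rw [smul_smul]
    have h1 := (hcl r θ hr hm).2
    have h2 := (hcl (t * r) θ (mul_pos ht hr) hm).2
    refine ⟨?_, ?_⟩
    · ext i
      fin_cases i
      · simp [radialField, polarField, h1, h2, radSq_smul_eR]
        field_simp
      · simp [radialField, polarField, h1, h2, radSq_smul_eR]
        field_simp
    · simp only [h1, h2, radSq_smul_eR]
      field_simp

/-- The number of sign intervals of a Jeffery-Hamel profile. -/
structure IsJHType (α : ℝ) (a b : ℕ) (f : ℝ → ℝ) : Prop where
  isJH : IsJH α f
  pos : numIntervals {θ | θ ∈ Ioo (-α) α ∧ 0 < f θ} = a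
  neg : numIntervals {θ | θ ∈ Ioo (-α) α ∧ f θ < 0} = b

theorem IsOfType.isJHType {α : ℝ} (hα : 0 < α) (hαπ : α < π) {a b : ℕ} {u : Plane → Plane}
    (h : IsOfType α a b u) : IsJHType α a b (profile u) :=
  ⟨(h.solution.isJH hα hαπ).1, h.outflow, h.inflow⟩

theorem IsJHType.exists_isOfType {α : ℝ} (hα : 0 < α) (hαπ : α < π) {a b : ℕ} {f : ℝ → ℝ}
    (h : IsJHType α a b f) :
    ∃ u, IsOfType α a b u ∧ (∀ θ ∈ Icc (-α) α, profile u θ = f θ) ∧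
      flux α u = ∫ θ in (-α)..α, f θ := by
  have hp : ∀ θ ∈ Icc (-α) α, profile (radialField f) θ = f θ := fun θ hθ =>
    profile_radialField hαπ hθ f
  refine ⟨radialField f, ⟨h.isJH.isSelfSimilarSolution hα hαπ, ?_, ?_⟩, hp, ?_⟩
  · rw [← h.pos]
    congr 1
    ext θ
    refine and_congr_right fun hθ => ?_
    rw [hp θ (Ioo_subset_Icc_self hθ)]
  · rw [← h.neg]
    congr 1
    ext θ
    refine and_congr_right fun hθ => ?_
    rw [hp θ (Ioo_subset_Icc_self hθ)]
  · refine intervalIntegral.integral_congr fun θ hθ => hp θ ?_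
    rwa [uIcc_of_le (by linarith)] at hθ

/-- From here on, questions about fluxes of flows are questions about profiles of the ordinary
differential equation. -/
theorem fluxSet_eq {α : ℝ} (hα : 0 < α) (hαπ : α < π) (a b : ℕ) :
    fluxSet a b α = {Φ | ∃ f, IsJHType α a b f ∧ ∫ θ in (-α)..α, f θ = Φ} := by
  ext Φ
  constructor
  · rintro ⟨u, hu, rfl⟩
    exact ⟨profile u, hu.isJHType hα hαπ, rfl⟩
  · rintro ⟨f, hf, rfl⟩
    obtain ⟨u, hu, -, hfl⟩ := hf.exists_isOfType hα hαπ
    exact ⟨u, hu, hfl⟩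

theorem eqOn_sector_iff {α : ℝ} (hα : 0 < α) (hαπ : α < π) {u v : Plane → Plane}
    (hu : IsSelfSimilarSolution α u) (hv : IsSelfSimilarSolution α v) :
    EqOn u v (sector α) ↔ ∀ θ ∈ Ioo (-α) α, profile u θ = profile v θ := by
  constructor
  · intro h θ hθ
    rw [profile, profile, h (eR_mem_sector hθ)]
  · rintro h x ⟨r, θ, hr, hθ, rfl⟩
    rw [(hu.isJH hα hαπ).2 r θ hr hθ, (hv.isJH hα hαπ).2 r θ hr hθ, h θ hθ]

theorem reflect_smul_eR (v : Plane → Plane) (r θ : ℝ) :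
    reflect v (r • eR θ) = !₂[v (r • eR (-θ)) 0, -v (r • eR (-θ)) 1] := by
  have : (!₂[(r • eR θ) 0, -(r • eR θ) 1] : Plane) = r • eR (-θ) := by
    ext i
    fin_cases i <;> simp
  rw [reflect, this]

theorem profile_reflect (v : Plane → Plane) (θ : ℝ) :
    profile (reflect v) θ = profile v (-θ) := by
  have := reflect_smul_eR v 1 θ
  rw [one_smul, one_smul] at this
  rw [profile_eq, profile_eq, this]
  simp

theorem eqOn_reflect_iff {α : ℝ} (hα : 0 < α) (hαπ : α < π) {u v : Plane → Plane}
    (hu : IsSelfSimilarSolution α u) (hv : IsSelfSimilarSolution α v) :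
    EqOn u (reflect v) (sector α) ↔ ∀ θ ∈ Ioo (-α) α, profile u θ = profile v (-θ) := by
  constructor
  · intro h θ hθ
    rw [← profile_reflect, profile, profile, h (eR_mem_sector hθ)]
  · rintro h x ⟨r, θ, hr, hθ, rfl⟩
    have hθ' : -θ ∈ Ioo (-α) α := ⟨by linarith [hθ.2], by linarith [hθ.1]⟩
    rw [(hu.isJH hα hαπ).2 r θ hr hθ, reflect_smul_eR, (hv.isJH hα hαπ).2 r (-θ) hr hθ', h θ hθ]
    ext i
    fin_cases i <;> simp

/-! ### Uniqueness and first integral of the Jeffery-Hamel equation -/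

section ODE

variable {C a b c : ℝ} {f f' g g' : ℝ → ℝ}

theorem IsJHOn.mono {a₂ b₂ : ℝ} (hf : IsJHOn C a b f f') (ha : a ≤ a₂) (hb : b₂ ≤ b) :
    IsJHOn C a₂ b₂ f f' := fun θ hθ => hf θ ⟨ha.trans_lt hθ.1, hθ.2.trans_le hb⟩

theorem IsJHOn.comp_add (hf : IsJHOn C a b f f') (c : ℝ) :
    IsJHOn C (a - c) (b - c) (fun θ => f (θ + c)) (fun θ => f' (θ + c)) := by
  intro θ hθ
  have h := hf (θ + c) ⟨by linarith [hθ.1], by linarith [hθ.2]⟩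
  exact ⟨h.1.comp_add_const θ c, h.2.comp_add_const θ c⟩

theorem IsJHOn.comp_const_sub (hf : IsJHOn C a b f f') (c : ℝ) :
    IsJHOn C (c - b) (c - a) (fun θ => f (c - θ)) (fun θ => -f' (c - θ)) := by
  intro θ hθ
  have h := hf (c - θ) ⟨by linarith [hθ.2], by linarith [hθ.1]⟩
  refine ⟨h.1.comp_const_sub c θ, ?_⟩
  have h2 : HasDerivAt (fun θ => -f' (c - θ)) _ θ := (h.2.comp_const_sub c θ).neg
  exact h2.congr_deriv (neg_neg _)

/-- Uniqueness for the initial value problem. -/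
theorem IsJHOn.eqOn (hf : IsJHOn C a b f f') (hg : IsJHOn C a b g g')
    (hfb : ∃ R, ∀ θ ∈ Ioo a b, |f θ| ≤ R) (hgb : ∃ R, ∀ θ ∈ Ioo a b, |g θ| ≤ R)
    (hc : c ∈ Ioo a b) (h0 : f c = g c) (h1 : f' c = g' c) :
    ∀ θ ∈ Ioo a b, f θ = g θ := by
  obtain ⟨R₁, hR₁⟩ := hfb
  obtain ⟨R₂, hR₂⟩ := hgb
  set R := max R₁ R₂
  have hR : 0 ≤ R := (abs_nonneg _).trans ((hR₁ c hc).trans (le_max_left _ _))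
  -- The quadratic right-hand side is Lipschitz only on strips |f| ≤ R, which is why both solutions
  -- are required to be bounded.
  have hlip : ∀ t ∈ Ioo a b, LipschitzOnWith (⟨5 + 2 * R, by linarith⟩ : NNReal)
      (fun p : ℝ × ℝ => (p.2, C - 4 * p.1 - p.1 ^ 2)) {p : ℝ × ℝ | |p.1| ≤ R} := by
    intro t _
    refine LipschitzOnWith.of_dist_le_mul fun p hp q hq => ?_
    simp only [mem_ofPred_eq] at hp hq
    simp only [Prod.dist_eq, Real.dist_eq]
    have hm1 := le_max_left |p.1 - q.1| |p.2 - q.2|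
    have hm2 := le_max_right |p.1 - q.1| |p.2 - q.2|
    set M := max |p.1 - q.1| |p.2 - q.2|
    have hM : 0 ≤ M := (abs_nonneg _).trans hm1
    refine max_le ?_ ?_
    · change _ ≤ (5 + 2 * R) * M
      nlinarith
    · change _ ≤ (5 + 2 * R) * M
      have : C - 4 * p.1 - p.1 ^ 2 - (C - 4 * q.1 - q.1 ^ 2) = -(4 + p.1 + q.1) * (p.1 - q.1) := by
        ring
      rw [this, abs_mul, abs_neg]
      have h4 : |4 + p.1 + q.1| ≤ 4 + 2 * R := by
        rw [abs_le] at hp hq ⊢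
        constructor <;> linarith [hp.1, hp.2, hq.1, hq.2]
      calc |4 + p.1 + q.1| * |p.1 - q.1| ≤ (4 + 2 * R) * M :=
            mul_le_mul h4 hm1 (abs_nonneg _) (by linarith)
        _ ≤ (5 + 2 * R) * M := by nlinarith
  have key := ODE_solution_unique_of_mem_Ioo (f := fun t => (f t, f' t)) (g := fun t => (g t, g' t))
    (v := fun _ p => (p.2, C - 4 * p.1 - p.1 ^ 2)) (s := fun _ => {p : ℝ × ℝ | |p.1| ≤ R})
    hlip hc
    (fun t ht => ⟨(hf t ht).1.prodMk (hf t ht).2, (hR₁ t ht).trans (le_max_left _ _)⟩)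
    (fun t ht => ⟨(hg t ht).1.prodMk (hg t ht).2, (hR₂ t ht).trans (le_max_right _ _)⟩)
    (by simp [h0, h1])
  exact fun θ hθ => congrArg Prod.fst (key hθ)

/-- The first integral of the equation. -/
theorem IsJHOn.energy (hf : IsJHOn C a b f f') {x y : ℝ} (hx : x ∈ Ioo a b) (hy : y ∈ Ioo a b) :
    f' x ^ 2 / 2 + 2 * f x ^ 2 + f x ^ 3 / 3 - C * f x =
      f' y ^ 2 / 2 + 2 * f y ^ 2 + f y ^ 3 / 3 - C * f y := by
  refine isConst_of_hasDerivAt_zero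
    (g := fun t => f' t ^ 2 / 2 + 2 * f t ^ 2 + f t ^ 3 / 3 - C * f t) (fun t ht => ?_) hx hy
  obtain ⟨h1, h2⟩ := hf t ht
  refine ((((h2.pow 2).div_const 2).add ((h1.pow 2).const_mul 2)).add
    ((h1.pow 3).div_const 3) |>.sub (h1.const_mul C)).congr_deriv ?_
  simp
  ring

end ODE

/-- The inverse of the primitive of a periodic function whose primitive is strictly increasing. -/
theorem exists_primitive_inverse {g : ℝ → ℝ} (hc : Continuous g) (hper : Function.Periodic g π)
    (hmono : StrictMono fun x => ∫ t in (0 : ℝ)..x, g t) :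
    ∃ ψ : ℝ → ℝ, Continuous ψ ∧ StrictMono ψ ∧ (∀ x, ψ (∫ t in (0 : ℝ)..x, g t) = x) ∧
      (∀ θ, ∫ t in (0 : ℝ)..ψ θ, g t = θ) ∧
      (∀ θ, g (ψ θ) ≠ 0 → HasDerivAt ψ (g (ψ θ))⁻¹ θ) ∧
      ∀ k : ℝ → ℝ, Continuous k → ∀ a b : ℝ,
        ∫ θ in (∫ t in (0 : ℝ)..a, g t)..(∫ t in (0 : ℝ)..b, g t), k (ψ θ) =
          ∫ x in a..b, k x * g x := by
  set Θ : ℝ → ℝ := fun x => ∫ t in (0 : ℝ)..x, g t with hΘ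
  have hd : ∀ x, HasDerivAt Θ (g x) x := fun x => hc.integral_hasStrictDerivAt 0 x |>.hasDerivAt
  have hcont : Continuous Θ := continuous_iff_continuousAt.2 fun x => (hd x).continuousAt
  have hpos : 0 < ∫ t in (0 : ℝ)..π, g t := by
    have h : (∫ t in (0 : ℝ)..0, g t) < ∫ t in (0 : ℝ)..π, g t := hmono pi_pos
    simpa using h
  have hint : ∀ t₁ t₂, IntervalIntegrable g MeasureTheory.volume t₁ t₂ := fun _ _ =>
    hc.intervalIntegrable _ _
  have hsurj : Function.Surjective Θ :=
    hcont.surjective (hper.tendsto_atTop_intervalIntegral_of_pos hpos pi_pos)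
      (hper.tendsto_atBot_intervalIntegral_of_pos hpos pi_pos)
  set e := StrictMono.orderIsoOfSurjective Θ hmono hsurj
  have he : ∀ x, e.symm (Θ x) = x := fun x => e.symm_apply_apply x
  have he' : ∀ θ, Θ (e.symm θ) = θ := fun θ => e.apply_symm_apply θ
  have hec : Continuous e.symm := e.symm.continuous
  refine ⟨e.symm, hec, e.symm.strictMono, he, he', fun θ hθ => ?_, fun k hk a b => ?_⟩
  -- Only non-vanishing at the point itself is needed. This matters for arcs with d > 0, whose
  -- integrand vanishes at the zeros of the cosine, that is, at the walls.
  · exact HasDerivAt.of_local_left_inverse hec.continuousAt (hd _) hθ (Eventually.of_forall he')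
  · have := intervalIntegral.integral_comp_mul_deriv (a := a) (b := b) (f := Θ) (f' := g)
      (g := fun θ => k (e.symm θ)) (fun x _ => hd x) hc.continuousOn (hk.comp hec)
    rw [← this]
    refine intervalIntegral.integral_congr fun x _ => ?_
    simp [he]

/-! ### Counting the intervals of a set -/

theorem connectedComponentIn_iUnion_Ioo {t : ℤ → ℝ} (ht : StrictMono t) {s : Set ℤ} {n : ℤ}
    (hn : n ∈ s) {θ : ℝ} (hθ : θ ∈ Ioo (t n) (t (n + 1))) :
    connectedComponentIn (⋃ n ∈ s, Ioo (t n) (t (n + 1))) θ = Ioo (t n) (t (n + 1)) := by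
  have hsub : Ioo (t n) (t (n + 1)) ⊆ ⋃ n ∈ s, Ioo (t n) (t (n + 1)) :=
    subset_biUnion_of_mem (u := fun n => Ioo (t n) (t (n + 1))) hn
  refine Subset.antisymm ?_ (isPreconnected_Ioo.subset_connectedComponentIn hθ hsub)
  -- The partition points lie in none of the intervals, so no connected subset of the union can
  -- cross one of them.
  have hnot : ∀ k : ℤ, t k ∉ ⋃ n ∈ s, Ioo (t n) (t (n + 1)) := by
    intro k hk
    simp only [mem_iUnion, mem_Ioo, exists_prop] at hk
    obtain ⟨j, -, h1, h2⟩ := hk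
    have h1' := ht.lt_iff_lt.1 h1
    have h2' := ht.lt_iff_lt.1 h2
    omega
  have hmem := mem_connectedComponentIn (hsub hθ)
  have hpc : IsPreconnected (connectedComponentIn (⋃ n ∈ s, Ioo (t n) (t (n + 1))) θ) :=
    isPreconnected_connectedComponentIn
  have hcs := connectedComponentIn_subset (⋃ n ∈ s, Ioo (t n) (t (n + 1))) θ
  intro y hy
  constructor
  · by_contra! h
    exact hnot n (hcs (hpc.ordConnected.out hy hmem ⟨h, hθ.1.le⟩))
  · by_contra! h
    exact hnot (n + 1) (hcs (hpc.ordConnected.out hmem hy ⟨hθ.2.le, h⟩))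

theorem numIntervals_iUnion_Ioo {t : ℤ → ℝ} (ht : StrictMono t) (s : Finset ℤ) :
    numIntervals (⋃ n ∈ (s : Set ℤ), Ioo (t n) (t (n + 1))) = s.card := by
  have himg : (fun θ => connectedComponentIn (⋃ n ∈ (s : Set ℤ), Ioo (t n) (t (n + 1))) θ) ''
      (⋃ n ∈ (s : Set ℤ), Ioo (t n) (t (n + 1))) =
      (fun n => Ioo (t n) (t (n + 1))) '' (s : Set ℤ) := by
    ext U
    constructor
    · rintro ⟨θ, hθ, rfl⟩
      simp only [mem_iUnion, exists_prop] at hθ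
      obtain ⟨n, hn, hθ⟩ := hθ
      exact ⟨n, hn, (connectedComponentIn_iUnion_Ioo ht hn hθ).symm⟩
    · rintro ⟨n, hn, rfl⟩
      obtain ⟨θ, hθ⟩ := nonempty_Ioo.2 (ht (Int.lt_succ n))
      exact ⟨θ, mem_biUnion hn hθ, connectedComponentIn_iUnion_Ioo ht hn hθ⟩
  have hinj : InjOn (fun n => Ioo (t n) (t (n + 1))) (s : Set ℤ) := by
    intro n _ k _ h
    obtain ⟨θ, hθ⟩ := nonempty_Ioo.2 (ht (Int.lt_succ n))
    have hθ' : θ ∈ Ioo (t k) (t (k + 1)) := by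
      have h' : Ioo (t n) (t (n + 1)) = Ioo (t k) (t (k + 1)) := h
      rw [← h']
      exact hθ
    have h1 := ht.lt_iff_lt.1 (hθ.1.trans hθ'.2)
    have h2 := ht.lt_iff_lt.1 (hθ'.1.trans hθ.2)
    omega
  rw [numIntervals, himg, hinj.encard_image, encard_coe_eq_coe_finsetCard]

theorem numIntervals_eq_zero_iff (S : Set ℝ) : numIntervals S = 0 ↔ S = ∅ := by
  rw [numIntervals, encard_eq_zero, image_eq_empty]

theorem numIntervals_eq_one_of_isPreconnected {S : Set ℝ} (hS : IsPreconnected S)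
    (hne : S.Nonempty) : numIntervals S = 1 := by
  rw [numIntervals, encard_eq_one]
  refine ⟨S, ?_⟩
  ext U
  constructor
  · rintro ⟨θ, hθ, rfl⟩
    exact hS.connectedComponentIn hθ
  · rintro rfl
    obtain ⟨θ, hθ⟩ := hne
    exact ⟨θ, hθ, hS.connectedComponentIn hθ⟩

theorem isPreconnected_of_numIntervals_eq_one {S : Set ℝ} (h : numIntervals S = 1) :
    IsPreconnected S := by
  rw [numIntervals, encard_eq_one] at h
  obtain ⟨U, hU⟩ := h
  have : S = U := by
    ext θ
    constructor
    · intro hθ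
      have hm : connectedComponentIn S θ ∈ ({U} : Set (Set ℝ)) := hU ▸ mem_image_of_mem _ hθ
      rw [← mem_singleton_iff.1 hm]
      exact mem_connectedComponentIn hθ
    · intro hθ
      have hm : U ∈ (fun θ => connectedComponentIn S θ) '' S := by rw [hU]; rfl
      obtain ⟨x, _, hx⟩ := hm
      rw [← hx] at hθ
      exact connectedComponentIn_subset _ _ hθ
  have hm : U ∈ (fun θ => connectedComponentIn S θ) '' S := by rw [hU]; rfl
  obtain ⟨x, _, hx⟩ := hm
  rw [this, ← hx]
  exact isPreconnected_connectedComponentIn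

/-! ### Incomplete elliptic integrals and the amplitude function -/

section EvenPeriodic

variable {h : ℝ → ℝ}

theorem integral_neg_of_even (he : ∀ t, h (-t) = h t) (φ : ℝ) :
    ∫ t in (0 : ℝ)..-φ, h t = -∫ t in (0 : ℝ)..φ, h t := by
  have := intervalIntegral.integral_comp_neg (a := 0) (b := φ) h
  simp only [he, neg_zero] at this
  rw [this, intervalIntegral.integral_symm]

theorem integral_add_int_mul_pi (hc : Continuous h) (he : ∀ t, h (-t) = h t)
    (hp : Function.Periodic h π) (φ : ℝ) (n : ℤ) :
    ∫ t in (0 : ℝ)..φ + n * π, h t =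
      (∫ t in (0 : ℝ)..φ, h t) + 2 * n * ∫ t in (0 : ℝ)..π / 2, h t := by
  have hi : ∀ a b, IntervalIntegrable h MeasureTheory.volume a b := fun a b =>
    hc.intervalIntegrable a b
  have h1 := hp.intervalIntegral_add_zsmul_eq n φ hi
  have h2 : ∫ t in (-(π / 2))..(-(π / 2) + π), h t = 2 * ∫ t in (0 : ℝ)..π / 2, h t := by
    rw [← intervalIntegral.integral_add_adjacent_intervals (hi _ 0) (hi 0 _),
      intervalIntegral.integral_symm 0 (-(π / 2)), integral_neg_of_even he,
      show -(π / 2) + π = π / 2 by ring]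
    ring
  have h3 := hp.intervalIntegral_add_eq φ (-(π / 2))
  rw [zsmul_eq_mul, zsmul_eq_mul, h3, h2] at h1
  rw [← intervalIntegral.integral_add_adjacent_intervals (hi 0 φ) (hi φ _), h1]
  ring

end EvenPeriodic

/-- The weight `(1 + κ sin² t)^(-1/2)`. -/
noncomputable def weight (κ t : ℝ) : ℝ := (√(1 + κ * sin t ^ 2))⁻¹

/-- The incomplete integral of the weight. -/
noncomputable def kInt (κ φ : ℝ) : ℝ := ∫ t in (0 : ℝ)..φ, weight κ t

/-- The incomplete integral of `sin²` against the weight. -/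
noncomputable def lInt (κ φ : ℝ) : ℝ := ∫ t in (0 : ℝ)..φ, sin t ^ 2 * weight κ t

theorem one_add_mul_sin_sq_pos {κ : ℝ} (hκ : 0 ≤ κ) (t : ℝ) : 0 < 1 + κ * sin t ^ 2 := by positivity

theorem weight_pos {κ : ℝ} (hκ : 0 ≤ κ) (t : ℝ) : 0 < weight κ t :=
  inv_pos.2 (sqrt_pos.2 (one_add_mul_sin_sq_pos hκ t))

theorem continuous_weight {κ : ℝ} (hκ : 0 ≤ κ) : Continuous (weight κ) := by
  unfold weight
  refine Continuous.inv₀ (by fun_prop) fun t => ?_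
  exact (sqrt_pos.2 (one_add_mul_sin_sq_pos hκ t)).ne'

theorem weight_neg (κ t : ℝ) : weight κ (-t) = weight κ t := by simp [weight]

theorem weight_periodic (κ : ℝ) : Function.Periodic (weight κ) π := by
  intro t
  simp [weight, sin_add_pi]

theorem kInt_zero (κ : ℝ) : kInt κ 0 = 0 := by simp [kInt]

theorem lInt_zero (κ : ℝ) : lInt κ 0 = 0 := by simp [lInt]

theorem kInt_neg (κ φ : ℝ) : kInt κ (-φ) = -kInt κ φ :=
  integral_neg_of_even (weight_neg κ) φ

theorem kInt_add_int_mul_pi {κ : ℝ} (hκ : 0 ≤ κ) (φ : ℝ) (n : ℤ) :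
    kInt κ (φ + n * π) = kInt κ φ + 2 * n * kInt κ (π / 2) :=
  integral_add_int_mul_pi (continuous_weight hκ) (weight_neg κ) (weight_periodic κ) φ n

theorem lInt_neg (κ φ : ℝ) : lInt κ (-φ) = -lInt κ φ :=
  integral_neg_of_even (fun t => by simp [weight_neg]) φ

theorem continuous_sin_sq_mul_weight {κ : ℝ} (hκ : 0 ≤ κ) :
    Continuous fun t => sin t ^ 2 * weight κ t := by
  have := continuous_weight hκ
  fun_prop

theorem lInt_add_int_mul_pi {κ : ℝ} (hκ : 0 ≤ κ) (φ : ℝ) (n : ℤ) :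
    lInt κ (φ + n * π) = lInt κ φ + 2 * n * lInt κ (π / 2) :=
  integral_add_int_mul_pi (continuous_sin_sq_mul_weight hκ)
    (fun t => by simp [weight_neg])
    (fun t => by simp only [sin_add_pi, weight_periodic κ t, neg_sq]) φ n

theorem hasDerivAt_kInt {κ : ℝ} (hκ : 0 ≤ κ) (φ : ℝ) : HasDerivAt (kInt κ) (weight κ φ) φ :=
  ((continuous_weight hκ).integral_hasStrictDerivAt 0 φ).hasDerivAt

theorem kInt_strictMono {κ : ℝ} (hκ : 0 ≤ κ) : StrictMono (kInt κ) :=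
  strictMono_of_hasDerivAt_pos (hasDerivAt_kInt hκ) (weight_pos hκ)

theorem kInt_pos {κ φ : ℝ} (hκ : 0 ≤ κ) (hφ : 0 < φ) : 0 < kInt κ φ := by
  have := kInt_strictMono hκ hφ
  rwa [kInt_zero] at this

/-- The inverse function of `kInt κ`. -/
noncomputable def amp (κ : ℝ) : ℝ → ℝ := Function.invFun (kInt κ)

/-- This is the Jacobi amplitude with parameter -κ, characterised by A' = √(1 + κ sin² A). The last
clause changes variables from the angle to the phase and turns fluxes into elliptic integrals. -/
theorem amp_spec {κ : ℝ} (hκ : 0 ≤ κ) : Continuous (amp κ) ∧ StrictMono (amp κ) ∧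
    (∀ x, amp κ (kInt κ x) = x) ∧ (∀ θ, kInt κ (amp κ θ) = θ) ∧
    (∀ θ, HasDerivAt (amp κ) (√(1 + κ * sin (amp κ θ) ^ 2)) θ) ∧
    ∀ k : ℝ → ℝ, Continuous k → ∀ a b : ℝ,
      ∫ θ in (kInt κ a)..(kInt κ b), k (amp κ θ) = ∫ x in a..b, k x * weight κ x := by
  obtain ⟨ψ, h1, h2, h3, h4, h5, h6⟩ := exists_primitive_inverse (continuous_weight hκ)
    (weight_periodic κ) (kInt_strictMono hκ)
  have : amp κ = ψ := by
    ext θ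
    have h := Function.leftInverse_invFun (kInt_strictMono hκ).injective (ψ θ)
    have h' : kInt κ (ψ θ) = θ := h4 θ
    rw [h'] at h
    exact h
  rw [this]
  refine ⟨h1, h2, h3, h4, fun θ => ?_, h6⟩
  have := h5 θ (weight_pos hκ _).ne'
  rwa [weight, inv_inv] at this

theorem continuous_amp {κ : ℝ} (hκ : 0 ≤ κ) : Continuous (amp κ) := (amp_spec hκ).1

theorem amp_kInt {κ : ℝ} (hκ : 0 ≤ κ) (x : ℝ) : amp κ (kInt κ x) = x := (amp_spec hκ).2.2.1 x

theorem kInt_amp {κ : ℝ} (hκ : 0 ≤ κ) (θ : ℝ) : kInt κ (amp κ θ) = θ := (amp_spec hκ).2.2.2.1 θ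

theorem hasDerivAt_amp {κ : ℝ} (hκ : 0 ≤ κ) (θ : ℝ) :
    HasDerivAt (amp κ) (√(1 + κ * sin (amp κ θ) ^ 2)) θ := (amp_spec hκ).2.2.2.2.1 θ

theorem amp_neg {κ : ℝ} (hκ : 0 ≤ κ) (θ : ℝ) : amp κ (-θ) = -amp κ θ := by
  rw [← amp_kInt hκ (-amp κ θ), kInt_neg, kInt_amp hκ]

theorem amp_add {κ : ℝ} (hκ : 0 ≤ κ) (θ : ℝ) (n : ℤ) :
    amp κ (θ + 2 * n * kInt κ (π / 2)) = amp κ θ + n * π := by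
  rw [← amp_kInt hκ (amp κ θ + n * π), kInt_add_int_mul_pi hκ, kInt_amp hκ]

/-! ### The two-parameter family of periodic solutions -/

/-- The scaling factor of the periodic solution with parameters `κ`, `x`. -/
noncomputable def scale (κ x : ℝ) : ℝ := 1 - κ + 3 * κ * sin x ^ 2

/-- The periodic solution of the Jeffery-Hamel equation whose range is
`6κ/s · [-sin² x, cos² x]`. -/
noncomputable def wave (κ x θ : ℝ) : ℝ :=
  6 * κ / scale κ x * (sin (amp κ (θ / √(scale κ x))) ^ 2 - sin x ^ 2)

/-- The derivative of `wave`. -/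
noncomputable def waveDeriv (κ x θ : ℝ) : ℝ :=
  6 * κ / scale κ x * (2 * sin (amp κ (θ / √(scale κ x))) * cos (amp κ (θ / √(scale κ x))) *
    √(1 + κ * sin (amp κ (θ / √(scale κ x))) ^ 2) / √(scale κ x))

/-- The constant of the equation solved by `wave`. -/
noncomputable def waveConst (κ x : ℝ) : ℝ :=
  12 * κ / scale κ x ^ 2 * (1 - 2 * sin x ^ 2 + 2 * κ * sin x ^ 2 - 3 * κ * sin x ^ 4)

section Wave

variable {κ x : ℝ}

/-- Put y = sin² A. In f'' + 4f + f² the y² terms cancel because the amplitude is 6κ/s, and the y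
terms cancel exactly when s = 1 - κ + 3κ sin² x, which is the reason for the form of `scale`. What
remains is `waveConst`. -/
theorem isJHOn_wave (hκ : 0 ≤ κ) (hs : 0 < scale κ x) (a b : ℝ) :
    IsJHOn (waveConst κ x) a b (wave κ x) (waveDeriv κ x) := by
  intro θ _
  set r := √(scale κ x) with hr
  have hr0 : 0 < r := sqrt_pos.2 hs
  have hr2 : r ^ 2 = scale κ x := sq_sqrt hs.le
  have hA : HasDerivAt (fun θ => amp κ (θ / r)) (√(1 + κ * sin (amp κ (θ / r)) ^ 2) / r) θ := by
    have h1 := (hasDerivAt_amp hκ (θ / r)).comp θ ((hasDerivAt_id θ).div_const r)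
    refine h1.congr_deriv ?_
    ring
  set A := amp κ (θ / r) with hAd
  have hq := one_add_mul_sin_sq_pos hκ A
  have hS := hA.sin
  have hCo := hA.cos
  set q := √(1 + κ * sin A ^ 2) with hqd
  have hq0 : 0 < q := sqrt_pos.2 hq
  have hq2 : q ^ 2 = 1 + κ * sin A ^ 2 := sq_sqrt hq.le
  have hsc : sin A ^ 2 + cos A ^ 2 = 1 := sin_sq_add_cos_sq A
  constructor
  · have h : HasDerivAt (wave κ x) _ θ := ((hS.pow 2).sub_const (sin x ^ 2)).const_mul
      (6 * κ / scale κ x)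
    refine h.congr_deriv ?_
    simp only [waveDeriv, ← hr, ← hAd, ← hqd]
    push_cast
    ring
  · have hQ : HasDerivAt (fun θ => √(1 + κ * sin (amp κ (θ / r)) ^ 2))
        (κ * sin A * cos A / r) θ := by
      have h0 : HasDerivAt (fun θ => 1 + κ * sin (amp κ (θ / r)) ^ 2) _ θ :=
        ((hS.pow 2).const_mul κ).const_add 1
      refine (h0.sqrt hq.ne').congr_deriv ?_
      rw [← hAd, ← hqd]
      simp
      field_simp
    have h : HasDerivAt (waveDeriv κ x) _ θ :=
      (((((hS.const_mul 2).mul hCo).mul hQ).div_const r)).const_mul (6 * κ / scale κ x)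
    refine h.congr_deriv ?_
    simp only [wave, waveConst, ← hr, ← hAd, ← hqd]
    rw [← hr2]
    field_simp
    have hs' : r ^ 2 = 1 - κ + 3 * κ * sin x ^ 2 := by rw [hr2, scale]
    have hc2 : cos A ^ 2 = 1 - sin A ^ 2 := by linarith
    simp only [Pi.mul_apply, ← hAd]
    linear_combination (12 * κ * (cos A ^ 2 - sin A ^ 2)) * hq2 +
      (12 * κ * (1 + κ * sin A ^ 2) + 12 * κ ^ 2 * sin A ^ 2) * hc2 +
      (24 * κ * (sin A ^ 2 - sin x ^ 2)) * hs'

theorem continuous_wave (hκ : 0 ≤ κ) (x : ℝ) : Continuous (wave κ x) := by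
  have := continuous_amp hκ
  unfold wave
  fun_prop

theorem abs_wave_le (hκ : 0 ≤ κ) (hs : 0 < scale κ x) (θ : ℝ) :
    |wave κ x θ| ≤ 6 * κ / scale κ x := by
  rw [wave, abs_mul, abs_of_nonneg (by positivity : 0 ≤ 6 * κ / scale κ x)]
  refine mul_le_of_le_one_right (by positivity) ?_
  rw [abs_le]
  constructor
  · nlinarith [sin_sq_le_one x, sq_nonneg (sin (amp κ (θ / √(scale κ x))))]
  · nlinarith [sin_sq_le_one (amp κ (θ / √(scale κ x))), sq_nonneg (sin x)]

theorem wave_neg (hκ : 0 ≤ κ) (x θ : ℝ) : wave κ x (-θ) = wave κ x θ := by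
  simp [wave, neg_div, amp_neg hκ]

theorem wave_add_period (hκ : 0 ≤ κ) (hs : 0 < scale κ x) (θ : ℝ) (n : ℤ) :
    wave κ x (θ + 2 * n * (√(scale κ x) * kInt κ (π / 2))) = wave κ x θ := by
  have hr0 : √(scale κ x) ≠ 0 := (sqrt_pos.2 hs).ne'
  have h : (θ + 2 * n * (√(scale κ x) * kInt κ (π / 2))) / √(scale κ x) =
      θ / √(scale κ x) + 2 * n * kInt κ (π / 2) := by
    field_simp
  rw [wave, wave, h, amp_add hκ]
  congr 2
  rw [sin_add_int_mul_pi]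
  rw [mul_pow, ← zpow_natCast, ← zpow_mul, mul_comm n, zpow_mul]
  norm_num

theorem wave_sqrt_mul_kInt (hκ : 0 ≤ κ) (hs : 0 < scale κ x) (φ : ℝ) :
    wave κ x (√(scale κ x) * kInt κ φ) = 6 * κ / scale κ x * (sin φ ^ 2 - sin x ^ 2) := by
  have hr0 : √(scale κ x) ≠ 0 := (sqrt_pos.2 hs).ne'
  rw [wave, mul_div_cancel_left₀ _ hr0, amp_kInt hκ]

theorem exists_eq_sqrt_mul_kInt (hκ : 0 ≤ κ) (hs : 0 < scale κ x) (θ : ℝ) :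
    ∃ φ, θ = √(scale κ x) * kInt κ φ := by
  have hr0 : √(scale κ x) ≠ 0 := (sqrt_pos.2 hs).ne'
  refine ⟨amp κ (θ / √(scale κ x)), ?_⟩
  rw [kInt_amp hκ]
  field_simp

theorem integral_wave (hκ : 0 ≤ κ) (hs : 0 < scale κ x) (a b : ℝ) :
    ∫ θ in (√(scale κ x) * kInt κ a)..(√(scale κ x) * kInt κ b), wave κ x θ =
      6 * κ / √(scale κ x) * ((lInt κ b - sin x ^ 2 * kInt κ b) -
        (lInt κ a - sin x ^ 2 * kInt κ a)) := by
  set r := √(scale κ x) with hr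
  have hr0 : 0 < r := sqrt_pos.2 hs
  have hr2 : r ^ 2 = scale κ x := sq_sqrt hs.le
  have h1 := intervalIntegral.integral_comp_div (a := r * kInt κ a) (b := r * kInt κ b)
    (fun u => 6 * κ / scale κ x * (sin (amp κ u) ^ 2 - sin x ^ 2)) hr0.ne'
  have h1' : ∫ θ in (r * kInt κ a)..(r * kInt κ b), wave κ x θ = _ := h1
  rw [h1', mul_div_cancel_left₀ _ hr0.ne', mul_div_cancel_left₀ _ hr0.ne',
    (amp_spec hκ).2.2.2.2.2 (fun φ => 6 * κ / scale κ x * (sin φ ^ 2 - sin x ^ 2)) (by fun_prop)]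
  have hw := continuous_weight hκ
  have hw2 := continuous_sin_sq_mul_weight hκ
  have h2 : ∀ c, ∫ t in (0 : ℝ)..c, 6 * κ / scale κ x * (sin t ^ 2 - sin x ^ 2) * weight κ t =
      6 * κ / scale κ x * (lInt κ c - sin x ^ 2 * kInt κ c) := by
    intro c
    rw [lInt, kInt, ← intervalIntegral.integral_const_mul, ← intervalIntegral.integral_sub
      (hw2.intervalIntegrable _ _) ((hw.const_mul _).intervalIntegrable _ _),
      ← intervalIntegral.integral_const_mul]
    refine intervalIntegral.integral_congr fun t _ => ?_
    ring
  have hint : ∀ c d, IntervalIntegrable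
      (fun t => 6 * κ / scale κ x * (sin t ^ 2 - sin x ^ 2) * weight κ t)
      MeasureTheory.volume c d := fun c d => by
    apply Continuous.intervalIntegrable
    fun_prop
  rw [← intervalIntegral.integral_interval_sub_left (hint 0 b) (hint 0 a), h2, h2, ← hr2,
    smul_eq_mul]
  field_simp

end Wave

/-! ### Zeros and sign pattern of the waves -/

/-- The increasing enumeration of the solutions `φ` of `sin² φ = sin² x`, with `-x` and `x` in the
places `0` and `1`. -/
noncomputable def zeroPhase (x : ℝ) (n : ℤ) : ℝ :=
  (n / 2 : ℤ) * π + if Even n then -x else x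

theorem zeroPhase_even (x : ℝ) (k : ℤ) : zeroPhase x (2 * k) = k * π - x := by
  simp [zeroPhase, sub_eq_add_neg]

theorem zeroPhase_odd (x : ℝ) (k : ℤ) : zeroPhase x (2 * k + 1) = k * π + x := by
  have h : (2 * k + 1) / 2 = k := by omega
  have h' : ¬ Even (2 * k + 1) := by simp
  simp [zeroPhase, h]

theorem zeroPhase_strictMono {x : ℝ} (hx : x ∈ Ioo 0 (π / 2)) : StrictMono (zeroPhase x) := by
  refine strictMono_int_of_lt_succ fun n => ?_
  obtain ⟨k, rfl | rfl⟩ := n.even_or_odd'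
  · rw [zeroPhase_even, zeroPhase_odd]
    linarith [hx.1]
  · rw [zeroPhase_odd, show 2 * k + 1 + 1 = 2 * (k + 1) by ring, zeroPhase_even]
    push_cast
    linarith [hx.2]

theorem zeroPhase_add_even (x : ℝ) (n k : ℤ) :
    zeroPhase x (n + 2 * k) = zeroPhase x n + k * π := by
  obtain ⟨j, rfl | rfl⟩ := n.even_or_odd'
  · rw [← mul_add, zeroPhase_even, zeroPhase_even]
    push_cast
    ring
  · rw [show 2 * j + 1 + 2 * k = 2 * (j + k) + 1 by ring, zeroPhase_odd, zeroPhase_odd]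
    push_cast
    ring

theorem sin_sq_add_int_mul_pi (φ : ℝ) (n : ℤ) : sin (φ + n * π) ^ 2 = sin φ ^ 2 := by
  rw [sin_add_int_mul_pi, mul_pow, ← zpow_natCast, ← zpow_mul, mul_comm n, zpow_mul]
  norm_num

theorem sin_sq_zeroPhase (x : ℝ) (n : ℤ) : sin (zeroPhase x n) ^ 2 = sin x ^ 2 := by
  obtain ⟨k, rfl | rfl⟩ := n.even_or_odd'
  · rw [zeroPhase_even, show (k : ℝ) * π - x = -x + k * π by ring, sin_sq_add_int_mul_pi]
    simp
  · rw [zeroPhase_odd, add_comm, sin_sq_add_int_mul_pi]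

theorem exists_zeroPhase_of_sin_sq_eq {x φ : ℝ} (h : sin φ ^ 2 = sin x ^ 2) :
    ∃ n, φ = zeroPhase x n := by
  have h2 : cos (2 * x) = cos (2 * φ) := by
    rw [cos_two_mul, cos_two_mul, cos_sq', cos_sq', h]
  obtain ⟨k, hk | hk⟩ := Real.cos_eq_cos_iff.1 h2
  · exact ⟨2 * k + 1, by rw [zeroPhase_odd]; linarith⟩
  · exact ⟨2 * k, by rw [zeroPhase_even]; linarith⟩

theorem sin_sq_lt_of_mem {x φ : ℝ} (hx : x ∈ Ioc 0 (π / 2)) {k : ℤ}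
    (hφ : φ ∈ Ioo (zeroPhase x (2 * k)) (zeroPhase x (2 * k + 1))) : sin φ ^ 2 < sin x ^ 2 := by
  rw [zeroPhase_even, zeroPhase_odd] at hφ
  have h : φ = (φ - k * π) + k * π := by ring
  rw [h, sin_sq_add_int_mul_pi, sq_lt_sq, abs_of_pos (sin_pos_of_pos_of_lt_pi hx.1
    (by linarith [hx.2, pi_pos])), abs_lt, ← sin_neg]
  constructor
  · exact sin_lt_sin_of_lt_of_le_pi_div_two (by linarith [hx.2]) (by linarith [hφ.2, hx.2])
      (by linarith [hφ.1])
  · exact sin_lt_sin_of_lt_of_le_pi_div_two (by linarith [hφ.1, hx.2]) hx.2 (by linarith [hφ.2])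

theorem sin_sq_gt_of_mem {x φ : ℝ} (hx : x ∈ Ico 0 (π / 2)) {k : ℤ}
    (hφ : φ ∈ Ioo (zeroPhase x (2 * k + 1)) (zeroPhase x (2 * k + 1 + 1))) :
    sin x ^ 2 < sin φ ^ 2 := by
  rw [zeroPhase_odd, show 2 * k + 1 + 1 = 2 * (k + 1) by ring, zeroPhase_even] at hφ
  push_cast at hφ
  have h : φ = (φ - k * π) + k * π := by ring
  rw [h, sin_sq_add_int_mul_pi]
  have h0 : 0 ≤ sin x := sin_nonneg_of_nonneg_of_le_pi hx.1 (by linarith [hx.2, pi_pos])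
  refine pow_lt_pow_left₀ ?_ h0 two_ne_zero
  rcases le_or_gt (φ - k * π) (π / 2) with h1 | h1
  · exact sin_lt_sin_of_lt_of_le_pi_div_two (by linarith [hx.1, pi_pos]) h1 (by linarith [hφ.1])
  · rw [← sin_pi_sub (φ - k * π)]
    exact sin_lt_sin_of_lt_of_le_pi_div_two (by linarith [hx.1, pi_pos]) (by linarith)
      (by linarith [hφ.2])

/-- Arcs with even index are negative and arcs with odd index are positive, so the type of a piece
of a wave is this parity count over its n consecutive arcs. -/
theorem card_filter_parity (i : ℤ) (n : ℕ) :
    ((Finset.Ico i (i + n)).filter Even).card = (if Even i then (n + 1) / 2 else n / 2) ∧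
    ((Finset.Ico i (i + n)).filter Odd).card = (if Even i then n / 2 else (n + 1) / 2) := by
  induction n with
  | zero => simp
  | succ n ih =>
    have hins : Finset.Ico i (i + (n + 1 : ℕ)) = insert (i + n) (Finset.Ico i (i + n)) := by
      ext k
      simp only [Finset.mem_Ico, Finset.mem_insert]
      push_cast
      omega
    have hn : i + n ∉ Finset.Ico i (i + n) := by simp
    rw [hins, Finset.filter_insert, Finset.filter_insert]
    rcases Int.even_or_odd i with hi | hi <;> rcases Nat.even_or_odd n with hn' | hn'
    · have he : Even (i + n) := hi.add (by exact_mod_cast hn')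
      have ho : ¬ Odd (i + n) := by simpa using he
      simp only [he, ho, hi, if_true, if_false] at ih ⊢
      rw [Finset.card_insert_of_notMem (by simp), ih.1, ih.2]
      obtain ⟨k, rfl⟩ := hn'
      omega
    · have ho : Odd (i + n) := hi.add_odd (by exact_mod_cast hn')
      have he : ¬ Even (i + n) := by simpa using ho
      simp only [he, ho, hi, if_true, if_false] at ih ⊢
      rw [Finset.card_insert_of_notMem (by simp), ih.1, ih.2]
      obtain ⟨k, rfl⟩ := hn'
      omega
    · have ho : Odd (i + n) := hi.add_even (by exact_mod_cast hn')
      have he : ¬ Even (i + n) := by simpa using ho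
      have hi' : ¬ Even i := by simpa using hi
      simp only [he, ho, hi', if_true, if_false] at ih ⊢
      rw [Finset.card_insert_of_notMem (by simp), ih.1, ih.2]
      obtain ⟨k, rfl⟩ := hn'
      omega
    · have he : Even (i + n) := hi.add_odd (by exact_mod_cast hn')
      have ho : ¬ Odd (i + n) := by simpa using he
      have hi' : ¬ Even i := by simpa using hi
      simp only [he, ho, hi', if_true, if_false] at ih ⊢
      rw [Finset.card_insert_of_notMem (by simp), ih.1, ih.2]
      obtain ⟨k, rfl⟩ := hn'
      omega

/-- The position of the zeros of `wave κ x`. -/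
noncomputable def waveZero (κ x : ℝ) (n : ℤ) : ℝ := √(scale κ x) * kInt κ (zeroPhase x n)

section

variable {κ x : ℝ}

theorem waveZero_strictMono (hκ : 0 ≤ κ) (hs : 0 < scale κ x) (hx : x ∈ Ioo 0 (π / 2)) :
    StrictMono (waveZero κ x) := fun _ _ h =>
  mul_lt_mul_of_pos_left (kInt_strictMono hκ (zeroPhase_strictMono hx h)) (sqrt_pos.2 hs)

theorem waveZero_add_even (hκ : 0 ≤ κ) (n k : ℤ) :
    waveZero κ x (n + 2 * k) = waveZero κ x n + 2 * k * (√(scale κ x) * kInt κ (π / 2)) := by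
  rw [waveZero, waveZero, zeroPhase_add_even, kInt_add_int_mul_pi hκ]
  ring

theorem wave_waveZero (hκ : 0 ≤ κ) (hs : 0 < scale κ x) (n : ℤ) :
    wave κ x (waveZero κ x n) = 0 := by
  rw [waveZero, wave_sqrt_mul_kInt hκ hs, sin_sq_zeroPhase]
  simp

theorem wave_eq_zero_iff (hκ : 0 < κ) (hs : 0 < scale κ x) (θ : ℝ) :
    wave κ x θ = 0 ↔ ∃ n, θ = waveZero κ x n := by
  constructor
  · intro h
    obtain ⟨φ, rfl⟩ := exists_eq_sqrt_mul_kInt hκ.le hs θ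
    rw [wave_sqrt_mul_kInt hκ.le hs, mul_eq_zero] at h
    rcases h with h | h
    · exact absurd h (by positivity)
    · obtain ⟨n, rfl⟩ := exists_zeroPhase_of_sin_sq_eq (sub_eq_zero.1 h)
      exact ⟨n, rfl⟩
  · rintro ⟨n, rfl⟩
    exact wave_waveZero hκ.le hs n

theorem exists_phase_of_mem_Ioo (hκ : 0 < κ) (hs : 0 < scale κ x) {n m : ℤ} {θ : ℝ}
    (hθ : θ ∈ Ioo (waveZero κ x n) (waveZero κ x m)) :
    ∃ φ ∈ Ioo (zeroPhase x n) (zeroPhase x m),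
      wave κ x θ = 6 * κ / scale κ x * (sin φ ^ 2 - sin x ^ 2) := by
  obtain ⟨φ, rfl⟩ := exists_eq_sqrt_mul_kInt hκ.le hs θ
  refine ⟨φ, ⟨?_, ?_⟩, wave_sqrt_mul_kInt hκ.le hs φ⟩
  · exact (kInt_strictMono hκ.le).lt_iff_lt.1 (lt_of_mul_lt_mul_left hθ.1 (sqrt_nonneg _))
  · exact (kInt_strictMono hκ.le).lt_iff_lt.1 (lt_of_mul_lt_mul_left hθ.2 (sqrt_nonneg _))

theorem wave_neg_of_even (hκ : 0 < κ) (hs : 0 < scale κ x) (hx : x ∈ Ioc 0 (π / 2)) {n : ℤ}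
    (hn : Even n) {θ : ℝ} (hθ : θ ∈ Ioo (waveZero κ x n) (waveZero κ x (n + 1))) :
    wave κ x θ < 0 := by
  obtain ⟨φ, hφ, h⟩ := exists_phase_of_mem_Ioo hκ hs hθ
  obtain ⟨k, rfl⟩ := even_iff_exists_two_mul.1 hn
  rw [h]
  exact mul_neg_of_pos_of_neg (by positivity) (sub_neg.2 (sin_sq_lt_of_mem hx hφ))

theorem wave_pos_of_odd (hκ : 0 < κ) (hs : 0 < scale κ x) (hx : x ∈ Ico 0 (π / 2)) {n : ℤ}
    (hn : Odd n) {θ : ℝ} (hθ : θ ∈ Ioo (waveZero κ x n) (waveZero κ x (n + 1))) :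
    0 < wave κ x θ := by
  obtain ⟨φ, hφ, h⟩ := exists_phase_of_mem_Ioo hκ hs hθ
  obtain ⟨k, rfl⟩ := hn
  rw [h]
  exact mul_pos (by positivity) (sub_pos.2 (sin_sq_gt_of_mem hx hφ))

/-- The zeros cut the window into arcs on which the sign is constant and alternates with the parity
of the index. The components of each sign set are therefore exactly the arcs of one parity. -/
theorem numIntervals_wave (hκ : 0 < κ) (hs : 0 < scale κ x) (hx : x ∈ Ioo 0 (π / 2)) (i : ℤ)
    (n : ℕ) (c : ℝ) :
    numIntervals {θ | θ ∈ Ioo (waveZero κ x i - c) (waveZero κ x (i + n) - c) ∧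
      0 < wave κ x (θ + c)} = ((Finset.Ico i (i + n)).filter Odd).card ∧
    numIntervals {θ | θ ∈ Ioo (waveZero κ x i - c) (waveZero κ x (i + n) - c) ∧
      wave κ x (θ + c) < 0} = ((Finset.Ico i (i + n)).filter Even).card := by
  set t : ℤ → ℝ := fun n => waveZero κ x n - c with ht_def
  have hw := waveZero_strictMono hκ.le hs hx
  have ht : StrictMono t := fun a b h => by simp only [ht_def]; linarith [hw h]
  have hpos : ∀ k, Odd k → ∀ θ ∈ Ioo (t k) (t (k + 1)), 0 < wave κ x (θ + c) := fun k hk θ hθ =>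
    wave_pos_of_odd hκ hs ⟨hx.1.le, hx.2⟩ hk
      ⟨by simp only [ht_def] at hθ; linarith [hθ.1], by simp only [ht_def] at hθ; linarith [hθ.2]⟩
  have hneg : ∀ k, Even k → ∀ θ ∈ Ioo (t k) (t (k + 1)), wave κ x (θ + c) < 0 := fun k hk θ hθ =>
    wave_neg_of_even hκ hs ⟨hx.1, hx.2.le⟩ hk
      ⟨by simp only [ht_def] at hθ; linarith [hθ.1], by simp only [ht_def] at hθ; linarith [hθ.2]⟩
  have hex : ∀ θ ∈ Ioo (t i) (t (i + n)), wave κ x (θ + c) = 0 ∨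
      ∃ k ∈ Finset.Ico i (i + n), θ ∈ Ioo (t k) (t (k + 1)) := by
    intro θ hθ
    have h1 : θ ∈ ⋃ k ∈ Ico i (i + n), Ioc (t k) (t (Order.succ k)) := by
      rw [ht.monotone.biUnion_Ico_Ioc_map_succ]
      exact Ioo_subset_Ioc_self hθ
    simp only [mem_iUnion, exists_prop] at h1
    obtain ⟨k, hk, hθk⟩ := h1
    rw [Order.succ_eq_add_one] at hθk
    rcases eq_or_lt_of_le hθk.2 with h | h
    · left
      rw [h]
      simp only [ht_def, sub_add_cancel]
      exact wave_waveZero hκ.le hs _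
    · exact Or.inr ⟨k, by simpa using hk, hθk.1, h⟩
  have hsub : ∀ k ∈ Finset.Ico i (i + n), Ioo (t k) (t (k + 1)) ⊆ Ioo (t i) (t (i + n)) := by
    intro k hk
    rw [Finset.mem_Ico] at hk
    exact Ioo_subset_Ioo (ht.monotone hk.1) (ht.monotone (by omega))
  constructor
  · rw [← numIntervals_iUnion_Ioo ht]
    congr 1
    ext θ
    simp only [mem_ofPred_eq, Finset.coe_filter, mem_iUnion, exists_prop]
    constructor
    · rintro ⟨h1, h2⟩
      rcases hex θ h1 with h | ⟨k, hk, hθ⟩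
      · exact absurd h h2.ne'
      · refine ⟨k, ⟨hk, ?_⟩, hθ⟩
        by_contra hc
        exact (hneg k (Int.not_odd_iff_even.1 hc) θ hθ).not_gt h2
    · rintro ⟨k, ⟨hk, ho⟩, hθ⟩
      exact ⟨hsub k hk hθ, hpos k ho θ hθ⟩
  · rw [← numIntervals_iUnion_Ioo ht]
    congr 1
    ext θ
    simp only [mem_ofPred_eq, Finset.coe_filter, mem_iUnion, exists_prop]
    constructor
    · rintro ⟨h1, h2⟩
      rcases hex θ h1 with h | ⟨k, hk, hθ⟩
      · exact absurd h h2.ne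
      · refine ⟨k, ⟨hk, ?_⟩, hθ⟩
        by_contra hc
        exact (hpos k (Int.not_even_iff_odd.1 hc) θ hθ).not_gt h2
    · rintro ⟨k, ⟨hk, ho⟩, hθ⟩
      exact ⟨hsub k hk hθ, hneg k ho θ hθ⟩

end

/-! ### Sign-changing solutions as pieces of waves -/

/-- The primitive of `sin² - sin² x` against the weight. -/
noncomputable def jInt (κ x φ : ℝ) : ℝ := lInt κ φ - sin x ^ 2 * kInt κ φ

/-- Half the period of the wave. -/
noncomputable def halfPeriod (κ x : ℝ) : ℝ := √(scale κ x) * kInt κ (π / 2)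

/-- Half the length of a negative arc of the wave. -/
noncomputable def negHalf (κ x : ℝ) : ℝ := √(scale κ x) * kInt κ x

/-- Half the flux over a period of the wave. -/
noncomputable def halfFlux (κ x : ℝ) : ℝ := 6 * κ / √(scale κ x) * jInt κ x (π / 2)

/-- Half the flux over a negative arc of the wave. -/
noncomputable def negFlux (κ x : ℝ) : ℝ := 6 * κ / √(scale κ x) * jInt κ x x

theorem exists_abs_le_of_continuousOn {a b : ℝ} {f : ℝ → ℝ} (h : ContinuousOn f (Icc a b)) :
    ∃ R, ∀ θ ∈ Ioo a b, |f θ| ≤ R := by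
  obtain ⟨R, hR⟩ := isCompact_Icc.exists_bound_of_continuousOn h
  exact ⟨R, fun θ hθ => hR θ (Ioo_subset_Icc_self hθ)⟩

theorem eqOn_Icc_of_eqOn_Ioo {a b : ℝ} (hab : a < b) {f g : ℝ → ℝ} (hf : ContinuousOn f (Icc a b))
    (hg : ContinuousOn g (Icc a b)) (h : ∀ θ ∈ Ioo a b, f θ = g θ) :
    ∀ θ ∈ Icc a b, f θ = g θ := by
  rw [← closure_Ioo hab.ne] at hf hg ⊢
  exact EqOn.of_subset_closure h hf hg subset_closure Subset.rfl

theorem nonempty_of_numIntervals {S : Set ℝ} {a : ℕ} (h : numIntervals S = a) (ha : 1 ≤ a) :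
    S.Nonempty := by
  rw [nonempty_iff_ne_empty]
  rintro rfl
  rw [(numIntervals_eq_zero_iff ∅).2 rfl] at h
  have : a = 0 := by exact_mod_cast h.symm
  omega

/-- The maximum M > 0 and the minimum -N < 0 are interior critical points, hence roots of the cubic
in the first integral. They determine C and the third root, and so κ and x; the wave with these
parameters has the same value and slope at the minimum, and uniqueness concludes. -/
theorem IsJH.exists_wave {α : ℝ} {f : ℝ → ℝ} (h : IsJH α f) {p q : ℝ} (hp : p ∈ Ioo (-α) α)
    (hq : q ∈ Ioo (-α) α) (hfp : 0 < f p) (hfq : f q < 0) :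
    ∃ κ x c : ℝ, 0 < κ ∧ x ∈ Ioo 0 (π / 2) ∧ 0 < scale κ x ∧
      ∀ θ ∈ Icc (-α) α, f θ = wave κ x (θ + c) := by
  obtain ⟨C, f', hode⟩ := h.ode
  have hα : -α < α := hp.1.trans hp.2
  have hIcc : (Icc (-α) α).Nonempty := ⟨p, Ioo_subset_Icc_self hp⟩
  obtain ⟨θ₁, hθ₁, hmax⟩ := isCompact_Icc.exists_isMaxOn hIcc h.continuousOn
  obtain ⟨θ₂, hθ₂, hmin⟩ := isCompact_Icc.exists_isMinOn hIcc h.continuousOn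
  have hM : 0 < f θ₁ := hfp.trans_le (hmax (Ioo_subset_Icc_self hp))
  have hN : f θ₂ < 0 := (hmin (Ioo_subset_Icc_self hq)).trans_lt hfq
  have hint : ∀ θ ∈ Icc (-α) α, f θ ≠ 0 → θ ∈ Ioo (-α) α := by
    intro θ hθ h0
    refine ⟨lt_of_le_of_ne hθ.1 fun e => h0 ?_, lt_of_le_of_ne hθ.2 fun e => h0 ?_⟩
    · rw [← e, h.left]
    · rw [e, h.right]
  have hθ₁' := hint θ₁ hθ₁ hM.ne'
  have hθ₂' := hint θ₂ hθ₂ hN.ne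
  have hd1 : f' θ₁ = 0 := (hmax.isLocalMax (Icc_mem_nhds hθ₁'.1 hθ₁'.2)).hasDerivAt_eq_zero
    (hode θ₁ hθ₁').1
  have hd2 : f' θ₂ = 0 := (hmin.isLocalMin (Icc_mem_nhds hθ₂'.1 hθ₂'.2)).hasDerivAt_eq_zero
    (hode θ₂ hθ₂').1
  set M := f θ₁ with hMd
  obtain ⟨N, hNd⟩ : ∃ N, N = -f θ₂ := ⟨_, rfl⟩
  have hN2 : f θ₂ = -N := by rw [hNd, neg_neg]
  have hNpos : 0 < N := by rw [hNd]; linarith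
  have hen := hode.energy hθ₁' hθ₂'
  rw [hd1, hd2, ← hMd, hN2] at hen
  have hC : C = 2 * (M - N) + (M ^ 2 - M * N + N ^ 2) / 3 := by
    have : (M + N) * (C - (2 * (M - N) + (M ^ 2 - M * N + N ^ 2) / 3)) = 0 := by
      linear_combination -hen
    rcases mul_eq_zero.1 this with h0 | h0
    · linarith
    · linarith
  -- The three roots of the cubic sum to -6, so the third one is -(6 + M - N).
  have hf'2 : ∀ θ ∈ Ioo (-α) α, f' θ ^ 2 = 2 / 3 * (M - f θ) * (f θ + N) * (f θ + 6 + M - N) := by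
    intro θ hθ
    have := hode.energy hθ hθ₁'
    rw [hd1, ← hMd, hC] at this
    linear_combination 2 * this
  have hbdd := exists_abs_le_of_continuousOn h.continuousOn
  -- the gap to the third root is positive
  have hw : 0 < 6 + M - 2 * N := by
    rcases lt_trichotomy (6 + M - 2 * N) 0 with hlt | heq | hgt
    · exfalso
      -- If the third root were above -N, then f'² would be negative at the value -N + ε, which f
      -- takes. Halving the minimum keeps this value below both M and the third root.
      set ε := min (-(6 + M - 2 * N)) (M + N) / 2 with hε
      have h1 : 0 < min (-(6 + M - 2 * N)) (M + N) := lt_min (by linarith) (by linarith)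
      have h2 := min_le_left (-(6 + M - 2 * N)) (M + N)
      have h3 := min_le_right (-(6 + M - 2 * N)) (M + N)
      have hv : -N + ε ∈ Icc (f θ₂) (f θ₁) := by
        rw [hN2, ← hMd]
        exact ⟨by linarith, by linarith⟩
      obtain ⟨θ, hθ, hfθ⟩ := isPreconnected_Icc.intermediate_value hθ₂ hθ₁ h.continuousOn hv
      have hθ' : θ ∈ Ioo (-α) α := by
        refine ⟨lt_of_le_of_ne hθ.1 ?_, lt_of_le_of_ne hθ.2 ?_⟩
        · rintro rfl
          have h4 := hf'2 p hp
          have h5 := hmin (Ioo_subset_Icc_self hp)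
          have h6 := hmax (Ioo_subset_Icc_self hp)
          simp only [mem_ofPred_eq] at h5 h6
          rw [h.left] at hfθ
          linarith
        · rintro rfl
          rw [h.right] at hfθ
          linarith
      have h4 := hf'2 θ hθ'
      rw [hfθ] at h4
      have h5 : 0 < 2 / 3 * (M - (-N + ε)) * (-N + ε + N) :=
        mul_pos (mul_pos (by norm_num) (by linarith)) (by linarith)
      have h6 := mul_neg_of_pos_of_neg h5 (show -N + ε + 6 + M - N < 0 by linarith)
      linarith [sq_nonneg (f' θ)]
    · exfalso
      -- A double root at -N would make the constant -N a solution with the same data at the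
      -- minimum.
      have hconst : IsJHOn C (-α) α (fun _ => -N) (fun _ => 0) := by
        intro θ _
        refine ⟨hasDerivAt_const _ _, (hasDerivAt_const θ (0 : ℝ)).congr_deriv ?_⟩
        have : M = 2 * N - 6 := by linarith
        rw [hC, this]
        ring
      have := hode.eqOn hconst hbdd ⟨|-N|, fun _ _ => le_rfl⟩ hθ₂' hN2 hd2 θ₁ hθ₁'
      linarith
    · exact hgt
  set w := 6 + M - 2 * N with hwd
  -- Substituting f = -N + (M + N) sin² A in the first integral gives A'² = (w/6)(1 + κ sin² A) with
  -- this κ. The zeros of f are where sin² A = N/(M + N), which defines x, and the scale is 6/w.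
  set κ := (M + N) / w with hκd
  have hκ : 0 < κ := by positivity
  have hρ : N / (M + N) < 1 := (div_lt_one (by positivity)).2 (by linarith)
  have hρ0 : 0 < N / (M + N) := by positivity
  set x := arcsin (√(N / (M + N))) with hxd
  have hsq1 : √(N / (M + N)) < 1 := by rwa [sqrt_lt' one_pos, one_pow]
  have hsin : sin x = √(N / (M + N)) :=
    sin_arcsin (by linarith [sqrt_nonneg (N / (M + N))]) hsq1.le
  have hsin2 : sin x ^ 2 = N / (M + N) := by rw [hsin, sq_sqrt hρ0.le]
  have hx : x ∈ Ioo 0 (π / 2) := ⟨arcsin_pos.2 (sqrt_pos.2 hρ0), arcsin_lt_pi_div_two.2 hsq1⟩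
  have hscale : scale κ x = 6 / w := by
    rw [scale, hsin2, hκd]
    field_simp
    rw [hwd]
    ring
  have hs : 0 < scale κ x := by rw [hscale]; positivity
  have hconst : waveConst κ x = C := by
    rw [waveConst, hscale, show sin x ^ 4 = (sin x ^ 2) ^ 2 by ring, hsin2, hC, hκd]
    field_simp
    rw [hwd]
    ring
  have hamp0 : amp κ 0 = 0 := by
    have := amp_kInt hκ.le 0
    rwa [kInt_zero] at this
  refine ⟨κ, x, -θ₂, hκ, hx, hs, ?_⟩
  have hwave : IsJHOn C (-α) α (fun θ => wave κ x (θ + -θ₂)) (fun θ => waveDeriv κ x (θ + -θ₂)) := by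
    have := (isJHOn_wave hκ.le hs (-α + -θ₂) (α + -θ₂)).comp_add (-θ₂)
    rw [hconst] at this
    simpa using this
  refine eqOn_Icc_of_eqOn_Ioo hα h.continuousOn
    ((continuous_wave hκ.le x).comp (continuous_id.add continuous_const)).continuousOn ?_
  refine hode.eqOn hwave hbdd ⟨_, fun θ _ => abs_wave_le hκ.le hs _⟩ hθ₂' ?_ ?_
  · rw [hN2, add_neg_cancel, wave, zero_div, hamp0, sin_zero, hscale, hsin2, hκd]
    field_simp
    ring
  · simp [waveDeriv, hamp0, hd2]

/-- Both walls are zeros of the wave. A shift by periods moves the left wall to index 0 or 1, which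
records whether the first arc is negative or positive; the number n of arcs then fixes both counts.
-/
theorem IsJHType.exists_waveZero {α : ℝ} {a b : ℕ} {f : ℝ → ℝ} (h : IsJHType α a b f) (ha : 1 ≤ a)
    (hb : 1 ≤ b) : ∃ (κ x c : ℝ) (i : ℤ) (n : ℕ), 0 < κ ∧ x ∈ Ioo 0 (π / 2) ∧ 0 < scale κ x ∧
      (i = 0 ∨ i = 1) ∧ waveZero κ x i = c - α ∧ waveZero κ x (i + n) = c + α ∧
      (∀ θ ∈ Icc (-α) α, f θ = wave κ x (θ + c)) ∧
      a = (if i = 0 then n / 2 else (n + 1) / 2) ∧ b = (if i = 0 then (n + 1) / 2 else n / 2) := by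
  obtain ⟨p, hp, hfp⟩ := nonempty_of_numIntervals h.pos ha
  obtain ⟨q, hq, hfq⟩ := nonempty_of_numIntervals h.neg hb
  obtain ⟨κ, x, c₀, hκ, hx, hs, hfw⟩ := h.isJH.exists_wave hp hq hfp hfq
  have hα : -α < α := hp.1.trans hp.2
  have hmono := waveZero_strictMono hκ.le hs hx
  have h1 : wave κ x (-α + c₀) = 0 := by rw [← hfw _ ⟨le_rfl, hα.le⟩, h.isJH.left]
  have h2 : wave κ x (α + c₀) = 0 := by rw [← hfw _ ⟨hα.le, le_rfl⟩, h.isJH.right]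
  obtain ⟨n₁, hn₁⟩ := (wave_eq_zero_iff hκ hs _).1 h1
  obtain ⟨n₂, hn₂⟩ := (wave_eq_zero_iff hκ hs _).1 h2
  have hlt : n₁ < n₂ := hmono.lt_iff_lt.1 (by rw [← hn₁, ← hn₂]; linarith)
  obtain ⟨n, hn⟩ := Int.eq_ofNat_of_zero_le (show 0 ≤ n₂ - n₁ by omega)
  set k := n₁ / 2 with hk
  set i := n₁ % 2 with hi
  have hn₁k : n₁ = i + 2 * k := by omega
  set c := c₀ - 2 * k * (√(scale κ x) * kInt κ (π / 2)) with hc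
  have hi01 : i = 0 ∨ i = 1 := by omega
  have hz1 : waveZero κ x i = c - α := by
    rw [hn₁k, waveZero_add_even hκ.le] at hn₁
    rw [hc]
    linarith
  have hz2 : waveZero κ x (i + n) = c + α := by
    have : n₂ = (i + n) + 2 * k := by omega
    rw [this, waveZero_add_even hκ.le] at hn₂
    rw [hc]
    linarith
  have hfc : ∀ θ ∈ Icc (-α) α, f θ = wave κ x (θ + c) := by
    intro θ hθ
    rw [hfw θ hθ, ← wave_add_period hκ.le hs (θ + c) k, hc]
    congr 1
    ring
  obtain ⟨hw1, hw2⟩ := numIntervals_wave hκ hs hx i n c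
  rw [hz1, hz2] at hw1 hw2
  have e1 : c - α - c = -α := by ring
  have e2 : c + α - c = α := by ring
  rw [e1, e2] at hw1 hw2
  have hset1 : {θ | θ ∈ Ioo (-α) α ∧ 0 < f θ} = {θ | θ ∈ Ioo (-α) α ∧ 0 < wave κ x (θ + c)} := by
    ext θ
    exact and_congr_right fun hθ => by rw [hfc θ (Ioo_subset_Icc_self hθ)]
  have hset2 : {θ | θ ∈ Ioo (-α) α ∧ f θ < 0} = {θ | θ ∈ Ioo (-α) α ∧ wave κ x (θ + c) < 0} := by
    ext θ
    exact and_congr_right fun hθ => by rw [hfc θ (Ioo_subset_Icc_self hθ)]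
  have hca := h.pos
  have hcb := h.neg
  rw [hset1, hw1, (card_filter_parity i n).2] at hca
  rw [hset2, hw2, (card_filter_parity i n).1] at hcb
  refine ⟨κ, x, c, i, n, hκ, hx, hs, hi01, hz1, hz2, hfc, ?_, ?_⟩
  · rcases hi01 with h0 | h0 <;> rw [h0] at hca ⊢ <;> simp at hca ⊢ <;> exact_mod_cast hca.symm
  · rcases hi01 with h0 | h0 <;> rw [h0] at hcb ⊢ <;> simp at hcb ⊢ <;> exact_mod_cast hcb.symm

theorem isJHType_wave {κ x : ℝ} (hκ : 0 < κ) (hx : x ∈ Ioo 0 (π / 2)) (hs : 0 < scale κ x) {i : ℤ}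
    {n : ℕ} {α c : ℝ} (h1 : waveZero κ x i = c - α) (h2 : waveZero κ x (i + n) = c + α) :
    IsJHType α ((Finset.Ico i (i + n)).filter Odd).card ((Finset.Ico i (i + n)).filter Even).card
      (fun θ => wave κ x (θ + c)) := by
  obtain ⟨hw1, hw2⟩ := numIntervals_wave hκ hs hx i n c
  have e1 : c - α - c = -α := by ring
  have e2 : c + α - c = α := by ring
  rw [h1, h2, e1, e2] at hw1 hw2
  refine ⟨⟨⟨waveConst κ x, fun θ => waveDeriv κ x (θ + c), ?_⟩, ?_, ?_, ?_⟩, hw1, hw2⟩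
  · simpa using (isJHOn_wave hκ.le hs (-α + c) (α + c)).comp_add c
  · exact ((continuous_wave hκ.le x).comp (continuous_id.add continuous_const)).continuousOn
  · rw [show -α + c = waveZero κ x i by rw [h1]; ring, wave_waveZero hκ.le hs]
  · rw [show α + c = waveZero κ x (i + n) by rw [h2]; ring, wave_waveZero hκ.le hs]

theorem integral_wave_shift {κ x : ℝ} (hκ : 0 < κ) (hs : 0 < scale κ x) {i j : ℤ}
    {α c : ℝ} (h1 : waveZero κ x i = c - α) (h2 : waveZero κ x j = c + α) :
    ∫ θ in (-α)..α, wave κ x (θ + c) = 6 * κ / √(scale κ x) *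
      (jInt κ x (zeroPhase x j) - jInt κ x (zeroPhase x i)) := by
  rw [intervalIntegral.integral_comp_add_right (fun θ => wave κ x θ),
    show -α + c = waveZero κ x i by rw [h1]; ring, show α + c = waveZero κ x j by rw [h2]; ring,
    waveZero, waveZero, integral_wave hκ.le hs]
  rfl

theorem jInt_zeroPhase_even {κ : ℝ} (hκ : 0 ≤ κ) (x : ℝ) (k : ℤ) :
    jInt κ x (zeroPhase x (2 * k)) = 2 * k * jInt κ x (π / 2) - jInt κ x x := by
  rw [zeroPhase_even, show (k : ℝ) * π - x = -x + k * π by ring, jInt, kInt_add_int_mul_pi hκ,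
    lInt_add_int_mul_pi hκ, kInt_neg, lInt_neg, jInt, jInt]
  ring

theorem jInt_zeroPhase_odd {κ : ℝ} (hκ : 0 ≤ κ) (x : ℝ) (k : ℤ) :
    jInt κ x (zeroPhase x (2 * k + 1)) = 2 * k * jInt κ x (π / 2) + jInt κ x x := by
  rw [zeroPhase_odd, add_comm, jInt, kInt_add_int_mul_pi hκ, lInt_add_int_mul_pi hκ, jInt, jInt]
  ring

theorem waveZero_even {κ : ℝ} (hκ : 0 ≤ κ) (x : ℝ) (k : ℤ) :
    waveZero κ x (2 * k) = 2 * k * halfPeriod κ x - negHalf κ x := by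
  rw [waveZero, zeroPhase_even, show (k : ℝ) * π - x = -x + k * π by ring, kInt_add_int_mul_pi hκ,
    kInt_neg, halfPeriod, negHalf]
  ring

theorem waveZero_odd {κ : ℝ} (hκ : 0 ≤ κ) (x : ℝ) (k : ℤ) :
    waveZero κ x (2 * k + 1) = 2 * k * halfPeriod κ x + negHalf κ x := by
  rw [waveZero, zeroPhase_odd, add_comm, kInt_add_int_mul_pi hκ, halfPeriod, negHalf]
  ring

/-- Admissible parameters of a wave that changes sign. -/
structure WaveParam (κ x : ℝ) : Prop where
  pos : 0 < κ
  mem : x ∈ Ioo 0 (π / 2)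
  scale_pos : 0 < scale κ x

theorem integral_congr_Icc {α : ℝ} (hα : 0 < α) {f g : ℝ → ℝ}
    (h : ∀ θ ∈ Icc (-α) α, f θ = g θ) : ∫ θ in (-α)..α, f θ = ∫ θ in (-α)..α, g θ :=
  intervalIntegral.integral_congr fun θ hθ => h θ (by rwa [uIcc_of_le (by linarith)] at hθ)

section Types

variable {κ x : ℝ} (hw : WaveParam κ x) (m : ℕ)

theorem WaveParam.isJHType_eq (hw : WaveParam κ x) (m : ℕ) :
    IsJHType (m * halfPeriod κ x) m m
      (fun θ => wave κ x (θ + (m * halfPeriod κ x - negHalf κ x))) ∧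
    ∫ θ in (-(m * halfPeriod κ x))..(m * halfPeriod κ x),
      wave κ x (θ + (m * halfPeriod κ x - negHalf κ x)) = 2 * m * halfFlux κ x := by
  have e0 := waveZero_even hw.pos.le x 0
  have e1 := waveZero_even hw.pos.le x m
  have h1 : waveZero κ x 0 = (m * halfPeriod κ x - negHalf κ x) - m * halfPeriod κ x := by
    simp only [mul_zero, Int.cast_zero] at e0
    linarith
  have h2 : waveZero κ x (2 * (m : ℤ)) =
      (m * halfPeriod κ x - negHalf κ x) + m * halfPeriod κ x := by
    push_cast at e1
    linarith
  constructor
  · have h := isJHType_wave hw.pos hw.mem hw.scale_pos (n := 2 * m) h1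
      (by rw [zero_add]; push_cast; exact h2)
    have hc := card_filter_parity 0 (2 * m)
    rw [hc.1, hc.2] at h
    have g1 : (2 * m + 1) / 2 = m := by omega
    have g2 : 2 * m / 2 = m := by omega
    simpa [g1, g2] using h
  · rw [integral_wave_shift hw.pos hw.scale_pos h1 h2, jInt_zeroPhase_even hw.pos.le,
      show (0 : ℤ) = 2 * 0 by ring, jInt_zeroPhase_even hw.pos.le, halfFlux]
    push_cast
    ring

/-- The case m = 0, a single negative arc, is included on purpose: it supplies the solutions of type
(0, 1). -/
theorem WaveParam.isJHType_lt (hw : WaveParam κ x) (m : ℕ) :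
    IsJHType (m * halfPeriod κ x + negHalf κ x) m (m + 1)
      (fun θ => wave κ x (θ + m * halfPeriod κ x)) ∧
    ∫ θ in (-(m * halfPeriod κ x + negHalf κ x))..(m * halfPeriod κ x + negHalf κ x),
      wave κ x (θ + m * halfPeriod κ x) = 2 * (m * halfFlux κ x + negFlux κ x) := by
  have e0 := waveZero_even hw.pos.le x 0
  have e1 := waveZero_odd hw.pos.le x m
  have h1 : waveZero κ x 0 = m * halfPeriod κ x - (m * halfPeriod κ x + negHalf κ x) := by
    simp only [mul_zero, Int.cast_zero] at e0
    linarith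
  have h2 : waveZero κ x (2 * (m : ℤ) + 1) =
      m * halfPeriod κ x + (m * halfPeriod κ x + negHalf κ x) := by
    push_cast at e1
    linarith
  constructor
  · have h := isJHType_wave hw.pos hw.mem hw.scale_pos (n := 2 * m + 1) h1
      (by rw [zero_add]; push_cast; exact h2)
    have hc := card_filter_parity 0 (2 * m + 1)
    rw [hc.1, hc.2] at h
    have g1 : (2 * m + 1 + 1) / 2 = m + 1 := by omega
    have g2 : (2 * m + 1) / 2 = m := by omega
    simpa [g1, g2] using h
  · rw [integral_wave_shift hw.pos hw.scale_pos h1 h2, jInt_zeroPhase_odd hw.pos.le,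
      show (0 : ℤ) = 2 * 0 by ring, jInt_zeroPhase_even hw.pos.le, halfFlux, negFlux]
    push_cast
    ring

theorem WaveParam.isJHType_gt (hw : WaveParam κ x) (m : ℕ) :
    IsJHType ((m + 1) * halfPeriod κ x - negHalf κ x) (m + 1) m
      (fun θ => wave κ x (θ + (m + 1) * halfPeriod κ x)) ∧
    ∫ θ in (-((m + 1) * halfPeriod κ x - negHalf κ x))..((m + 1) * halfPeriod κ x - negHalf κ x),
      wave κ x (θ + (m + 1) * halfPeriod κ x) = 2 * ((m + 1) * halfFlux κ x - negFlux κ x) := by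
  have e0 := waveZero_odd hw.pos.le x 0
  have e1 := waveZero_even hw.pos.le x (m + 1)
  have h1 : waveZero κ x (2 * 0 + 1) =
      (m + 1) * halfPeriod κ x - ((m + 1) * halfPeriod κ x - negHalf κ x) := by
    rw [e0]
    push_cast
    ring
  have h2 : waveZero κ x (2 * ((m : ℤ) + 1)) =
      (m + 1) * halfPeriod κ x + ((m + 1) * halfPeriod κ x - negHalf κ x) := by
    push_cast at e1
    linarith
  constructor
  · have h := isJHType_wave hw.pos hw.mem hw.scale_pos (i := 2 * 0 + 1) (n := 2 * m + 1) h1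
      (by rw [← h2]; congr 1; push_cast; ring)
    have hc := card_filter_parity (2 * 0 + 1) (2 * m + 1)
    rw [hc.1, hc.2] at h
    have g1 : (2 * m + 1 + 1) / 2 = m + 1 := by omega
    have g2 : (2 * m + 1) / 2 = m := by omega
    simpa [g1, g2] using h
  · rw [integral_wave_shift hw.pos hw.scale_pos h1 h2, jInt_zeroPhase_odd hw.pos.le,
      jInt_zeroPhase_even hw.pos.le, halfFlux, negFlux]
    push_cast
    ring

end Types

/-- An even number of arcs may begin with a negative or a positive one. The two alternatives are
mirror images, and they are the only source of non-uniqueness at fixed parameters. -/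
theorem IsJHType.eq_wave_eq {α : ℝ} {m : ℕ} {f : ℝ → ℝ} (hm : 1 ≤ m) (h : IsJHType α m m f) :
    ∃ κ x, WaveParam κ x ∧ α = m * halfPeriod κ x ∧
      ((∀ θ ∈ Icc (-α) α, f θ = wave κ x (θ + (α - negHalf κ x))) ∨
        ∀ θ ∈ Icc (-α) α, f θ = wave κ x (θ + (α + negHalf κ x))) ∧
      ∫ θ in (-α)..α, f θ = 2 * m * halfFlux κ x := by
  obtain ⟨κ, x, c, i, n, hκ, hx, hs, hi, h1, h2, hf, ha, hb⟩ := h.exists_waveZero hm hm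
  have hn : n = 2 * m := by rcases hi with rfl | rfl <;> simp at ha hb <;> omega
  subst hn
  have hα : 0 < α := by
    have := waveZero_strictMono hκ.le hs hx (show i < i + (2 * m : ℕ) by omega)
    linarith
  have e0 := waveZero_even hκ.le x 0
  have e1 := waveZero_even hκ.le x m
  have e2 := waveZero_odd hκ.le x 0
  have e3 := waveZero_odd hκ.le x m
  push_cast at e0 e1 e2 e3
  refine ⟨κ, x, ⟨hκ, hx, hs⟩, ?_⟩
  rcases hi with rfl | rfl
  · rw [mul_zero] at e0
    rw [zero_add] at h2
    push_cast at h2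
    have hα' : α = m * halfPeriod κ x := by linarith
    have hc : c = α - negHalf κ x := by linarith
    subst hc
    refine ⟨hα', Or.inl hf, ?_⟩
    rw [integral_congr_Icc hα hf, integral_wave_shift hκ hs h1 h2, jInt_zeroPhase_even hκ.le,
      show (0 : ℤ) = 2 * 0 by ring, jInt_zeroPhase_even hκ.le, halfFlux]
    push_cast
    ring
  · rw [add_comm] at h2
    push_cast at h2
    have hα' : α = m * halfPeriod κ x := by linarith
    have hc : c = α + negHalf κ x := by linarith
    subst hc
    refine ⟨hα', Or.inr hf, ?_⟩
    rw [integral_congr_Icc hα hf, integral_wave_shift hκ hs h1 h2, jInt_zeroPhase_odd hκ.le,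
      show (1 : ℤ) = 2 * 0 + 1 by ring, jInt_zeroPhase_odd hκ.le, halfFlux]
    push_cast
    ring

theorem IsJHType.eq_wave_lt {α : ℝ} {m : ℕ} {f : ℝ → ℝ} (hm : 1 ≤ m) (h : IsJHType α m (m + 1) f) :
    ∃ κ x, WaveParam κ x ∧ α = m * halfPeriod κ x + negHalf κ x ∧
      ∫ θ in (-α)..α, f θ = 2 * (m * halfFlux κ x + negFlux κ x) := by
  obtain ⟨κ, x, c, i, n, hκ, hx, hs, hi, h1, h2, hf, ha, hb⟩ := h.exists_waveZero hm (by omega)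
  -- One negative arc in excess forces negative arcs at both walls.
  have hn : n = 2 * m + 1 ∧ i = 0 := by rcases hi with rfl | rfl <;> simp at ha hb <;> omega
  obtain ⟨rfl, rfl⟩ := hn
  have hα : 0 < α := by
    have := waveZero_strictMono hκ.le hs hx (show (0 : ℤ) < 0 + (2 * m + 1 : ℕ) by omega)
    linarith
  have e0 := waveZero_even hκ.le x 0
  have e3 := waveZero_odd hκ.le x m
  push_cast at e0 e3
  rw [mul_zero] at e0
  rw [zero_add] at h2
  push_cast at h2
  have hα' : α = m * halfPeriod κ x + negHalf κ x := by linarith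
  refine ⟨κ, x, ⟨hκ, hx, hs⟩, hα', ?_⟩
  rw [integral_congr_Icc hα hf, integral_wave_shift hκ hs h1 h2, jInt_zeroPhase_odd hκ.le,
    show (0 : ℤ) = 2 * 0 by ring, jInt_zeroPhase_even hκ.le, halfFlux, negFlux]
  push_cast
  ring

theorem IsJHType.eq_wave_gt {α : ℝ} {m : ℕ} {f : ℝ → ℝ} (hm : 1 ≤ m) (h : IsJHType α (m + 1) m f) :
    ∃ κ x, WaveParam κ x ∧ α = (m + 1) * halfPeriod κ x - negHalf κ x ∧
      ∫ θ in (-α)..α, f θ = 2 * ((m + 1) * halfFlux κ x - negFlux κ x) := by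
  obtain ⟨κ, x, c, i, n, hκ, hx, hs, hi, h1, h2, hf, ha, hb⟩ := h.exists_waveZero (by omega) hm
  have hn : n = 2 * m + 1 ∧ i = 1 := by rcases hi with rfl | rfl <;> simp at ha hb <;> omega
  obtain ⟨rfl, rfl⟩ := hn
  have hα : 0 < α := by
    have := waveZero_strictMono hκ.le hs hx (show (1 : ℤ) < 1 + (2 * m + 1 : ℕ) by omega)
    linarith
  have e0 := waveZero_odd hκ.le x 0
  have e3 := waveZero_even hκ.le x (m + 1)
  push_cast at e0 e3
  rw [show (1 : ℤ) + (2 * m + 1 : ℕ) = 2 * ((m : ℤ) + 1) by push_cast; ring] at h2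
  have hα' : α = (m + 1) * halfPeriod κ x - negHalf κ x := by linarith
  refine ⟨κ, x, ⟨hκ, hx, hs⟩, hα', ?_⟩
  rw [integral_congr_Icc hα hf, integral_wave_shift hκ hs h1 h2, jInt_zeroPhase_even hκ.le,
    show (1 : ℤ) = 2 * 0 + 1 by ring, jInt_zeroPhase_odd hκ.le, halfFlux, negFlux]
  push_cast
  ring

/-! ### Solutions of one sign -/

/-- The polynomial governing a single arc with extremal value `M`. -/
noncomputable def arcQ (M d ψ : ℝ) : ℝ := cos ψ ^ 2 * (6 + M * (1 + cos ψ ^ 2)) + d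

/-- The half-length of a single arc with extremal value `M`. -/
noncomputable def arcT (M d : ℝ) : ℝ := ∫ ψ in (0 : ℝ)..π / 2, √6 * cos ψ / √(arcQ M d ψ)

/-- Half the flux of a single arc with extremal value `M`. -/
noncomputable def arcF (M d : ℝ) : ℝ :=
  M * ∫ ψ in (0 : ℝ)..π / 2, cos ψ ^ 2 * (√6 * cos ψ / √(arcQ M d ψ))

/-- Admissible parameters of a single arc. -/
structure ArcParam (M d : ℝ) : Prop where
  ne : M ≠ 0
  nonneg : 0 ≤ d
  pos : 0 < 6 + 2 * M + d

section

variable {M d : ℝ}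

/-- For M < 0 the quadratic is concave in y, hence above the chord joining its values d at y = 0 and
6 + 2M + d at y = 1. For M ≥ 0 positivity is clear term by term. -/
theorem quadratic_pos (hd : 0 ≤ d) (hp : 0 < 6 + 2 * M + d) {y : ℝ} (hy : 0 ≤ y) (hy1 : y ≤ 1)
    (hyd : 0 < y ∨ 0 < d) : 0 < y * (6 + M * (1 + y)) + d := by
  rcases le_or_gt 0 M with hM | hM
  · have : 0 ≤ M * (1 + y) := mul_nonneg hM (by linarith)
    rcases hyd with h | h
    · nlinarith
    · nlinarith
  · have h1 : y * (6 + 2 * M + d) + (1 - y) * d ≤ y * (6 + M * (1 + y)) + d := by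
      nlinarith [mul_nonneg hy (sub_nonneg.2 hy1)]
    have h2 : 0 < y * (6 + 2 * M + d) + (1 - y) * d := by
      rcases hyd with h | h
      · have := mul_pos h hp
        have := mul_nonneg (sub_nonneg.2 hy1) hd
        linarith
      · rcases eq_or_lt_of_le hy with h0 | h0
        · rw [← h0]
          linarith
        · have := mul_pos h0 hp
          have := mul_nonneg (sub_nonneg.2 hy1) hd
          linarith
    linarith

theorem arcQ_pos (hd : 0 ≤ d) (hp : 0 < 6 + 2 * M + d) {ψ : ℝ} (hψ : cos ψ ≠ 0) :
    0 < arcQ M d ψ :=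
  quadratic_pos hd hp (sq_nonneg _) (cos_sq_le_one ψ) (Or.inl (by positivity))

theorem arcQ_pos_of_pos (hd : 0 < d) (hp : 0 < 6 + 2 * M + d) (ψ : ℝ) : 0 < arcQ M d ψ :=
  quadratic_pos hd.le hp (sq_nonneg _) (cos_sq_le_one ψ) (Or.inr hd)

theorem continuous_arcQ (M d : ℝ) : Continuous (arcQ M d) := by
  unfold arcQ
  fun_prop

/-- A continuous representative of the speed of a single arc. -/
theorem exists_arc_speed (hd : 0 ≤ d) (hp : 0 < 6 + 2 * M + d) :
    ∃ g : ℝ → ℝ, Continuous g ∧ Function.Periodic g π ∧ (∀ t, g (-t) = g t) ∧ (∀ t, 0 ≤ g t) ∧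
      ∀ t, cos t ≠ 0 → g t = √6 * |cos t| / √(arcQ M d t) := by
  rcases eq_or_lt_of_le hd with rfl | hd'
  · have hpos : ∀ t, 0 < 6 + M * (1 + cos t ^ 2) := by
      intro t
      rcases le_or_gt 0 M with hM | hM
      · positivity
      · nlinarith [cos_sq_le_one t]
    -- For d = 0 the cosine cancels against the square root, which removes the indeterminate 0/0 at
    -- odd multiples of π/2.
    refine ⟨fun t => √6 / √(6 + M * (1 + cos t ^ 2)), ?_, ?_, ?_, ?_, ?_⟩
    · exact Continuous.div (by fun_prop) (by fun_prop) fun t => (sqrt_pos.2 (hpos t)).ne'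
    · intro t
      simp [cos_add_pi]
    · intro t
      simp
    · intro t
      positivity
    · intro t ht
      have h1 : √(arcQ M 0 t) = |cos t| * √(6 + M * (1 + cos t ^ 2)) := by
        rw [arcQ, add_zero, sqrt_mul (sq_nonneg _), sqrt_sq_eq_abs]
      have h2 := abs_pos.2 ht
      have h3 := sqrt_pos.2 (hpos t)
      rw [h1]
      field_simp
  · refine ⟨fun t => √6 * |cos t| / √(arcQ M d t), ?_, ?_, ?_, ?_, fun t _ => rfl⟩
    · refine Continuous.div (by fun_prop) ((continuous_arcQ M d).sqrt) fun t => ?_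
      exact (sqrt_pos.2 (arcQ_pos_of_pos hd' hp t)).ne'
    · intro t
      simp [arcQ, cos_add_pi]
    · intro t
      simp [arcQ]
    · intro t
      positivity

theorem exists_cos_ne_zero {a b : ℝ} (hab : a < b) : ∃ c ∈ Icc a b, cos c ≠ 0 := by
  by_contra! h
  set δ := min (b - a) 1 with hδ
  have h0 : 0 < δ := lt_min (by linarith) one_pos
  have h1 : δ ≤ b - a := min_le_left _ _
  have h2 : δ ≤ 1 := min_le_right _ _
  have ha := h a ⟨le_rfl, hab.le⟩
  have hb := h (a + δ) ⟨by linarith, by linarith⟩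
  rw [cos_add, ha, zero_mul, zero_sub, neg_eq_zero, mul_eq_zero] at hb
  rcases hb with hb | hb
  · nlinarith [sin_sq_add_cos_sq a]
  · exact (sin_pos_of_pos_of_lt_pi h0 (by linarith [pi_gt_three])).ne' hb

theorem strictMono_primitive {g : ℝ → ℝ} (hc : Continuous g) (h0 : ∀ t, 0 ≤ g t)
    (h : ∀ t, cos t ≠ 0 → 0 < g t) : StrictMono fun x => ∫ t in (0 : ℝ)..x, g t := by
  intro a b hab
  have hi : ∀ a b, IntervalIntegrable g MeasureTheory.volume a b := fun a b =>
    hc.intervalIntegrable a b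
  have h1 := intervalIntegral.integral_interval_sub_left (hi 0 b) (hi 0 a)
  obtain ⟨c, hc1, hc2⟩ := exists_cos_ne_zero hab
  have h2 := intervalIntegral.integral_lt_integral_of_continuousOn_of_le_of_exists_lt
    (f := fun _ => 0) (g := g) hab continuousOn_const hc.continuousOn (fun t _ => h0 t)
    ⟨c, hc1, h c hc2⟩
  simp only [intervalIntegral.integral_zero] at h2
  simp only
  linarith

/-- The explicit single-arc solution. -/
theorem exists_arc (h : ArcParam M d) : ∃ f f' : ℝ → ℝ, 0 < arcT M d ∧
    IsJHOn (M * (6 + M - d) / 3) (-arcT M d) (arcT M d) f f' ∧ Continuous f ∧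
    f 0 = M ∧ f' 0 = 0 ∧ f (-arcT M d) = 0 ∧ f (arcT M d) = 0 ∧
    (∀ θ ∈ Ioo (-arcT M d) (arcT M d), 0 < f θ / M) ∧
    ∫ θ in (-arcT M d)..arcT M d, f θ = 2 * arcF M d := by
  obtain ⟨g, hgc, hgp, hge, hg0, hgf⟩ := exists_arc_speed h.nonneg h.pos
  have h6 : 0 < √6 := by positivity
  have hgpos : ∀ t, cos t ≠ 0 → 0 < g t := by
    intro t ht
    rw [hgf t ht]
    have := arcQ_pos h.nonneg h.pos ht
    positivity
  have hmono := strictMono_primitive hgc hg0 hgpos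
  obtain ⟨ψ, hψc, hψm, hψ1, hψ2, hψd, hψi⟩ := exists_primitive_inverse hgc hgp hmono
  have hcongr : ∀ k : ℝ → ℝ, ∫ t in (0 : ℝ)..π / 2, k t * g t =
      ∫ t in (0 : ℝ)..π / 2, k t * (√6 * cos t / √(arcQ M d t)) := by
    intro k
    refine intervalIntegral.integral_congr_ae ?_
    have hae : ∀ᵐ t : ℝ, t ≠ π / 2 := by
      simp [MeasureTheory.ae_iff, MeasureTheory.measure_singleton]
    filter_upwards [hae] with t ht hm
    rw [uIoc_of_le (by positivity)] at hm
    have hcos : 0 < cos t := cos_pos_of_mem_Ioo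
      ⟨by linarith [hm.1, pi_pos], lt_of_le_of_ne hm.2 ht⟩
    rw [hgf t hcos.ne', abs_of_pos hcos]
  have hT : ∫ t in (0 : ℝ)..π / 2, g t = arcT M d := by
    have := hcongr 1
    simpa [arcT] using this
  have hTn : ∫ t in (0 : ℝ)..-(π / 2), g t = -arcT M d := by
    rw [integral_neg_of_even hge, hT]
  have hTpos : 0 < arcT M d := by
    rw [← hT]
    have h0 : (∫ t in (0 : ℝ)..0, g t) < ∫ t in (0 : ℝ)..π / 2, g t := hmono (by positivity)
    simpa using h0
  have hψ0 : ψ 0 = 0 := by simpa using hψ1 0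
  have hψT : ψ (arcT M d) = π / 2 := by rw [← hT, hψ1]
  have hψTn : ψ (-arcT M d) = -(π / 2) := by rw [← hTn, hψ1]
  have hcosψ : ∀ θ ∈ Ioo (-arcT M d) (arcT M d), 0 < cos (ψ θ) := by
    intro θ hθ
    refine cos_pos_of_mem_Ioo ⟨?_, ?_⟩
    · rw [← hψTn]
      exact hψm hθ.1
    · rw [← hψT]
      exact hψm hθ.2
  -- With f = M cos² ψ, the first integral f'² = (2/3)(M - f)(f² + (6 + M) f + M d) becomes 6 cos² ψ
  -- · ψ'² = Q(ψ), so the angle is the primitive of √6 cos ψ / √Q.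
  refine ⟨fun θ => M * cos (ψ θ) ^ 2,
    fun θ => -2 * M / √6 * (sin (ψ θ) * √(arcQ M d (ψ θ))), hTpos, fun θ hθ => ?_, by fun_prop,
    by simp [hψ0], by simp [hψ0], by simp [hψTn], by simp [hψT], fun θ hθ => ?_, ?_⟩
  · have hc := hcosψ θ hθ
    have hQ := arcQ_pos h.nonneg h.pos hc.ne'
    have hd := hψd θ (hgpos _ hc.ne').ne'
    rw [hgf _ hc.ne', abs_of_pos hc, inv_div] at hd
    have hcos := hd.cos
    have hsin := hd.sin
    have hq0 : 0 < √(arcQ M d (ψ θ)) := sqrt_pos.2 hQ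
    have hq2 : √(arcQ M d (ψ θ)) ^ 2 = arcQ M d (ψ θ) := sq_sqrt hQ.le
    have h62 : √6 ^ 2 = (6 : ℝ) := sq_sqrt (by norm_num)
    have hAd : HasDerivAt (fun θ => arcQ M d (ψ θ)) (-2 * sin (ψ θ) * (6 + M + 2 * M * cos (ψ θ) ^ 2)
        * (√(arcQ M d (ψ θ)) / √6)) θ := by
      have h0 : HasDerivAt (fun θ => arcQ M d (ψ θ)) _ θ :=
        (((hcos.pow 2).mul ((((hcos.pow 2).const_add 1).const_mul M).const_add 6)).add_const d)
      refine h0.congr_deriv ?_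
      simp
      field_simp
      ring
    constructor
    · have h0 : HasDerivAt (fun θ => M * cos (ψ θ) ^ 2) _ θ := (hcos.pow 2).const_mul M
      refine h0.congr_deriv ?_
      simp
      field_simp
    · have h0 : HasDerivAt (fun θ => -2 * M / √6 * (sin (ψ θ) * √(arcQ M d (ψ θ)))) _ θ :=
        (hsin.mul (hAd.sqrt hQ.ne')).const_mul (-2 * M / √6)
      refine h0.congr_deriv ?_
      field_simp
      rw [hq2, h62, arcQ]
      have hs2 : sin (ψ θ) ^ 2 = 1 - cos (ψ θ) ^ 2 := sin_sq _
      simp only [hs2]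
      ring
  · have := hcosψ θ hθ
    have hM := h.ne
    rw [mul_div_cancel_left₀ _ hM]
    positivity
  · have hi := hψi (fun t => M * cos t ^ 2) (by fun_prop) (-(π / 2)) (π / 2)
    rw [hT, hTn] at hi
    rw [hi]
    have hgi : ∀ a b, IntervalIntegrable (fun t => M * cos t ^ 2 * g t)
        MeasureTheory.volume a b := fun a b => by
      apply Continuous.intervalIntegrable
      fun_prop
    rw [← intervalIntegral.integral_add_adjacent_intervals (hgi _ 0) (hgi 0 _),
      intervalIntegral.integral_symm 0 (-(π / 2)), integral_neg_of_even (fun t => by simp [hge]),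
      hcongr (fun t => M * cos t ^ 2), arcF, ← intervalIntegral.integral_const_mul]
    simp only [mul_assoc]
    ring

/-- The data of a solution without sign change. -/
structure IsArc (α : ℝ) (f : ℝ → ℝ) (M d : ℝ) : Prop where
  param : ArcParam M d
  length : arcT M d = α
  flux : ∫ θ in (-α)..α, f θ = 2 * arcF M d
  data : ∃ f', IsJHOn (M * (6 + M - d) / 3) (-α) α f f' ∧ f 0 = M ∧ f' 0 = 0

/-- A solution without interior zeros is even about its extremum, so the extremum sits at 0. The
value M there and C determine d; the first integral gives d ≥ 0 at the wall and 6 + 2M + d > 0 near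
the extremum, and uniqueness identifies f with the explicit arc. The sign σ treats both cases at
once. -/
theorem IsJH.isArc {α : ℝ} (hα : 0 < α) {f : ℝ → ℝ} (h : IsJH α f) {σ : ℝ} (hσ : σ = 1 ∨ σ = -1)
    (hf : ∀ θ ∈ Ioo (-α) α, 0 < σ * f θ) : ∃ M d, 0 < σ * M ∧ IsArc α f M d := by
  obtain ⟨C, f', hode⟩ := h.ode
  have hα' : -α < α := by linarith
  have h0mem : (0 : ℝ) ∈ Ioo (-α) α := ⟨by linarith, hα⟩
  have hbdd := exists_abs_le_of_continuousOn h.continuousOn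
  have hfne : ∀ θ ∈ Ioo (-α) α, f θ ≠ 0 := by
    intro θ hθ h0
    have := hf θ hθ
    rw [h0, mul_zero] at this
    exact this.false
  obtain ⟨θ₁, hθ₁, hmax⟩ := isCompact_Icc.exists_isMaxOn (nonempty_Icc.2 hα'.le)
    (h.continuousOn.const_smul σ)
  have hpos : 0 < σ * f θ₁ := (hf 0 h0mem).trans_le (hmax (Ioo_subset_Icc_self h0mem))
  have hθ₁' : θ₁ ∈ Ioo (-α) α := by
    refine ⟨lt_of_le_of_ne hθ₁.1 fun e => ?_, lt_of_le_of_ne hθ₁.2 fun e => ?_⟩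
    · rw [← e, h.left, mul_zero] at hpos
      exact hpos.false
    · rw [e, h.right, mul_zero] at hpos
      exact hpos.false
  have hσ0 : σ ≠ 0 := by rcases hσ with rfl | rfl <;> norm_num
  have hd1 : f' θ₁ = 0 := by
    have h1 : HasDerivAt (fun θ => σ • f θ) (σ • f' θ₁) θ₁ := (hode θ₁ hθ₁').1.const_smul σ
    have h2 := (hmax.isLocalMax (Icc_mem_nhds hθ₁'.1 hθ₁'.2)).hasDerivAt_eq_zero h1
    rcases mul_eq_zero.1 h2 with h3 | h3
    · exact absurd h3 hσ0
    · exact h3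
  have hrefl := hode.comp_const_sub (2 * θ₁)
  have hreflb : ∀ θ ∈ Ioo (2 * θ₁ - α) (2 * θ₁ + α), 2 * θ₁ - θ ∈ Ioo (-α) α := fun θ hθ =>
    ⟨by linarith [hθ.2], by linarith [hθ.1]⟩
  -- If the extremum were off centre, reflection about it would carry the nearer wall to an interior
  -- zero.
  have hθ0 : θ₁ = 0 := by
    obtain ⟨R, hR⟩ := hbdd
    rcases lt_trichotomy θ₁ 0 with hneg | hz | hpos'
    · exfalso
      have hA := hode.mono (a₂ := -α) (b₂ := 2 * θ₁ + α) le_rfl (by linarith)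
      have hB := hrefl.mono (a₂ := -α) (b₂ := 2 * θ₁ + α) (by linarith) (by linarith)
      have := hA.eqOn hB ⟨R, fun θ hθ => hR θ ⟨hθ.1, by linarith [hθ.2]⟩⟩
        ⟨R, fun θ hθ => hR _ (hreflb θ ⟨by linarith [hθ.1], hθ.2⟩)⟩
        (c := θ₁) ⟨hθ₁'.1, by linarith [hθ₁'.1]⟩ (by ring_nf) (by
          rw [show 2 * θ₁ - θ₁ = θ₁ by ring, hd1, neg_zero])
      have h3 := eqOn_Icc_of_eqOn_Ioo (by linarith [hθ₁'.1])
        (h.continuousOn.mono (Icc_subset_Icc le_rfl (by linarith)))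
        (h.continuousOn.comp (by fun_prop) fun θ hθ => ⟨by linarith [hθ.2], by linarith [hθ.1]⟩)
        this (-α) ⟨le_rfl, by linarith [hθ₁'.1]⟩
      rw [h.left] at h3
      exact hfne (2 * θ₁ - -α) ⟨by linarith [hθ₁'.1], by linarith⟩ h3.symm
    · exact hz
    · exfalso
      have hA := hode.mono (a₂ := 2 * θ₁ - α) (b₂ := α) (by linarith) le_rfl
      have hB := hrefl.mono (a₂ := 2 * θ₁ - α) (b₂ := α) le_rfl (by linarith)
      have := hA.eqOn hB ⟨R, fun θ hθ => hR θ ⟨by linarith [hθ.1], hθ.2⟩⟩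
        ⟨R, fun θ hθ => hR _ (hreflb θ ⟨hθ.1, by linarith [hθ.2]⟩)⟩
        (c := θ₁) ⟨by linarith [hθ₁'.2], hθ₁'.2⟩ (by ring_nf) (by
          rw [show 2 * θ₁ - θ₁ = θ₁ by ring, hd1, neg_zero])
      have h3 := eqOn_Icc_of_eqOn_Ioo (by linarith [hθ₁'.2])
        (h.continuousOn.mono (Icc_subset_Icc (by linarith) le_rfl))
        (h.continuousOn.comp (by fun_prop) fun θ hθ => ⟨by linarith [hθ.2], by linarith [hθ.1]⟩)
        this α ⟨by linarith [hθ₁'.2], le_rfl⟩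
      rw [h.right] at h3
      exact hfne (2 * θ₁ - α) ⟨by linarith, by linarith [hθ₁'.2]⟩ h3.symm
  rw [hθ0] at hd1 hpos hmax
  obtain ⟨M, hM⟩ : ∃ M, M = f 0 := ⟨_, rfl⟩
  rw [← hM] at hpos
  have hM0 : M ≠ 0 := by
    intro e
    rw [e, mul_zero] at hpos
    exact hpos.false
  -- This d makes the quadratic cofactor of M - f equal to f² + (6 + M) f + M d; at the wall f'²
  -- tends to (2/3) M² d.
  obtain ⟨d, hd⟩ : ∃ d, d = 6 + M - 3 * C / M := ⟨_, rfl⟩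
  have hC : C = M * (6 + M - d) / 3 := by
    rw [hd]
    field_simp
    ring
  have hen : ∀ θ ∈ Ioo (-α) α,
      f' θ ^ 2 = 2 / 3 * (M - f θ) * (f θ ^ 2 + (6 + M) * f θ + M * d) := by
    intro θ hθ
    have := hode.energy hθ h0mem
    rw [hd1, ← hM, hC] at this
    linear_combination 2 * this
  have hd0 : 0 ≤ d := by
    have hcl : α ∈ closure (Ioo (-α) α) := by
      rw [closure_Ioo hα'.ne]
      exact ⟨hα'.le, le_rfl⟩
    have hfc : ContinuousWithinAt f (Ioo (-α) α) α :=
      (h.continuousOn α ⟨hα'.le, le_rfl⟩).mono Ioo_subset_Icc_self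
    have := ContinuousWithinAt.closure_le (f := fun _ => (0 : ℝ))
      (g := fun θ => 2 / 3 * (M - f θ) * (f θ ^ 2 + (6 + M) * f θ + M * d)) hcl
      continuousWithinAt_const (by fun_prop) (fun θ hθ => by
        rw [← hen θ hθ]
        positivity)
    rw [h.right] at this
    have hM2 : 0 < M ^ 2 := by positivity
    by_contra! hneg
    nlinarith
  have hfc0 : ∀ y ∈ Ioo (0 : ℝ) 1, ∃ θ ∈ Ioo (-α) α, f θ = y * M := by
    intro y hy
    have hsub : Icc 0 α ⊆ Icc (-α) α := Icc_subset_Icc (by linarith) le_rfl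
    have hv : σ * (y * M) ∈ Icc (σ • f α) (σ • f 0) := by
      rw [h.right, ← hM, smul_zero, smul_eq_mul]
      constructor
      · nlinarith [hy.1]
      · nlinarith [hy.2]
    obtain ⟨θ, hθ, he⟩ := isPreconnected_Icc.intermediate_value (a := α) (b := 0)
      (right_mem_Icc.2 hα.le) (left_mem_Icc.2 hα.le) ((h.continuousOn.mono hsub).const_smul σ) hv
    have he' : f θ = y * M := mul_left_cancel₀ hσ0 he
    refine ⟨θ, ⟨by linarith [hθ.1], lt_of_le_of_ne hθ.2 ?_⟩, he'⟩
    rintro rfl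
    rw [h.right] at he'
    rcases mul_eq_zero.1 he'.symm with h1 | h1
    · exact hy.1.ne' h1
    · exact hM0 h1
  -- A negative value would make f'² negative close to the extremum; the value zero would make the
  -- constant M a solution with the same data at 0.
  have hp : 0 < 6 + 2 * M + d := by
    rcases lt_trichotomy (6 + 2 * M + d) 0 with hlt | heq | hgt
    · exfalso
      have hcont : Continuous fun y : ℝ => M * y ^ 2 + (6 + M) * y + d := by fun_prop
      have hev : ∀ᶠ y in 𝓝 (1 : ℝ), M * y ^ 2 + (6 + M) * y + d < 0 :=
        hcont.continuousAt.eventually_lt_const (by linarith)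
      obtain ⟨y, hy1, hy2⟩ := ((hev.filter_mono nhdsWithin_le_nhds).and
        (Ioo_mem_nhdsLT (zero_lt_one' ℝ))).exists
      obtain ⟨θ, hθ, he⟩ := hfc0 y hy2
      have h1 := hen θ hθ
      rw [he] at h1
      have h2 : f' θ ^ 2 = 2 / 3 * (M ^ 2 * (1 - y)) * (M * y ^ 2 + (6 + M) * y + d) := by
        rw [h1]
        ring
      have h3 : 0 < 2 / 3 * (M ^ 2 * (1 - y)) := by
        have := hy2.2
        have : 0 < 1 - y := by linarith
        positivity
      nlinarith [sq_nonneg (f' θ), mul_neg_of_pos_of_neg h3 hy1]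
    · exfalso
      have hconst : IsJHOn C (-α) α (fun _ => M) (fun _ => 0) := by
        intro θ _
        refine ⟨hasDerivAt_const _ _, (hasDerivAt_const θ (0 : ℝ)).congr_deriv ?_⟩
        rw [hC]
        linear_combination (M / 3) * heq
      have := eqOn_Icc_of_eqOn_Ioo hα' h.continuousOn continuousOn_const
        (hode.eqOn hconst hbdd ⟨|M|, fun _ _ => le_rfl⟩ h0mem hM.symm hd1) α ⟨hα'.le, le_rfl⟩
      rw [h.right] at this
      exact hM0 this.symm
    · exact hgt
  have hparam : ArcParam M d := ⟨hM0, hd0, hp⟩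
  obtain ⟨g, g', hT, hg, hgc, hg0, hg0', hgl, hgr, hgs, hgf⟩ := exists_arc hparam
  rw [← hC] at hg
  obtain ⟨R', hR'⟩ := exists_abs_le_of_continuousOn
    (hgc.continuousOn (s := Icc (-arcT M d) (arcT M d)))
  -- Both solutions agree on the shorter of the two intervals, and at its end one of them vanishes
  -- while the other does not.
  have hTα : arcT M d = α := by
    obtain ⟨R, hR⟩ := hbdd
    rcases lt_trichotomy (arcT M d) α with hlt | heq | hgt
    · exfalso
      have hA := hode.mono (a₂ := -arcT M d) (b₂ := arcT M d) (by linarith) hlt.le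
      have := eqOn_Icc_of_eqOn_Ioo (by linarith) (h.continuousOn.mono (Icc_subset_Icc (by linarith)
        hlt.le)) hgc.continuousOn (hA.eqOn hg ⟨R, fun θ hθ => hR θ ⟨by linarith [hθ.1],
          by linarith [hθ.2]⟩⟩ ⟨R', hR'⟩ (c := 0) ⟨by linarith, hT⟩ (by rw [hg0, hM])
          (by rw [hd1, hg0'])) (arcT M d) ⟨by linarith, le_rfl⟩
      rw [hgr] at this
      exact hfne _ ⟨by linarith, hlt⟩ this
    · exact heq
    · exfalso
      have hA := hg.mono (a₂ := -α) (b₂ := α) (by linarith) hgt.le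
      have := eqOn_Icc_of_eqOn_Ioo hα' h.continuousOn hgc.continuousOn
        (hode.eqOn hA ⟨R, hR⟩ ⟨R', fun θ hθ => hR' θ ⟨by linarith [hθ.1], by linarith [hθ.2]⟩⟩
          h0mem (by rw [hg0, hM]) (by rw [hd1, hg0'])) α ⟨hα'.le, le_rfl⟩
      rw [h.right] at this
      have h1 := hgs α ⟨by linarith, hgt⟩
      rw [← this, zero_div] at h1
      exact h1.false
  rw [hTα] at hg hgf hR'
  refine ⟨M, d, hpos, hparam, hTα, ?_, f', ?_, hM.symm, hd1⟩
  · rw [← hgf]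
    refine integral_congr_Icc hα (eqOn_Icc_of_eqOn_Ioo hα' h.continuousOn hgc.continuousOn ?_)
    exact hode.eqOn hg hbdd ⟨R', hR'⟩ h0mem (by rw [hg0, hM]) (by rw [hd1, hg0'])
  · rwa [← hC]

theorem IsArc.eqOn {α : ℝ} {f g : ℝ → ℝ} (hα : 0 < α) (hf : IsArc α f M d) (hg : IsArc α g M d)
    (hfc : ContinuousOn f (Icc (-α) α)) (hgc : ContinuousOn g (Icc (-α) α)) :
    ∀ θ ∈ Ioo (-α) α, f θ = g θ := by
  obtain ⟨f', h1, h2, h3⟩ := hf.data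
  obtain ⟨g', h4, h5, h6⟩ := hg.data
  exact h1.eqOn h4 (exists_abs_le_of_continuousOn hfc) (exists_abs_le_of_continuousOn hgc)
    (c := 0) ⟨by linarith, hα⟩ (by rw [h2, h5]) (by rw [h3, h6])

end

/-! ### Complete elliptic integrals: continuity, bounds, derivatives -/

theorem continuous_weight_max : Continuous fun p : ℝ × ℝ => weight (max p.1 0) p.2 := by
  unfold weight
  refine Continuous.inv₀ (by fun_prop) fun p => ?_
  exact (sqrt_pos.2 (one_add_mul_sin_sq_pos (le_max_right _ _) _)).ne'

/-- Clamping κ at 0 makes the integrand continuous on the whole plane, so that the theorem on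
integrals with a parameter applies without restriction; the clamp is removed on κ ≥ 0. -/
theorem continuous_kInt_max : Continuous fun p : ℝ × ℝ => kInt (max p.1 0) p.2 := by
  have h : Continuous (Function.uncurry fun (p : ℝ × ℝ) (t : ℝ) => weight (max p.1 0) t) :=
    continuous_weight_max.comp (f := fun q : (ℝ × ℝ) × ℝ => (q.1.1, q.2)) (by fun_prop)
  exact intervalIntegral.continuous_parametric_intervalIntegral_of_continuous
    (μ := MeasureTheory.volume) (a₀ := 0) h continuous_snd

theorem continuous_lInt_max : Continuous fun p : ℝ × ℝ => lInt (max p.1 0) p.2 := by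
  have h : Continuous (Function.uncurry fun (p : ℝ × ℝ) (t : ℝ) =>
      sin t ^ 2 * weight (max p.1 0) t) := by
    refine Continuous.mul (by fun_prop) ?_
    exact continuous_weight_max.comp (f := fun q : (ℝ × ℝ) × ℝ => (q.1.1, q.2)) (by fun_prop)
  exact intervalIntegral.continuous_parametric_intervalIntegral_of_continuous
    (μ := MeasureTheory.volume) (a₀ := 0) h continuous_snd

theorem continuousOn_kInt : ContinuousOn (fun p : ℝ × ℝ => kInt p.1 p.2) {p | 0 ≤ p.1} :=
  continuous_kInt_max.continuousOn.congr fun p hp => by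
    simp only [max_eq_left (show 0 ≤ p.1 from hp)]

theorem continuousOn_lInt : ContinuousOn (fun p : ℝ × ℝ => lInt p.1 p.2) {p | 0 ≤ p.1} :=
  continuous_lInt_max.continuousOn.congr fun p hp => by
    simp only [max_eq_left (show 0 ≤ p.1 from hp)]

theorem continuousOn_kInt_left (φ : ℝ) : ContinuousOn (fun κ => kInt κ φ) (Ici 0) :=
  continuousOn_kInt.comp (f := fun κ => (κ, φ)) (by fun_prop) fun _ h => h

theorem continuousOn_lInt_left (φ : ℝ) : ContinuousOn (fun κ => lInt κ φ) (Ici 0) :=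
  continuousOn_lInt.comp (f := fun κ => (κ, φ)) (by fun_prop) fun _ h => h

theorem continuous_scale : Continuous fun p : ℝ × ℝ => scale p.1 p.2 := by
  unfold scale
  fun_prop

/-- The complete integral of the reciprocal weight. -/
noncomputable def rootInt (κ : ℝ) : ℝ := ∫ t in (0 : ℝ)..π / 2, √(1 + κ * sin t ^ 2)

theorem weight_zero (t : ℝ) : weight 0 t = 1 := by simp [weight]

theorem kInt_zero_left (φ : ℝ) : kInt 0 φ = φ := by simp [kInt, weight_zero]

section

variable {κ : ℝ}

theorem weight_sq (hκ : 0 ≤ κ) (t : ℝ) : weight κ t ^ 2 * (1 + κ * sin t ^ 2) = 1 := by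
  have h := one_add_mul_sin_sq_pos hκ t
  rw [weight, inv_pow, sq_sqrt h.le, inv_mul_cancel₀ h.ne']

theorem sqrt_eq_mul_weight (hκ : 0 ≤ κ) (t : ℝ) :
    √(1 + κ * sin t ^ 2) = (1 + κ * sin t ^ 2) * weight κ t := by
  have h := one_add_mul_sin_sq_pos hκ t
  have h2 := sqrt_pos.2 h
  rw [weight]
  nth_rewrite 2 [← sq_sqrt h.le]
  field_simp

theorem weight_le_one (hκ : 0 ≤ κ) (t : ℝ) : weight κ t ≤ 1 := by
  refine inv_le_one_of_one_le₀ (one_le_sqrt.2 ?_)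
  nlinarith [mul_nonneg hκ (sq_nonneg (sin t))]

theorem intervalIntegrable_weight (hκ : 0 ≤ κ) (a b : ℝ) :
    IntervalIntegrable (weight κ) MeasureTheory.volume a b :=
  (continuous_weight hκ).intervalIntegrable a b

theorem intervalIntegrable_sin_sq_mul_weight (hκ : 0 ≤ κ) (a b : ℝ) :
    IntervalIntegrable (fun t => sin t ^ 2 * weight κ t) MeasureTheory.volume a b :=
  (continuous_sin_sq_mul_weight hκ).intervalIntegrable a b

theorem rootInt_eq (hκ : 0 ≤ κ) : rootInt κ = kInt κ (π / 2) + κ * lInt κ (π / 2) := by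
  rw [rootInt, kInt, lInt, ← intervalIntegral.integral_const_mul, ← intervalIntegral.integral_add
    (intervalIntegrable_weight hκ _ _)
    ((intervalIntegrable_sin_sq_mul_weight hκ _ _).const_mul κ)]
  refine intervalIntegral.integral_congr fun t _ => ?_
  simp only [sqrt_eq_mul_weight hκ t]
  ring

theorem kInt_le (hκ : 0 ≤ κ) {φ : ℝ} (hφ : 0 ≤ φ) : kInt κ φ ≤ φ := by
  have := intervalIntegral.integral_mono_on hφ (intervalIntegrable_weight hκ 0 φ)
    (intervalIntegrable_const (c := (1 : ℝ)) (μ := MeasureTheory.volume))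
    fun t _ => weight_le_one hκ t
  simpa [kInt] using this

theorem lInt_pos (hκ : 0 ≤ κ) {φ : ℝ} (hφ : 0 < φ) (hφ2 : φ ≤ π / 2) : 0 < lInt κ φ := by
  refine intervalIntegral.intervalIntegral_pos_of_pos_on
    (intervalIntegrable_sin_sq_mul_weight hκ 0 φ) (fun t ht => ?_) hφ
  have h1 : 0 < sin t := sin_pos_of_pos_of_lt_pi ht.1 (by linarith [ht.2, pi_pos])
  have := weight_pos hκ t
  positivity

/-- A Chebyshev argument: 1 - 2 sin² changes sign at π/4 and the weight decreases, so replacing the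
weight by its value at π/4 lowers the integral, and 1 - 2 sin² has integral zero. -/
theorem two_mul_lInt_le (hκ : 0 ≤ κ) : 2 * lInt κ (π / 2) ≤ kInt κ (π / 2) := by
  have hi := (intervalIntegrable_weight hκ 0 (π / 2)).sub
    ((intervalIntegrable_sin_sq_mul_weight hκ 0 (π / 2)).const_mul 2)
  have hc : Continuous fun t : ℝ => (1 - 2 * sin t ^ 2) * weight κ (π / 4) := by fun_prop
  have h := intervalIntegral.integral_mono_on (by positivity) (hc.intervalIntegrable 0 (π / 2)) hi
    fun t ht => by
      have h1 : (1 - 2 * sin t ^ 2) * weight κ (π / 4) ≤ (1 - 2 * sin t ^ 2) * weight κ t := by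
        have hq : sin (π / 4) ^ 2 = 1 / 2 := by
          rw [sin_pi_div_four, div_pow, sq_sqrt (by norm_num)]
          norm_num
        rcases le_total (sin t ^ 2) (1 / 2) with h | h
        · refine mul_le_mul_of_nonneg_left ?_ (by linarith)
          refine inv_anti₀ (sqrt_pos.2 (one_add_mul_sin_sq_pos hκ t)) (sqrt_le_sqrt ?_)
          rw [hq]
          gcongr
        · refine mul_le_mul_of_nonpos_left ?_ (by linarith)
          refine inv_anti₀ (sqrt_pos.2 (one_add_mul_sin_sq_pos hκ _)) (sqrt_le_sqrt ?_)
          rw [hq]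
          gcongr
      calc _ ≤ _ := h1
        _ = _ := by ring
  rw [intervalIntegral.integral_sub (intervalIntegrable_weight hκ _ _)
    ((intervalIntegrable_sin_sq_mul_weight hκ _ _).const_mul 2),
    intervalIntegral.integral_const_mul, intervalIntegral.integral_mul_const] at h
  have h0 : ∫ t in (0 : ℝ)..π / 2, (1 - 2 * sin t ^ 2) = 0 := by
    rw [intervalIntegral.integral_sub (by simp) ((by fun_prop : Continuous fun t : ℝ =>
      2 * sin t ^ 2).intervalIntegrable _ _), intervalIntegral.integral_const_mul, integral_sin_sq]
    simp
    ring
  rw [h0] at h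
  change _ ≤ kInt κ (π / 2) - 2 * lInt κ (π / 2) at h
  linarith

/-- Since √κ sin t is at most √(1 + κ sin² t), the integrand is bounded by sin t. -/
theorem lInt_mul_sqrt_le (hκ : 0 ≤ κ) : √κ * lInt κ (π / 2) ≤ 1 := by
  have h := intervalIntegral.integral_mono_on (a := 0) (b := π / 2) (by positivity)
    ((intervalIntegrable_sin_sq_mul_weight hκ 0 (π / 2)).const_mul (√κ))
    (continuous_sin.intervalIntegrable 0 (π / 2)) fun t ht => by
      have h1 : 0 ≤ sin t := sin_nonneg_of_nonneg_of_le_pi ht.1 (by linarith [ht.2, pi_pos])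
      have h2 : √κ * sin t * weight κ t ≤ 1 := by
        rw [weight, ← div_eq_mul_inv]
        refine div_le_one_of_le₀ ?_ (sqrt_nonneg _)
        refine le_sqrt_of_sq_le ?_
        rw [mul_pow, sq_sqrt hκ]
        linarith
      calc √κ * (sin t ^ 2 * weight κ t) = sin t * (√κ * sin t * weight κ t) := by ring
        _ ≤ sin t * 1 := mul_le_mul_of_nonneg_left h2 h1
        _ = sin t := mul_one _
  rw [intervalIntegral.integral_const_mul, integral_sin] at h
  simpa [lInt] using h

/-- From 1 + κ sin² t ≤ (1 + √κ t)². Logarithmic growth is weak but suffices to drive the fluxes to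
-∞ as κ grows. -/
theorem log_le_sqrt_mul_kInt (hκ : 0 ≤ κ) {φ : ℝ} (hφ : 0 ≤ φ) :
    log (1 + √κ * φ) ≤ √κ * kInt κ φ := by
  have hs := sqrt_nonneg κ
  have hd : ∀ t ∈ uIcc 0 φ, HasDerivAt (fun t => log (1 + √κ * t)) (√κ / (1 + √κ * t)) t := by
    intro t ht
    rw [uIcc_of_le hφ] at ht
    have h1 : 0 < 1 + √κ * t := by nlinarith [mul_nonneg hs ht.1]
    have h2 : HasDerivAt (fun t => 1 + √κ * t) √κ t := by
      simpa using ((hasDerivAt_id t).const_mul √κ).const_add 1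
    exact h2.log h1.ne'
  have hc : ContinuousOn (fun t : ℝ => √κ / (1 + √κ * t)) (uIcc 0 φ) := by
    refine ContinuousOn.div (by fun_prop) (by fun_prop) fun t ht => ?_
    rw [uIcc_of_le hφ] at ht
    nlinarith [mul_nonneg hs ht.1]
  have h := intervalIntegral.integral_eq_sub_of_hasDerivAt hd hc.intervalIntegrable
  have h2 := intervalIntegral.integral_mono_on hφ hc.intervalIntegrable
    ((intervalIntegrable_weight hκ 0 φ).const_mul √κ) fun t ht => by
      rw [weight, ← div_eq_mul_inv]
      have h3 := mul_nonneg hs ht.1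
      refine div_le_div_of_nonneg_left hs (sqrt_pos.2 (one_add_mul_sin_sq_pos hκ t)) ?_
      refine sqrt_le_iff.2 ⟨by linarith, ?_⟩
      have h4 : sin t ^ 2 ≤ t ^ 2 := by
        rw [sq_le_sq]
        exact abs_sin_le_abs
      have h5 : κ = √κ ^ 2 := (sq_sqrt hκ).symm
      nlinarith [mul_le_mul_of_nonneg_left h4 hκ]
  rw [h, intervalIntegral.integral_const_mul] at h2
  simpa [kInt] using h2

theorem tendsto_sqrt_mul_kInt {φ : ℝ} (hφ : 0 < φ) :
    Tendsto (fun κ => √κ * kInt κ φ) atTop atTop := by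
  refine tendsto_atTop_mono' atTop ((eventually_ge_atTop 0).mono fun κ hκ =>
    log_le_sqrt_mul_kInt hκ hφ.le) ?_
  exact tendsto_log_atTop.comp (tendsto_atTop_add_const_left _ _
    (tendsto_sqrt_atTop.atTop_mul_const hφ))

theorem hasDerivAt_weight (hκ : 0 ≤ κ) (t : ℝ) :
    HasDerivAt (fun κ => weight κ t) (-(sin t ^ 2 * weight κ t ^ 3) / 2) κ := by
  have h := one_add_mul_sin_sq_pos hκ t
  have h1 : HasDerivAt (fun κ => 1 + κ * sin t ^ 2) (sin t ^ 2) κ := by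
    simpa using ((hasDerivAt_id κ).mul_const (sin t ^ 2)).const_add 1
  have h2 := (h1.sqrt h.ne').inv (sqrt_pos.2 h).ne'
  refine h2.congr_deriv ?_
  rw [weight]
  have := sqrt_pos.2 h
  field_simp

theorem hasDerivAt_sqrt_one_add (hκ : 0 ≤ κ) (t : ℝ) :
    HasDerivAt (fun κ => √(1 + κ * sin t ^ 2)) (sin t ^ 2 * weight κ t / 2) κ := by
  have h := one_add_mul_sin_sq_pos hκ t
  have h1 : HasDerivAt (fun κ => 1 + κ * sin t ^ 2) (sin t ^ 2) κ := by
    simpa using ((hasDerivAt_id κ).mul_const (sin t ^ 2)).const_add 1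
  refine (h1.sqrt h.ne').congr_deriv ?_
  rw [weight]
  have := sqrt_pos.2 h
  field_simp

/-- The difference of the two integrands is the derivative of κ sin t cos t · `weight κ t`, which
vanishes at 0 and at π/2. This closes the system of derivatives of the complete integrals with
respect to κ. -/
theorem integral_weight_cube (hκ : 0 ≤ κ) :
    (1 + κ) * ∫ t in (0 : ℝ)..π / 2, weight κ t ^ 3 = rootInt κ := by
  have hd : ∀ t ∈ uIcc 0 (π / 2), HasDerivAt (fun t => κ * (sin t * cos t * weight κ t))
      ((1 + κ) * weight κ t ^ 3 - √(1 + κ * sin t ^ 2)) t := by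
    intro t _
    have h := one_add_mul_sin_sq_pos hκ t
    have h1 : HasDerivAt (fun t => 1 + κ * sin t ^ 2) (κ * (2 * sin t * cos t)) t := by
      have := (((hasDerivAt_sin t).pow 2).const_mul κ).const_add 1
      exact this.congr_deriv (by simp)
    have h2 : HasDerivAt (weight κ) _ t := (h1.sqrt h.ne').inv (sqrt_pos.2 h).ne'
    have h3 : HasDerivAt (fun t => sin t * cos t) _ t := (hasDerivAt_sin t).mul (hasDerivAt_cos t)
    have h4 : HasDerivAt (fun t => κ * (sin t * cos t * weight κ t)) _ t := (h3.mul h2).const_mul κ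
    refine h4.congr_deriv ?_
    have h5 := sqrt_eq_mul_weight hκ t
    have h6 : (√(1 + κ * sin t ^ 2))⁻¹ = weight κ t := rfl
    have h7 := weight_sq hκ t
    have h8 : cos t ^ 2 = 1 - sin t ^ 2 := cos_sq' t
    have h9 : -(κ * (2 * sin t * cos t) / (2 * √(1 + κ * sin t ^ 2))) / √(1 + κ * sin t ^ 2) ^ 2 =
        -(κ * (sin t * cos t)) * weight κ t ^ 3 := by
      rw [weight]
      have := sqrt_pos.2 h
      field_simp
    rw [h9, h5]
    generalize weight κ t = w at *
    generalize sin t = s at *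
    have e1 : w = w ^ 3 * (1 + κ * s ^ 2) := by linear_combination -w * h7
    have e2 : κ * ((cos t * cos t + s * -s) * w + s * cos t * (-(κ * (s * cos t)) * w ^ 3)) =
        κ * ((cos t ^ 2 - s ^ 2) * w - κ * s ^ 2 * cos t ^ 2 * w ^ 3) := by ring
    rw [e2, h8]
    nth_rewrite 1 [e1]
    nth_rewrite 4 [e1]
    ring
  have hcw := continuous_weight hκ
  have hc1 : Continuous fun t => (1 + κ) * weight κ t ^ 3 := by fun_prop
  have hc2 : Continuous fun t : ℝ => √(1 + κ * sin t ^ 2) := by fun_prop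
  have h := intervalIntegral.integral_eq_sub_of_hasDerivAt hd
    ((hc1.sub hc2).intervalIntegrable _ _)
  rw [intervalIntegral.integral_sub (hc1.intervalIntegrable _ _) (hc2.intervalIntegrable _ _),
    intervalIntegral.integral_const_mul] at h
  simp only [cos_pi_div_two, sin_zero, mul_zero, zero_mul, sub_zero] at h
  rw [rootInt]
  linarith

/-- Differentiation under the integral produces sin² times the cube of the weight w, and κ sin² w³ =
w - w³ reduces it to `integral_weight_cube`. -/
theorem hasDerivAt_complete_kInt (hκ : 0 < κ) : HasDerivAt (fun κ => kInt κ (π / 2))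
    ((rootInt κ / (1 + κ) - kInt κ (π / 2)) / (2 * κ)) κ := by
  have hnn : ∀ y ∈ Ioi (0 : ℝ), (0 : ℝ) ≤ y := fun y hy => le_of_lt hy
  have hb : ∀ y ∈ Ioi (0 : ℝ), ∀ t, ‖-(sin t ^ 2 * weight y t ^ 3) / 2‖ ≤ 1 := by
    intro y hy t
    have h1 := weight_pos (hnn y hy) t
    have h2 := weight_le_one (hnn y hy) t
    have h3 : weight y t ^ 3 ≤ 1 := pow_le_one₀ h1.le h2
    have h4 : 0 < weight y t ^ 3 := by positivity
    have h5 := sin_sq_le_one t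
    rw [norm_eq_abs, abs_le]
    constructor <;> nlinarith [sq_nonneg (sin t)]
  have h := intervalIntegral.hasDerivAt_integral_of_dominated_loc_of_deriv_le
    (μ := MeasureTheory.volume) (a := 0) (b := π / 2) (F := weight)
    (F' := fun κ t => -(sin t ^ 2 * weight κ t ^ 3) / 2) (x₀ := κ) (s := Ioi 0)
    (bound := fun _ => 1) (Ioi_mem_nhds hκ)
    ((eventually_gt_nhds hκ).mono fun y hy => (continuous_weight hy.le).aestronglyMeasurable)
    (intervalIntegrable_weight hκ.le _ _)
    (by
      have := continuous_weight hκ.le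
      exact Continuous.aestronglyMeasurable (by fun_prop))
    (Eventually.of_forall fun t _ y hy => hb y hy t)
    intervalIntegrable_const
    (Eventually.of_forall fun t _ y hy => hasDerivAt_weight (hnn y hy) t)
  refine h.2.congr_deriv ?_
  have h3 := integral_weight_cube hκ.le
  have h4 : ∫ t in (0 : ℝ)..π / 2, -(sin t ^ 2 * weight κ t ^ 3) / 2 =
      ∫ t in (0 : ℝ)..π / 2, (weight κ t ^ 3 - weight κ t) / (2 * κ) := by
    refine intervalIntegral.integral_congr fun t _ => ?_
    have h5 := weight_sq hκ.le t
    field_simp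
    linear_combination -weight κ t * h5
  have hcw := continuous_weight hκ.le
  rw [h4, intervalIntegral.integral_div, intervalIntegral.integral_sub
    ((by fun_prop : Continuous fun t => weight κ t ^ 3).intervalIntegrable _ _)
    (intervalIntegrable_weight hκ.le _ _)]
  congr 2
  rw [eq_div_iff (by positivity), ← h3]
  ring

theorem hasDerivAt_rootInt (hκ : 0 < κ) :
    HasDerivAt rootInt (lInt κ (π / 2) / 2) κ := by
  have hnn : ∀ y ∈ Ioi (0 : ℝ), (0 : ℝ) ≤ y := fun y hy => le_of_lt hy
  have hb : ∀ y ∈ Ioi (0 : ℝ), ∀ t, ‖sin t ^ 2 * weight y t / 2‖ ≤ 1 := by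
    intro y hy t
    have h1 := weight_pos (hnn y hy) t
    have h2 := weight_le_one (hnn y hy) t
    have h5 := sin_sq_le_one t
    rw [norm_eq_abs, abs_le]
    constructor <;> nlinarith [sq_nonneg (sin t)]
  have hcw := continuous_weight hκ.le
  have h := intervalIntegral.hasDerivAt_integral_of_dominated_loc_of_deriv_le
    (μ := MeasureTheory.volume) (a := 0) (b := π / 2) (F := fun κ t => √(1 + κ * sin t ^ 2))
    (F' := fun κ t => sin t ^ 2 * weight κ t / 2) (x₀ := κ) (s := Ioi 0)
    (bound := fun _ => 1) (Ioi_mem_nhds hκ)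
    (Eventually.of_forall fun y => Continuous.aestronglyMeasurable (by fun_prop))
    ((by fun_prop : Continuous fun t : ℝ => √(1 + κ * sin t ^ 2)).intervalIntegrable _ _)
    (Continuous.aestronglyMeasurable (by fun_prop))
    (Eventually.of_forall fun t _ y hy => hb y hy t)
    intervalIntegrable_const
    (Eventually.of_forall fun t _ y hy => hasDerivAt_sqrt_one_add (hnn y hy) t)
  refine h.2.congr_deriv ?_
  rw [intervalIntegral.integral_div]
  rfl

end

/-! ### The relation between flux and period -/

/-- For a wave of half-period `T`, the flux over a period is `(4/T) fluxCoeff κ - 4T`. -/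
noncomputable def fluxCoeff (κ : ℝ) : ℝ :=
  kInt κ (π / 2) * (3 * κ * lInt κ (π / 2) + (1 - κ) * kInt κ (π / 2))

/-- The phase enters the flux only through 3κ sin² x, which equals s - 1 + κ, and sK² is T². So at
fixed half-period the flux is a function of κ alone. -/
theorem halfPeriod_mul_halfFlux {κ x : ℝ} (hs : 0 < scale κ x) :
    halfPeriod κ x * halfFlux κ x = 2 * fluxCoeff κ - 2 * halfPeriod κ x ^ 2 := by
  have h1 := sqrt_pos.2 hs
  have h2 : √(scale κ x) ^ 2 = 1 - κ + 3 * κ * sin x ^ 2 := sq_sqrt hs.le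
  have h3 : halfPeriod κ x * halfFlux κ x =
      6 * κ * kInt κ (π / 2) * (lInt κ (π / 2) - sin x ^ 2 * kInt κ (π / 2)) := by
    rw [halfPeriod, halfFlux, jInt]
    field_simp
  rw [h3, halfPeriod, mul_pow, h2, fluxCoeff]
  ring

theorem continuousOn_fluxCoeff : ContinuousOn fluxCoeff (Ici 0) := by
  have h1 := continuousOn_kInt_left (π / 2)
  have h2 := continuousOn_lInt_left (π / 2)
  unfold fluxCoeff
  fun_prop

/-- With K, l the complete integrals and E = K + κ l, the coefficient is K(3E - (2 + κ)K). Its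
derivative has the numerator 3E² - 2(2 + κ)EK + (1 + κ)K² = -κ(K(K - 2l) + κ l(2K - 3l)), which is
negative because 2l ≤ K. -/
theorem strictAntiOn_fluxCoeff : StrictAntiOn fluxCoeff (Ici 0) := by
  refine strictAntiOn_of_deriv_neg (convex_Ici 0) continuousOn_fluxCoeff fun κ hκ => ?_
  rw [interior_Ici, mem_Ioi] at hκ
  set K := kInt κ (π / 2) with hK
  set L := rootInt κ with hL
  set l := lInt κ (π / 2) with hl
  have hKpos : 0 < K := kInt_pos hκ.le (by positivity)
  have hlpos : 0 < l := lInt_pos hκ.le (by positivity) le_rfl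
  have hl2 : 2 * l ≤ K := two_mul_lInt_le hκ.le
  have hLe : L = K + κ * l := rootInt_eq hκ.le
  have hdK := hasDerivAt_complete_kInt hκ
  have hdL := hasDerivAt_rootInt hκ
  have hd1 : HasDerivAt (fun κ => 3 * rootInt κ - (2 + κ) * kInt κ (π / 2)) _ κ :=
    (hdL.const_mul 3).sub (((hasDerivAt_id κ).const_add 2).mul hdK)
  have hd2 : HasDerivAt (fun κ => kInt κ (π / 2) * (3 * rootInt κ - (2 + κ) * kInt κ (π / 2))) _ κ :=
    hdK.mul hd1
  have hd3 : HasDerivAt fluxCoeff _ κ := hd2.congr_of_eventuallyEq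
    ((eventually_gt_nhds hκ).mono fun y hy => by
      simp only [fluxCoeff, rootInt_eq hy.le]
      ring)
  rw [hd3.deriv]
  simp only [id, ← hK, ← hL, ← hl]
  have e : (L / (1 + κ) - K) / (2 * κ) * (3 * L - (2 + κ) * K) +
      K * (3 * (l / 2) - (1 * K + (2 + κ) * ((L / (1 + κ) - K) / (2 * κ)))) =
      (3 * L ^ 2 - 2 * (2 + κ) * L * K + (1 + κ) * K ^ 2) / (2 * κ * (1 + κ)) := by
    have h1 : 1 + κ ≠ 0 := by positivity
    have h2 : l = (L - K) / κ := by
      rw [hLe]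
      field_simp
      ring
    rw [h2]
    field_simp
    ring
  rw [e]
  refine div_neg_of_neg_of_pos ?_ (by positivity)
  rw [hLe]
  have h1 : 3 * (K + κ * l) ^ 2 - 2 * (2 + κ) * (K + κ * l) * K + (1 + κ) * K ^ 2 =
      -κ * (K * (K - 2 * l) + κ * l * (2 * K - 3 * l)) := by
    ring
  rw [h1, neg_mul, neg_lt_zero]
  have h2 : 0 < κ * l * (2 * K - 3 * l) := mul_pos (mul_pos hκ hlpos) (by linarith)
  have h3 : 0 ≤ K * (K - 2 * l) := mul_nonneg hKpos.le (by linarith)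
  exact mul_pos hκ (by linarith)

/-- In y = √κ K the coefficient is 3y(√κ l) + K² - y², with √κ l ≤ 1 and K ≤ π/2; the term -y²
dominates. -/
theorem fluxCoeff_le {κ : ℝ} (hκ : 0 ≤ κ) : fluxCoeff κ ≤
    3 * (√κ * kInt κ (π / 2)) + (π / 2) ^ 2 - (√κ * kInt κ (π / 2)) ^ 2 := by
  have h1 := lInt_mul_sqrt_le hκ
  have h2 := kInt_le hκ (show 0 ≤ π / 2 by positivity)
  have h3 := (kInt_pos hκ (show 0 < π / 2 by positivity)).le
  have h4 := sqrt_nonneg κ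
  have h5 : κ = √κ ^ 2 := (sq_sqrt hκ).symm
  have h6 : fluxCoeff κ = 3 * (√κ * kInt κ (π / 2)) * (√κ * lInt κ (π / 2)) + kInt κ (π / 2) ^ 2 -
      (√κ * kInt κ (π / 2)) ^ 2 := by
    rw [mul_pow, sq_sqrt hκ, fluxCoeff]
    have : √κ * √κ = κ := mul_self_sqrt hκ
    linear_combination -3 * kInt κ (π / 2) * lInt κ (π / 2) * this
  rw [h6]
  have h7 := mul_nonneg h4 h3
  have h8 : kInt κ (π / 2) ^ 2 ≤ (π / 2) ^ 2 := by gcongr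
  nlinarith

theorem tendsto_fluxCoeff : Tendsto fluxCoeff atTop atBot := by
  have h := tendsto_sqrt_mul_kInt (show 0 < π / 2 by positivity)
  have h2 : Tendsto (fun y : ℝ => (π / 2) ^ 2 - y) atTop atBot :=
    tendsto_atBot_add_const_left _ _ tendsto_neg_atTop_atBot
  refine tendsto_atBot_mono' atTop ?_ (h2.comp h)
  filter_upwards [eventually_ge_atTop 0, h.eventually_ge_atTop 4] with κ h0 h4
  have := fluxCoeff_le h0
  simp only [Function.comp]
  nlinarith

/-! ### Edge arcs, tangent to zero at the walls -/

/-- The half-length of a single arc with extremal value `M` that meets the axis tangentially. -/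
noncomputable def edgeT (M : ℝ) : ℝ := ∫ ψ in (0 : ℝ)..π / 2, √6 / √(6 + M * (1 + cos ψ ^ 2))

/-- Half the flux of a single arc with extremal value `M` that meets the axis tangentially. -/
noncomputable def edgeF (M : ℝ) : ℝ :=
  M * ∫ ψ in (0 : ℝ)..π / 2, cos ψ ^ 2 * (√6 / √(6 + M * (1 + cos ψ ^ 2)))

section

variable {M : ℝ}

theorem edge_pos (hM : -3 < M) (ψ : ℝ) : 0 < 6 + M * (1 + cos ψ ^ 2) := by
  rcases le_or_gt 0 M with h | h
  · positivity
  · nlinarith [cos_sq_le_one ψ]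

theorem continuous_edge (hM : -3 < M) : Continuous fun ψ => √6 / √(6 + M * (1 + cos ψ ^ 2)) :=
  Continuous.div (by fun_prop) (by fun_prop) fun ψ => (sqrt_pos.2 (edge_pos hM ψ)).ne'

theorem edgeT_zero : edgeT 0 = π / 2 := by
  simp [edgeT]

theorem edgeF_zero : edgeF 0 = 0 := by simp [edgeF]

theorem strictAntiOn_edgeT : StrictAntiOn edgeT (Ioi (-3)) := by
  intro M hM N hN hMN
  have hlt : ∀ ψ, √6 / √(6 + N * (1 + cos ψ ^ 2)) < √6 / √(6 + M * (1 + cos ψ ^ 2)) := by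
    intro ψ
    refine div_lt_div_of_pos_left (by positivity) (sqrt_pos.2 (edge_pos hM ψ))
      (sqrt_lt_sqrt (edge_pos hM ψ).le ?_)
    have : 0 < 1 + cos ψ ^ 2 := by positivity
    nlinarith [mul_lt_mul_of_pos_right hMN this]
  exact intervalIntegral.integral_lt_integral_of_continuousOn_of_le_of_exists_lt (by positivity)
    (continuous_edge hN).continuousOn (continuous_edge hM).continuousOn
    (fun ψ _ => (hlt ψ).le) ⟨0, ⟨le_rfl, by positivity⟩, hlt 0⟩

/-- In terms of q = √(6 + M(1 + cos² ψ)) the flux density is proportional to q - 6/q, which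
increases with q and hence with M whatever the sign of M. -/
theorem div_sqrt_edge (hM : -3 < M) (ψ : ℝ) : M * (√6 / √(6 + M * (1 + cos ψ ^ 2))) =
    √6 * (√(6 + M * (1 + cos ψ ^ 2)) - 6 / √(6 + M * (1 + cos ψ ^ 2))) / (1 + cos ψ ^ 2) := by
  have h1 := sqrt_pos.2 (edge_pos hM ψ)
  have h2 := sq_sqrt (edge_pos hM ψ).le
  have h3 : 0 < 1 + cos ψ ^ 2 := by positivity
  field_simp
  linear_combination -h2

theorem edge_flux_lt {N : ℝ} (hM : -3 < M) (hMN : M < N) (ψ : ℝ) :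
    M * (√6 / √(6 + M * (1 + cos ψ ^ 2))) < N * (√6 / √(6 + N * (1 + cos ψ ^ 2))) := by
  have hN : -3 < N := hM.trans hMN
  rw [div_sqrt_edge hM, div_sqrt_edge hN]
  have h3 : 0 < 1 + cos ψ ^ 2 := by positivity
  have h4 : √(6 + M * (1 + cos ψ ^ 2)) < √(6 + N * (1 + cos ψ ^ 2)) :=
    sqrt_lt_sqrt (edge_pos hM ψ).le (by nlinarith [mul_lt_mul_of_pos_right hMN h3])
  have h5 : 6 / √(6 + N * (1 + cos ψ ^ 2)) < 6 / √(6 + M * (1 + cos ψ ^ 2)) :=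
    div_lt_div_of_pos_left (by norm_num) (sqrt_pos.2 (edge_pos hM ψ)) h4
  gcongr

theorem strictMonoOn_edgeF : StrictMonoOn edgeF (Ioi (-3)) := by
  intro M hM N hN hMN
  have hlt := fun ψ => edge_flux_lt hM hMN ψ
  have hcM := continuous_edge hM
  have hcN := continuous_edge hN
  rw [edgeF, edgeF, ← intervalIntegral.integral_const_mul, ← intervalIntegral.integral_const_mul]
  refine intervalIntegral.integral_lt_integral_of_continuousOn_of_le_of_exists_lt (by positivity)
    (Continuous.continuousOn (by fun_prop)) (Continuous.continuousOn (by fun_prop))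
    (fun ψ _ => ?_) ⟨0, ⟨le_rfl, by positivity⟩, ?_⟩
  · nlinarith [mul_le_mul_of_nonneg_left (hlt ψ).le (sq_nonneg (cos ψ))]
  · simpa using hlt 0

theorem arc_integrand_zero (hM : -3 < M) {ψ : ℝ} (hψ : 0 < cos ψ) :
    √6 * cos ψ / √(arcQ M 0 ψ) = √6 / √(6 + M * (1 + cos ψ ^ 2)) := by
  have h1 := sqrt_pos.2 (edge_pos hM ψ)
  rw [arcQ, add_zero, sqrt_mul (sq_nonneg _), sqrt_sq hψ.le]
  field_simp

theorem integral_congr_of_cos_pos {f g : ℝ → ℝ} (h : ∀ ψ, 0 < cos ψ → f ψ = g ψ) :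
    ∫ ψ in (0 : ℝ)..π / 2, f ψ = ∫ ψ in (0 : ℝ)..π / 2, g ψ := by
  refine intervalIntegral.integral_congr_ae ?_
  filter_upwards [MeasureTheory.Measure.ae_ne MeasureTheory.volume (π / 2)] with ψ hψ hm
  rw [uIoc_of_le (by positivity)] at hm
  exact h ψ (cos_pos_of_mem_Ioo ⟨by linarith [hm.1, pi_pos], lt_of_le_of_ne hm.2 hψ⟩)

theorem arcT_zero (hM : -3 < M) : arcT M 0 = edgeT M :=
  integral_congr_of_cos_pos fun _ h => arc_integrand_zero hM h

theorem arcF_zero (hM : -3 < M) : arcF M 0 = edgeF M := by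
  rw [arcF, edgeF]
  congr 1
  exact integral_congr_of_cos_pos fun _ h => by rw [arc_integrand_zero hM h]

theorem integral_comp_cos (h : ℝ → ℝ) :
    ∫ ψ in (0 : ℝ)..π / 2, h (cos ψ) = ∫ ψ in (0 : ℝ)..π / 2, h (sin ψ) := by
  have := intervalIntegral.integral_comp_sub_left (a := 0) (b := π / 2) (fun ψ => h (cos ψ)) (π / 2)
  simp only [cos_pi_div_two_sub, sub_self, sub_zero] at this
  exact this.symm

end

/-! ### Edge arcs as limits of waves -/

section

variable {κ : ℝ}

theorem scale_zero (κ : ℝ) : scale κ 0 = 1 - κ := by simp [scale]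

theorem scale_pi_div_two (κ : ℝ) : scale κ (π / 2) = 1 + 2 * κ := by
  simp [scale]
  ring

theorem neg_three_lt_low (hκ : 0 ≤ κ) (hκ1 : κ < 1) : -3 < 6 * κ / (1 - κ) := by
  have : 0 ≤ 6 * κ / (1 - κ) := div_nonneg (by linarith) (by linarith)
  linarith

theorem neg_three_lt_high (hκ : 0 ≤ κ) : -3 < -6 * κ / (1 + 2 * κ) := by
  rw [lt_div_iff₀ (by positivity)]
  linarith

theorem low_integrand (hκ : 0 ≤ κ) (hκ1 : κ < 1) (c : ℝ) :
    √6 / √(6 + 6 * κ / (1 - κ) * (1 + c ^ 2)) = √(1 - κ) * (√(1 + κ * c ^ 2))⁻¹ := by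
  have h1 : 0 < 1 - κ := by linarith
  have h2 : 0 < 1 + κ * c ^ 2 := by positivity
  have e : 6 + 6 * κ / (1 - κ) * (1 + c ^ 2) = 6 * (1 + κ * c ^ 2) / (1 - κ) := by
    field_simp
    ring
  rw [e, sqrt_div (by positivity), sqrt_mul (by norm_num)]
  have h3 := sqrt_pos.2 h1
  have h4 := sqrt_pos.2 h2
  field_simp

theorem high_integrand (hκ : 0 ≤ κ) (ψ : ℝ) :
    √6 / √(6 + -6 * κ / (1 + 2 * κ) * (1 + cos ψ ^ 2)) = √(1 + 2 * κ) * weight κ ψ := by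
  have h1 : 0 < 1 + 2 * κ := by positivity
  have h2 := one_add_mul_sin_sq_pos hκ ψ
  have e : 6 + -6 * κ / (1 + 2 * κ) * (1 + cos ψ ^ 2) = 6 * (1 + κ * sin ψ ^ 2) / (1 + 2 * κ) := by
    rw [cos_sq']
    field_simp
    ring
  rw [e, sqrt_div (by positivity), sqrt_mul (by norm_num), weight]
  have h3 := sqrt_pos.2 h1
  have h4 := sqrt_pos.2 h2
  field_simp

/-- At x = 0 the negative arcs have shrunk to points, and the positive arc left over touches the
axis at both ends. The bound κ < 1 is the positivity of the scale there. -/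
theorem edgeT_low (hκ : 0 ≤ κ) (hκ1 : κ < 1) : edgeT (6 * κ / (1 - κ)) = halfPeriod κ 0 := by
  rw [edgeT, halfPeriod, scale_zero, kInt, ← intervalIntegral.integral_const_mul]
  simp only [low_integrand hκ hκ1]
  exact integral_comp_cos fun c => √(1 - κ) * (√(1 + κ * c ^ 2))⁻¹

theorem edgeF_low (hκ : 0 ≤ κ) (hκ1 : κ < 1) : edgeF (6 * κ / (1 - κ)) = halfFlux κ 0 := by
  have h1 : 0 < 1 - κ := by linarith
  rw [edgeF, halfFlux, scale_zero, jInt]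
  simp only [low_integrand hκ hκ1]
  rw [integral_comp_cos fun c => c ^ 2 * (√(1 - κ) * (√(1 + κ * c ^ 2))⁻¹)]
  have : ∀ ψ, sin ψ ^ 2 * (√(1 - κ) * (√(1 + κ * sin ψ ^ 2))⁻¹) =
    √(1 - κ) * (sin ψ ^ 2 * weight κ ψ) := fun ψ => by rw [weight]; ring
  simp only [this]
  rw [intervalIntegral.integral_const_mul]
  change _ * (_ * lInt κ (π / 2)) = _
  have h3 := sqrt_pos.2 h1
  have h4 := sq_sqrt h1.le
  simp only [sin_zero]
  field_simp
  rw [h4]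
  field_simp
  ring

/-- At x = π/2 it is the positive arcs that have shrunk to points. -/
theorem edgeT_high (hκ : 0 ≤ κ) : edgeT (-6 * κ / (1 + 2 * κ)) = halfPeriod κ (π / 2) := by
  rw [edgeT, halfPeriod, scale_pi_div_two, kInt, ← intervalIntegral.integral_const_mul]
  simp only [high_integrand hκ]

theorem edgeF_high (hκ : 0 ≤ κ) : edgeF (-6 * κ / (1 + 2 * κ)) = halfFlux κ (π / 2) := by
  have h1 : 0 < 1 + 2 * κ := by positivity
  rw [edgeF, halfFlux, scale_pi_div_two, jInt]
  simp only [high_integrand hκ]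
  have : ∀ ψ, cos ψ ^ 2 * (√(1 + 2 * κ) * weight κ ψ) =
    √(1 + 2 * κ) * (weight κ ψ - sin ψ ^ 2 * weight κ ψ) := fun ψ => by rw [cos_sq']; ring
  simp only [this]
  rw [intervalIntegral.integral_const_mul, intervalIntegral.integral_sub
    (intervalIntegrable_weight hκ _ _) (intervalIntegrable_sin_sq_mul_weight hκ _ _)]
  change _ * (_ * (kInt κ (π / 2) - lInt κ (π / 2))) = _
  have h3 := sqrt_pos.2 h1
  have h4 := sq_sqrt h1.le
  simp only [sin_pi_div_two]
  field_simp
  rw [show 1 + κ * 2 = 1 + 2 * κ by ring, h4]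
  ring

/-- The scale and the elliptic integral need not be differentiated: as an edge arc the extremal
value 6κ/(1 - κ) increases with κ, and `edgeT` decreases. -/
theorem strictAntiOn_halfPeriod_low : StrictAntiOn (fun κ => halfPeriod κ 0) (Ico 0 1) := by
  intro κ hκ μ hμ h
  simp only
  rw [← edgeT_low hκ.1 hκ.2, ← edgeT_low hμ.1 hμ.2]
  refine strictAntiOn_edgeT (neg_three_lt_low hκ.1 hκ.2) (neg_three_lt_low hμ.1 hμ.2) ?_
  rw [div_lt_div_iff₀ (by linarith [hκ.2]) (by linarith [hμ.2])]
  nlinarith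

theorem strictMonoOn_halfPeriod_high :
    StrictMonoOn (fun κ => halfPeriod κ (π / 2)) (Ici 0) := by
  intro κ hκ μ hμ h
  rw [mem_Ici] at hκ hμ
  simp only
  rw [← edgeT_high hκ, ← edgeT_high hμ]
  refine strictAntiOn_edgeT (neg_three_lt_high hμ) (neg_three_lt_high hκ) ?_
  rw [div_lt_div_iff₀ (by positivity) (by positivity)]
  nlinarith

theorem continuousOn_halfPeriod :
    ContinuousOn (fun p : ℝ × ℝ => halfPeriod p.1 p.2) {p | 0 ≤ p.1} := by
  refine ContinuousOn.mul (continuous_sqrt.comp continuous_scale).continuousOn ?_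
  exact continuousOn_kInt.comp (f := fun p : ℝ × ℝ => (p.1, π / 2)) (by fun_prop) fun _ h => h

theorem continuousOn_negHalf :
    ContinuousOn (fun p : ℝ × ℝ => negHalf p.1 p.2) {p | 0 ≤ p.1} :=
  (continuous_sqrt.comp continuous_scale).continuousOn.mul continuousOn_kInt

theorem continuousOn_jInt {β : Type*} [TopologicalSpace β] {f g h : β → ℝ} {s : Set β}
    (hf : ContinuousOn f s) (hg : ContinuousOn g s) (hh : ContinuousOn h s)
    (hpos : ∀ p ∈ s, 0 ≤ f p) : ContinuousOn (fun p => jInt (f p) (g p) (h p)) s := by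
  have h1 := continuousOn_kInt.comp (f := fun p => (f p, h p)) (hf.prodMk hh) fun p hp => hpos p hp
  have h2 := continuousOn_lInt.comp (f := fun p => (f p, h p)) (hf.prodMk hh) fun p hp => hpos p hp
  have h3 : ContinuousOn (fun p => sin (g p) ^ 2) s := (continuous_sin.comp_continuousOn hg).pow 2
  exact h2.sub (h3.mul h1)

theorem continuousOn_halfFlux :
    ContinuousOn (fun p : ℝ × ℝ => halfFlux p.1 p.2) {p | 0 ≤ p.1 ∧ 0 < scale p.1 p.2} := by
  refine ContinuousOn.mul (ContinuousOn.div (by fun_prop)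
    (continuous_sqrt.comp continuous_scale).continuousOn fun p hp => (sqrt_pos.2 hp.2).ne') ?_
  exact continuousOn_jInt (by fun_prop) (by fun_prop) (by fun_prop) fun p hp => hp.1

theorem continuousOn_negFlux :
    ContinuousOn (fun p : ℝ × ℝ => negFlux p.1 p.2) {p | 0 ≤ p.1 ∧ 0 < scale p.1 p.2} := by
  refine ContinuousOn.mul (ContinuousOn.div (by fun_prop)
    (continuous_sqrt.comp continuous_scale).continuousOn fun p hp => (sqrt_pos.2 hp.2).ne') ?_
  exact continuousOn_jInt (by fun_prop) (by fun_prop) (by fun_prop) fun p hp => hp.1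

theorem continuousOn_halfPeriod_left (x : ℝ) :
    ContinuousOn (fun κ => halfPeriod κ x) (Ici 0) :=
  continuousOn_halfPeriod.comp (f := fun κ => (κ, x)) (by fun_prop) fun _ h => h

theorem halfPeriod_zero_left (x : ℝ) : halfPeriod 0 x = π / 2 := by
  simp [halfPeriod, scale, kInt_zero_left]

theorem negHalf_zero_right (κ : ℝ) : negHalf κ 0 = 0 := by
  simp [negHalf, kInt_zero]

/-- The root of a non-positive scale is 0 by convention. This default keeps the half-period
continuous in κ past 1, so intermediate value arguments need no case distinction. -/
theorem halfPeriod_of_one_le (hκ : 1 ≤ κ) : halfPeriod κ 0 = 0 := by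
  rw [halfPeriod, scale_zero, sqrt_eq_zero_of_nonpos (by linarith), zero_mul]

theorem exists_halfPeriod_low {τ : ℝ} (hτ : 0 < τ) (hτ2 : τ ≤ π / 2) :
    ∃ κ ∈ Ico (0 : ℝ) 1, halfPeriod κ 0 = τ := by
  have h := intermediate_value_Icc' (zero_le_one' ℝ)
    ((continuousOn_halfPeriod_left 0).mono fun x (hx : x ∈ Icc (0 : ℝ) 1) => hx.1)
  rw [halfPeriod_zero_left, halfPeriod_of_one_le le_rfl] at h
  obtain ⟨κ, hκ, h1⟩ := h ⟨hτ.le, hτ2⟩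
  refine ⟨κ, ⟨hκ.1, lt_of_le_of_ne hκ.2 ?_⟩, h1⟩
  rintro rfl
  simp only [halfPeriod_of_one_le le_rfl] at h1
  exact hτ.ne h1

theorem exists_halfPeriod_high {τ : ℝ} (hτ : π / 2 ≤ τ) :
    ∃ κ, 0 ≤ κ ∧ halfPeriod κ (π / 2) = τ := by
  obtain ⟨b, hb0, hb⟩ := ((eventually_ge_atTop 0).and
    ((tendsto_sqrt_mul_kInt (show 0 < π / 2 by positivity)).eventually_ge_atTop τ)).exists
  have h := intermediate_value_Icc hb0
    ((continuousOn_halfPeriod_left (π / 2)).mono fun x (hx : x ∈ Icc (0 : ℝ) b) => hx.1)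
  rw [halfPeriod_zero_left] at h
  have hb2 : √b * kInt b (π / 2) ≤ halfPeriod b (π / 2) := by
    rw [halfPeriod, scale_pi_div_two]
    exact mul_le_mul_of_nonneg_right (sqrt_le_sqrt (by linarith)) (kInt_pos hb0 (by positivity)).le
  obtain ⟨κ, hκ, h1⟩ := h ⟨hτ, hb.trans hb2⟩
  exact ⟨κ, hκ.1, h1⟩

/-- The half-length of the symmetric wave profile with `m` positive arcs and `m + 1` negative
arcs. -/
noncomputable def waveHalf (m : ℕ) (κ x : ℝ) : ℝ := m * halfPeriod κ x + negHalf κ x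

theorem sin_sq_lt_sin_sq {x y : ℝ} (hx : 0 ≤ x) (hxy : x < y) (hy : y ≤ π / 2) :
    sin x ^ 2 < sin y ^ 2 := by
  have h1 : 0 ≤ sin x := sin_nonneg_of_nonneg_of_le_pi hx (by linarith [pi_pos])
  have h2 : sin x < sin y := sin_lt_sin_of_lt_of_le_pi_div_two (by linarith [pi_pos]) hy hxy
  gcongr

theorem scale_lt_scale (hκ : 0 < κ) {x y : ℝ} (hx : 0 ≤ x) (hxy : x < y) (hy : y ≤ π / 2) :
    scale κ x < scale κ y := by
  have := sin_sq_lt_sin_sq hx hxy hy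
  unfold scale
  gcongr

theorem halfPeriod_lt (hκ : 0 < κ) {x y : ℝ} (hx : 0 ≤ x) (hxy : x < y) (hy : y ≤ π / 2)
    (hs : 0 < scale κ y) : halfPeriod κ x < halfPeriod κ y :=
  mul_lt_mul_of_pos_right ((sqrt_lt_sqrt_iff_of_pos hs).2 (scale_lt_scale hκ hx hxy hy))
    (kInt_pos hκ.le (by positivity))

theorem negHalf_lt (hκ : 0 ≤ κ) {x y : ℝ} (hx : 0 ≤ x) (hxy : x < y) (hy : y ≤ π / 2)
    (hs : 0 < scale κ y) : negHalf κ x < negHalf κ y := by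
  have h1 : √(scale κ x) ≤ √(scale κ y) := by
    rcases hκ.eq_or_lt with rfl | hκ
    · simp [scale]
    · exact sqrt_le_sqrt (scale_lt_scale hκ hx hxy hy).le
  have h2 := kInt_strictMono hκ hxy
  have h3 : 0 ≤ kInt κ x := by
    have := (kInt_strictMono hκ).monotone hx
    rwa [kInt_zero] at this
  calc √(scale κ x) * kInt κ x ≤ √(scale κ y) * kInt κ x := mul_le_mul_of_nonneg_right h1 h3
    _ < _ := mul_lt_mul_of_pos_left h2 (sqrt_pos.2 hs)

theorem waveHalf_lt (m : ℕ) (hκ : 0 ≤ κ) {x y : ℝ} (hx : 0 ≤ x) (hxy : x < y) (hy : y ≤ π / 2)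
    (hs : 0 < scale κ y) : waveHalf m κ x < waveHalf m κ y := by
  have h1 : halfPeriod κ x ≤ halfPeriod κ y := by
    rcases hκ.eq_or_lt with rfl | hκ
    · simp [halfPeriod_zero_left]
    · exact (halfPeriod_lt hκ hx hxy hy hs).le
  have h2 := negHalf_lt hκ hx hxy hy hs
  unfold waveHalf
  have := mul_le_mul_of_nonneg_left h1 (Nat.cast_nonneg (α := ℝ) m)
  linarith

/-- For fixed κ the half-period grows strictly with the phase, through the scale, and so sweeps the
open interval between its two edge values. -/
theorem exists_waveParam_halfPeriod_iff (hκ : 0 < κ) {τ : ℝ} (hτ : 0 < τ) :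
    (∃ x, WaveParam κ x ∧ halfPeriod κ x = τ) ↔
      halfPeriod κ 0 < τ ∧ τ < halfPeriod κ (π / 2) := by
  have hpi : (0 : ℝ) ≤ π / 2 := by positivity
  constructor
  · rintro ⟨x, hw, rfl⟩
    refine ⟨halfPeriod_lt hκ le_rfl hw.mem.1 hw.mem.2.le hw.scale_pos,
      halfPeriod_lt hκ hw.mem.1.le hw.mem.2 le_rfl ?_⟩
    rw [scale_pi_div_two]
    positivity
  · intro h
    have hc : ContinuousOn (fun x => halfPeriod κ x) (Icc 0 (π / 2)) :=
      continuousOn_halfPeriod.comp (f := fun x => (κ, x)) (by fun_prop) fun _ _ => hκ.le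
    obtain ⟨x, hx, hx2⟩ := intermediate_value_Ioo hpi hc h
    refine ⟨x, ⟨hκ, hx, ?_⟩, hx2⟩
    by_contra! hs
    simp only [halfPeriod, sqrt_eq_zero_of_nonpos hs, zero_mul] at hx2
    exact hτ.ne hx2

/-- Of the two bounds on τ only one is active. For τ ≤ π/2 the upper bound is automatic and the
lower one is solved for κ₀ at x = 0; for τ ≥ π/2 the roles are exchanged and κ₀ belongs to x = π/2.
Either way the admissible κ form a half-line starting at an edge arc. -/
theorem exists_edge {τ : ℝ} (hτ : 0 < τ) : ∃ κ₀ M, 0 ≤ κ₀ ∧ -3 < M ∧ edgeT M = τ ∧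
    τ * edgeF M = 2 * fluxCoeff κ₀ - 2 * τ ^ 2 ∧
    ∀ κ, 0 < κ → ((∃ x, WaveParam κ x ∧ halfPeriod κ x = τ) ↔ κ₀ < κ) := by
  rcases le_total τ (π / 2) with h | h
  · obtain ⟨κ₀, hκ₀, h1⟩ := exists_halfPeriod_low hτ h
    refine ⟨κ₀, 6 * κ₀ / (1 - κ₀), hκ₀.1, neg_three_lt_low hκ₀.1 hκ₀.2, ?_, ?_, fun κ hκ => ?_⟩
    · rw [edgeT_low hκ₀.1 hκ₀.2, h1]
    · rw [edgeF_low hκ₀.1 hκ₀.2, ← h1]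
      exact halfPeriod_mul_halfFlux (by rw [scale_zero]; linarith [hκ₀.2])
    · rw [exists_waveParam_halfPeriod_iff hκ hτ, and_iff_left]
      · rcases lt_or_ge κ 1 with h2 | h2
        · rw [← h1]
          exact strictAntiOn_halfPeriod_low.lt_iff_gt ⟨hκ.le, h2⟩ hκ₀
        · rw [halfPeriod_of_one_le h2]
          exact ⟨fun _ => hκ₀.2.trans_le h2, fun _ => hτ⟩
      · have := strictMonoOn_halfPeriod_high (mem_Ici.2 le_rfl) (mem_Ici.2 hκ.le) hκ
        simp only [halfPeriod_zero_left] at this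
        linarith
  · obtain ⟨κ₀, hκ₀, h1⟩ := exists_halfPeriod_high h
    refine ⟨κ₀, -6 * κ₀ / (1 + 2 * κ₀), hκ₀, neg_three_lt_high hκ₀, ?_, ?_, fun κ hκ => ?_⟩
    · rw [edgeT_high hκ₀, h1]
    · rw [edgeF_high hκ₀, ← h1]
      exact halfPeriod_mul_halfFlux (by rw [scale_pi_div_two]; positivity)
    · rw [exists_waveParam_halfPeriod_iff hκ hτ, and_iff_right]
      · rw [← h1]
        exact strictMonoOn_halfPeriod_high.lt_iff_lt hκ₀ hκ.le
      · rcases lt_or_ge κ 1 with h2 | h2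
        · have := strictAntiOn_halfPeriod_low (by simp) ⟨hκ.le, h2⟩ hκ
          simp only [halfPeriod_zero_left] at this
          linarith
        · rw [halfPeriod_of_one_le h2]
          exact hτ

end

/-! ### Type (m, m): fluxes and uniqueness -/

theorem image_fluxCoeff {κ₀ : ℝ} (h0 : 0 ≤ κ₀) :
    fluxCoeff '' Ioi κ₀ = Iio (fluxCoeff κ₀) := by
  ext y
  constructor
  · rintro ⟨κ, hκ, rfl⟩
    exact strictAntiOn_fluxCoeff h0 (h0.trans (le_of_lt hκ)) hκ
  · intro hy
    obtain ⟨b, hb0, hb⟩ := ((eventually_ge_atTop κ₀).and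
      (tendsto_fluxCoeff.eventually_le_atBot y)).exists
    have hc : ContinuousOn fluxCoeff (Icc κ₀ b) :=
      continuousOn_fluxCoeff.mono fun x hx => h0.trans hx.1
    obtain ⟨κ, hκ, h⟩ := intermediate_value_Icc' hb0 hc ⟨hb, le_of_lt hy⟩
    refine ⟨κ, lt_of_le_of_ne hκ.1 ?_, h⟩
    rintro rfl
    exact (ne_of_lt hy) h.symm

theorem WaveParam.halfPeriod_pos {κ x : ℝ} (hw : WaveParam κ x) : 0 < halfPeriod κ x :=
  mul_pos (sqrt_pos.2 hw.scale_pos) (kInt_pos hw.pos.le (by positivity))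

theorem WaveParam.negHalf_pos {κ x : ℝ} (hw : WaveParam κ x) : 0 < negHalf κ x :=
  mul_pos (sqrt_pos.2 hw.scale_pos) (kInt_pos hw.pos.le hw.mem.1)

theorem WaveParam.negHalf_lt_halfPeriod {κ x : ℝ} (hw : WaveParam κ x) :
    negHalf κ x < halfPeriod κ x :=
  mul_lt_mul_of_pos_left (kInt_strictMono hw.pos.le hw.mem.2) (sqrt_pos.2 hw.scale_pos)

/-- The half-period is forced to be τ, so the flux is a strictly decreasing function of κ > κ₀ that
tends to -∞. The bound is the flux of the edge arc at κ₀, which is excluded, hence an open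
half-line. -/
theorem fluxSet_self_aux {τ : ℝ} (hτ : 0 < τ) {m : ℕ} (hm : 1 ≤ m)
    (hmπ : m * τ < π) : ∃ M, -3 < M ∧ edgeT M = τ ∧
      fluxSet m m (m * τ) = Iio (2 * m * edgeF M) := by
  obtain ⟨κ₀, M, h0, hM, hT, hF, hiff⟩ := exists_edge hτ
  have hm0 : (0 : ℝ) < m := by exact_mod_cast hm
  refine ⟨M, hM, hT, ?_⟩
  ext Φ
  rw [fluxSet_eq (by positivity) hmπ]
  constructor
  · rintro ⟨f, hf, rfl⟩
    obtain ⟨κ, x, hw, hα, -, hflux⟩ := hf.eq_wave_eq hm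
    have hα' : halfPeriod κ x = τ := (mul_left_cancel₀ hm0.ne' hα).symm
    have hκ := (hiff κ hw.pos).1 ⟨x, hw, hα'⟩
    have h1 := strictAntiOn_fluxCoeff h0 hw.pos.le hκ
    have h2 := halfPeriod_mul_halfFlux hw.scale_pos
    rw [hα'] at h2
    have h3 : halfFlux κ x < edgeF M := lt_of_mul_lt_mul_left (by linarith) hτ.le
    rw [hflux, mem_Iio]
    gcongr
  · intro hΦ
    have h1 : (τ * (Φ / (2 * m)) + 2 * τ ^ 2) / 2 ∈ Iio (fluxCoeff κ₀) := by
      have h2 : Φ / (2 * m) < edgeF M := by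
        rw [div_lt_iff₀ (by positivity)]
        linarith [mem_Iio.1 hΦ]
      have := mul_lt_mul_of_pos_left h2 hτ
      rw [mem_Iio]
      linarith
    rw [← image_fluxCoeff h0] at h1
    obtain ⟨κ, hκ, hκ2⟩ := h1
    obtain ⟨x, hw, hx⟩ := (hiff κ (h0.trans_lt hκ)).2 hκ
    have h2 := halfPeriod_mul_halfFlux hw.scale_pos
    have h3 := hw.isJHType_eq m
    rw [hx] at h2 h3
    refine ⟨_, h3.1, ?_⟩
    rw [h3.2]
    have h4 : τ * halfFlux κ x = τ * (Φ / (2 * m)) := by linarith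
    rw [mul_left_cancel₀ hτ.ne' h4]
    field_simp

/-- The fluxes of type `(m, m)` fill a half-line. -/
theorem fluxSet_self {M : ℝ} (hM : -3 < M) {m : ℕ} (hm : 1 ≤ m) (hT : 0 < edgeT M)
    (hα : m * edgeT M < π) : fluxSet m m (m * edgeT M) = Iio (2 * m * edgeF M) := by
  obtain ⟨N, hN, hT', h⟩ := fluxSet_self_aux hT hm hα
  rw [h, strictAntiOn_edgeT.injOn hN hM hT']

theorem edgeT_pos {M : ℝ} (hM : -3 < M) : 0 < edgeT M :=
  intervalIntegral.intervalIntegral_pos_of_pos_on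
    ((continuous_edge hM).intervalIntegrable _ _) (fun ψ _ => by
      have := sqrt_pos.2 (edge_pos hM ψ)
      positivity) (by positivity)

theorem exists_edgeT_eq {τ : ℝ} (hτ : 0 < τ) : ∃ M, -3 < M ∧ edgeT M = τ := by
  obtain ⟨κ₀, M, h0, hM, hT, -⟩ := exists_edge hτ
  exact ⟨M, hM, hT⟩

theorem maxFlux_self {M : ℝ} (hM : -3 < M) {m : ℕ} (hm : 1 ≤ m)
    (hα : m * edgeT M < π) : maxFlux m m (m * edgeT M) = 2 * m * edgeF M := by
  rw [maxFlux, fluxSet_self hM hm (edgeT_pos hM) hα, csSup_Iio]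

theorem exists_edge_div {α : ℝ} (hα : 0 < α) (hαπ : α < π) {m : ℕ} (hm : 1 ≤ m) :
    ∃ M, -3 < M ∧ m * edgeT M = α ∧ fluxSet m m α = Iio (2 * m * edgeF M) ∧
      maxFlux m m α = 2 * m * edgeF M := by
  have hm0 : (0 : ℝ) < m := by exact_mod_cast hm
  obtain ⟨M, hM, hT⟩ := exists_edgeT_eq (div_pos hα hm0)
  have h : m * edgeT M = α := by
    rw [hT]
    field_simp
  refine ⟨M, hM, h, ?_, ?_⟩
  · have := fluxSet_self hM hm (edgeT_pos hM) (by rwa [h])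
    rwa [h] at this
  · have := maxFlux_self hM hm (by rwa [h])
    rwa [h] at this

theorem maxFlux_one_one {M : ℝ} (hM : -3 < M) (hα : edgeT M < π) :
    maxFlux 1 1 (edgeT M) = 2 * edgeF M := by
  have := maxFlux_self hM le_rfl (by simpa using hα)
  simpa using this

theorem maxFlux_self_eq {α : ℝ} (hα : 0 < α) (hαπ : α < π) {m : ℕ} (hm : 1 ≤ m) :
    maxFlux m m α = m * maxFlux 1 1 (α / m) := by
  have hm0 : (1 : ℝ) ≤ m := by exact_mod_cast hm
  obtain ⟨M, hM, rfl, -, h⟩ := exists_edge_div hα hαπ hm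
  have hT := edgeT_pos hM
  rw [h, mul_div_cancel_left₀ _ (by positivity), maxFlux_one_one hM (by nlinarith)]
  ring

theorem strictAntiOn_maxFlux_one_one : StrictAntiOn (maxFlux 1 1) (Ioo 0 π) := by
  intro α hα β hβ h
  obtain ⟨M, hM, rfl⟩ := exists_edgeT_eq hα.1
  obtain ⟨N, hN, rfl⟩ := exists_edgeT_eq hβ.1
  rw [maxFlux_one_one hM hα.2, maxFlux_one_one hN hβ.2]
  have := strictMonoOn_edgeF hN hM ((strictAntiOn_edgeT.lt_iff_gt hM hN).1 h)
  linarith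

theorem halfPeriod_injOn {κ x y : ℝ} (hx : WaveParam κ x) (hy : WaveParam κ y)
    (h : halfPeriod κ x = halfPeriod κ y) : x = y := by
  rcases lt_trichotomy x y with h1 | h1 | h1
  · exact absurd h (halfPeriod_lt hx.pos hx.mem.1.le h1 hy.mem.2.le hy.scale_pos).ne
  · exact h1
  · exact absurd h.symm (halfPeriod_lt hx.pos hy.mem.1.le h1 hx.mem.2.le hx.scale_pos).ne

/-- Half-period and flux determine `fluxCoeff κ`, hence κ; then the half-period determines the
phase. -/
theorem WaveParam.eq_of_flux_eq {κ x κ' x' : ℝ} (h : WaveParam κ x) (h' : WaveParam κ' x')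
    (hT : halfPeriod κ x = halfPeriod κ' x') (hF : halfFlux κ x = halfFlux κ' x') :
    κ = κ' ∧ x = x' := by
  have h1 := halfPeriod_mul_halfFlux h.scale_pos
  have h2 := halfPeriod_mul_halfFlux h'.scale_pos
  rw [hT, hF] at h1
  have h3 : κ = κ' := strictAntiOn_fluxCoeff.injOn h.pos.le h'.pos.le (by linarith)
  subst h3
  exact ⟨rfl, halfPeriod_injOn h h' hT⟩

theorem exists_unique_self {α : ℝ} (hα : 0 < α) (hαπ : α < π) {m : ℕ} (hm : 1 ≤ m) {Φ : ℝ}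
    (hΦ : Φ < maxFlux m m α) : ∃ u, (IsOfType α m m u ∧ flux α u = Φ) ∧
      ∀ v, IsOfType α m m v → flux α v = Φ →
        EqOn v u (sector α) ∨ EqOn v (reflect u) (sector α) := by
  have hm0 : (0 : ℝ) < m := by exact_mod_cast hm
  obtain ⟨M, hM, hT, hset, hmax⟩ := exists_edge_div hα hαπ hm
  have hmem : Φ ∈ fluxSet m m α := by rw [hset]; rwa [hmax] at hΦ
  rw [fluxSet_eq hα hαπ] at hmem
  obtain ⟨f, hf, hfΦ⟩ := hmem
  obtain ⟨κ, x, hw, hακ, -, hflux⟩ := hf.eq_wave_eq hm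
  have hJ := hw.isJHType_eq m
  rw [← hακ] at hJ
  obtain ⟨u, hu, hup, huf⟩ := hJ.1.exists_isOfType hα hαπ
  refine ⟨u, ⟨hu, by rw [huf, hJ.2, ← hflux, hfΦ]⟩, fun v hv hvΦ => ?_⟩
  have hvJ := hv.isJHType hα hαπ
  obtain ⟨κ', x', hw', hακ', hcase, hflux'⟩ := hvJ.eq_wave_eq hm
  have hF : halfFlux κ x = halfFlux κ' x' := by
    have h1 : flux α v = 2 * m * halfFlux κ' x' := hflux'
    rw [hvΦ, ← hfΦ, hflux] at h1
    exact mul_left_cancel₀ (by positivity) h1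
  obtain ⟨rfl, rfl⟩ := hw.eq_of_flux_eq hw' (mul_left_cancel₀ hm0.ne' (hακ.symm.trans hακ')) hF
  rcases hcase with h | h
  · left
    rw [eqOn_sector_iff hα hαπ hv.solution hu.solution]
    intro θ hθ
    rw [h θ (Ioo_subset_Icc_self hθ), hup θ (Ioo_subset_Icc_self hθ)]
  · right
    rw [eqOn_reflect_iff hα hαπ hv.solution hu.solution]
    intro θ hθ
    rw [h θ (Ioo_subset_Icc_self hθ), hup (-θ) ⟨by linarith [hθ.2], by linarith [hθ.1]⟩]
    -- Shifting by -m periods subtracts 2α from the argument, which becomes -(θ + α + `negHalf κ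
    -- x`). Evenness of the wave then matches the profile that starts with a positive arc.
    have h1 := wave_add_period hw.pos.le hw.scale_pos (-θ + (α - negHalf κ x)) (-m)
    rw [← h1, ← wave_neg hw.pos.le]
    congr 1
    rw [show √(scale κ x) * kInt κ (π / 2) = halfPeriod κ x from rfl]
    push_cast
    linarith

theorem isLUB_maxFlux {a b : ℕ} {α : ℝ} (h : (fluxSet a b α).Nonempty)
    (hb : BddAbove (fluxSet a b α)) :
    (fluxSet a b α).Nonempty ∧ IsLUB (fluxSet a b α) (maxFlux a b α) :=
  ⟨h, isLUB_csSup h hb⟩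

theorem isLUB_maxFlux_self {α : ℝ} (hα : 0 < α) (hαπ : α < π) {m : ℕ} (hm : 1 ≤ m) :
    (fluxSet m m α).Nonempty ∧ IsLUB (fluxSet m m α) (maxFlux m m α) := by
  obtain ⟨M, -, -, hset, -⟩ := exists_edge_div hα hαπ hm
  refine isLUB_maxFlux ?_ ?_ <;> rw [hset]
  · exact nonempty_Iio
  · exact bddAbove_Iio

/-- A monotone implicit function is continuous. -/
theorem continuousOn_implicit {β : Type*} [TopologicalSpace β] {T : β → ℝ → ℝ} {I : Set β}
    {D : Set ℝ} (hD : D.OrdConnected) {d : β → ℝ} {c : ℝ} (hd : ∀ p ∈ I, d p ∈ D)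
    (h0 : ∀ p ∈ I, T p (d p) = c) (hlt : ∀ p ∈ I, ∀ y ∈ D, y < d p → T p y < c)
    (hgt : ∀ p ∈ I, ∀ y ∈ D, d p < y → c < T p y)
    (hc : ∀ y ∈ D, ContinuousOn (fun p => T p y) I) : ContinuousOn d I := by
  intro p₀ hp₀
  have hev : ∀ᶠ p in 𝓝[I] p₀, p ∈ I := self_mem_nhdsWithin
  refine tendsto_order.2 ⟨fun y hy => ?_, fun y hy => ?_⟩
  · by_cases hyD : y ∈ D
    · filter_upwards [(hc y hyD p₀ hp₀).eventually_lt_const (hlt p₀ hp₀ y hyD hy), hev] with p h1 hp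
      by_contra! h2
      rcases h2.eq_or_lt with rfl | h2
      · exact h1.ne (h0 p hp)
      · exact (hgt p hp y hyD h2).not_gt h1
    · filter_upwards [hev] with p hp
      by_contra! h2
      exact hyD (hD.out (hd p hp) (hd p₀ hp₀) ⟨h2, hy.le⟩)
  · by_cases hyD : y ∈ D
    · filter_upwards [(hc y hyD p₀ hp₀).eventually_const_lt (hgt p₀ hp₀ y hyD hy), hev] with p h1 hp
      by_contra! h2
      rcases h2.eq_or_lt with rfl | h2
      · exact h1.ne (h0 p hp).symm
      · exact (hlt p hp y hyD h2).not_gt h1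
    · filter_upwards [hev] with p hp
      by_contra! h2
      exact hyD (hD.out (hd p₀ hp₀) (hd p hp) ⟨hy.le, h2⟩)

/-! ### Single arcs and type (1, 0) -/

theorem IsJH.pos_of_isPreconnected {α : ℝ} {f : ℝ → ℝ} (h : IsJH α f) {σ : ℝ}
    (hpos : IsPreconnected {θ | θ ∈ Ioo (-α) α ∧ 0 < σ * f θ})
    (hne : {θ | θ ∈ Ioo (-α) α ∧ 0 < σ * f θ}.Nonempty)
    (hneg : ∀ θ ∈ Ioo (-α) α, 0 ≤ σ * f θ) : ∀ θ ∈ Ioo (-α) α, 0 < σ * f θ := by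
  obtain ⟨p, hp, hfp⟩ := hne
  have hσ : σ ≠ 0 := by
    rintro rfl
    simp at hfp
  obtain ⟨C, f', hode⟩ := h.ode
  by_contra! hc
  obtain ⟨c, hc, hc0⟩ := hc
  have hfc : σ * f c = 0 := le_antisymm hc0 (hneg c hc)
  have hoc := hpos.ordConnected
  have hcp : c ≠ p := by
    rintro rfl
    exact hfp.ne' hfc
  -- Vanishing near a point forces C = 0, and then uniqueness makes f vanish at p as well.
  have hfin : ∀ q, q ∈ Ioo (-α) α → (∀ᶠ θ in 𝓝 q, f θ = 0) → False := by
    intro q hq hz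
    have hz2 := hz.eventually_nhds
    have hI : ∀ᶠ θ in 𝓝 q, θ ∈ Ioo (-α) α := Ioo_mem_nhds hq.1 hq.2
    have hf'0 : ∀ᶠ θ in 𝓝 q, f' θ = 0 := by
      filter_upwards [hz2, hI] with θ hθ hθI
      have h1 : HasDerivAt f 0 θ := (hasDerivAt_const θ (0 : ℝ)).congr_of_eventuallyEq hθ
      exact (hode θ hθI).1.unique h1
    have h2 : HasDerivAt f' 0 q := (hasDerivAt_const q (0 : ℝ)).congr_of_eventuallyEq hf'0
    have h3 := (hode q hq).2.unique h2
    rw [hz.self_of_nhds] at h3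
    have hzero : IsJHOn C (-α) α (fun _ => 0) (fun _ => 0) := by
      intro θ _
      refine ⟨hasDerivAt_const _ _, (hasDerivAt_const θ (0 : ℝ)).congr_deriv ?_⟩
      linarith
    have := hode.eqOn hzero (exists_abs_le_of_continuousOn h.continuousOn) ⟨0, by simp⟩ hq
      hz.self_of_nhds hf'0.self_of_nhds p hp
    rw [this, mul_zero] at hfp
    exact hfp.false
  -- The set where σ f > 0 is an interval around p that misses c, so nothing beyond c, as seen from
  -- p, can belong to it.
  have hzero : ∀ θ ∈ Ioo (-α) α, (c ∈ Icc θ p ∨ c ∈ Icc p θ) → f θ = 0 := by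
    intro θ hθ hcθ
    by_contra hne
    have hθpos : 0 < σ * f θ := lt_of_le_of_ne (hneg θ hθ) (mul_ne_zero hσ hne).symm
    have : c ∈ {θ | θ ∈ Ioo (-α) α ∧ 0 < σ * f θ} := by
      rcases hcθ with h1 | h1
      · exact hoc.out ⟨hθ, hθpos⟩ ⟨hp, hfp⟩ h1
      · exact hoc.out ⟨hp, hfp⟩ ⟨hθ, hθpos⟩ h1
    exact this.2.ne' hfc
  rcases lt_or_gt_of_ne hcp with h1 | h1
  · obtain ⟨q, hq1, hq2⟩ := exists_between hc.1
    refine hfin q ⟨hq1, hq2.trans hc.2⟩ ?_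
    filter_upwards [Ioo_mem_nhds hq1 hq2] with θ hθ
    exact hzero θ ⟨hθ.1, hθ.2.trans hc.2⟩ (Or.inl ⟨hθ.2.le, h1.le⟩)
  · obtain ⟨q, hq1, hq2⟩ := exists_between hc.2
    refine hfin q ⟨hc.1.trans hq1, hq2⟩ ?_
    filter_upwards [Ioo_mem_nhds hq1 hq2] with θ hθ
    exact hzero θ ⟨hc.1.trans hθ.1, hθ.2⟩ (Or.inr ⟨h1.le, hθ.1.le⟩)

theorem IsJHType.exists_isArc_pos {α : ℝ} (hα : 0 < α) {f : ℝ → ℝ} (h : IsJHType α 1 0 f) :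
    ∃ M d, 0 < M ∧ IsArc α f M d := by
  have h1 := isPreconnected_of_numIntervals_eq_one (by simpa using h.pos)
  have h2 := nonempty_of_numIntervals h.pos le_rfl
  have h3 := (numIntervals_eq_zero_iff _).1 (by simpa using h.neg)
  have h4 := h.isJH.pos_of_isPreconnected (σ := 1) (by simpa using h1) (by simpa using h2)
    fun θ hθ => by
      by_contra! hc
      rw [one_mul] at hc
      exact (h3 ▸ (show θ ∈ {θ | θ ∈ Ioo (-α) α ∧ f θ < 0} from ⟨hθ, hc⟩) : θ ∈ (∅ : Set ℝ))
  obtain ⟨M, d, hM, hA⟩ := h.isJH.isArc hα (Or.inl rfl) h4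
  exact ⟨M, d, by simpa using hM, hA⟩

theorem IsJHType.exists_isArc_neg {α : ℝ} (hα : 0 < α) {f : ℝ → ℝ} (h : IsJHType α 0 1 f) :
    ∃ M d, M < 0 ∧ IsArc α f M d := by
  have h1 := isPreconnected_of_numIntervals_eq_one (by simpa using h.neg)
  have h2 := nonempty_of_numIntervals h.neg le_rfl
  have h3 := (numIntervals_eq_zero_iff _).1 (by simpa using h.pos)
  have h4 := h.isJH.pos_of_isPreconnected (σ := -1) (by simpa using h1) (by simpa using h2)
    fun θ hθ => by
      by_contra! hc
      have hc' : 0 < f θ := by linarith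
      exact (h3 ▸ (show θ ∈ {θ | θ ∈ Ioo (-α) α ∧ 0 < f θ} from ⟨hθ, hc'⟩) : θ ∈ (∅ : Set ℝ))
  obtain ⟨M, d, hM, hA⟩ := h.isJH.isArc hα (Or.inr rfl) h4
  exact ⟨M, d, by linarith, hA⟩

section

variable {M d : ℝ}

theorem ArcParam.exists_isJH (h : ArcParam M d) : ∃ f, 0 < arcT M d ∧ IsJH (arcT M d) f ∧
    (∀ θ ∈ Ioo (-arcT M d) (arcT M d), 0 < f θ / M) ∧
    ∫ θ in (-arcT M d)..arcT M d, f θ = 2 * arcF M d := by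
  obtain ⟨f, f', hT, hf, hc, -, -, hl, hr, hs, hF⟩ := exists_arc h
  exact ⟨f, hT, ⟨⟨_, f', hf⟩, hc.continuousOn, hl, hr⟩, hs, hF⟩

theorem numIntervals_Ioo {a b : ℝ} (hab : a < b) : numIntervals (Ioo a b) = 1 :=
  numIntervals_eq_one_of_isPreconnected isPreconnected_Ioo (nonempty_Ioo.2 hab)

theorem ArcParam.exists_isJHType_pos (h : ArcParam M d) (hM : 0 < M) :
    ∃ f, IsJHType (arcT M d) 1 0 f ∧ ∫ θ in (-arcT M d)..arcT M d, f θ = 2 * arcF M d := by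
  obtain ⟨f, hT, hJ, hs, hF⟩ := h.exists_isJH
  have hpos : ∀ θ ∈ Ioo (-arcT M d) (arcT M d), 0 < f θ := fun θ hθ => by
    have := hs θ hθ
    rwa [lt_div_iff₀ hM, zero_mul] at this
  refine ⟨f, ⟨hJ, ?_, ?_⟩, hF⟩
  · rw [show {θ | θ ∈ Ioo (-arcT M d) (arcT M d) ∧ 0 < f θ} = Ioo (-arcT M d) (arcT M d) from
      Subset.antisymm (fun θ h => h.1) fun θ h => ⟨h, hpos θ h⟩, numIntervals_Ioo (by linarith)]
    simp
  · rw [(numIntervals_eq_zero_iff _).2]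
    · simp
    · exact eq_empty_of_forall_notMem fun θ h => (hpos θ h.1).not_gt h.2

theorem intervalIntegrable_arc (hd : 0 ≤ d) (hp : 0 < 6 + 2 * M + d) :
    IntervalIntegrable (fun ψ => √6 * cos ψ / √(arcQ M d ψ)) MeasureTheory.volume 0 (π / 2) := by
  obtain ⟨g, hc, -, -, -, hg⟩ := exists_arc_speed hd hp
  refine (hc.intervalIntegrable 0 (π / 2)).congr_ae ?_
  rw [uIoc_of_le (by positivity)]
  refine (MeasureTheory.ae_restrict_iff' measurableSet_Ioc).2 ?_
  filter_upwards [MeasureTheory.Measure.ae_ne MeasureTheory.volume (π / 2)] with ψ hψ hm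
  have h := cos_pos_of_mem_Ioo ⟨by linarith [hm.1, pi_pos], lt_of_le_of_ne hm.2 hψ⟩
  rw [hg ψ h.ne', abs_of_pos h]

theorem intervalIntegrable_arc_mul (hd : 0 ≤ d) (hp : 0 < 6 + 2 * M + d) :
    IntervalIntegrable (fun ψ => cos ψ ^ 2 * (√6 * cos ψ / √(arcQ M d ψ))) MeasureTheory.volume
      0 (π / 2) :=
  (intervalIntegrable_arc hd hp).continuousOn_mul (by fun_prop)

theorem integral_pos_of_cos_pos {f : ℝ → ℝ}
    (hf : IntervalIntegrable f MeasureTheory.volume 0 (π / 2)) (h : ∀ ψ, 0 < cos ψ → 0 < f ψ) :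
    0 < ∫ ψ in (0 : ℝ)..π / 2, f ψ :=
  intervalIntegral.intervalIntegral_pos_of_pos_on hf (fun ψ hψ =>
    h ψ (cos_pos_of_mem_Ioo ⟨by linarith [hψ.1, pi_pos], hψ.2⟩)) (by positivity)

theorem integral_lt_of_cos_pos {f g : ℝ → ℝ}
    (hf : IntervalIntegrable f MeasureTheory.volume 0 (π / 2))
    (hg : IntervalIntegrable g MeasureTheory.volume 0 (π / 2)) (h : ∀ ψ, 0 < cos ψ → f ψ < g ψ) :
    ∫ ψ in (0 : ℝ)..π / 2, f ψ < ∫ ψ in (0 : ℝ)..π / 2, g ψ := by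
  have := integral_pos_of_cos_pos (hg.sub hf) fun ψ hψ => sub_pos.2 (h ψ hψ)
  rw [intervalIntegral.integral_sub hg hf] at this
  linarith

theorem integral_le_of_cos_pos {f g : ℝ → ℝ}
    (hf : IntervalIntegrable f MeasureTheory.volume 0 (π / 2))
    (hg : IntervalIntegrable g MeasureTheory.volume 0 (π / 2)) (h : ∀ ψ, 0 < cos ψ → f ψ ≤ g ψ) :
    ∫ ψ in (0 : ℝ)..π / 2, f ψ ≤ ∫ ψ in (0 : ℝ)..π / 2, g ψ :=
  intervalIntegral.integral_mono_on_of_le_Ioo (by positivity) hf hg fun ψ hψ =>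
    h ψ (cos_pos_of_mem_Ioo ⟨by linarith [hψ.1, pi_pos], hψ.2⟩)

theorem arc_integrand_lt {e N : ℝ} {ψ : ℝ} (hψ : 0 < cos ψ) (h0 : 0 < arcQ M d ψ)
    (h : arcQ M d ψ < arcQ N e ψ) :
    √6 * cos ψ / √(arcQ N e ψ) < √6 * cos ψ / √(arcQ M d ψ) :=
  div_lt_div_of_pos_left (by positivity) (sqrt_pos.2 h0) (sqrt_lt_sqrt h0.le h)

theorem arcT_lt_of_lt {e : ℝ} (hd : 0 ≤ d) (hp : 0 < 6 + 2 * M + d) (h : d < e) :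
    arcT M e < arcT M d :=
  integral_lt_of_cos_pos (intervalIntegrable_arc (hd.trans h.le) (by linarith))
    (intervalIntegrable_arc hd hp) fun ψ hψ =>
      arc_integrand_lt hψ (arcQ_pos hd hp hψ.ne') (by unfold arcQ; linarith)

theorem arcT_lt_of_lt_left {N : ℝ} (hd : 0 ≤ d) (hp : 0 < 6 + 2 * M + d) (h : M < N) :
    arcT N d < arcT M d :=
  integral_lt_of_cos_pos (intervalIntegrable_arc hd (by linarith))
    (intervalIntegrable_arc hd hp) fun ψ hψ =>
      arc_integrand_lt hψ (arcQ_pos hd hp hψ.ne') (by unfold arcQ; gcongr)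

theorem arcF_lt_of_lt {e : ℝ} (hM : 0 < M) (hd : 0 ≤ d) (h : d < e) : arcF M e < arcF M d := by
  have hp : 0 < 6 + 2 * M + d := by positivity
  refine mul_lt_mul_of_pos_left (integral_lt_of_cos_pos
    (intervalIntegrable_arc_mul (hd.trans h.le) (by linarith))
    (intervalIntegrable_arc_mul hd hp) fun ψ hψ => ?_) hM
  have := arc_integrand_lt hψ (arcQ_pos hd hp hψ.ne') (show arcQ M d ψ < arcQ M e ψ by
    unfold arcQ; linarith)
  gcongr

/-- At fixed d the density is proportional to M/√Q, which increases with M > 0: squared, the claim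
is M² Q_N < N² Q_M, where the positive parts of N² Q_M grow faster. -/
theorem arcF_lt_of_lt_left {N : ℝ} (hM : 0 < M) (hd : 0 ≤ d) (h : M < N) :
    arcF M d < arcF N d := by
  have hN := hM.trans h
  have hp : 0 < 6 + 2 * M + d := by positivity
  have hp' : 0 < 6 + 2 * N + d := by positivity
  rw [arcF, arcF, ← intervalIntegral.integral_const_mul, ← intervalIntegral.integral_const_mul]
  refine integral_lt_of_cos_pos ((intervalIntegrable_arc_mul hd hp).const_mul _)
    ((intervalIntegrable_arc_mul hd hp').const_mul _) fun ψ hψ => ?_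
  have hQ := arcQ_pos hd hp hψ.ne'
  have hQ' := arcQ_pos hd hp' hψ.ne'
  have h1 : M * √(arcQ N d ψ) < N * √(arcQ M d ψ) := by
    refine lt_of_pow_lt_pow_left₀ 2 (by positivity) ?_
    rw [mul_pow, mul_pow, sq_sqrt hQ.le, sq_sqrt hQ'.le, arcQ, arcQ]
    have h2 : 0 < M * N * (N - M) * (cos ψ ^ 2 * (1 + cos ψ ^ 2)) := by
      have : 0 < N - M := by linarith
      positivity
    have h3 : 0 ≤ (N ^ 2 - M ^ 2) * (6 * cos ψ ^ 2 + d) := by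
      have : 0 ≤ N ^ 2 - M ^ 2 := by nlinarith
      positivity
    nlinarith
  have h4 : M / √(arcQ M d ψ) < N / √(arcQ N d ψ) := by
    rw [div_lt_div_iff₀ (sqrt_pos.2 hQ) (sqrt_pos.2 hQ')]
    exact h1
  calc M * (cos ψ ^ 2 * (√6 * cos ψ / √(arcQ M d ψ)))
      = cos ψ ^ 2 * (√6 * cos ψ) * (M / √(arcQ M d ψ)) := by ring
    _ < cos ψ ^ 2 * (√6 * cos ψ) * (N / √(arcQ N d ψ)) :=
        mul_lt_mul_of_pos_left h4 (by positivity)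
    _ = _ := by ring

/-- A single-crossing argument. In y = cos² ψ the difference of the two polynomials is (M - N)(y +
y² - const), which changes sign at most once, at some v. So y - v times the difference of the length
densities is nonnegative; its integral loses the v term because the lengths agree, leaving a
comparison of the second moments. The signs of M and N do the rest. -/
theorem arcF_lt_of_arcT_eq {N e : ℝ} (hd : 0 ≤ d) (hp : 0 < 6 + 2 * M + d) (he : 0 ≤ e)
    (hp' : 0 < 6 + 2 * N + e) (hMN : N < M) (hM : M ≤ 0) (hT : arcT M d = arcT N e) :
    arcF N e < arcF M d := by
  have hi := intervalIntegrable_arc hd hp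
  have hi' := intervalIntegrable_arc he hp'
  have hj := intervalIntegrable_arc_mul hd hp
  have hj' := intervalIntegrable_arc_mul he hp'
  -- The crossing point is the nonnegative root of v + v² = (e - d)/(M - N); when the right side is
  -- negative there is no crossing and v = 0 serves.
  obtain ⟨v, hv0, hv⟩ : ∃ v, 0 ≤ v ∧ ((e - d) / (M - N) = v + v ^ 2 ∨
      (v = 0 ∧ (e - d) / (M - N) ≤ 0)) := by
    rcases le_or_gt 0 ((e - d) / (M - N)) with h | h
    · have h1 : 0 ≤ 1 + 4 * ((e - d) / (M - N)) := by linarith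
      have h2 := sq_sqrt h1
      have h3 : 1 ≤ √(1 + 4 * ((e - d) / (M - N))) := one_le_sqrt.2 (by linarith)
      exact ⟨(√(1 + 4 * ((e - d) / (M - N))) - 1) / 2, by linarith, Or.inl (by linarith)⟩
    · exact ⟨0, le_rfl, Or.inr ⟨rfl, h.le⟩⟩
  have hMN' : 0 < M - N := by linarith
  have hQ : ∀ ψ, arcQ M d ψ - arcQ N e ψ =
      (M - N) * (cos ψ ^ 2 + (cos ψ ^ 2) ^ 2 - (e - d) / (M - N)) := by
    intro ψ
    unfold arcQ
    field_simp
    ring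
  have key : ∀ ψ, 0 < cos ψ → 0 ≤ (cos ψ ^ 2 - v) *
      (√6 * cos ψ / √(arcQ N e ψ) - √6 * cos ψ / √(arcQ M d ψ)) := by
    intro ψ hψ
    have hq := arcQ_pos hd hp hψ.ne'
    have hq' := arcQ_pos he hp' hψ.ne'
    have h6 : 0 ≤ √6 * cos ψ := by positivity
    have hc2 : 0 ≤ cos ψ ^ 2 := sq_nonneg _
    rcases le_total v (cos ψ ^ 2) with h | h
    · refine mul_nonneg (by linarith) (sub_nonneg.2 ?_)
      refine div_le_div_of_nonneg_left h6 (sqrt_pos.2 hq') (sqrt_le_sqrt ?_)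
      rw [← sub_nonneg, hQ]
      refine mul_nonneg hMN'.le ?_
      rcases hv with hv | ⟨rfl, hv⟩
      · rw [hv]
        nlinarith
      · nlinarith
    · rcases hv with hv | ⟨rfl, hv⟩
      · refine mul_nonneg_of_nonpos_of_nonpos (by linarith) (sub_nonpos.2 ?_)
        refine div_le_div_of_nonneg_left h6 (sqrt_pos.2 hq) (sqrt_le_sqrt ?_)
        rw [← sub_nonpos, hQ]
        refine mul_nonpos_of_nonneg_of_nonpos hMN'.le ?_
        rw [hv]
        nlinarith
      · have : cos ψ ^ 2 = 0 := le_antisymm h hc2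
        rw [this]
        simp
  have h1 : 0 ≤ ∫ ψ in (0 : ℝ)..π / 2, ((cos ψ ^ 2 * (√6 * cos ψ / √(arcQ N e ψ)) -
      cos ψ ^ 2 * (√6 * cos ψ / √(arcQ M d ψ))) -
      v * (√6 * cos ψ / √(arcQ N e ψ) - √6 * cos ψ / √(arcQ M d ψ))) := by
    have := integral_le_of_cos_pos (intervalIntegrable_const (c := (0 : ℝ)))
      ((hj'.sub hj).sub ((hi'.sub hi).const_mul v)) fun ψ hψ => by
        have := key ψ hψ
        linarith
    simpa using this
  rw [intervalIntegral.integral_sub (hj'.sub hj) ((hi'.sub hi).const_mul v),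
    intervalIntegral.integral_const_mul, intervalIntegral.integral_sub hj' hj,
    intervalIntegral.integral_sub hi' hi] at h1
  change 0 ≤ _ - v * (arcT N e - arcT M d) at h1
  rw [hT, sub_self, mul_zero, sub_zero, sub_nonneg] at h1
  have h2 : 0 < ∫ ψ in (0 : ℝ)..π / 2, cos ψ ^ 2 * (√6 * cos ψ / √(arcQ M d ψ)) :=
    integral_pos_of_cos_pos hj fun ψ hψ => by
      have := sqrt_pos.2 (arcQ_pos hd hp hψ.ne')
      positivity
  have hN : N < 0 := by linarith
  calc arcF N e ≤ N * ∫ ψ in (0 : ℝ)..π / 2, cos ψ ^ 2 * (√6 * cos ψ / √(arcQ M d ψ)) :=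
        mul_le_mul_of_nonpos_left h1 hN.le
    _ < arcF M d := mul_lt_mul_of_pos_right hMN h2

end

theorem abs_arc_integrand_le {M d : ℝ} (hM : 0 ≤ M) (hd : 0 ≤ d) {ψ : ℝ} (hψ : 0 < cos ψ) :
    |√6 * cos ψ / √(arcQ M d ψ)| ≤ 1 := by
  rw [abs_of_nonneg (by positivity)]
  refine div_le_one_of_le₀ (le_sqrt_of_sq_le ?_) (sqrt_nonneg _)
  rw [mul_pow, sq_sqrt (by norm_num), arcQ]
  have : 0 ≤ M * (1 + cos ψ ^ 2) * cos ψ ^ 2 := by positivity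
  nlinarith

/-- Dominated convergence: for M, d ≥ 0 one has Q ≥ 6 cos² ψ, so the integrand is bounded by 1
uniformly, including the degenerate boundary d = 0. -/
theorem continuousOn_arc_integral {p : ℝ → ℝ} (hp : Continuous p) (hp1 : ∀ ψ, |p ψ| ≤ 1) :
    ContinuousOn (fun q : ℝ × ℝ =>
      ∫ ψ in (0 : ℝ)..π / 2, p ψ * (√6 * cos ψ / √(arcQ q.1 q.2 ψ))) (Ici 0 ×ˢ Ici 0) := by
  intro q hq
  have hcos : ∀ᵐ ψ, ψ ∈ uIoc 0 (π / 2) → 0 < cos ψ := by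
    filter_upwards [MeasureTheory.Measure.ae_ne MeasureTheory.volume (π / 2)] with ψ hψ hm
    rw [uIoc_of_le (by positivity)] at hm
    exact cos_pos_of_mem_Ioo ⟨by linarith [hm.1, pi_pos], lt_of_le_of_ne hm.2 hψ⟩
  refine intervalIntegral.continuousWithinAt_of_dominated_interval (bound := fun _ => 1) ?_ ?_
    intervalIntegrable_const ?_
  · refine Eventually.of_forall fun q => Measurable.aestronglyMeasurable ?_
    have := continuous_arcQ q.1 q.2
    refine hp.measurable.mul (Measurable.div (by fun_prop) ?_)
    exact this.measurable.sqrt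
  · filter_upwards [self_mem_nhdsWithin] with r hr
    filter_upwards [hcos] with ψ hψ hm
    have := abs_arc_integrand_le hr.1 hr.2 (hψ hm)
    rw [norm_mul, norm_eq_abs, norm_eq_abs]
    exact mul_le_one₀ (hp1 ψ) (abs_nonneg _) this
  · filter_upwards [hcos] with ψ hψ hm
    have hne : √(arcQ q.1 q.2 ψ) ≠ 0 := by
      have h1 : 0 ≤ q.1 := hq.1
      have h2 : 0 ≤ q.2 := hq.2
      exact (sqrt_pos.2 (arcQ_pos h2 (by linarith) (hψ hm).ne')).ne'
    refine ContinuousAt.continuousWithinAt ?_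
    unfold arcQ at hne ⊢
    fun_prop (disch := exact hne)

theorem continuousOn_arcT : ContinuousOn (fun q : ℝ × ℝ => arcT q.1 q.2) (Ici 0 ×ˢ Ici 0) := by
  have := continuousOn_arc_integral (p := fun _ => 1) continuous_const (by simp)
  simpa [arcT] using this

theorem continuousOn_arcF : ContinuousOn (fun q : ℝ × ℝ => arcF q.1 q.2) (Ici 0 ×ˢ Ici 0) := by
  refine ContinuousOn.mul (by fun_prop)
    (continuousOn_arc_integral (p := fun ψ => cos ψ ^ 2) (by fun_prop) fun ψ => ?_)
  rw [abs_of_nonneg (sq_nonneg _)]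
  exact cos_sq_le_one ψ

theorem arcT_le {M d : ℝ} (hM : 0 ≤ M) (hd : 0 < d) : arcT M d ≤ √6 / √d * (π / 2) := by
  have hs := sqrt_pos.2 hd
  have h := integral_le_of_cos_pos (intervalIntegrable_arc (M := M) hd.le (by linarith))
    (intervalIntegrable_const (c := √6 / √d)) fun ψ hψ => by
      refine div_le_div₀ (by positivity) ?_ hs (sqrt_le_sqrt ?_)
      · exact mul_le_of_le_one_right (by positivity) (cos_le_one ψ)
      · unfold arcQ
        have : 0 ≤ cos ψ ^ 2 * (6 + M * (1 + cos ψ ^ 2)) := by positivity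
        linarith
  rw [intervalIntegral.integral_const] at h
  simp only [sub_zero, smul_eq_mul] at h
  rw [mul_comm]
  exact h

theorem arcF_pos {M d : ℝ} (hM : 0 < M) (hd : 0 ≤ d) : 0 < arcF M d :=
  mul_pos hM (integral_pos_of_cos_pos (intervalIntegrable_arc_mul hd (by linarith)) fun ψ hψ => by
    have := sqrt_pos.2 (arcQ_pos (M := M) hd (by linarith) hψ.ne')
    positivity)

theorem arcF_neg {M d : ℝ} (hM : M < 0) (hd : 0 ≤ d) (hp : 0 < 6 + 2 * M + d) : arcF M d < 0 :=
  mul_neg_of_neg_of_pos hM (integral_pos_of_cos_pos (intervalIntegrable_arc_mul hd hp)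
    fun ψ hψ => by
      have := sqrt_pos.2 (arcQ_pos hd hp hψ.ne')
      positivity)

theorem arcF_le {M d : ℝ} (hM : 0 ≤ M) (hd : 0 ≤ d) : arcF M d ≤ M * arcT M d := by
  have hp : 0 < 6 + 2 * M + d := by positivity
  refine mul_le_mul_of_nonneg_left ?_ hM
  refine integral_le_of_cos_pos (intervalIntegrable_arc_mul hd hp) (intervalIntegrable_arc hd hp)
    fun ψ hψ => mul_le_of_le_one_left (by positivity) (cos_sq_le_one ψ)

theorem exists_arcT_eq {M α : ℝ} (hM : 0 < M) (hα : 0 < α) (h : α ≤ edgeT M) :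
    ∃ d, 0 ≤ d ∧ arcT M d = α := by
  obtain ⟨b, hb0, hb⟩ : ∃ b, 0 < b ∧ √6 / √b * (π / 2) ≤ α := by
    -- The value of d at which the bound of `arcT_le` equals α.
    refine ⟨6 * (π / 2 / α) ^ 2, by positivity, ?_⟩
    rw [sqrt_mul (by norm_num), sqrt_sq (by positivity)]
    field_simp
    rfl
  have hc : ContinuousOn (fun d => arcT M d) (Icc 0 b) :=
    continuousOn_arcT.comp (f := fun d => (M, d)) (by fun_prop) fun d hd => ⟨hM.le, hd.1⟩
  have hT0 := arcT_zero (M := M) (by linarith)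
  obtain ⟨d, hd, h2⟩ := intermediate_value_Icc' hb0.le hc
    ⟨(arcT_le hM.le hb0).trans hb, by simpa only [hT0] using h⟩
  exact ⟨d, hd.1, h2⟩

theorem edge_extremum_pos {M : ℝ} (hM : -3 < M) (h : edgeT M < π / 2) : 0 < M := by
  rw [← edgeT_zero] at h
  exact (strictAntiOn_edgeT.lt_iff_gt hM (by norm_num)).1 h

/-- Raising the extremal value shortens an arc, and so does raising d. An arc as long as the edge
arc therefore cannot have a larger extremal value. -/
theorem arc_param_le {M d N : ℝ} (hM : -3 < M) (hd : 0 ≤ d) (hp : 0 < 6 + 2 * N + d)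
    (hT : arcT N d = edgeT M) : N ≤ M := by
  by_contra! h
  have hN : -3 < N := hM.trans h
  have h1 := strictAntiOn_edgeT hM hN h
  rw [← hT, ← arcT_zero hN] at h1
  rcases hd.eq_or_lt with rfl | hd
  · exact h1.false
  · exact (arcT_lt_of_lt le_rfl (by linarith) hd).not_gt h1

/-- At fixed length d is a continuous function of the extremal value N in (0, M], and the flux runs
continuously from 0 to the edge value at N = M, where d = 0. The edge arc itself is an admissible
solution of this type, so here the maximum is attained. -/
theorem fluxSet_one_zero {M : ℝ} (hM : -3 < M) (hT : edgeT M < π / 2) :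
    fluxSet 1 0 (edgeT M) = Ioc 0 (2 * edgeF M) := by
  have hM0 := edge_extremum_pos hM hT
  have hα := edgeT_pos hM
  ext Φ
  rw [fluxSet_eq hα (by linarith [pi_pos])]
  constructor
  · rintro ⟨f, hf, rfl⟩
    obtain ⟨N, d, hN, hA⟩ := hf.exists_isArc_pos hα
    have hd := hA.param.nonneg
    have hNM := arc_param_le hM hd hA.param.pos hA.length
    rw [hA.flux]
    refine ⟨by linarith [arcF_pos hN hd], ?_⟩
    have h1 : arcF N d ≤ arcF N 0 := by
      rcases hd.eq_or_lt with rfl | hd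
      · rfl
      · exact (arcF_lt_of_lt hN le_rfl hd).le
    rw [arcF_zero (by linarith)] at h1
    have h2 := strictMonoOn_edgeF.monotoneOn (show -3 < N by linarith) hM hNM
    linarith
  · rintro ⟨h0, hle⟩
    have hex : ∀ N ∈ Ioc 0 M, ∃ d, 0 ≤ d ∧ arcT N d = edgeT M := fun N hN =>
      exists_arcT_eq hN.1 hα (strictAntiOn_edgeT.antitoneOn
        (show -3 < N by linarith [hN.1]) hM hN.2)
    choose! d hd hdT using hex
    have hdc : ContinuousOn d (Ioc 0 M) := by
      refine continuousOn_implicit (T := fun N y => -arcT N y) (D := Ici 0) (c := -edgeT M)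
        ordConnected_Ici hd (fun N hN => by rw [hdT N hN]) (fun N hN y hy hyd => ?_)
        (fun N hN y hy hyd => ?_) fun y hy => ?_
      · rw [neg_lt_neg_iff, ← hdT N hN]
        exact arcT_lt_of_lt hy (by linarith [hN.1, mem_Ici.1 hy]) hyd
      · rw [neg_lt_neg_iff, ← hdT N hN]
        exact arcT_lt_of_lt (hd N hN) (by linarith [hN.1, hd N hN]) hyd
      · exact (continuousOn_arcT.comp (f := fun N => (N, y)) (by fun_prop)
          fun N hN => ⟨hN.1.le, hy⟩).neg
    have hFc : ContinuousOn (fun N => arcF N (d N)) (Ioc 0 M) :=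
      continuousOn_arcF.comp (f := fun N => (N, d N)) (continuousOn_id.prodMk hdc)
        fun N hN => ⟨hN.1.le, hd N hN⟩
    have hdM : d M = 0 := by
      have hMm : M ∈ Ioc 0 M := ⟨hM0, le_rfl⟩
      by_contra hne
      have h1 := arcT_lt_of_lt (M := M) le_rfl (by linarith) ((hd M hMm).lt_of_ne (Ne.symm hne))
      rw [hdT M hMm, arcT_zero hM] at h1
      exact h1.false
    -- Half the flux is at most the extremal value times the half-length, so this ε makes it at most
    -- Φ/2.
    set ε := min M (Φ / 2 / edgeT M) with hε
    have hε0 : 0 < ε := lt_min hM0 (by positivity)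
    have hεM : ε ≤ M := min_le_left _ _
    have hlow : arcF ε (d ε) ≤ Φ / 2 := by
      have h1 := arcF_le hε0.le (hd ε ⟨hε0, hεM⟩)
      rw [hdT ε ⟨hε0, hεM⟩] at h1
      refine h1.trans ?_
      calc ε * edgeT M ≤ Φ / 2 / edgeT M * edgeT M :=
            mul_le_mul_of_nonneg_right (min_le_right _ _) hα.le
        _ = Φ / 2 := by field_simp
    obtain ⟨N, hN, hNF⟩ := intermediate_value_Icc hεM
      (hFc.mono fun x hx => ⟨hε0.trans_le hx.1, hx.2⟩)
      (show Φ / 2 ∈ Icc _ _ from ⟨hlow, by simp only [hdM]; rw [arcF_zero hM]; linarith⟩)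
    have hNm : N ∈ Ioc 0 M := ⟨hε0.trans_le hN.1, hN.2⟩
    have hP : ArcParam N (d N) := ⟨hNm.1.ne', hd N hNm, by linarith [hNm.1, hd N hNm]⟩
    obtain ⟨f, hf, hfF⟩ := hP.exists_isJHType_pos hNm.1
    rw [hdT N hNm] at hf hfF
    refine ⟨f, hf, ?_⟩
    rw [hfF]
    simp only at hNF
    rw [hNF]
    ring

theorem maxFlux_one_zero {M : ℝ} (hM : -3 < M) (hT : edgeT M < π / 2) :
    maxFlux 1 0 (edgeT M) = 2 * edgeF M := by
  rw [maxFlux, fluxSet_one_zero hM hT, csSup_Ioc]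
  have h := edge_extremum_pos hM hT
  have := strictMonoOn_edgeF (show -3 < (0 : ℝ) by norm_num) hM h
  rw [edgeF_zero] at this
  linarith

theorem isLUB_maxFlux_one_zero {α : ℝ} (hα : 0 < α) (hα2 : α < π / 2) :
    (fluxSet 1 0 α).Nonempty ∧ IsLUB (fluxSet 1 0 α) (maxFlux 1 0 α) := by
  obtain ⟨M, hM, rfl⟩ := exists_edgeT_eq hα
  have h := edge_extremum_pos hM hα2
  have := strictMonoOn_edgeF (show -3 < (0 : ℝ) by norm_num) hM h
  rw [edgeF_zero] at this
  refine isLUB_maxFlux ?_ ?_ <;> rw [fluxSet_one_zero hM hα2]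
  · exact nonempty_Ioc.2 (by linarith)
  · exact bddAbove_Ioc

theorem maxFlux_one_one_eq_one_zero {α : ℝ} (hα : 0 < α) (hα2 : α < π / 2) :
    maxFlux 1 1 α = maxFlux 1 0 α := by
  obtain ⟨M, hM, rfl⟩ := exists_edgeT_eq hα
  rw [maxFlux_one_one hM (by linarith), maxFlux_one_zero hM hα2]

theorem unique_of_isArc {α : ℝ} (hα : 0 < α) (hαπ : α < π) {u v : Plane → Plane}
    (hu : IsSelfSimilarSolution α u) (hv : IsSelfSimilarSolution α v) {M d : ℝ}
    (h1 : IsArc α (profile u) M d) (h2 : IsArc α (profile v) M d) : EqOn v u (sector α) := by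
  rw [eqOn_sector_iff hα hαπ hv hu]
  exact h2.eqOn hα h1 (hv.isJH hα hαπ).1.continuousOn (hu.isJH hα hαπ).1.continuousOn

theorem arc_param_eq_of_arcT_eq {M d e : ℝ} (hd : 0 ≤ d) (hp : 0 < 6 + 2 * M + d) (he : 0 ≤ e)
    (hp' : 0 < 6 + 2 * M + e) (h : arcT M d = arcT M e) : d = e := by
  rcases lt_trichotomy d e with h1 | h1 | h1
  · exact absurd h (arcT_lt_of_lt hd hp h1).ne'
  · exact h1
  · exact absurd h (arcT_lt_of_lt he hp' h1).ne

theorem exists_unique_one_zero {α : ℝ} (hα : 0 < α) (hα2 : α < π / 2) {Φ : ℝ} (h0 : 0 < Φ)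
    (hΦ : Φ < maxFlux 1 0 α) : ∃ u, (IsOfType α 1 0 u ∧ flux α u = Φ) ∧
      ∀ v, IsOfType α 1 0 v → flux α v = Φ → EqOn v u (sector α) := by
  have hαπ : α < π := by linarith [pi_pos]
  have hmem : Φ ∈ fluxSet 1 0 α := by
    obtain ⟨M, hM, rfl⟩ := exists_edgeT_eq hα
    rw [fluxSet_one_zero hM hα2]
    rw [maxFlux_one_zero hM hα2] at hΦ
    exact ⟨h0, hΦ.le⟩
  obtain ⟨u, hu, huΦ⟩ := hmem
  refine ⟨u, ⟨hu, huΦ⟩, fun v hv hvΦ => ?_⟩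
  obtain ⟨M, d, hM, hA⟩ := (hu.isJHType hα hαπ).exists_isArc_pos hα
  obtain ⟨N, e, hN, hB⟩ := (hv.isJHType hα hαπ).exists_isArc_pos hα
  have hF : arcF M d = arcF N e := by
    have h1 : flux α u = 2 * arcF M d := hA.flux
    have h2 : flux α v = 2 * arcF N e := hB.flux
    linarith
  -- At equal length a larger extremal value comes with a smaller d, and for positive arcs both
  -- changes raise the flux.
  have hlt : ∀ M d N e : ℝ, 0 < M → ArcParam M d → ArcParam N e → arcT M d = arcT N e → M < N →
      arcF M d < arcF N e := by
    intro M d N e hM hd he hT hMN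
    have h1 : e < d := by
      by_contra! h
      have h2 := arcT_lt_of_lt_left hd.nonneg hd.pos hMN
      rcases h.eq_or_lt with rfl | h
      · exact h2.ne' hT
      · exact (h2.trans' (arcT_lt_of_lt hd.nonneg (by linarith [hd.pos]) h)).ne' hT
    exact (arcF_lt_of_lt hM he.nonneg h1).trans (arcF_lt_of_lt_left hM he.nonneg hMN)
  have hT : arcT M d = arcT N e := by rw [hA.length, hB.length]
  have hMN : M = N := by
    rcases lt_trichotomy M N with h | h | h
    · exact absurd hF (hlt M d N e hM hA.param hB.param hT h).ne
    · exact h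
    · exact absurd hF (hlt N e M d hN hB.param hA.param hT.symm h).ne'
  subst hMN
  have := arc_param_eq_of_arcT_eq hA.param.nonneg hA.param.pos hB.param.nonneg hB.param.pos hT
  subst this
  exact unique_of_isArc hα hαπ hu.solution hv.solution hA hB

/-! ### Type (0, 1): uniqueness and upper bounds -/

theorem unique_zero_one {α : ℝ} (hα : 0 < α) (hαπ : α < π) {u v : Plane → Plane}
    (hu : IsOfType α 0 1 u) (hv : IsOfType α 0 1 v) (h : flux α v = flux α u) :
    EqOn v u (sector α) := by
  obtain ⟨M, d, hM, hA⟩ := (hu.isJHType hα hαπ).exists_isArc_neg hα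
  obtain ⟨N, e, hN, hB⟩ := (hv.isJHType hα hαπ).exists_isArc_neg hα
  have hF : arcF M d = arcF N e := by
    have h1 : flux α u = 2 * arcF M d := hA.flux
    have h2 : flux α v = 2 * arcF N e := hB.flux
    linarith
  have hT : arcT M d = arcT N e := by rw [hA.length, hB.length]
  have hMN : M = N := by
    rcases lt_trichotomy M N with h | h | h
    · exact absurd hF (arcF_lt_of_arcT_eq hB.param.nonneg hB.param.pos hA.param.nonneg
        hA.param.pos h hN.le hT.symm).ne
    · exact h
    · exact absurd hF (arcF_lt_of_arcT_eq hA.param.nonneg hA.param.pos hB.param.nonneg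
        hB.param.pos h hM.le hT).ne'
  subst hMN
  have := arc_param_eq_of_arcT_eq hA.param.nonneg hA.param.pos hB.param.nonneg hB.param.pos hT
  subst this
  exact unique_of_isArc hα hαπ hu.solution hv.solution hA hB

theorem fluxSet_zero_one_neg {α : ℝ} (hα : 0 < α) (hαπ : α < π) :
    ∀ Φ ∈ fluxSet 0 1 α, Φ < 0 := by
  rintro Φ ⟨u, hu, rfl⟩
  obtain ⟨M, d, hM, hA⟩ := (hu.isJHType hα hαπ).exists_isArc_neg hα
  have h1 : flux α u = 2 * arcF M d := hA.flux
  linarith [arcF_neg hM hA.param.nonneg hA.param.pos]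

/-- The edge arc of the same length has the largest extremal value, and by the comparison of arcs of
equal length it has the largest flux. -/
theorem fluxSet_zero_one_le {M : ℝ} (hM : -3 < M) (hM0 : M ≤ 0) (hαπ : edgeT M < π) :
    ∀ Φ ∈ fluxSet 0 1 (edgeT M), Φ ≤ 2 * edgeF M := by
  rintro Φ ⟨u, hu, rfl⟩
  obtain ⟨N, d, hN, hA⟩ := (hu.isJHType (edgeT_pos hM) hαπ).exists_isArc_neg (edgeT_pos hM)
  have h1 : flux (edgeT M) u = 2 * arcF N d := hA.flux
  rw [h1, ← arcF_zero hM]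
  have hNM := arc_param_le hM hA.param.nonneg hA.param.pos hA.length
  have hT : arcT M 0 = arcT N d := by rw [arcT_zero hM, hA.length]
  rcases hNM.eq_or_lt with rfl | hlt
  · rw [arc_param_eq_of_arcT_eq le_rfl (by linarith) hA.param.nonneg hA.param.pos hT]
  · have := arcF_lt_of_arcT_eq le_rfl (by linarith) hA.param.nonneg hA.param.pos hlt hM0 hT
    linarith

/-! ### The family of symmetric waves of fixed length -/

/-- Half the flux of the symmetric wave profile with `m` positive arcs and `m + 1` negative
arcs. -/
noncomputable def waveFlux (m : ℕ) (κ x : ℝ) : ℝ := m * halfFlux κ x + negFlux κ x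

section

variable {κ x : ℝ} {m : ℕ}

theorem lInt_sub_le (hκ : 0 ≤ κ) {φ : ℝ} (h0 : 0 ≤ φ) (hφ : φ ≤ x) (hx : x ≤ π / 2) :
    lInt κ x - lInt κ φ ≤ sin x ^ 2 * (kInt κ x - kInt κ φ) := by
  rw [lInt, lInt, intervalIntegral.integral_interval_sub_left
    (intervalIntegrable_sin_sq_mul_weight hκ _ _) (intervalIntegrable_sin_sq_mul_weight hκ _ _),
    kInt, kInt, intervalIntegral.integral_interval_sub_left
    (intervalIntegrable_weight hκ _ _) (intervalIntegrable_weight hκ _ _),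
    ← intervalIntegral.integral_const_mul]
  refine intervalIntegral.integral_mono_on hφ (intervalIntegrable_sin_sq_mul_weight hκ _ _)
    ((intervalIntegrable_weight hκ _ _).const_mul _) fun t ht => ?_
  have hw := (weight_pos hκ t).le
  refine mul_le_mul_of_nonneg_right ?_ hw
  have h1 : 0 ≤ t := h0.trans ht.1
  have h2 : 0 ≤ sin t := sin_nonneg_of_nonneg_of_le_pi h1 (by linarith [ht.2, pi_pos])
  have h3 : sin t ≤ sin x := sin_le_sin_of_le_of_le_pi_div_two (by linarith [pi_pos]) hx ht.2
  gcongr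

/-- The integrand sin² - sin² x is nonpositive on [0, x]; discard [φ, x], and on [0, φ] replace sin²
by its largest value. -/
theorem jInt_self_le (hκ : 0 ≤ κ) {φ : ℝ} (h0 : 0 ≤ φ) (hφ : φ ≤ x) (hx : x ≤ π / 2) :
    jInt κ x x ≤ (sin φ ^ 2 - sin x ^ 2) * kInt κ φ := by
  have h1 := lInt_sub_le hκ h0 hφ hx
  have h2 := lInt_sub_le hκ le_rfl h0 (hφ.trans hx)
  rw [lInt_zero, kInt_zero, sub_zero, sub_zero] at h2
  rw [jInt]
  linarith

theorem WaveParam.negFlux_neg (hw : WaveParam κ x) : negFlux κ x < 0 := by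
  have hx := hw.mem
  have h1 := jInt_self_le hw.pos.le (show 0 ≤ x / 2 by linarith [hx.1])
    (show x / 2 ≤ x by linarith [hx.1]) hx.2.le
  have h2 := sin_sq_lt_sin_sq (show 0 ≤ x / 2 by linarith [hx.1])
    (show x / 2 < x by linarith [hx.1]) hx.2.le
  have h3 := kInt_pos hw.pos.le (show 0 < x / 2 by linarith [hx.1])
  have hκ := hw.pos
  have hs := sqrt_pos.2 hw.scale_pos
  exact mul_neg_of_pos_of_neg (by positivity) (by nlinarith)

/-- For κ ≥ 2 a positive scale forces sin² x > 1/6, hence x ≥ 1/4. Then `jInt_self_le` at φ = 1/4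
gives the factor 1/16 - 1/6 = -5/48, and √s ≤ 2√κ supplies 3√κ. The bound is uniform in the phase.
-/
theorem WaveParam.negFlux_le (hw : WaveParam κ x) (h2 : 2 ≤ κ) :
    negFlux κ x ≤ -(5 / 16) * (√κ * kInt κ (1 / 4)) := by
  have hκ := hw.pos
  have hs := hw.scale_pos
  have hpi := pi_gt_three
  have hx6 : 1 / 6 < sin x ^ 2 := by
    unfold scale at hs
    nlinarith
  have h4 : sin (1 / 4) ^ 2 ≤ 1 / 16 := by
    have h5 : sin (1 / 4) ≤ 1 / 4 := sin_le (by norm_num)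
    have h6 : 0 ≤ sin (1 / 4) := sin_nonneg_of_nonneg_of_le_pi (by norm_num) (by linarith)
    nlinarith
  have hx4 : 1 / 4 ≤ x := by
    by_contra! h
    have := sin_sq_lt_sin_sq hw.mem.1.le h (by linarith)
    linarith
  have hj := jInt_self_le hκ.le (by norm_num) hx4 hw.mem.2.le
  have hk := kInt_pos hκ.le (show (0 : ℝ) < 1 / 4 by norm_num)
  have hj2 : jInt κ x x ≤ -(5 / 48) * kInt κ (1 / 4) := hj.trans (by nlinarith)
  have hr : √(scale κ x) ≤ 2 * √κ := by
    rw [sqrt_le_left (by positivity), mul_pow, sq_sqrt hκ.le, scale]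
    nlinarith [sin_sq_le_one x]
  have hr0 := sqrt_pos.2 hs
  have hq : 3 * √κ ≤ 6 * κ / √(scale κ x) := by
    rw [le_div_iff₀ hr0]
    have h7 : √κ * √κ = κ := mul_self_sqrt hκ.le
    nlinarith [mul_le_mul_of_nonneg_left hr (sqrt_nonneg κ)]
  calc negFlux κ x ≤ 6 * κ / √(scale κ x) * (-(5 / 48) * kInt κ (1 / 4)) :=
        mul_le_mul_of_nonneg_left hj2 (by positivity)
    _ ≤ 3 * √κ * (-(5 / 48) * kInt κ (1 / 4)) :=
        mul_le_mul_of_nonpos_right hq (by linarith)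
    _ = _ := by ring

/-- For large κ the flux over a period is nonpositive because `fluxCoeff` is, and the extra negative
arc alone drives the total to -∞, uniformly in x. -/
theorem exists_waveFlux_le (m : ℕ) (R : ℝ) :
    ∃ b, ∀ κ, b ≤ κ → ∀ x, WaveParam κ x → waveFlux m κ x ≤ R := by
  have h1 := (tendsto_sqrt_mul_kInt (show (0 : ℝ) < 1 / 4 by norm_num)).const_mul_atTop_of_neg
    (show (-(5 / 16) : ℝ) < 0 by norm_num)
  obtain ⟨b, hb⟩ := eventually_atTop.1 ((eventually_ge_atTop 2).and
    ((tendsto_fluxCoeff.eventually_le_atBot 0).and (h1.eventually_le_atBot R)))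
  refine ⟨b, fun κ hκ x hw => ?_⟩
  obtain ⟨h2, h3, h4⟩ := hb κ hκ
  have h5 := halfPeriod_mul_halfFlux hw.scale_pos
  have h6 := hw.halfPeriod_pos
  have h7 : halfFlux κ x ≤ 0 := by
    by_contra! h
    have := mul_pos h6 h
    nlinarith [sq_nonneg (halfPeriod κ x)]
  have h8 : (m : ℝ) * halfFlux κ x ≤ 0 := mul_nonpos_of_nonneg_of_nonpos (Nat.cast_nonneg m) h7
  have h9 := hw.negFlux_le h2
  unfold waveFlux
  linarith

theorem waveHalf_zero_right (m : ℕ) (κ : ℝ) : waveHalf m κ 0 = m * halfPeriod κ 0 := by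
  simp [waveHalf, negHalf_zero_right]

theorem waveHalf_pi_div_two (m : ℕ) (κ : ℝ) :
    waveHalf m κ (π / 2) = (m + 1) * halfPeriod κ (π / 2) := by
  rw [waveHalf, show negHalf κ (π / 2) = halfPeriod κ (π / 2) from rfl]
  ring

/-- The root of a non-positive scale is 0 by convention, so a positive length certifies that the
scale is positive. -/
theorem scale_pos_of_waveHalf_pos (h : 0 < waveHalf m κ x) : 0 < scale κ x := by
  by_contra! hs
  simp [waveHalf, halfPeriod, negHalf, sqrt_eq_zero_of_nonpos hs] at h

theorem continuousOn_waveHalf (m : ℕ) :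
    ContinuousOn (fun p : ℝ × ℝ => waveHalf m p.1 p.2) {p | 0 ≤ p.1} :=
  (continuousOn_halfPeriod.const_smul (m : ℝ)).add continuousOn_negHalf

theorem continuousOn_waveFlux (m : ℕ) :
    ContinuousOn (fun p : ℝ × ℝ => waveFlux m p.1 p.2) {p | 0 ≤ p.1 ∧ 0 < scale p.1 p.2} :=
  (continuousOn_halfFlux.const_smul (m : ℝ)).add continuousOn_negFlux

end

/-- A continuous choice of the phase `X κ` for which the wave has half-length `α`. -/
structure WaveFamily (m : ℕ) (α κ₀ : ℝ) (X : ℝ → ℝ) : Prop where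
  nonneg : 0 ≤ κ₀
  continuousOn : ContinuousOn X (Ici κ₀)
  mem : ∀ κ, κ₀ ≤ κ → X κ ∈ Icc 0 (π / 2)
  half : ∀ κ, κ₀ ≤ κ → waveHalf m κ (X κ) = α
  scale_pos : ∀ κ, κ₀ ≤ κ → 0 < scale κ (X κ)
  param : ∀ κ, κ₀ < κ → WaveParam κ (X κ)

theorem waveHalf_phase_unique {m : ℕ} {α κ x y : ℝ} (hα : 0 < α) (hκ : 0 ≤ κ)
    (hx : x ∈ Icc 0 (π / 2)) (hy : y ∈ Icc 0 (π / 2)) (h1 : waveHalf m κ x = α)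
    (h2 : waveHalf m κ y = α) : x = y := by
  rcases lt_trichotomy x y with h | h | h
  · have := waveHalf_lt m hκ hx.1 h hy.2 (scale_pos_of_waveHalf_pos (m := m) (by rwa [h2]))
    linarith
  · exact h
  · have := waveHalf_lt m hκ hy.1 h hx.2 (scale_pos_of_waveHalf_pos (m := m) (by rwa [h1]))
    linarith

/-- The bounds on α place it between the values of the half-length at x = 0 and x = π/2. Strict
monotonicity in x makes the solution a continuous function of κ, and the strict bounds keep it off
both ends for κ > κ₀. -/
theorem exists_waveFamily {m : ℕ} {α κ₀ : ℝ} (hα : 0 < α) (h0 : 0 ≤ κ₀)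
    (hle : ∀ κ, κ₀ ≤ κ → m * halfPeriod κ 0 ≤ α ∧ α ≤ (m + 1) * halfPeriod κ (π / 2))
    (hlt : ∀ κ, κ₀ < κ → m * halfPeriod κ 0 < α ∧ α < (m + 1) * halfPeriod κ (π / 2)) :
    ∃ X, WaveFamily m α κ₀ X := by
  have hpi : (0 : ℝ) ≤ π / 2 := by positivity
  have hex : ∀ κ, κ₀ ≤ κ → ∃ x ∈ Icc 0 (π / 2), waveHalf m κ x = α := by
    intro κ hκ
    have hc : ContinuousOn (fun x => waveHalf m κ x) (Icc 0 (π / 2)) :=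
      (continuousOn_waveHalf m).comp (f := fun x => (κ, x)) (by fun_prop)
        fun _ _ => h0.trans hκ
    obtain ⟨x, hx, h⟩ := intermediate_value_Icc hpi hc
      (show α ∈ Icc _ _ by rw [waveHalf_zero_right, waveHalf_pi_div_two]; exact hle κ hκ)
    exact ⟨x, hx, h⟩
  choose! X hX hXα using hex
  have hs : ∀ κ, κ₀ ≤ κ → 0 < scale κ (X κ) := fun κ hκ =>
    scale_pos_of_waveHalf_pos (m := m) (by rwa [hXα κ hκ])
  refine ⟨X, h0, ?_, hX, hXα, hs, fun κ hκ => ⟨h0.trans_lt hκ, ⟨?_, ?_⟩, hs κ hκ.le⟩⟩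
  · refine continuousOn_implicit (T := fun κ y => waveHalf m κ y) ordConnected_Icc hX hXα
      (fun κ hκ y hy h => ?_) (fun κ hκ y hy h => ?_) fun y hy => ?_
    · rw [← hXα κ hκ]
      exact waveHalf_lt m (h0.trans hκ) hy.1 h (hX κ hκ).2 (hs κ hκ)
    · rw [← hXα κ hκ]
      refine waveHalf_lt m (h0.trans hκ) (hX κ hκ).1 h hy.2 ?_
      rcases (h0.trans hκ).eq_or_lt with h1 | h1
      · simp [scale, ← h1]
      · exact (hs κ hκ).trans (scale_lt_scale h1 (hX κ hκ).1 h hy.2)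
    · exact (continuousOn_waveHalf m).comp (f := fun κ => (κ, y)) (by fun_prop)
        fun κ hκ => h0.trans hκ
  · refine lt_of_le_of_ne (hX κ hκ.le).1 fun h => ?_
    have h1 := hXα κ hκ.le
    rw [← h, waveHalf_zero_right] at h1
    exact (hlt κ hκ).1.ne h1
  · refine lt_of_le_of_ne (hX κ hκ.le).2 fun h => ?_
    have h1 := hXα κ hκ.le
    rw [h, waveHalf_pi_div_two] at h1
    exact (hlt κ hκ).2.ne h1.symm

section

variable {m : ℕ} {α κ₀ : ℝ} {X : ℝ → ℝ}

theorem WaveFamily.continuousOn_flux (h : WaveFamily m α κ₀ X) :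
    ContinuousOn (fun κ => waveFlux m κ (X κ)) (Ici κ₀) :=
  (continuousOn_waveFlux m).comp (f := fun κ => (κ, X κ)) (continuousOn_id.prodMk h.continuousOn)
    fun κ hκ => ⟨h.nonneg.trans hκ, h.scale_pos κ hκ⟩

theorem WaveFamily.exists_flux_eq (h : WaveFamily m α κ₀ X) {κ₁ Φ : ℝ} (h1 : κ₀ ≤ κ₁)
    (hΦ : Φ < waveFlux m κ₁ (X κ₁)) : ∃ κ, κ₁ < κ ∧ waveFlux m κ (X κ) = Φ := by
  obtain ⟨b, hb⟩ := exists_waveFlux_le m Φ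
  set c := max b (κ₁ + 1) with hc
  have hc1 : κ₁ < c := (lt_add_one κ₁).trans_le (le_max_right _ _)
  obtain ⟨κ, hκ, hκΦ⟩ := intermediate_value_Icc' hc1.le
    (h.continuousOn_flux.mono fun κ hκ => h1.trans hκ.1)
    ⟨hb c (le_max_left _ _) _ (h.param c (h1.trans_lt hc1)), hΦ.le⟩
  refine ⟨κ, lt_of_le_of_ne hκ.1 ?_, hκΦ⟩
  rintro rfl
  exact hΦ.ne hκΦ.symm

theorem WaveFamily.mem_fluxSet (h : WaveFamily m α κ₀ X) (hα : 0 < α) (hαπ : α < π) {κ : ℝ}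
    (hκ : κ₀ < κ) : 2 * waveFlux m κ (X κ) ∈ fluxSet m (m + 1) α := by
  rw [fluxSet_eq hα hαπ]
  have h1 := (h.param κ hκ).isJHType_lt m
  have h2 : m * halfPeriod κ (X κ) + negHalf κ (X κ) = α := h.half κ hκ.le
  rw [h2] at h1
  exact ⟨_, h1.1, h1.2⟩

theorem WaveFamily.Iio_subset (h : WaveFamily m α κ₀ X) (hα : 0 < α) (hαπ : α < π) :
    Iio (2 * waveFlux m κ₀ (X κ₀)) ⊆ fluxSet m (m + 1) α := by
  intro Φ hΦ
  obtain ⟨κ, hκ, h1⟩ := h.exists_flux_eq (Φ := Φ / 2) le_rfl (by linarith [mem_Iio.1 hΦ])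
  have := h.mem_fluxSet hα hαπ hκ
  rwa [h1, mul_div_cancel₀ _ (two_ne_zero' ℝ)] at this

end

/-- The fluxes of type `(0, 1)` for a half-angle of at most a right angle. -/
theorem fluxSet_zero_one_of_le {α : ℝ} (hα : 0 < α) (hα2 : α ≤ π / 2) :
    fluxSet 0 1 α = Iio 0 := by
  have hαπ : α < π := by linarith [pi_pos]
  refine Subset.antisymm (fluxSet_zero_one_neg hα hαπ) ?_
  have hmono := strictMonoOn_halfPeriod_high
  obtain ⟨X, hX⟩ := exists_waveFamily (m := 0) hα le_rfl
    (fun κ hκ => by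
      have := hmono.monotoneOn (mem_Ici.2 le_rfl) (mem_Ici.2 hκ) hκ
      simp only [halfPeriod_zero_left] at this
      simp only [Nat.cast_zero, zero_mul, zero_add, one_mul]
      exact ⟨hα.le, hα2.trans this⟩)
    (fun κ hκ => by
      have := hmono (mem_Ici.2 le_rfl) (mem_Ici.2 hκ.le) hκ
      simp only [halfPeriod_zero_left] at this
      simp only [Nat.cast_zero, zero_mul, zero_add, one_mul]
      exact ⟨hα, hα2.trans_lt this⟩)
  have := hX.Iio_subset hα hαπ
  -- At κ = 0 the wave is identically zero, so the family starts from flux 0.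
  simpa [waveFlux, halfFlux, negFlux] using this

/-- The negative arcs of fixed length form a family that starts, at x = π/2, from the edge arc; its
flux then falls continuously to -∞. -/
theorem Iio_subset_fluxSet_zero_one {M : ℝ} (hM : -3 < M) (hT : π / 2 ≤ edgeT M)
    (hTπ : edgeT M < π) : Iio (2 * edgeF M) ⊆ fluxSet 0 1 (edgeT M) := by
  have hα := edgeT_pos hM
  have hmono := strictMonoOn_halfPeriod_high
  obtain ⟨κ₀, h0, hκ₀⟩ := exists_halfPeriod_high hT
  obtain ⟨X, hX⟩ := exists_waveFamily (m := 0) hα h0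
    (fun κ hκ => by
      have := hmono.monotoneOn h0 (mem_Ici.2 (h0.trans hκ)) hκ
      simp only [hκ₀] at this
      simp only [Nat.cast_zero, zero_mul, zero_add, one_mul]
      exact ⟨hα.le, this⟩)
    (fun κ hκ => by
      have := hmono h0 (mem_Ici.2 (h0.trans hκ.le)) hκ
      simp only [hκ₀] at this
      simp only [Nat.cast_zero, zero_mul, zero_add, one_mul]
      exact ⟨hα, this⟩)
  have h1 : X κ₀ = π / 2 := waveHalf_phase_unique hα h0 (hX.mem κ₀ le_rfl)
    ⟨by positivity, le_rfl⟩ (hX.half κ₀ le_rfl) (by rw [waveHalf_pi_div_two, hκ₀]; simp)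
  have h2 : M = -6 * κ₀ / (1 + 2 * κ₀) :=
    strictAntiOn_edgeT.injOn hM (neg_three_lt_high h0) (by rw [edgeT_high h0, hκ₀])
  have h3 : waveFlux 0 κ₀ (X κ₀) = edgeF M := by
    rw [h1, h2, edgeF_high h0, waveFlux, Nat.cast_zero, zero_mul, zero_add]
    rfl
  have := hX.Iio_subset hα hTπ
  rwa [h3] at this

theorem isLUB_of_Iio_subset {s : Set ℝ} {B : ℝ} (h1 : Iio B ⊆ s) (h2 : ∀ Φ ∈ s, Φ ≤ B) :
    IsLUB s B :=
  ⟨h2, fun _ hc => isLUB_Iio.2 fun _ hy => hc (h1 hy)⟩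

theorem exists_isLUB_zero_one {α : ℝ} (hα : 0 < α) (hαπ : α < π) :
    ∃ B, Iio B ⊆ fluxSet 0 1 α ∧ IsLUB (fluxSet 0 1 α) B := by
  rcases le_total α (π / 2) with h | h
  · rw [fluxSet_zero_one_of_le hα h]
    exact ⟨0, Subset.rfl, isLUB_Iio⟩
  · obtain ⟨M, hM, rfl⟩ := exists_edgeT_eq hα
    have hM0 : M ≤ 0 := by
      rw [← edgeT_zero] at h
      exact (strictAntiOn_edgeT.le_iff_ge (by norm_num) hM).1 h
    have h1 := Iio_subset_fluxSet_zero_one hM h hαπ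
    exact ⟨_, h1, isLUB_of_Iio_subset h1 (fluxSet_zero_one_le hM hM0 hαπ)⟩

theorem isLUB_maxFlux_zero_one {α : ℝ} (hα : 0 < α) (hαπ : α < π) :
    (fluxSet 0 1 α).Nonempty ∧ IsLUB (fluxSet 0 1 α) (maxFlux 0 1 α) := by
  obtain ⟨B, h1, h2⟩ := exists_isLUB_zero_one hα hαπ
  exact isLUB_maxFlux (nonempty_Iio.mono h1) ⟨B, h2.1⟩

theorem maxFlux_one_one_eq_zero_one {α : ℝ} (hα : π / 2 ≤ α) (hαπ : α < π) :
    maxFlux 1 1 α = maxFlux 0 1 α := by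
  have hα0 : 0 < α := by linarith [pi_pos]
  obtain ⟨M, hM, rfl⟩ := exists_edgeT_eq hα0
  have hM0 : M ≤ 0 := by
    rw [← edgeT_zero] at hα
    exact (strictAntiOn_edgeT.le_iff_ge (by norm_num) hM).1 hα
  have h1 := Iio_subset_fluxSet_zero_one hM hα hαπ
  have h2 := isLUB_of_Iio_subset h1 (fluxSet_zero_one_le hM hM0 hαπ)
  rw [maxFlux_one_one hM hαπ]
  exact h2.unique (isLUB_maxFlux_zero_one hα0 hαπ).2

theorem exists_unique_zero_one {α : ℝ} (hα : 0 < α) (hαπ : α < π) {Φ : ℝ}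
    (hΦ : Φ < maxFlux 0 1 α) : ∃ u, (IsOfType α 0 1 u ∧ flux α u = Φ) ∧
      ∀ v, IsOfType α 0 1 v → flux α v = Φ → EqOn v u (sector α) := by
  obtain ⟨B, h1, h2⟩ := exists_isLUB_zero_one hα hαπ
  rw [← h2.unique (isLUB_maxFlux_zero_one hα hαπ).2] at hΦ
  obtain ⟨u, hu, huΦ⟩ := h1 hΦ
  exact ⟨u, ⟨hu, huΦ⟩, fun v hv hvΦ => unique_zero_one hα hαπ hu hv (by rw [huΦ, hvΦ])⟩

/-! ### First-order gain from an additional negative arc -/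

/-- Near a non-negative extremal value, the flux of the edge arc varies at least proportionally to
its length. -/
theorem exists_edge_comparison {M₀ : ℝ} (h0 : 0 ≤ M₀) :
    ∃ c, 0 < c ∧ ∀ M, M₀ ≤ M → M ≤ M₀ + 1 →
      c * (edgeT M₀ - edgeT M) ≤ edgeF M - edgeF M₀ := by
  set Q := 8 + 2 * M₀ with hQ
  have hQ0 : 0 < √Q := sqrt_pos.2 (by positivity)
  -- The quotient of two rates per unit of M: the flux grows by at least √6/(2√Q) · π/4, the length
  -- shrinks by at most π/12. For M ≤ M₀ + 1 the number Q bounds 6 + M(1 + cos² ψ).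
  refine ⟨√6 / (2 * √Q) * (π / 4) / (π / 12), by positivity, fun M hM hM1 => ?_⟩
  have hM0 : -3 < M₀ := by linarith
  have hM3 : -3 < M := by linarith
  have hc0 := continuous_edge hM0
  have hc := continuous_edge hM3
  have hroot : ∀ ψ, 0 < √(6 + M₀ * (1 + cos ψ ^ 2)) ∧ 0 < √(6 + M * (1 + cos ψ ^ 2)) ∧
      (√(6 + M * (1 + cos ψ ^ 2)) - √(6 + M₀ * (1 + cos ψ ^ 2))) *
        (√(6 + M * (1 + cos ψ ^ 2)) + √(6 + M₀ * (1 + cos ψ ^ 2))) =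
        (M - M₀) * (1 + cos ψ ^ 2) ∧
      √(6 + M₀ * (1 + cos ψ ^ 2)) ≤ √(6 + M * (1 + cos ψ ^ 2)) ∧
      √(6 + M * (1 + cos ψ ^ 2)) ≤ √Q ∧ √6 ≤ √(6 + M₀ * (1 + cos ψ ^ 2)) := by
    intro ψ
    have h1 := edge_pos hM0 ψ
    have h2 := edge_pos hM3 ψ
    have hu : 0 ≤ 1 + cos ψ ^ 2 := by positivity
    refine ⟨sqrt_pos.2 h1, sqrt_pos.2 h2, ?_, sqrt_le_sqrt (by gcongr), sqrt_le_sqrt ?_,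
      sqrt_le_sqrt ?_⟩
    · have e1 := sq_sqrt h1.le
      have e2 := sq_sqrt h2.le
      linear_combination e2 - e1
    · nlinarith [cos_sq_le_one ψ]
    · linarith [mul_nonneg h0 hu]
  have hT : edgeT M₀ - edgeT M ≤ (M - M₀) * (π / 12) := by
    rw [edgeT, edgeT, ← intervalIntegral.integral_sub (hc0.intervalIntegrable _ _)
      (hc.intervalIntegrable _ _)]
    have h := integral_le_of_cos_pos ((hc0.sub hc).intervalIntegrable 0 (π / 2))
      (intervalIntegrable_const (c := (M - M₀) / 6)) fun ψ _ => by
        obtain ⟨p1, p2, p3, p4, p5, p6⟩ := hroot ψ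
        have h6 : 0 < √6 := by positivity
        have h66 : √6 ^ 2 = 6 := sq_sqrt (by norm_num)
        simp only [Pi.sub_apply]
        rw [div_sub_div _ _ p1.ne' p2.ne', div_le_iff₀ (by positivity)]
        generalize √(6 + M₀ * (1 + cos ψ ^ 2)) = a at *
        generalize √(6 + M * (1 + cos ψ ^ 2)) = b at *
        have h7 : (b - a) * (2 * √6) ≤ (M - M₀) * 2 := by
          calc (b - a) * (2 * √6) ≤ (b - a) * (b + a) := by
                apply mul_le_mul_of_nonneg_left <;> linarith
            _ ≤ (M - M₀) * 2 := by
                rw [p3]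
                apply mul_le_mul_of_nonneg_left <;> nlinarith [cos_sq_le_one ψ]
        have h8 : 6 ≤ a * b := by nlinarith
        nlinarith [mul_le_mul_of_nonneg_left h8 (sub_nonneg.2 hM)]
    rw [intervalIntegral.integral_const] at h
    simp only [sub_zero, smul_eq_mul] at h
    refine h.trans (le_of_eq ?_)
    ring
  have hF : √6 / (2 * √Q) * (M - M₀) * (π / 4) ≤ edgeF M - edgeF M₀ := by
    rw [edgeF, edgeF, ← intervalIntegral.integral_const_mul, ← intervalIntegral.integral_const_mul,
      ← intervalIntegral.integral_sub (Continuous.intervalIntegrable (by fun_prop) _ _)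
      (Continuous.intervalIntegrable (by fun_prop) _ _)]
    have h := integral_le_of_cos_pos
      ((by fun_prop : Continuous fun ψ : ℝ =>
        √6 / (2 * √Q) * (M - M₀) * cos ψ ^ 2).intervalIntegrable 0 (π / 2))
      ((by fun_prop : Continuous fun ψ : ℝ =>
        M * (cos ψ ^ 2 * (√6 / √(6 + M * (1 + cos ψ ^ 2)))) -
        M₀ * (cos ψ ^ 2 * (√6 / √(6 + M₀ * (1 + cos ψ ^ 2))))).intervalIntegrable 0 (π / 2))
      fun ψ _ => by
        obtain ⟨p1, p2, p3, p4, p5, p6⟩ := hroot ψ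
        have e1 := div_sqrt_edge hM0 ψ
        have e2 := div_sqrt_edge hM3 ψ
        have hu : 0 < 1 + cos ψ ^ 2 := by positivity
        have h7 : √6 / (2 * √Q) * (M - M₀) ≤ M * (√6 / √(6 + M * (1 + cos ψ ^ 2))) -
            M₀ * (√6 / √(6 + M₀ * (1 + cos ψ ^ 2))) := by
          rw [e1, e2, ← sub_div, le_div_iff₀ hu]
          have h8 : 6 / √(6 + M * (1 + cos ψ ^ 2)) ≤ 6 / √(6 + M₀ * (1 + cos ψ ^ 2)) :=
            div_le_div_of_nonneg_left (by norm_num) p1 p4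
          generalize √(6 + M₀ * (1 + cos ψ ^ 2)) = a at *
          generalize √(6 + M * (1 + cos ψ ^ 2)) = b at *
          have h9 : (M - M₀) * (1 + cos ψ ^ 2) ≤ (b - a) * (2 * √Q) := by
            rw [← p3]
            apply mul_le_mul_of_nonneg_left <;> linarith
          calc √6 / (2 * √Q) * (M - M₀) * (1 + cos ψ ^ 2)
              = √6 * ((M - M₀) * (1 + cos ψ ^ 2) / (2 * √Q)) := by ring
            _ ≤ √6 * (b - a) := by
                refine mul_le_mul_of_nonneg_left ?_ (sqrt_nonneg 6)
                rwa [div_le_iff₀ (by positivity)]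
            _ ≤ √6 * (b - a) + √6 * (6 / a - 6 / b) := by
                have := mul_nonneg (sqrt_nonneg 6) (sub_nonneg.2 h8)
                linarith
            _ = _ := by ring
        nlinarith [mul_le_mul_of_nonneg_right h7 (sq_nonneg (cos ψ))]
    rw [intervalIntegral.integral_const_mul, integral_cos_sq] at h
    refine le_trans (le_of_eq ?_) h
    rw [cos_pi_div_two, sin_zero]
    ring
  calc √6 / (2 * √Q) * (π / 4) / (π / 12) * (edgeT M₀ - edgeT M)
      ≤ √6 / (2 * √Q) * (π / 4) / (π / 12) * ((M - M₀) * (π / 12)) :=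
        mul_le_mul_of_nonneg_left hT (by positivity)
    _ = √6 / (2 * √Q) * (M - M₀) * (π / 4) := by
        field_simp
    _ ≤ _ := hF

section

variable {κ x : ℝ}

theorem scale_zero_le (hκ : 0 ≤ κ) (x : ℝ) : 1 - κ ≤ scale κ x := by
  have : 0 ≤ 3 * κ * sin x ^ 2 := by positivity
  unfold scale
  linarith

theorem kInt_complete_le_two (hκ : 0 ≤ κ) : kInt κ (π / 2) ≤ 2 :=
  (kInt_le hκ (by positivity)).trans (by linarith [pi_lt_four])

/-- Opening the phase from 0 to x costs only a multiple of sin² x, since x enters the flux only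
through sin² x and p keeps the scale away from 0. The constant 30 is generous. -/
theorem halfFlux_zero_sub_le {p : ℝ} (hp : 0 < p) (hκ : 0 ≤ κ) (hκp : κ ≤ 1 - p) :
    halfFlux κ 0 - 30 / p ^ 2 * sin x ^ 2 ≤ halfFlux κ x := by
  have hp1 : p ≤ 1 := by linarith
  have hs0 : 0 < 1 - κ := by linarith
  have hs : 0 < scale κ x := hs0.trans_le (scale_zero_le hκ x)
  have hK := kInt_complete_le_two hκ
  have hK0 := kInt_pos hκ (show 0 < π / 2 by positivity)
  have hl := two_mul_lInt_le hκ
  have hl0 := lInt_pos hκ (show 0 < π / 2 by positivity) le_rfl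
  have ha := sqrt_pos.2 hs0
  have hb := sqrt_pos.2 hs
  have ha2 := sq_sqrt hs0.le
  have hb2 : √(scale κ x) ^ 2 = 1 - κ + 3 * κ * sin x ^ 2 := sq_sqrt hs.le
  have hab : √(1 - κ) ≤ √(scale κ x) := sqrt_le_sqrt (scale_zero_le hκ x)
  have hpa : p ≤ √(1 - κ) := le_sqrt_of_sq_le (by nlinarith)
  rw [halfFlux, halfFlux, scale_zero, jInt, jInt, sin_zero]
  set a := √(1 - κ)
  set b := √(scale κ x)
  set S := sin x ^ 2
  have hS : 0 ≤ S := sq_nonneg _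
  set K := kInt κ (π / 2)
  set l := lInt κ (π / 2)
  have hinv : 1 / a - 1 / b ≤ 3 * κ * S / (2 * p ^ 2) := by
    rw [div_sub_div _ _ ha.ne' hb.ne', div_le_div_iff₀ (by positivity) (by positivity)]
    have h1 : (b - a) * (b + a) = 3 * κ * S := by linear_combination hb2 - ha2
    have h2 : 0 ≤ b - a := by linarith
    have h3 : p ^ 2 ≤ a ^ 2 := by gcongr
    have h4 : a ^ 2 ≤ a * b := by nlinarith
    have h6 : a ^ 2 ≤ 1 := by linarith
    have h5 : (b - a) * (2 * p ^ 2) ≤ (b - a) * ((b + a) * (a * b)) := by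
      refine mul_le_mul_of_nonneg_left ?_ h2
      have h7 : p ≤ 1 := hp1
      have h8 : a ^ 2 * (2 * a) ≤ (b + a) * (a * b) := by nlinarith
      have h9 : p ^ 2 ≤ a ^ 3 := by
        have : a ≤ 1 := by nlinarith
        have h10 : p ≤ a ^ 2 := by linarith
        nlinarith
      nlinarith
    nlinarith
  have h1 : 6 * κ / a * (l - 0 ^ 2 * K) - 6 * κ / b * (l - S * K) =
      6 * κ * l * (1 / a - 1 / b) + 6 * κ * S * K * (1 / b) := by ring
  have hκ1 : κ ≤ 1 := by linarith
  have hl1 : l ≤ 1 := by linarith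
  have h2 : 6 * κ * l * (1 / a - 1 / b) ≤ 6 * (3 * κ * S / (2 * p ^ 2)) := by
    have hab0 : 0 ≤ 1 / a - 1 / b := sub_nonneg.2 (one_div_le_one_div_of_le ha hab)
    have : κ * l ≤ 1 := mul_le_one₀ hκ1 hl0.le hl1
    nlinarith
  have h3 : 6 * (3 * κ * S / (2 * p ^ 2)) ≤ 9 * S / p ^ 2 := by
    rw [mul_div_assoc', div_le_div_iff₀ (by positivity) (by positivity)]
    have : κ * S ≤ S := mul_le_of_le_one_left hS hκ1
    have hp2 : 0 < p ^ 2 := by positivity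
    nlinarith
  have h4 : 6 * κ * S * K * (1 / b) ≤ 12 * S / p ^ 2 := by
    have h5 : 1 / b ≤ 1 / p ^ 2 := by
      refine one_div_le_one_div_of_le (by positivity) ?_
      nlinarith
    have h6 : κ * K ≤ 2 := by nlinarith
    calc 6 * κ * S * K * (1 / b) = 6 * S * (κ * K) * (1 / b) := by ring
      _ ≤ 6 * S * 2 * (1 / p ^ 2) := by gcongr
      _ = _ := by ring
  have h5 : 30 / p ^ 2 * S = 9 * S / p ^ 2 + 12 * S / p ^ 2 + 9 * S / p ^ 2 := by ring
  have h6 : 0 ≤ 9 * S / p ^ 2 := by positivity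
  linarith

theorem negFlux_ge {p : ℝ} (hp : 0 < p) (hκ : 0 ≤ κ) (hκp : κ ≤ 1 - p) (hx : 0 ≤ x)
    (hx2 : x ≤ π / 2) : -(12 / p * sin x ^ 2) ≤ negFlux κ x := by
  have hs0 : 0 < 1 - κ := by linarith
  have hs : 0 < scale κ x := hs0.trans_le (scale_zero_le hκ x)
  have hpb : p ≤ √(scale κ x) := le_sqrt_of_sq_le (by nlinarith [scale_zero_le hκ x])
  have hk := (kInt_strictMono hκ).monotone hx2
  have hk0 : 0 ≤ kInt κ x := by
    have := (kInt_strictMono hκ).monotone hx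
    rwa [kInt_zero] at this
  have hk2 := hk.trans (kInt_complete_le_two hκ)
  have hl : 0 ≤ lInt κ x := by
    rcases hx.eq_or_lt with rfl | hx
    · rw [lInt_zero]
    · exact (lInt_pos hκ hx hx2).le
  have h1 : 6 * κ / √(scale κ x) ≤ 6 / p := by
    refine div_le_div₀ (by norm_num) (by linarith) hp hpb
  have h2 : 0 ≤ 6 * κ / √(scale κ x) := by positivity
  have h3 : -(2 * sin x ^ 2) ≤ jInt κ x x := by
    unfold jInt
    nlinarith [sq_nonneg (sin x)]
  calc -(12 / p * sin x ^ 2) = 6 / p * -(2 * sin x ^ 2) := by ring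
    _ ≤ 6 * κ / √(scale κ x) * -(2 * sin x ^ 2) :=
        mul_le_mul_of_nonpos_right h1 (by nlinarith [sq_nonneg (sin x)])
    _ ≤ _ := mul_le_mul_of_nonneg_left h3 h2

/-- In contrast with the flux losses, which are quadratic in x, the length of the new arc is of
first order; this imbalance produces the gain. -/
theorem negHalf_ge {p : ℝ} (hp : 0 < p) (hκ : 0 ≤ κ) (hκp : κ ≤ 1 - p) (hx : 0 ≤ x) :
    p / 2 * x ≤ negHalf κ x := by
  have hpb : p ≤ √(scale κ x) := le_sqrt_of_sq_le (by nlinarith [scale_zero_le hκ x])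
  have h1 : x / 2 ≤ kInt κ x := by
    have h := intervalIntegral.integral_mono_on hx
      (intervalIntegrable_const (c := (1 / 2 : ℝ)) (μ := MeasureTheory.volume))
      (intervalIntegrable_weight hκ 0 x) fun t _ => by
        rw [weight, ← one_div]
        refine one_div_le_one_div_of_le (sqrt_pos.2 (one_add_mul_sin_sq_pos hκ t)) ?_
        rw [sqrt_le_left (by norm_num)]
        nlinarith [sin_sq_le_one t, sq_nonneg (sin t)]
    rw [intervalIntegral.integral_const] at h
    simp only [sub_zero, smul_eq_mul] at h
    change _ ≤ kInt κ x at h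
    linarith
  calc p / 2 * x = p * (x / 2) := by ring
    _ ≤ _ := mul_le_mul hpb h1 (by linarith) (sqrt_nonneg _)

end

/-- Opening an additional negative arc increases the flux to first order. -/
theorem WaveFamily.exists_waveFlux_gt {m : ℕ} (hm : 1 ≤ m) {α κ₀ : ℝ} {X : ℝ → ℝ}
    (h : WaveFamily m α κ₀ X) (hκ₁ : κ₀ < 1) (hα : m * halfPeriod κ₀ 0 = α) (hX0 : X κ₀ = 0) :
    ∃ κ, κ₀ < κ ∧ m * halfFlux κ₀ 0 < waveFlux m κ (X κ) := by
  have h0 := h.nonneg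
  have hm0 : (1 : ℝ) ≤ m := by exact_mod_cast hm
  set p := (1 - κ₀) / 2 with hp
  have hp0 : 0 < p := by linarith
  set μ : ℝ → ℝ := fun κ => 6 * κ / (1 - κ) with hμ
  have hμ0 : 0 ≤ μ κ₀ := div_nonneg (by linarith) (by linarith)
  obtain ⟨c, hc, hcomp⟩ := exists_edge_comparison hμ0
  set B := (m : ℝ) * (30 / p ^ 2) + 12 / p with hB
  have hB0 : 0 < B := by positivity
  have hXt : Tendsto X (𝓝[>] κ₀) (𝓝 0) := by
    have := (h.continuousOn κ₀ (mem_Ici.2 le_rfl)).mono Ioi_subset_Ici_self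
    rwa [ContinuousWithinAt, hX0] at this
  have hμc : ContinuousAt μ κ₀ := by
    refine ContinuousAt.div (by fun_prop) (by fun_prop) ?_
    linarith
  -- Below this threshold the quadratic loss B X² is smaller than the linear gain c (p/2) X.
  have e1 : ∀ᶠ κ in 𝓝[>] κ₀, X κ < c * (p / 2) / B :=
    hXt.eventually_lt_const (by positivity)
  have e2 : ∀ᶠ κ in 𝓝[>] κ₀, μ κ < μ κ₀ + 1 :=
    (hμc.eventually_lt_const (by linarith)).filter_mono nhdsWithin_le_nhds
  have e3 : ∀ᶠ κ in 𝓝[>] κ₀, κ < 1 - p :=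
    (eventually_lt_nhds (show κ₀ < 1 - p by linarith)).filter_mono nhdsWithin_le_nhds
  have e4 : ∀ᶠ κ in 𝓝[>] κ₀, κ₀ < κ := self_mem_nhdsWithin
  obtain ⟨κ, h1, h2, h3, h4⟩ := (e1.and (e2.and (e3.and e4))).exists
  have hκ0 : 0 ≤ κ := h0.trans h4.le
  have hκ1 : κ < 1 := by linarith
  have hw := h.param κ h4
  have hμle : μ κ₀ ≤ μ κ := by
    rw [hμ]
    simp only
    rw [div_le_div_iff₀ (by linarith) (by linarith)]
    nlinarith
  have hc1 := hcomp (μ κ) hμle h2.le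
  rw [edgeT_low h0 hκ₁, edgeT_low hκ0 hκ1, edgeF_low h0 hκ₁, edgeF_low hκ0 hκ1] at hc1
  have hh : m * halfPeriod κ (X κ) + negHalf κ (X κ) = α := h.half κ h4.le
  have hT := (halfPeriod_lt hw.pos le_rfl hw.mem.1 hw.mem.2.le hw.scale_pos).le
  have hN := negHalf_ge hp0 hκ0 h3.le hw.mem.1.le
  have hF := halfFlux_zero_sub_le (x := X κ) hp0 hκ0 h3.le
  have hG := negFlux_ge hp0 hκ0 h3.le hw.mem.1.le hw.mem.2.le
  refine ⟨κ, h4, ?_⟩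
  have hx0 := hw.mem.1
  have hsin : sin (X κ) ^ 2 ≤ X κ ^ 2 := by
    rw [sq_le_sq]
    exact abs_sin_le_abs
  -- The total length is fixed, so the length of the new negative arc is taken from the m periods.
  have i1 : p / 2 * X κ ≤ m * (halfPeriod κ₀ 0 - halfPeriod κ 0) := by nlinarith
  have i2 : c * (p / 2 * X κ) ≤ m * (halfFlux κ 0 - halfFlux κ₀ 0) := by
    calc c * (p / 2 * X κ) ≤ c * (m * (halfPeriod κ₀ 0 - halfPeriod κ 0)) := by gcongr
      _ = m * (c * (halfPeriod κ₀ 0 - halfPeriod κ 0)) := by ring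
      _ ≤ _ := by gcongr
  have i3 : B * sin (X κ) ^ 2 < c * (p / 2 * X κ) := by
    have h5 : B * X κ < c * (p / 2) := by
      rw [lt_div_iff₀ hB0] at h1
      linarith
    calc B * sin (X κ) ^ 2 ≤ B * X κ ^ 2 := by gcongr
      _ = B * X κ * X κ := by ring
      _ < c * (p / 2) * X κ := by gcongr
      _ = _ := by ring
  have i4 : (m : ℝ) * (halfFlux κ 0 - 30 / p ^ 2 * sin (X κ) ^ 2) ≤ m * halfFlux κ (X κ) := by
    gcongr
  have i5 : waveFlux m κ (X κ) = m * halfFlux κ (X κ) + negFlux κ (X κ) := rfl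
  rw [i5]
  have i6 : B * sin (X κ) ^ 2 =
      m * (30 / p ^ 2 * sin (X κ) ^ 2) + 12 / p * sin (X κ) ^ 2 := by
    rw [hB]
    ring
  linarith

/-! ### Type (m, m + 1): maximal flux and non-uniqueness -/

theorem pi_div_two_le_halfPeriod {κ : ℝ} (hκ : 0 ≤ κ) : π / 2 ≤ halfPeriod κ (π / 2) := by
  have := strictMonoOn_halfPeriod_high.monotoneOn (mem_Ici.2 le_rfl) (mem_Ici.2 hκ) hκ
  simpa only [halfPeriod_zero_left] using this

theorem halfPeriod_zero_le {κ : ℝ} (hκ : 0 ≤ κ) : halfPeriod κ 0 ≤ π / 2 := by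
  rcases lt_or_ge κ 1 with h | h
  · have := strictAntiOn_halfPeriod_low.antitoneOn (by simp) ⟨hκ, h⟩ hκ
    simpa only [halfPeriod_zero_left] using this
  · rw [halfPeriod_of_one_le h]
    positivity

theorem halfPeriod_zero_lt_of_lt {κ₀ κ : ℝ} (h0 : 0 ≤ κ₀) (h1 : κ₀ < 1) (h : κ₀ < κ) :
    halfPeriod κ 0 < halfPeriod κ₀ 0 := by
  rcases lt_or_ge κ 1 with h2 | h2
  · exact strictAntiOn_halfPeriod_low ⟨h0, h1⟩ ⟨h0.trans h.le, h2⟩ h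
  · rw [halfPeriod_of_one_le h2, halfPeriod, scale_zero]
    exact mul_pos (sqrt_pos.2 (by linarith)) (kInt_pos h0 (by positivity))

theorem lt_add_one_mul_halfPeriod {m : ℕ} (hm : 1 ≤ m) {α κ : ℝ} (hαπ : α < π) (hκ : 0 ≤ κ) :
    α < (m + 1) * halfPeriod κ (π / 2) := by
  have hm0 : (1 : ℝ) ≤ m := by exact_mod_cast hm
  nlinarith [pi_div_two_le_halfPeriod hκ, pi_pos]

/-- The data of the family of all solutions of type `(m, m + 1)`. -/
theorem exists_complete_waveFamily {m : ℕ} (hm : 1 ≤ m) {α : ℝ} (hα : 0 < α) (hαπ : α < π) :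
    ∃ κ₀ X, WaveFamily m α κ₀ X ∧ (∀ κ x, WaveParam κ x → waveHalf m κ x = α → κ₀ < κ) ∧
      (∃ κ, κ₀ < κ ∧ maxFlux m m α < 2 * waveFlux m κ (X κ)) ∧
      (α ≤ m * (π / 2) → 2 * waveFlux m κ₀ (X κ₀) = maxFlux m m α) := by
  have hm0 : (1 : ℝ) ≤ m := by exact_mod_cast hm
  have hmp : (0 : ℝ) < m := by linarith
  rcases le_or_gt α (m * (π / 2)) with hle | hgt
  · obtain ⟨κ₀, ⟨h0, h1⟩, hκ₀⟩ := exists_halfPeriod_low (div_pos hα hmp)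
      (by rw [div_le_iff₀ hmp]; linarith)
    have hκα : m * halfPeriod κ₀ 0 = α := by
      rw [hκ₀]
      field_simp
    have hlt : ∀ κ, κ₀ < κ → m * halfPeriod κ 0 < α := fun κ hκ => by
      rw [← hκα]
      exact mul_lt_mul_of_pos_left (halfPeriod_zero_lt_of_lt h0 h1 hκ) hmp
    obtain ⟨X, hX⟩ := exists_waveFamily (m := m) hα h0
      (fun κ hκ => ⟨by
        rcases hκ.eq_or_lt with rfl | hκ
        · exact hκα.le
        · exact (hlt κ hκ).le, (lt_add_one_mul_halfPeriod hm hαπ (h0.trans hκ)).le⟩)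
      (fun κ hκ => ⟨hlt κ hκ, lt_add_one_mul_halfPeriod hm hαπ (h0.trans hκ.le)⟩)
    have hX0 : X κ₀ = 0 := waveHalf_phase_unique hα h0 (hX.mem κ₀ le_rfl)
      ⟨le_rfl, by positivity⟩ (hX.half κ₀ le_rfl) (by rw [waveHalf_zero_right, hκα])
    have hmax : maxFlux m m α = 2 * (m * halfFlux κ₀ 0) := by
      have := maxFlux_self (neg_three_lt_low h0 h1) hm (by rwa [edgeT_low h0 h1, hκα])
      rw [edgeT_low h0 h1, hκα, edgeF_low h0 h1] at this
      rw [this]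
      ring
    refine ⟨κ₀, X, hX, fun κ x hw hx => ?_, ?_, fun _ => ?_⟩
    · by_contra! hκ
      have h2 := waveHalf_lt m hw.pos.le le_rfl hw.mem.1 hw.mem.2.le hw.scale_pos
      rw [waveHalf_zero_right, hx, ← hκα] at h2
      have h3 := strictAntiOn_halfPeriod_low.antitoneOn ⟨hw.pos.le, hκ.trans_lt h1⟩ ⟨h0, h1⟩ hκ
      exact (mul_le_mul_of_nonneg_left h3 hmp.le).not_gt h2
    · obtain ⟨κ, hκ, h2⟩ := hX.exists_waveFlux_gt hm h1 hκα hX0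
      exact ⟨κ, hκ, by linarith⟩
    · rw [hmax, hX0, waveFlux, negFlux, jInt, kInt_zero, lInt_zero]
      ring
  -- As α < π, this case occurs only for m = 1. The family then starts from the zero flow at κ = 0,
  -- whose flux 0 exceeds the maximal flux of type (1, 1), which is negative because α > π/2.
  · have hm1 : m = 1 := by
      by_contra hne
      have h2 : (2 : ℝ) ≤ m := by exact_mod_cast (show 2 ≤ m by omega)
      nlinarith [pi_pos]
    subst hm1
    simp only [Nat.cast_one, one_mul] at hgt
    have hlt : ∀ κ, 0 ≤ κ → (1 : ℕ) * halfPeriod κ 0 < α ∧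
        α < ((1 : ℕ) + 1) * halfPeriod κ (π / 2) := fun κ hκ =>
      ⟨by
        rw [Nat.cast_one, one_mul]
        exact (halfPeriod_zero_le hκ).trans_lt hgt, lt_add_one_mul_halfPeriod le_rfl hαπ hκ⟩
    obtain ⟨X, hX⟩ := exists_waveFamily (m := 1) hα le_rfl
      (fun κ hκ => ⟨(hlt κ hκ).1.le, (hlt κ hκ).2.le⟩) fun κ hκ => hlt κ hκ.le
    have hneg : maxFlux 1 1 α < 0 := by
      obtain ⟨M, hM, rfl⟩ := exists_edgeT_eq hα
      have hM0 : M < 0 := by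
        rw [← edgeT_zero] at hgt
        exact (strictAntiOn_edgeT.lt_iff_gt (by norm_num) hM).1 hgt
      have := strictMonoOn_edgeF hM (show -3 < (0 : ℝ) by norm_num) hM0
      rw [edgeF_zero] at this
      rw [maxFlux_one_one hM hαπ]
      linarith
    refine ⟨0, X, hX, fun κ x hw _ => hw.pos, ?_, fun h => ?_⟩
    · have hc := (hX.continuousOn_flux 0 (mem_Ici.2 le_rfl)).mono Ioi_subset_Ici_self
      have hz : waveFlux 1 0 (X 0) = 0 := by simp [waveFlux, halfFlux, negFlux]
      have h1 : ∀ᶠ κ in 𝓝[>] (0 : ℝ), maxFlux 1 1 α / 2 < waveFlux 1 κ (X κ) :=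
        hc.eventually_const_lt (by simp only [hz]; linarith)
      obtain ⟨κ, h2, h3⟩ := (h1.and self_mem_nhdsWithin).exists
      exact ⟨κ, h3, by linarith⟩
    · simp only [Nat.cast_one, one_mul] at h
      exact absurd h hgt.not_ge

theorem WaveFamily.fluxSet_eq {m : ℕ} (hm : 1 ≤ m) {α κ₀ : ℝ} {X : ℝ → ℝ} (hα : 0 < α)
    (hαπ : α < π) (h : WaveFamily m α κ₀ X)
    (hall : ∀ κ x, WaveParam κ x → waveHalf m κ x = α → κ₀ < κ) :
    fluxSet m (m + 1) α = (fun κ => 2 * waveFlux m κ (X κ)) '' Ioi κ₀ := by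
  refine Subset.antisymm (fun Φ hΦ => ?_) ?_
  · rw [SectorFlow.fluxSet_eq hα hαπ] at hΦ
    obtain ⟨f, hf, rfl⟩ := hΦ
    obtain ⟨κ, x, hw, hx, hflux⟩ := hf.eq_wave_lt hm
    have hκ := hall κ x hw hx.symm
    have : X κ = x := waveHalf_phase_unique hα hw.pos.le (h.mem κ hκ.le)
      (Ioo_subset_Icc_self hw.mem) (h.half κ hκ.le) hx.symm
    refine ⟨κ, hκ, ?_⟩
    simp only [this]
    exact hflux.symm
  · rintro _ ⟨κ, hκ, rfl⟩
    exact h.mem_fluxSet hα hαπ hκ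

theorem WaveFamily.bddAbove {m : ℕ} {α κ₀ : ℝ} {X : ℝ → ℝ} (h : WaveFamily m α κ₀ X) :
    BddAbove ((fun κ => 2 * waveFlux m κ (X κ)) '' Ioi κ₀) := by
  obtain ⟨b, hb⟩ := exists_waveFlux_le m 0
  obtain ⟨R, hR⟩ := isCompact_Icc.exists_bound_of_continuousOn
    (h.continuousOn_flux.mono (Icc_subset_Ici_self : Icc κ₀ b ⊆ Ici κ₀))
  refine ⟨2 * max R 0, ?_⟩
  rintro _ ⟨κ, hκ, rfl⟩
  simp only
  have : waveFlux m κ (X κ) ≤ max R 0 := by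
    rcases le_total b κ with h1 | h1
    · exact (hb κ h1 _ (h.param κ hκ)).trans (le_max_right _ _)
    · exact ((le_abs_self _).trans (hR κ ⟨le_of_lt hκ, h1⟩)).trans (le_max_left _ _)
  linarith

theorem isLUB_maxFlux_succ_right {m : ℕ} (hm : 1 ≤ m) {α : ℝ} (hα : 0 < α) (hαπ : α < π) :
    (fluxSet m (m + 1) α).Nonempty ∧ IsLUB (fluxSet m (m + 1) α) (maxFlux m (m + 1) α) := by
  obtain ⟨κ₀, X, h, hall, -, -⟩ := exists_complete_waveFamily hm hα hαπ
  refine isLUB_maxFlux ?_ ?_ <;> rw [h.fluxSet_eq hm hα hαπ hall]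
  · exact nonempty_Ioi.image _
  · exact h.bddAbove

theorem maxFlux_self_lt {m : ℕ} (hm : 1 ≤ m) {α : ℝ} (hα : 0 < α) (hαπ : α < π) :
    maxFlux m m α < maxFlux m (m + 1) α := by
  obtain ⟨κ₀, X, h, hall, ⟨κ, hκ, hlt⟩, -⟩ := exists_complete_waveFamily hm hα hαπ
  exact hlt.trans_le ((isLUB_maxFlux_succ_right hm hα hαπ).2.1 (h.mem_fluxSet hα hαπ hκ))

/-- Dropping the extra negative arc only increases the flux and leaves m periods, each a flow of
type (1, 1) of half-angle T. A negative half-arc is shorter than T, so T > α/(m+1), and the maximal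
flux of type (1, 1) is decreasing. -/
theorem maxFlux_succ_right_le {m : ℕ} (hm : 1 ≤ m) {α : ℝ} (hα : 0 < α) (hαπ : α < π) :
    maxFlux m (m + 1) α ≤ (m : ℝ) / ((m : ℝ) + 1) * maxFlux (m + 1) (m + 1) α := by
  have hm0 : (1 : ℝ) ≤ m := by exact_mod_cast hm
  obtain ⟨κ₀, X, h, hall, -, -⟩ := exists_complete_waveFamily hm hα hαπ
  refine (isLUB_maxFlux_succ_right hm hα hαπ).2.2 ?_
  rw [h.fluxSet_eq hm hα hαπ hall]
  rintro _ ⟨κ, hκ, rfl⟩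
  have hw := h.param κ hκ
  have hh : m * halfPeriod κ (X κ) + negHalf κ (X κ) = α := h.half κ (le_of_lt hκ)
  have h1 := hw.negHalf_pos
  have h2 := hw.negHalf_lt_halfPeriod
  have h3 := hw.halfPeriod_pos
  have hTα : halfPeriod κ (X κ) < α := by nlinarith
  have hTα' : α / (m + 1) < halfPeriod κ (X κ) := by
    rw [div_lt_iff₀ (by linarith)]
    nlinarith
  have hmem : 2 * halfFlux κ (X κ) ∈ fluxSet 1 1 (halfPeriod κ (X κ)) := by
    rw [SectorFlow.fluxSet_eq h3 (hTα.trans hαπ)]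
    have := hw.isJHType_eq 1
    simp only [Nat.cast_one, one_mul, mul_one] at this
    exact ⟨_, this.1, this.2⟩
  have h4 := (isLUB_maxFlux_self h3 (hTα.trans hαπ) le_rfl).2.1 hmem
  have h5 := strictAntiOn_maxFlux_one_one ⟨by positivity, hTα'.trans (hTα.trans hαπ)⟩
    ⟨h3, hTα.trans hαπ⟩ hTα'
  have h6 := maxFlux_self_eq hα hαπ (show 1 ≤ m + 1 by omega)
  push_cast at h6
  have h7 := hw.negFlux_neg
  have h8 : (m : ℝ) / (m + 1) * maxFlux (m + 1) (m + 1) α = m * maxFlux 1 1 (α / (m + 1)) := by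
    rw [h6]
    field_simp
  rw [h8]
  simp only [waveFlux]
  nlinarith

theorem maxFlux_self_pos {m : ℕ} (hm : 2 ≤ m) {α : ℝ} (hα : 0 < α) (hαπ : α < π) :
    0 < maxFlux m m α := by
  have hm0 : (2 : ℝ) ≤ m := by exact_mod_cast hm
  obtain ⟨M, hM, rfl, -, h⟩ := exists_edge_div hα hαπ (by omega : 1 ≤ m)
  have hT := edgeT_pos hM
  have hM0 := edge_extremum_pos hM (by nlinarith)
  have := strictMonoOn_edgeF (show -3 < (0 : ℝ) by norm_num) hM hM0
  rw [edgeF_zero] at this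
  rw [h]
  positivity

/-- The centre of the profile is a trough of the wave for even m and a crest for odd m; the other
extremum lies half a period away and is still interior because m ≥ 1. -/
theorem exists_wave_extrema {m : ℕ} (hm : 1 ≤ m) {κ x : ℝ} (hw : WaveParam κ x) :
    (∃ θ ∈ Ioo (-waveHalf m κ x) (waveHalf m κ x),
      wave κ x (θ + m * halfPeriod κ x) = 6 * κ / scale κ x * (0 - sin x ^ 2)) ∧
    ∃ θ ∈ Ioo (-waveHalf m κ x) (waveHalf m κ x),
      wave κ x (θ + m * halfPeriod κ x) = 6 * κ / scale κ x * (1 - sin x ^ 2) := by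
  have hm0 : (1 : ℝ) ≤ m := by exact_mod_cast hm
  have hT := hw.halfPeriod_pos
  have hN := hw.negHalf_pos
  have hlt : halfPeriod κ x < waveHalf m κ x := by
    unfold waveHalf
    nlinarith
  have h0 : wave κ x 0 = 6 * κ / scale κ x * (0 - sin x ^ 2) := by
    have := wave_sqrt_mul_kInt hw.pos.le hw.scale_pos 0
    simpa [kInt_zero] using this
  have h1 : wave κ x (halfPeriod κ x) = 6 * κ / scale κ x * (1 - sin x ^ 2) := by
    have := wave_sqrt_mul_kInt hw.pos.le hw.scale_pos (π / 2)
    rwa [sin_pi_div_two, one_pow] at this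
  have hper : ∀ θ (n : ℤ), wave κ x (θ + 2 * n * halfPeriod κ x) = wave κ x θ :=
    wave_add_period hw.pos.le hw.scale_pos
  obtain ⟨n, rfl | rfl⟩ := m.even_or_odd'
  · refine ⟨⟨0, ⟨by linarith, by linarith⟩, ?_⟩, ⟨halfPeriod κ x, ⟨by linarith, hlt⟩, ?_⟩⟩
    · rw [← h0, ← hper 0 n]
      push_cast
      rfl
    · rw [← h1, ← hper (halfPeriod κ x) n]
      push_cast
      rfl
  · refine ⟨⟨-halfPeriod κ x, ⟨by linarith, by linarith⟩, ?_⟩, ⟨0, ⟨by linarith, by linarith⟩, ?_⟩⟩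
    · rw [← h0, ← hper 0 n]
      push_cast
      congr 1
      ring
    · rw [← h1, ← hper (halfPeriod κ x) n]
      push_cast
      congr 1
      ring

theorem wave_mem_Icc {κ x : ℝ} (hw : WaveParam κ x) (θ : ℝ) :
    wave κ x θ ∈ Icc (6 * κ / scale κ x * (0 - sin x ^ 2))
      (6 * κ / scale κ x * (1 - sin x ^ 2)) := by
  have hκ := hw.pos
  have hs := hw.scale_pos
  unfold wave
  constructor <;> gcongr
  · positivity
  · exact sin_sq_le_one _

/-- The range of the profile reveals the parameters: its width is 6κ/s, its minimum then gives sin²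
x, and the definition of s is a linear equation for κ. -/
theorem WaveParam.eq_of_wave_eq {m : ℕ} (hm : 1 ≤ m) {κ x κ' x' : ℝ} (hw : WaveParam κ x)
    (hw' : WaveParam κ' x') (hα : waveHalf m κ x = waveHalf m κ' x')
    (h : ∀ θ ∈ Ioo (-waveHalf m κ x) (waveHalf m κ x),
      wave κ x (θ + m * halfPeriod κ x) = wave κ' x' (θ + m * halfPeriod κ' x')) : κ = κ' := by
  obtain ⟨⟨θ₁, h1, e1⟩, ⟨θ₂, h2, e2⟩⟩ := exists_wave_extrema hm hw
  obtain ⟨⟨θ₃, h3, e3⟩, ⟨θ₄, h4, e4⟩⟩ := exists_wave_extrema hm hw'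
  rw [← hα] at h3 h4
  have i1 := (wave_mem_Icc hw' (θ₁ + m * halfPeriod κ' x')).1
  have i2 := (wave_mem_Icc hw' (θ₂ + m * halfPeriod κ' x')).2
  have i3 := (wave_mem_Icc hw (θ₃ + m * halfPeriod κ x)).1
  have i4 := (wave_mem_Icc hw (θ₄ + m * halfPeriod κ x)).2
  rw [← h θ₁ h1, e1] at i1
  rw [← h θ₂ h2, e2] at i2
  rw [h θ₃ h3, e3] at i3
  rw [h θ₄ h4, e4] at i4
  have hs := hw.scale_pos
  have hs' := hw'.scale_pos
  have hκ := hw.pos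
  have hκ' := hw'.pos
  have hp : 0 < 6 * κ / scale κ x := by positivity
  have hpe : 6 * κ / scale κ x = 6 * κ' / scale κ' x' := by linarith
  have hse : sin x ^ 2 = sin x' ^ 2 := by
    rw [← hpe] at i1 i3
    have i5 := le_antisymm i1 i3
    have := mul_left_cancel₀ hp.ne' i5
    linarith
  set p := 6 * κ / scale κ x with hpdef
  have e5 : 6 * κ = p * (1 - κ + 3 * κ * sin x ^ 2) := by
    rw [hpdef, ← scale]
    field_simp
  have e6 : 6 * κ' = p * (1 - κ' + 3 * κ' * sin x ^ 2) := by
    rw [hse, ← scale, hpe]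
    field_simp
  have e7 : κ * (6 + p - 3 * p * sin x ^ 2) = p := by linarith
  have e8 : κ' * (6 + p - 3 * p * sin x ^ 2) = p := by linarith
  have hne : 6 + p - 3 * p * sin x ^ 2 ≠ 0 := by
    intro h0
    rw [h0, mul_zero] at e7
    exact hp.ne e7
  exact mul_right_cancel₀ hne (e7.trans e8.symm)

/-- Along the family the flux starts at the maximum of type (m, m), exceeds Φ at some κ₁ and finally
tends to -∞, so Φ is taken on both sides of κ₁. The profiles are even, and equal profiles would have
equal κ; hence neither equality nor reflection can identify the two flows. -/
theorem exists_two_succ_right {m : ℕ} (hm : 1 ≤ m) {α : ℝ} (hα : 0 < α) (hαπ : α < π)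
    (hα1 : m = 1 → α ≤ π / 2) {Φ : ℝ} (h1 : maxFlux m m α < Φ) (h2 : Φ < maxFlux m (m + 1) α) :
    ∃ u v, (IsOfType α m (m + 1) u ∧ flux α u = Φ) ∧ (IsOfType α m (m + 1) v ∧ flux α v = Φ) ∧
      ¬ EqOn u v (sector α) ∧ ¬ EqOn u (reflect v) (sector α) := by
  have hαm : α ≤ m * (π / 2) := by
    rcases hm.eq_or_lt with rfl | hm2
    · simpa using hα1 rfl
    · have : (2 : ℝ) ≤ m := by exact_mod_cast hm2
      nlinarith [pi_pos]
  obtain ⟨κ₀, X, h, hall, -, hlim⟩ := exists_complete_waveFamily hm hα hαπ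
  replace hlim := hlim hαm
  obtain ⟨_, hmem, hlt⟩ := exists_lt_of_lt_csSup (isLUB_maxFlux_succ_right hm hα hαπ).1 h2
  rw [h.fluxSet_eq hm hα hαπ hall] at hmem
  obtain ⟨κ₁, hκ₁, rfl⟩ := hmem
  simp only at hlt
  obtain ⟨κ₂, hκ₂, hF₂⟩ := h.exists_flux_eq (Φ := Φ / 2) (le_of_lt hκ₁) (by linarith)
  obtain ⟨κ₃, hκ₃, hF₃⟩ := intermediate_value_Icc (le_of_lt hκ₁)
    (h.continuousOn_flux.mono Icc_subset_Ici_self)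
    (show Φ / 2 ∈ Icc _ _ from ⟨by linarith, by linarith⟩)
  simp only at hF₃
  have hκ₃0 : κ₀ < κ₃ := by
    refine lt_of_le_of_ne hκ₃.1 ?_
    rintro rfl
    linarith
  have hκ₂0 : κ₀ < κ₂ := lt_trans hκ₁ hκ₂
  have hne : κ₃ ≠ κ₂ := (hκ₃.2.trans_lt hκ₂).ne
  have hex : ∀ κ, κ₀ < κ → waveFlux m κ (X κ) = Φ / 2 →
      ∃ u, (IsOfType α m (m + 1) u ∧ flux α u = Φ) ∧ ∀ θ ∈ Icc (-α) α,
        profile u θ = wave κ (X κ) (θ + m * halfPeriod κ (X κ)) := by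
    intro κ hκ hF
    have hJ := (h.param κ hκ).isJHType_lt m
    have hh : m * halfPeriod κ (X κ) + negHalf κ (X κ) = α := h.half κ hκ.le
    rw [hh] at hJ
    obtain ⟨u, hu, hup, huf⟩ := hJ.1.exists_isOfType hα hαπ
    refine ⟨u, ⟨hu, ?_⟩, hup⟩
    rw [huf, hJ.2]
    change 2 * waveFlux m κ (X κ) = Φ
    linarith
  obtain ⟨u, hu, hup⟩ := hex κ₃ hκ₃0 hF₃
  obtain ⟨v, hv, hvp⟩ := hex κ₂ hκ₂0 hF₂
  have hw₃ := h.param κ₃ hκ₃0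
  have hw₂ := h.param κ₂ hκ₂0
  have hα₃ := h.half κ₃ hκ₃0.le
  have hα₂ := h.half κ₂ hκ₂0.le
  refine ⟨u, v, hu, hv, fun he => ?_, fun he => ?_⟩
  · rw [eqOn_sector_iff hα hαπ hu.1.solution hv.1.solution] at he
    refine hne (hw₃.eq_of_wave_eq hm hw₂ (hα₃.trans hα₂.symm) fun θ hθ => ?_)
    rw [hα₃] at hθ
    rw [← hup θ (Ioo_subset_Icc_self hθ), ← hvp θ (Ioo_subset_Icc_self hθ), he θ hθ]
  · rw [eqOn_reflect_iff hα hαπ hu.1.solution hv.1.solution] at he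
    refine hne (hw₃.eq_of_wave_eq hm hw₂ (hα₃.trans hα₂.symm) fun θ hθ => ?_)
    rw [hα₃] at hθ
    rw [← hup θ (Ioo_subset_Icc_self hθ), he θ hθ, hvp (-θ) ⟨by linarith [hθ.2], by linarith [hθ.1]⟩]
    have h3 := wave_add_period hw₂.pos.le hw₂.scale_pos (θ - m * halfPeriod κ₂ (X κ₂)) m
    rw [show -θ + m * halfPeriod κ₂ (X κ₂) = -(θ - m * halfPeriod κ₂ (X κ₂)) by ring,
      wave_neg hw₂.pos.le, ← h3, ← halfPeriod]
    congr 1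
    push_cast
    ring

/-! ### Type (m + 1, m) -/

theorem WaveParam.mem_fluxSet_succ_left {κ x : ℝ} (hw : WaveParam κ x) {m : ℕ} {α : ℝ}
    (hα : 0 < α) (hαπ : α < π) (h : (m + 1) * halfPeriod κ x - negHalf κ x = α) :
    2 * ((m + 1) * halfFlux κ x - negFlux κ x) ∈ fluxSet (m + 1) m α := by
  rw [fluxSet_eq hα hαπ]
  have h1 := hw.isJHType_gt m
  rw [h] at h1
  exact ⟨_, h1.1, h1.2⟩

/-- The difference is half the flux of a positive arc, an integral over [x, π/2]; discarding the
subtracted sin² x leaves √κ l ≤ 1 times 6√κ K. -/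
theorem WaveParam.halfFlux_sub_negFlux_le {κ x : ℝ} (hw : WaveParam κ x) :
    halfPeriod κ x * (halfFlux κ x - negFlux κ x) ≤ 6 * (√κ * kInt κ (π / 2)) := by
  have hκ := hw.pos
  have hs := sqrt_pos.2 hw.scale_pos
  have hK := kInt_pos hκ.le (show 0 < π / 2 by positivity)
  have hk := kInt_strictMono hκ.le hw.mem.2
  have hl := lInt_mul_sqrt_le hκ.le
  have hlx := lInt_pos hκ.le hw.mem.1 hw.mem.2.le
  have e : halfPeriod κ x * (halfFlux κ x - negFlux κ x) =
      6 * κ * kInt κ (π / 2) * (lInt κ (π / 2) - lInt κ x -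
        sin x ^ 2 * (kInt κ (π / 2) - kInt κ x)) := by
    rw [halfPeriod, halfFlux, negFlux, jInt, jInt]
    field_simp
    ring
  have h1 : lInt κ (π / 2) - lInt κ x - sin x ^ 2 * (kInt κ (π / 2) - kInt κ x) ≤
      lInt κ (π / 2) := by
    have : 0 ≤ sin x ^ 2 * (kInt κ (π / 2) - kInt κ x) :=
      mul_nonneg (sq_nonneg _) (by linarith)
    linarith
  rw [e]
  calc _ ≤ 6 * κ * kInt κ (π / 2) * lInt κ (π / 2) := mul_le_mul_of_nonneg_left h1 (by positivity)
    _ = 6 * (√κ * kInt κ (π / 2)) * (√κ * lInt κ (π / 2)) := by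
        have : √κ * √κ = κ := mul_self_sqrt hκ.le
        linear_combination -6 * kInt κ (π / 2) * lInt κ (π / 2) * this
    _ ≤ 6 * (√κ * kInt κ (π / 2)) * 1 := mul_le_mul_of_nonneg_left hl (by positivity)
    _ = _ := mul_one _

/-- With y = √κ K, T times half the flux is at most m(12y - 2y²) plus a constant: the extra positive
arc contributes only linearly in y and is absorbed by the -y² of the m full periods. Finally α ≤ (m
+ 1)T bounds 1/T. -/
theorem bddAbove_fluxSet_succ_left {m : ℕ} (hm : 1 ≤ m) {α : ℝ} (hα : 0 < α) (hαπ : α < π) :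
    BddAbove (fluxSet (m + 1) m α) := by
  have hm0 : (1 : ℝ) ≤ m := by exact_mod_cast hm
  refine ⟨2 * (2 * m * (9 + (π / 2) ^ 2) * (m + 1) / α), fun Φ hΦ => ?_⟩
  rw [fluxSet_eq hα hαπ] at hΦ
  obtain ⟨f, hf, rfl⟩ := hΦ
  obtain ⟨κ, x, hw, hx, hflux⟩ := hf.eq_wave_gt hm
  rw [hflux]
  have hT := hw.halfPeriod_pos
  have hN := hw.negHalf_pos
  have h1 := hw.halfFlux_sub_negFlux_le
  have h2 := halfPeriod_mul_halfFlux hw.scale_pos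
  have h3 := fluxCoeff_le hw.pos.le
  set y := √κ * kInt κ (π / 2) with hy
  set T := halfPeriod κ x with hTdef
  have hy0 : 0 ≤ y := mul_nonneg (sqrt_nonneg _) (kInt_pos hw.pos.le (by positivity)).le
  have h4 : T * ((m + 1) * halfFlux κ x - negFlux κ x) ≤ 2 * m * (9 + (π / 2) ^ 2) := by
    have e : T * ((m + 1) * halfFlux κ x - negFlux κ x) =
        m * (T * halfFlux κ x) + T * (halfFlux κ x - negFlux κ x) := by ring
    rw [e, h2]
    have h5 : m * (2 * fluxCoeff κ - 2 * T ^ 2) ≤ m * (2 * (3 * y + (π / 2) ^ 2 - y ^ 2)) := by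
      refine mul_le_mul_of_nonneg_left ?_ (by linarith)
      nlinarith [sq_nonneg T]
    have h6 : 6 * y ≤ m * (6 * y) := le_mul_of_one_le_left (by linarith) hm0
    have h7 : m * (12 * y - 2 * y ^ 2) ≤ m * 18 := by
      refine mul_le_mul_of_nonneg_left ?_ (by linarith)
      nlinarith [sq_nonneg (y - 3)]
    linarith
  refine mul_le_mul_of_nonneg_left ?_ (by norm_num)
  rw [le_div_iff₀ hα]
  have hB : 0 ≤ 2 * m * (9 + (π / 2) ^ 2) := by positivity
  rcases le_or_gt ((m + 1) * halfFlux κ x - negFlux κ x) 0 with h0 | h0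
  · have : ((m + 1) * halfFlux κ x - negFlux κ x) * α ≤ 0 := mul_nonpos_of_nonpos_of_nonneg h0 hα.le
    have : 0 ≤ 2 * m * (9 + (π / 2) ^ 2) * (m + 1) := by positivity
    linarith
  · have hαT : α ≤ (m + 1) * T := by linarith
    calc ((m + 1) * halfFlux κ x - negFlux κ x) * α
        ≤ ((m + 1) * halfFlux κ x - negFlux κ x) * ((m + 1) * T) := by gcongr
      _ = T * ((m + 1) * halfFlux κ x - negFlux κ x) * (m + 1) := by ring
      _ ≤ _ := by gcongr

/-- The edge flow of type (m+1, m+1) has x = 0 and the right length. For small x > 0 the lengths at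
κ₀ - η and κ₀ + η still enclose α, so some κ between them gives a genuine flow of type (m+1, m), and
continuity of the flux keeps it above c. -/
theorem exists_mem_fluxSet_succ_left {m : ℕ} (hm : 1 ≤ m) {α : ℝ} (hα : 0 < α) (hαπ : α < π)
    {c : ℝ} (hc : c < maxFlux (m + 1) (m + 1) α) : ∃ Φ ∈ fluxSet (m + 1) m α, c < Φ := by
  have hm0 : (1 : ℝ) ≤ m := by exact_mod_cast hm
  have hmp : (0 : ℝ) < m + 1 := by linarith
  have hτ : α / (m + 1) < π / 2 := by
    rw [div_lt_iff₀ hmp]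
    nlinarith
  obtain ⟨κ₀, ⟨h0, h1⟩, hκ₀⟩ := exists_halfPeriod_low (div_pos hα hmp) hτ.le
  have h0' : 0 < κ₀ := by
    refine lt_of_le_of_ne h0 ?_
    rintro rfl
    rw [halfPeriod_zero_left] at hκ₀
    exact hτ.ne hκ₀.symm
  have hκα : (m + 1) * halfPeriod κ₀ 0 = α := by
    rw [hκ₀]
    field_simp
  have hmax : maxFlux (m + 1) (m + 1) α = 2 * ((m + 1) * halfFlux κ₀ 0) := by
    have := maxFlux_self (neg_three_lt_low h0 h1) (show 1 ≤ m + 1 by omega)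
      (by rw [edgeT_low h0 h1]; push_cast; rwa [hκα])
    rw [edgeT_low h0 h1] at this
    push_cast at this
    rw [hκα, edgeF_low h0 h1] at this
    rw [this]
    ring
  set P : ℝ × ℝ → ℝ := fun p => (m + 1) * halfFlux p.1 p.2 - negFlux p.1 p.2 with hP
  have hPc : ContinuousAt P (κ₀, 0) := by
    have h2 : ContinuousOn P {p | 0 ≤ p.1 ∧ 0 < scale p.1 p.2} :=
      (continuousOn_halfFlux.const_smul (m + 1 : ℝ)).sub continuousOn_negFlux
    refine h2.continuousAt ?_
    have h3 : ∀ᶠ p : ℝ × ℝ in 𝓝 (κ₀, 0), 0 < p.1 :=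
      (continuous_fst.tendsto _).eventually_const_lt h0'
    have h4 : ∀ᶠ p : ℝ × ℝ in 𝓝 (κ₀, 0), 0 < scale p.1 p.2 :=
      (continuous_scale.tendsto _).eventually_const_lt (by rw [scale_zero]; linarith)
    filter_upwards [h3, h4] with p h5 h6 using ⟨h5.le, h6⟩
  have hP0 : c / 2 < P (κ₀, 0) := by
    have : P (κ₀, 0) = (m + 1) * halfFlux κ₀ 0 := by
      simp [hP, negFlux, jInt, kInt_zero, lInt_zero]
    linarith
  obtain ⟨r, hr, hball⟩ := Metric.eventually_nhds_iff.1 (hPc.eventually_const_lt hP0)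
  obtain ⟨η, hη, hηr, hη0, hη1⟩ : ∃ η, 0 < η ∧ η < r ∧ η < κ₀ ∧ η < 1 - κ₀ := by
    obtain ⟨η, hη, hlt⟩ := exists_between (lt_min hr (lt_min h0' (sub_pos.2 h1)))
    simp only [lt_min_iff] at hlt
    exact ⟨η, hη, hlt.1, hlt.2.1, hlt.2.2⟩
  set S : ℝ → ℝ → ℝ := fun κ x => (m + 1) * halfPeriod κ x - negHalf κ x with hS
  have hSc : ContinuousOn (fun p : ℝ × ℝ => S p.1 p.2) {p | 0 ≤ p.1} :=
    (continuousOn_halfPeriod.const_smul (m + 1 : ℝ)).sub continuousOn_negHalf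
  have hSx : ∀ κ, 0 ≤ κ → Continuous (S κ) := fun κ hκ => by
    rw [← continuousOn_univ]
    exact hSc.comp (f := fun x => (κ, x)) (by fun_prop) fun _ _ => hκ
  have hS0 : ∀ κ, S κ 0 = (m + 1) * halfPeriod κ 0 := fun κ => by
    simp [hS, negHalf_zero_right]
  have hl : α < S (κ₀ - η) 0 := by
    rw [hS0, ← hκα]
    exact mul_lt_mul_of_pos_left
      (halfPeriod_zero_lt_of_lt (by linarith) (by linarith) (by linarith)) hmp
  have hu : S (κ₀ + η) 0 < α := by
    rw [hS0, ← hκα]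
    exact mul_lt_mul_of_pos_left (halfPeriod_zero_lt_of_lt h0 h1 (by linarith)) hmp
  have e1 : ∀ᶠ x in 𝓝[>] (0 : ℝ), α < S (κ₀ - η) x :=
    ((hSx (κ₀ - η) (by linarith)).continuousAt.eventually_const_lt hl).filter_mono
      nhdsWithin_le_nhds
  have e2 : ∀ᶠ x in 𝓝[>] (0 : ℝ), S (κ₀ + η) x < α :=
    ((hSx (κ₀ + η) (by linarith)).continuousAt.eventually_lt_const hu).filter_mono
      nhdsWithin_le_nhds
  obtain ⟨x, hx1, hx2, hx3⟩ := (e1.and (e2.and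
    (Ioo_mem_nhdsGT (lt_min hr (show 0 < π / 2 by positivity))))).exists
  obtain ⟨κ, hκ, hκS⟩ := intermediate_value_Icc' (show κ₀ - η ≤ κ₀ + η by linarith)
    (hSc.comp (f := fun κ => (κ, x)) (s := Icc (κ₀ - η) (κ₀ + η)) (by fun_prop)
      fun κ hκ => show 0 ≤ κ by linarith [hκ.1])
    ⟨hx2.le, hx1.le⟩
  have hκ0 : 0 < κ := by linarith [hκ.1]
  have hw : WaveParam κ x := ⟨hκ0, ⟨hx3.1, hx3.2.trans_le (min_le_right _ _)⟩,
    lt_of_lt_of_le (by linarith [hκ.2]) (scale_zero_le hκ0.le x)⟩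
  refine ⟨_, hw.mem_fluxSet_succ_left hα hαπ hκS, ?_⟩
  have := hball (y := (κ, x)) (by
    rw [Prod.dist_eq, max_lt_iff, Real.dist_eq, Real.dist_eq, sub_zero, abs_of_pos hx3.1, abs_lt]
    exact ⟨⟨by linarith [hκ.1], by linarith [hκ.2]⟩, hx3.2.trans_le (min_le_left _ _)⟩)
  simp only [hP] at this
  linarith

theorem isLUB_maxFlux_succ_left {m : ℕ} (hm : 1 ≤ m) {α : ℝ} (hα : 0 < α) (hαπ : α < π) :
    (fluxSet (m + 1) m α).Nonempty ∧ IsLUB (fluxSet (m + 1) m α) (maxFlux (m + 1) m α) := by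
  obtain ⟨Φ, hΦ, -⟩ := exists_mem_fluxSet_succ_left hm hα hαπ (sub_one_lt _)
  exact isLUB_maxFlux ⟨Φ, hΦ⟩ (bddAbove_fluxSet_succ_left hm hα hαπ)

theorem maxFlux_self_le_succ_left {m : ℕ} (hm : 1 ≤ m) {α : ℝ} (hα : 0 < α) (hαπ : α < π) :
    maxFlux (m + 1) (m + 1) α ≤ maxFlux (m + 1) m α := by
  refine le_of_forall_lt fun c hc => ?_
  obtain ⟨Φ, hΦ, hlt⟩ := exists_mem_fluxSet_succ_left hm hα hαπ hc
  exact hlt.trans_le ((isLUB_maxFlux_succ_left hm hα hαπ).2.1 hΦ)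

/-! ### Asymptotics of the maximal flux of type (1, 0) -/

/-- The moments `∫ uⁿ / √(1 - u⁴)` of the lemniscate. -/
noncomputable def lemniscateInt (n : ℕ) : ℝ :=
  ∫ ψ in (0 : ℝ)..π / 2, cos ψ ^ n * (√(1 + cos ψ ^ 2))⁻¹

theorem sqrt_one_add_cos_sq_pos (ψ : ℝ) : 0 < √(1 + cos ψ ^ 2) := sqrt_pos.2 (by positivity)

theorem continuous_lemniscate (n : ℕ) : Continuous fun ψ => cos ψ ^ n * (√(1 + cos ψ ^ 2))⁻¹ :=
  Continuous.mul (by fun_prop) (Continuous.inv₀ (by fun_prop)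
    fun ψ => (sqrt_one_add_cos_sq_pos ψ).ne')

theorem lemniscateInt_nonneg (n : ℕ) : 0 ≤ lemniscateInt n := by
  refine intervalIntegral.integral_nonneg (by positivity) fun ψ hψ => ?_
  have h1 : 0 ≤ cos ψ := cos_nonneg_of_mem_Icc ⟨by linarith [hψ.1, pi_pos], hψ.2⟩
  have := sqrt_one_add_cos_sq_pos ψ
  positivity

theorem lemniscateInt_succ_le (n : ℕ) : lemniscateInt (n + 1) ≤ lemniscateInt n :=
  integral_le_of_cos_pos ((continuous_lemniscate _).intervalIntegrable _ _)
    ((continuous_lemniscate _).intervalIntegrable _ _) fun ψ hψ => by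
      have := sqrt_one_add_cos_sq_pos ψ
      rw [pow_succ]
      have h1 : cos ψ ^ n * cos ψ ≤ cos ψ ^ n := mul_le_of_le_one_right (by positivity) (cos_le_one ψ)
      gcongr

theorem hasDerivAt_sqrt_one_add_cos_sq (ψ : ℝ) :
    HasDerivAt (fun ψ => √(1 + cos ψ ^ 2)) (-(sin ψ * cos ψ) * (√(1 + cos ψ ^ 2))⁻¹) ψ := by
  have h : HasDerivAt (fun ψ => 1 + cos ψ ^ 2) (-(2 * cos ψ * sin ψ)) ψ := by
    refine (((hasDerivAt_cos ψ).pow 2).const_add 1).congr_deriv ?_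
    simp
  refine (h.sqrt (by positivity)).congr_deriv ?_
  have := sqrt_one_add_cos_sq_pos ψ
  field_simp

/-- Integrate the derivative of sin ψ cosⁿ⁺¹ ψ √(1 + cos² ψ), which vanishes at both ends. -/
theorem lemniscateInt_add_four (n : ℕ) :
    (n + 1) * lemniscateInt n = (n + 3) * lemniscateInt (n + 4) := by
  have hd : ∀ ψ ∈ uIcc 0 (π / 2), HasDerivAt
      (fun ψ => sin ψ * cos ψ ^ (n + 1) * √(1 + cos ψ ^ 2))
      ((n + 3) * (cos ψ ^ (n + 4) * (√(1 + cos ψ ^ 2))⁻¹) -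
        (n + 1) * (cos ψ ^ n * (√(1 + cos ψ ^ 2))⁻¹)) ψ := by
    intro ψ _
    have h1 : HasDerivAt (fun ψ => cos ψ ^ (n + 1)) ((n + 1) * cos ψ ^ n * -sin ψ) ψ := by
      refine ((hasDerivAt_cos ψ).pow (n + 1)).congr_deriv ?_
      simp
    have h2 : HasDerivAt (fun ψ => sin ψ * cos ψ ^ (n + 1)) _ ψ := (hasDerivAt_sin ψ).mul h1
    refine (h2.mul (hasDerivAt_sqrt_one_add_cos_sq ψ)).congr_deriv ?_
    have h3 := sqrt_one_add_cos_sq_pos ψ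
    have h4 : √(1 + cos ψ ^ 2) ^ 2 = 1 + cos ψ ^ 2 := sq_sqrt (by positivity)
    have h5 := sin_sq ψ
    field_simp
    rw [h4]
    simp only [pow_succ]
    linear_combination (-(n + 1) * cos ψ ^ n * (1 + cos ψ ^ 2) - cos ψ ^ n * cos ψ ^ 2) * h5
  have h := intervalIntegral.integral_eq_sub_of_hasDerivAt hd
    ((((continuous_lemniscate (n + 4)).const_mul _).sub
      ((continuous_lemniscate n).const_mul _)).intervalIntegrable _ _)
  rw [intervalIntegral.integral_sub
    (((continuous_lemniscate (n + 4)).const_mul _).intervalIntegrable _ _)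
    (((continuous_lemniscate n).const_mul _).intervalIntegrable _ _),
    intervalIntegral.integral_const_mul, intervalIntegral.integral_const_mul] at h
  simp only [cos_pi_div_two, sin_zero, zero_mul, ne_eq, Nat.add_eq_zero_iff, one_ne_zero, and_false,
    not_false_eq_true, zero_pow, mul_zero, sub_self] at h
  unfold lemniscateInt
  linarith

theorem lemniscateInt_one : lemniscateInt 1 = π / 4 := by
  have hlt : ∀ ψ, sin ψ / √2 ∈ Ioo (-1 : ℝ) 1 := by
    intro ψ
    have h2 : 1 < √2 := by
      rw [lt_sqrt] <;> norm_num
    constructor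
    · rw [lt_div_iff₀ (by positivity)]
      linarith [neg_one_le_sin ψ]
    · rw [div_lt_one (by positivity)]
      linarith [sin_le_one ψ]
  have hd : ∀ ψ ∈ uIcc 0 (π / 2), HasDerivAt (fun ψ => arcsin (sin ψ / √2))
      (cos ψ ^ 1 * (√(1 + cos ψ ^ 2))⁻¹) ψ := by
    intro ψ _
    have h1 := (hasDerivAt_arcsin (hlt ψ).1.ne' (hlt ψ).2.ne).comp ψ
      ((hasDerivAt_sin ψ).div_const (√2))
    refine h1.congr_deriv ?_
    have h2 : 0 < √2 := by positivity
    have h22 : √2 ^ 2 = 2 := sq_sqrt (by norm_num)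
    have h3 : √(1 - (sin ψ / √2) ^ 2) = √(1 + cos ψ ^ 2) / √2 := by
      rw [← sqrt_div (by positivity)]
      congr 1
      rw [div_pow, h22, cos_sq']
      ring
    have h4 := sqrt_one_add_cos_sq_pos ψ
    rw [h3]
    field_simp
  have h := intervalIntegral.integral_eq_sub_of_hasDerivAt hd
    ((continuous_lemniscate 1).intervalIntegrable _ _)
  rw [lemniscateInt, h, sin_pi_div_two, sin_zero, zero_div, arcsin_zero, sub_zero]
  refine arcsin_eq_of_sin_eq ?_ ⟨by linarith [pi_pos], by linarith [pi_pos]⟩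
  rw [sin_pi_div_four]
  have h22 : √2 * √2 = 2 := mul_self_sqrt (by norm_num)
  field_simp
  linarith

theorem lemniscateInt_three : lemniscateInt 3 = 1 / 2 := by
  have hd : ∀ ψ ∈ uIcc 0 (π / 2), HasDerivAt (fun ψ => sin ψ * √(1 + cos ψ ^ 2) / 2)
      (cos ψ ^ 3 * (√(1 + cos ψ ^ 2))⁻¹) ψ := by
    intro ψ _
    refine (((hasDerivAt_sin ψ).mul (hasDerivAt_sqrt_one_add_cos_sq ψ)).div_const 2).congr_deriv ?_
    have h3 := sqrt_one_add_cos_sq_pos ψ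
    have h4 : √(1 + cos ψ ^ 2) ^ 2 = 1 + cos ψ ^ 2 := sq_sqrt (by positivity)
    have h5 := sin_sq ψ
    field_simp
    rw [h4, h5]
    ring
  have h := intervalIntegral.integral_eq_sub_of_hasDerivAt hd
    ((continuous_lemniscate 3).intervalIntegrable _ _)
  rw [lemniscateInt, h]
  simp

/-- A Wallis-type evaluation. -/
theorem lemniscateInt_zero_mul_two : lemniscateInt 0 * lemniscateInt 2 = π / 4 := by
  -- The recurrence makes Q periodic with period 2, and the monotonicity of the moments gives Q(n+1)
  -- ≤ (1 + 1/(n+1)) Q(n). Letting n grow along each parity forces Q(0) = Q(1), and Q(1) consists of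
  -- the two elementary moments.
  set Q : ℕ → ℝ := fun n => (n + 1) * lemniscateInt n * lemniscateInt (n + 2) with hQ
  have hQ2 : ∀ n, Q (n + 2) = Q n := by
    intro n
    have := lemniscateInt_add_four n
    simp only [hQ]
    push_cast
    rw [show n + 2 + 2 = n + 4 by ring, this]
    ring
  have hQ0 : ∀ j, Q (2 * j) = Q 0 := by
    intro j
    induction j with
    | zero => rfl
    | succ j ih => rw [show 2 * (j + 1) = 2 * j + 2 by ring, hQ2, ih]
  have hQ1 : ∀ j, Q (2 * j + 1) = Q 1 := by
    intro j
    induction j with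
    | zero => rfl
    | succ j ih => rw [show 2 * (j + 1) + 1 = 2 * j + 1 + 2 by ring, hQ2, ih]
  have hle : ∀ n : ℕ, Q (n + 1) ≤ (1 + 1 / ((n : ℝ) + 1)) * Q n := by
    intro n
    have h1 := lemniscateInt_succ_le n
    have h2 := lemniscateInt_succ_le (n + 2)
    have h3 := lemniscateInt_nonneg (n + 3)
    have h4 := lemniscateInt_nonneg n
    have e : (1 + 1 / ((n : ℝ) + 1)) * Q n =
        (n + 2) * (lemniscateInt n * lemniscateInt (n + 2)) := by
      simp only [hQ]
      field_simp
      ring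
    rw [e]
    simp only [hQ]
    push_cast
    calc ((n : ℝ) + 1 + 1) * lemniscateInt (n + 1) * lemniscateInt (n + 1 + 2)
        = (n + 2) * (lemniscateInt (n + 1) * lemniscateInt (n + 3)) := by ring_nf
      _ ≤ (n + 2) * (lemniscateInt n * lemniscateInt (n + 2)) := by gcongr
  have hlim : ∀ c : ℝ, Tendsto (fun j : ℕ => (1 + 1 / ((j : ℝ) + 1)) * c) atTop (𝓝 c) := by
    intro c
    have := (tendsto_one_div_add_atTop_nhds_zero_nat (𝕜 := ℝ)).const_add 1 |>.mul_const c
    simpa using this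
  have hnn : ∀ n, 0 ≤ Q n := fun n =>
    mul_nonneg (mul_nonneg (by positivity) (lemniscateInt_nonneg _)) (lemniscateInt_nonneg _)
  have hmono : ∀ j n : ℕ, j ≤ n → ∀ k, (1 + 1 / ((n : ℝ) + 1)) * Q k ≤
      (1 + 1 / ((j : ℝ) + 1)) * Q k := by
    intro j n hjn k
    have := hnn k
    gcongr
  have h1 : Q 1 ≤ Q 0 := ge_of_tendsto' (hlim (Q 0)) fun j => by
    have := hle (2 * j)
    rw [hQ1, hQ0] at this
    exact this.trans (hmono j (2 * j) (by omega) 0)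
  have h2 : Q 0 ≤ Q 1 := ge_of_tendsto' (hlim (Q 1)) fun j => by
    have := hle (2 * j + 1)
    rw [show 2 * j + 1 + 1 = 2 * (j + 1) by ring, hQ1, hQ0] at this
    exact this.trans (hmono j (2 * j + 1) (by omega) 1)
  have h3 := le_antisymm h2 h1
  simp only [hQ, lemniscateInt_one] at h3
  norm_num at h3
  rw [h3, lemniscateInt_three]
  ring

section

variable {M : ℝ}

theorem one_le_one_add_cos_sq (ψ : ℝ) : 1 ≤ 1 + cos ψ ^ 2 := by nlinarith [sq_nonneg (cos ψ)]

theorem edge_le (hM : 0 < M) (ψ : ℝ) :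
    √6 / √(6 + M * (1 + cos ψ ^ 2)) ≤ √6 / √M * (√(1 + cos ψ ^ 2))⁻¹ := by
  have h := one_le_one_add_cos_sq ψ
  have h1 := sqrt_one_add_cos_sq_pos ψ
  have h2 := sqrt_pos.2 hM
  rw [← div_eq_mul_inv, div_div, ← sqrt_mul hM.le]
  refine div_le_div_of_nonneg_left (by positivity) (sqrt_pos.2 (by positivity)) (sqrt_le_sqrt ?_)
  linarith

theorem le_edge (hM : 0 < M) (ψ : ℝ) :
    √6 / √(M + 6) * (√(1 + cos ψ ^ 2))⁻¹ ≤ √6 / √(6 + M * (1 + cos ψ ^ 2)) := by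
  have h := one_le_one_add_cos_sq ψ
  have h1 := sqrt_one_add_cos_sq_pos ψ
  rw [← div_eq_mul_inv, div_div, ← sqrt_mul (by positivity)]
  refine div_le_div_of_nonneg_left (by positivity) (sqrt_pos.2 (by positivity)) (sqrt_le_sqrt ?_)
  linarith

theorem continuous_inv_sqrt_one_add_cos_sq : Continuous fun ψ : ℝ => (√(1 + cos ψ ^ 2))⁻¹ := by
  have := continuous_lemniscate 0
  simpa using this

theorem lemniscateInt_zero : lemniscateInt 0 = ∫ ψ in (0 : ℝ)..π / 2, (√(1 + cos ψ ^ 2))⁻¹ := by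
  simp [lemniscateInt]

/-- Between the denominators √M √(1 + cos²) and √(M + 6) √(1 + cos²) both integrals are multiples of
lemniscate moments, with product 6 · π/4 in the limit M → ∞. -/
theorem edgeT_mul_edgeF_bounds (hM : 0 < M) :
    3 * π / 2 * (1 - 6 / (M + 6)) ≤ edgeT M * edgeF M ∧ edgeT M * edgeF M ≤ 3 * π / 2 := by
  have hM3 : -3 < M := by linarith
  have hc := continuous_edge hM3
  have hl := continuous_inv_sqrt_one_add_cos_sq
  have hl2 := continuous_lemniscate 2
  have hA0 := lemniscateInt_nonneg 0
  have hA2 := lemniscateInt_nonneg 2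
  have hP := lemniscateInt_zero_mul_two
  have t1 : edgeT M ≤ √6 / √M * lemniscateInt 0 := by
    rw [lemniscateInt_zero, edgeT, ← intervalIntegral.integral_const_mul]
    exact integral_le_of_cos_pos (hc.intervalIntegrable _ _)
      ((hl.const_mul _).intervalIntegrable _ _) fun ψ _ => edge_le hM ψ
  have t2 : √6 / √(M + 6) * lemniscateInt 0 ≤ edgeT M := by
    rw [lemniscateInt_zero, edgeT, ← intervalIntegral.integral_const_mul]
    exact integral_le_of_cos_pos ((hl.const_mul _).intervalIntegrable _ _)
      (hc.intervalIntegrable _ _) fun ψ _ => le_edge hM ψ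
  have hce : Continuous fun ψ => cos ψ ^ 2 * (√6 / √(6 + M * (1 + cos ψ ^ 2))) := by fun_prop
  have f1 : edgeF M ≤ M * (√6 / √M * lemniscateInt 2) := by
    refine mul_le_mul_of_nonneg_left ?_ hM.le
    rw [lemniscateInt, ← intervalIntegral.integral_const_mul]
    refine integral_le_of_cos_pos (hce.intervalIntegrable _ _)
      ((hl2.const_mul _).intervalIntegrable _ _) fun ψ _ => ?_
    nlinarith [mul_le_mul_of_nonneg_left (edge_le hM ψ) (sq_nonneg (cos ψ))]
  have f2 : M * (√6 / √(M + 6) * lemniscateInt 2) ≤ edgeF M := by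
    refine mul_le_mul_of_nonneg_left ?_ hM.le
    rw [lemniscateInt, ← intervalIntegral.integral_const_mul]
    refine integral_le_of_cos_pos ((hl2.const_mul _).intervalIntegrable _ _)
      (hce.intervalIntegrable _ _) fun ψ _ => ?_
    nlinarith [mul_le_mul_of_nonneg_left (le_edge hM ψ) (sq_nonneg (cos ψ))]
  have h6 : √6 ^ 2 = 6 := sq_sqrt (by norm_num)
  have hM2 : √M ^ 2 = M := sq_sqrt hM.le
  have hM6 : √(M + 6) ^ 2 = M + 6 := sq_sqrt (by linarith)
  have hs := sqrt_pos.2 hM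
  have hs6 : 0 < √(M + 6) := sqrt_pos.2 (by linarith)
  constructor
  · calc 3 * π / 2 * (1 - 6 / (M + 6))
        = 6 / (M + 6) * M * (lemniscateInt 0 * lemniscateInt 2) := by
          rw [hP]
          field_simp
          ring
      _ = √6 / √(M + 6) * lemniscateInt 0 * (M * (√6 / √(M + 6) * lemniscateInt 2)) := by
          nth_rewrite 1 [← h6]
          nth_rewrite 1 [← hM6]
          ring
      _ ≤ _ := mul_le_mul t2 f2 (by positivity) (edgeT_pos hM3).le
  · calc edgeT M * edgeF M ≤ √6 / √M * lemniscateInt 0 * (M * (√6 / √M * lemniscateInt 2)) := by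
          refine mul_le_mul t1 f1 ?_ (by positivity)
          exact le_trans (by positivity) f2
      _ = 6 / M * M * (lemniscateInt 0 * lemniscateInt 2) := by
          nth_rewrite 3 [← h6]
          nth_rewrite 4 [← hM2]
          ring
      _ = 3 * π / 2 := by
          rw [hP]
          field_simp
          ring

theorem le_edgeT (hM : 0 < M) : √6 / √(6 + 2 * M) * (π / 2) ≤ edgeT M := by
  have h := integral_le_of_cos_pos (intervalIntegrable_const (c := √6 / √(6 + 2 * M)))
    ((continuous_edge (show -3 < M by linarith)).intervalIntegrable 0 (π / 2)) fun ψ _ => by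
      refine div_le_div_of_nonneg_left (by positivity) (sqrt_pos.2 (by positivity))
        (sqrt_le_sqrt ?_)
      nlinarith [cos_sq_le_one ψ]
  rw [intervalIntegral.integral_const] at h
  simp only [sub_zero, smul_eq_mul] at h
  rw [mul_comm]
  exact h

/-- The relative error 6/(M + 6) is at most α², because α is at least π/2 times √6/√(6 + 2M). -/
theorem abs_maxFlux_one_zero_sub_le {α : ℝ} (hα : 0 < α) (hα2 : α < π / 2) :
    |maxFlux 1 0 α - 3 * π / α| ≤ 3 * π * α := by
  obtain ⟨M, hM, rfl⟩ := exists_edgeT_eq hα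
  have hM0 := edge_extremum_pos hM hα2
  rw [maxFlux_one_zero hM hα2]
  obtain ⟨h1, h2⟩ := edgeT_mul_edgeF_bounds hM0
  have h3 := le_edgeT hM0
  set T := edgeT M with hT
  have h4 : 6 / (M + 6) ≤ T ^ 2 := by
    have h5 : (√6 / √(6 + 2 * M) * (π / 2)) ^ 2 ≤ T ^ 2 := by gcongr
    rw [mul_pow, div_pow, sq_sqrt (by norm_num), sq_sqrt (by linarith)] at h5
    refine le_trans ?_ h5
    have h6 : 2 ≤ (π / 2) ^ 2 := by nlinarith [pi_gt_three]
    calc 6 / (M + 6) ≤ 6 / (6 + 2 * M) * 2 := by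
          rw [div_mul_eq_mul_div, div_le_div_iff₀ (by linarith) (by linarith)]
          linarith
      _ ≤ _ := by gcongr
  have h5 : 2 * edgeF M - 3 * π / T = (2 * (T * edgeF M) - 3 * π) / T := by
    field_simp
  rw [h5, abs_div, abs_of_pos hα, div_le_iff₀ hα, abs_le]
  have hpi := pi_pos
  constructor
  · have := mul_le_mul_of_nonneg_left h4 (show 0 ≤ 3 * π by positivity)
    linarith
  · have : 0 ≤ 3 * π * T * T := by positivity
    linarith

theorem maxFlux_one_zero_isLittleO_zero :
    (fun α : ℝ => maxFlux 1 0 α - 3 * π / α) =o[𝓝[>] 0] (fun α : ℝ => 1 / α) := by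
  refine Asymptotics.isLittleO_iff.2 fun c hc => ?_
  have hpi := pi_pos
  filter_upwards [Ioo_mem_nhdsGT (show (0 : ℝ) < min 1 (c / (3 * π)) by positivity)] with α hα
  have h1 : α < 1 := hα.2.trans_le (min_le_left _ _)
  have h2 : α < c / (3 * π) := hα.2.trans_le (min_le_right _ _)
  have h3 := abs_maxFlux_one_zero_sub_le hα.1 (by linarith [pi_gt_three])
  rw [norm_eq_abs, norm_eq_abs, abs_of_pos (one_div_pos.2 hα.1)]
  refine h3.trans ?_
  rw [mul_one_div, le_div_iff₀ hα.1]
  rw [lt_div_iff₀ (by positivity)] at h2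
  have h4 : α * (α * (3 * π)) ≤ 1 * c := mul_le_mul h1.le h2.le (by have := hα.1; positivity) one_pos.le
  linarith

/-- With z = M(1 + cos² ψ)/6 this is the expansion of (1 + z)^(-1/2), with the remainder between 0
and z²/2; and z ≤ M/3. -/
theorem edge_expansion (hM : 0 < M) (hM1 : M ≤ 1) (ψ : ℝ) :
    1 - M * (1 + cos ψ ^ 2) / 12 ≤ √6 / √(6 + M * (1 + cos ψ ^ 2)) ∧
    √6 / √(6 + M * (1 + cos ψ ^ 2)) ≤ 1 - M * (1 + cos ψ ^ 2) / 12 + M ^ 2 / 18 := by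
  have hu1 := one_le_one_add_cos_sq ψ
  have hu2 : 1 + cos ψ ^ 2 ≤ 2 := by linarith [cos_sq_le_one ψ]
  set z := M * (1 + cos ψ ^ 2) / 6 with hz
  have hz0 : 0 ≤ z := by positivity
  have hzM : z ≤ M / 3 := by
    rw [hz]
    nlinarith
  have hz3 : z ≤ 1 / 3 := by linarith
  have e : √6 / √(6 + M * (1 + cos ψ ^ 2)) = 1 / √(1 + z) := by
    rw [show 6 + M * (1 + cos ψ ^ 2) = 6 * (1 + z) by rw [hz]; ring, sqrt_mul (by norm_num)]
    field_simp
  have hs : 0 < √(1 + z) := sqrt_pos.2 (by linarith)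
  have hs2 : √(1 + z) ^ 2 = 1 + z := sq_sqrt (by linarith)
  rw [e, show M * (1 + cos ψ ^ 2) / 12 = z / 2 by rw [hz]; ring]
  constructor
  · rw [le_div_iff₀ hs]
    refine le_of_pow_le_pow_left₀ two_ne_zero zero_le_one ?_
    rw [mul_pow, hs2]
    nlinarith [mul_nonneg (sq_nonneg z) (show 0 ≤ 3 - z by linarith)]
  · have h1 : 1 / √(1 + z) ≤ 1 - z / 2 + z ^ 2 / 2 := by
      rw [div_le_iff₀ hs]
      have h2 : 0 ≤ 1 - z / 2 + z ^ 2 / 2 := by nlinarith [sq_nonneg z]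
      refine le_of_pow_le_pow_left₀ two_ne_zero (mul_nonneg h2 hs.le) ?_
      rw [mul_pow, hs2]
      have e2 : (1 - z / 2 + z ^ 2 / 2) ^ 2 * (1 + z) =
          1 + z ^ 2 / 4 * (1 + 3 * z + z ^ 2 * (z - 1)) := by ring
      rw [e2, one_pow]
      have h3 : 0 ≤ 1 + 3 * z + z ^ 2 * (z - 1) := by
        nlinarith [mul_nonneg (sq_nonneg z) hz0, mul_nonneg hz0 (show 0 ≤ 1 - z by linarith)]
      have : 0 ≤ z ^ 2 / 4 * (1 + 3 * z + z ^ 2 * (z - 1)) := by positivity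
      linarith
    have h4 : z ^ 2 ≤ (M / 3) ^ 2 := by gcongr
    linarith

/-- To first order in M the integrand of the difference is M((4/3) cos² ψ - 2/3), which integrates
to zero on [0, π/2]; this cancellation produces the factor 8. The rest is of order M², and M is
comparable to π/2 - T. -/
theorem abs_edge_expansion_le (hM : 0 < M) (hM1 : M ≤ 1) :
    M / 24 ≤ π / 2 - edgeT M ∧ |2 * edgeF M - 8 * (π / 2 - edgeT M)| ≤ 2 * M ^ 2 := by
  have hM3 : -3 < M := by linarith
  have hc := continuous_edge hM3
  have hpi4 := pi_lt_four
  have hT : π / 2 - edgeT M = ∫ ψ in (0 : ℝ)..π / 2, (1 - √6 / √(6 + M * (1 + cos ψ ^ 2))) := by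
    rw [intervalIntegral.integral_sub intervalIntegrable_const (hc.intervalIntegrable _ _), edgeT]
    simp
  constructor
  · rw [hT]
    have h := integral_le_of_cos_pos (intervalIntegrable_const (c := M / 36))
      ((by fun_prop : Continuous fun ψ : ℝ =>
        1 - √6 / √(6 + M * (1 + cos ψ ^ 2))).intervalIntegrable 0 (π / 2)) fun ψ _ => by
          have h1 := (edge_expansion hM hM1 ψ).2
          have h2 := one_le_one_add_cos_sq ψ
          nlinarith
    rw [intervalIntegral.integral_const] at h
    simp only [sub_zero, smul_eq_mul] at h
    have := pi_gt_three
    nlinarith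
  · set e : ℝ → ℝ := fun ψ => 2 * (M * (cos ψ ^ 2 * (√6 / √(6 + M * (1 + cos ψ ^ 2))))) -
      8 * (1 - √6 / √(6 + M * (1 + cos ψ ^ 2))) - (M * 4 / 3 * cos ψ ^ 2 - M * 2 / 3) with he
    have hec : Continuous e := by fun_prop
    have hint : ∫ ψ in (0 : ℝ)..π / 2, e ψ = 2 * edgeF M - 8 * (π / 2 - edgeT M) := by
      rw [hT, edgeF, ← intervalIntegral.integral_const_mul, ← intervalIntegral.integral_const_mul,
        ← intervalIntegral.integral_const_mul, ← intervalIntegral.integral_sub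
        (Continuous.intervalIntegrable (by fun_prop) _ _)
        (Continuous.intervalIntegrable (by fun_prop) _ _), he,
        intervalIntegral.integral_sub (Continuous.intervalIntegrable (by fun_prop) _ _)
        (Continuous.intervalIntegrable (by fun_prop) _ _), sub_eq_self,
        intervalIntegral.integral_sub (Continuous.intervalIntegrable (by fun_prop) _ _)
        intervalIntegrable_const, intervalIntegral.integral_const_mul, integral_cos_sq,
        intervalIntegral.integral_const, cos_pi_div_two, sin_zero]
      simp only [smul_eq_mul]
      ring
    have hb := intervalIntegral.norm_integral_le_of_norm_le_const (a := 0) (b := π / 2) (f := e)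
      (C := M ^ 2) fun ψ _ => by
        obtain ⟨h1, h2⟩ := edge_expansion hM hM1 ψ
        have h3 := one_le_one_add_cos_sq ψ
        have h4 := cos_sq_le_one ψ
        have h5 := sq_nonneg (cos ψ)
        simp only [he]
        set y := √6 / √(6 + M * (1 + cos ψ ^ 2))
        have h6 : 0 ≤ M * cos ψ ^ 2 * (1 - y) := by
          have : 0 ≤ 1 - y := by nlinarith
          positivity
        have h7 : M * cos ψ ^ 2 * (1 - y) ≤ M ^ 2 / 6 := by
          have h8 : 1 - y ≤ M / 6 := by nlinarith
          have h9 : M * cos ψ ^ 2 ≤ M := mul_le_of_le_one_right hM.le h4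
          have h10 : 0 ≤ M * cos ψ ^ 2 := by positivity
          nlinarith
        rw [norm_eq_abs, abs_le]
        constructor <;> nlinarith
    rw [hint, norm_eq_abs, sub_zero, abs_of_pos (show 0 < π / 2 by positivity)] at hb
    nlinarith [sq_nonneg M]

theorem maxFlux_one_zero_isLittleO_pi_div_two :
    (fun α : ℝ => maxFlux 1 0 α - 8 * (π / 2 - α)) =o[𝓝[<] (π / 2)]
      (fun α : ℝ => π / 2 - α) := by
  refine Asymptotics.isLittleO_iff.2 fun c hc => ?_
  have hT1 : edgeT 1 < π / 2 := by
    rw [← edgeT_zero]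
    exact strictAntiOn_edgeT (by norm_num) (by norm_num) one_pos
  have h0 := edgeT_pos (show (-3 : ℝ) < 1 by norm_num)
  -- With M ≤ 24(π/2 - T) the error 2M² is at most 1152(π/2 - T)². The bound by `edgeT 1` ensures M
  -- < 1.
  filter_upwards [Ioo_mem_nhdsLT (show max (edgeT 1) (π / 2 - c / 1152) < π / 2 from
    max_lt hT1 (by linarith))] with α hα
  have h1 := (le_max_left _ _).trans_lt hα.1
  have h2 := (le_max_right _ _).trans_lt hα.1
  obtain ⟨M, hM, rfl⟩ := exists_edgeT_eq (h0.trans h1)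
  have hM0 := edge_extremum_pos hM hα.2
  have hM1 : M < 1 := (strictAntiOn_edgeT.lt_iff_gt (by norm_num) hM).1 h1
  obtain ⟨h3, h4⟩ := abs_edge_expansion_le hM0 hM1.le
  rw [maxFlux_one_zero hM hα.2, norm_eq_abs, norm_eq_abs,
    abs_of_pos (show 0 < π / 2 - edgeT M by linarith [hα.2])]
  refine h4.trans ?_
  have h5 : M ≤ 24 * (π / 2 - edgeT M) := by linarith
  nlinarith

end

end SectorFlow

theorem theorem1p3 :
    -- The maximal fluxes are well defined: the fluxes of a type are nonempty and bounded above.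
    (∀ α ∈ Set.Ioo 0 Real.pi, ∀ a b : ℕ, (a, b) ≠ (0, 0) → a ≤ b + 1 → b ≤ a + 1 →
      ((a, b) = (1, 0) → α < Real.pi / 2) →
        (SectorFlow.fluxSet a b α).Nonempty ∧
          IsLUB (SectorFlow.fluxSet a b α) (SectorFlow.maxFlux a b α)) ∧
    -- Properties of the maximal fluxes.
    ((fun α : ℝ => SectorFlow.maxFlux 1 0 α - 3 * Real.pi / α)
        =o[nhdsWithin 0 (Set.Ioi 0)] (fun α : ℝ => 1 / α)) ∧
    ((fun α : ℝ => SectorFlow.maxFlux 1 0 α - 8 * (Real.pi / 2 - α))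
        =o[nhdsWithin (Real.pi / 2) (Set.Iio (Real.pi / 2))] (fun α : ℝ => Real.pi / 2 - α)) ∧
    StrictAntiOn (SectorFlow.maxFlux 1 1) (Set.Ioo 0 Real.pi) ∧
    (∀ α ∈ Set.Ioo 0 (Real.pi / 2), SectorFlow.maxFlux 1 1 α = SectorFlow.maxFlux 1 0 α) ∧
    (∀ α ∈ Set.Ico (Real.pi / 2) Real.pi,
      SectorFlow.maxFlux 1 1 α = SectorFlow.maxFlux 0 1 α) ∧
    (∀ α ∈ Set.Ioo 0 Real.pi, ∀ m : ℕ, 2 ≤ m →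
      SectorFlow.maxFlux m m α = m * SectorFlow.maxFlux 1 1 (α / m) ∧
      SectorFlow.maxFlux m m α = m * SectorFlow.maxFlux 1 0 (α / m)) ∧
    (∀ α ∈ Set.Ioo 0 Real.pi, ∀ m : ℕ, 1 ≤ m →
      SectorFlow.maxFlux m m α < SectorFlow.maxFlux m (m + 1) α ∧
      SectorFlow.maxFlux m (m + 1) α
        ≤ (m : ℝ) / ((m : ℝ) + 1) * SectorFlow.maxFlux (m + 1) (m + 1) α ∧
      (m : ℝ) / ((m : ℝ) + 1) * SectorFlow.maxFlux (m + 1) (m + 1) α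
        < SectorFlow.maxFlux (m + 1) (m + 1) α ∧
      SectorFlow.maxFlux (m + 1) (m + 1) α ≤ SectorFlow.maxFlux (m + 1) m α) ∧
    -- Existence and uniqueness for the types (1, 0), (0, 1), and (m, m) up to reflection.
    (∀ α ∈ Set.Ioo 0 (Real.pi / 2), ∀ Φ : ℝ, 0 < Φ → Φ < SectorFlow.maxFlux 1 0 α →
      ∃ u, (SectorFlow.IsOfType α 1 0 u ∧ SectorFlow.flux α u = Φ) ∧
        ∀ v, SectorFlow.IsOfType α 1 0 v → SectorFlow.flux α v = Φ →
          Set.EqOn v u (SectorFlow.sector α)) ∧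
    (∀ α ∈ Set.Ioo 0 Real.pi, ∀ Φ : ℝ, Φ < SectorFlow.maxFlux 0 1 α →
      ∃ u, (SectorFlow.IsOfType α 0 1 u ∧ SectorFlow.flux α u = Φ) ∧
        ∀ v, SectorFlow.IsOfType α 0 1 v → SectorFlow.flux α v = Φ →
          Set.EqOn v u (SectorFlow.sector α)) ∧
    (∀ α ∈ Set.Ioo 0 Real.pi, ∀ m : ℕ, 1 ≤ m → ∀ Φ : ℝ, Φ < SectorFlow.maxFlux m m α →
      ∃ u, (SectorFlow.IsOfType α m m u ∧ SectorFlow.flux α u = Φ) ∧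
        ∀ v, SectorFlow.IsOfType α m m v → SectorFlow.flux α v = Φ →
          Set.EqOn v u (SectorFlow.sector α) ∨
            Set.EqOn v (SectorFlow.reflect u) (SectorFlow.sector α)) ∧
    -- Non-uniqueness for the types (m, m + 1), even up to reflection.
    (∀ α ∈ Set.Ioo 0 Real.pi, ∀ m : ℕ, 1 ≤ m → (m = 1 → α ≤ Real.pi / 2) → ∀ Φ : ℝ,
      SectorFlow.maxFlux m m α < Φ → Φ < SectorFlow.maxFlux m (m + 1) α →
      ∃ u v, (SectorFlow.IsOfType α m (m + 1) u ∧ SectorFlow.flux α u = Φ) ∧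
        (SectorFlow.IsOfType α m (m + 1) v ∧ SectorFlow.flux α v = Φ) ∧
        ¬ Set.EqOn u v (SectorFlow.sector α) ∧
        ¬ Set.EqOn u (SectorFlow.reflect v) (SectorFlow.sector α)) := by
  have hdiv : ∀ {α : ℝ} {m : ℕ}, 0 < α → α < Real.pi → 2 ≤ m →
      0 < α / m ∧ α / m < Real.pi / 2 := by
    intro α m hα hαπ hm
    have hm0 : (2 : ℝ) ≤ m := by exact_mod_cast hm
    refine ⟨by positivity, ?_⟩
    rw [div_lt_iff₀ (by linarith)]
    nlinarith [Real.pi_pos]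
  refine ⟨?_, SectorFlow.maxFlux_one_zero_isLittleO_zero,
    SectorFlow.maxFlux_one_zero_isLittleO_pi_div_two, SectorFlow.strictAntiOn_maxFlux_one_one,
    fun α hα => SectorFlow.maxFlux_one_one_eq_one_zero hα.1 hα.2,
    fun α hα => SectorFlow.maxFlux_one_one_eq_zero_one hα.1 hα.2, ?_, ?_,
    fun α hα Φ h0 hΦ => SectorFlow.exists_unique_one_zero hα.1 hα.2 h0 hΦ,
    fun α hα Φ hΦ => SectorFlow.exists_unique_zero_one hα.1 hα.2 hΦ,
    fun α hα m hm Φ hΦ => SectorFlow.exists_unique_self hα.1 hα.2 hm hΦ,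
    fun α hα m hm h1 Φ hΦ hΦ' => SectorFlow.exists_two_succ_right hm hα.1 hα.2 h1 hΦ hΦ'⟩
  · intro α hα a b h0 hab hba h10
    obtain rfl | rfl | rfl : a = b ∨ b = a + 1 ∨ a = b + 1 := by omega
    · refine SectorFlow.isLUB_maxFlux_self hα.1 hα.2 ?_
      rcases a with _ | a
      · exact absurd rfl h0
      · omega
    · rcases a with _ | a
      · exact SectorFlow.isLUB_maxFlux_zero_one hα.1 hα.2
      · exact SectorFlow.isLUB_maxFlux_succ_right (by omega) hα.1 hα.2
    · rcases b with _ | b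
      · exact SectorFlow.isLUB_maxFlux_one_zero hα.1 (h10 rfl)
      · exact SectorFlow.isLUB_maxFlux_succ_left (by omega) hα.1 hα.2
  · intro α hα m hm
    have h := SectorFlow.maxFlux_self_eq hα.1 hα.2 (by omega : 1 ≤ m)
    obtain ⟨h1, h2⟩ := hdiv hα.1 hα.2 hm
    exact ⟨h, by rw [h, SectorFlow.maxFlux_one_one_eq_one_zero h1 h2]⟩
  · intro α hα m hm
    have hpos := SectorFlow.maxFlux_self_pos (show 2 ≤ m + 1 by omega) hα.1 hα.2
    refine ⟨SectorFlow.maxFlux_self_lt hm hα.1 hα.2, SectorFlow.maxFlux_succ_right_le hm hα.1 hα.2,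
      ?_, SectorFlow.maxFlux_self_le_succ_left hm hα.1 hα.2⟩
    refine mul_lt_of_lt_one_left hpos ?_
    rw [div_lt_one (by positivity)]
    exact lt_add_one _
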